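/- **Setting.** Let $X$ be a mixture of $r$ product distributions on $\{1,\dots,\ell\}^n$, with weights $w_q>0$, $\sum_q w_q=1$: a sample $y$ is drawn by choosing a type $q$ with probability $w_q$ and then the coordinates independently with $\mathbb P(y_i=j\mid q)=(\pi_q)_{(i,j)}=:\pi^{(i)}_{q,j}$. It is encoded as $x\in\{0,1\}^{\ell n}$ with $x_{(i,j)}=1$ iff $y_i=j$. Let $\Pi=[\pi_1\cdots\pi_r]\in\mathbb R^{\ell n\times r}$, $W=\mathrm{diag}(w)$, $M_2=\Pi W\Pi^T$, let $\sigma_1\ge\dots\ge\sigma_r>0$ be its $r$ largest singular values ($\sigma_r>0$ is assumed), $w_{\min}=\min_q w_q$, $w_{\max}=\max_q w_q$. Let $M_2$ be $\mu$-block-incoherent, i.e. if $M_2=USV^T$ is its rank-$r$ singular value decomposition, every $\ell\times r$ block $U^{(i)}$ has spectral norm at most $\mu\sqrt{r/n}$ (for instance, let $\mu$ be the smallest such number). Let $\eta,\delta\in(0,1)$. **Algorithm (Spectral-Dist).** The input is a set of $|\mathcal S|=2m$ i.i.d. samples $x_1,\dots,x_{2m}$ of $X$; the parameters are $r$ and integers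 $T\ge1$, $N\ge0$, $L\ge1$. Let $P_{\Omega_2}$ (resp. $P_{\Omega_3}$) set to zero all entries of a matrix (resp. tensor) whose row/column block indices in $[n]$ are not pairwise distinct. For a tensor $Z$ and a matrix $R$ let $Z[R,R,R]_{abc}=\sum_{ijk}Z_{ijk}R_{ia}R_{jb}R_{kc}$. 1. Let $S_2=\frac1m\sum_{t\le m}x_tx_t^T$. Let $U_0$ have as columns orthonormal eigenvectors of $P_{\Omega_2}(S_2)$ for its $r$ largest eigenvalues. For $\tau=0,\dots,T-1$ let $\widehat U_{\tau+1}$ be a minimizer of $\|P_{\Omega_2}(S_2)-P_{\Omega_2}(\,\cdot\,U_\tau^T)\|_F$ and $\widehat U_{\tau+1}=U_{\tau+1}R_{\tau+1}$ a QR decomposition. Put $\widehat M_2=\widehat U_TU_{T-1}^T$, and let $\widehat U\in\mathbb R^{\ell n\times r}$ and $\widehat\Sigma$ be the left singular vectors and the $r$ largest singular values of $\widehat M_2$. 2. Let $S_3=\frac1m\sum_{t>m}x_t\otimes x_t\otimes x_t$, $Q=\widehat U\widehat\Sigma^{-1/2}$ and, for $Z\in\mathbb R^{r\times r\times r}$,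 $\widehat A(Z)=P_{\Omega_3}\big(Z[B,B,B]\big)[Q,Q,Q]$ with $B=(\widehat U\widehat\Sigma^{1/2})^T$. Let $\widehat G$ minimize $\|\widehat A(Z)-P_{\Omega_3}(S_3)[Q,Q,Q]\|_F$ over $Z$. 3. Apply the robust tensor power method to $\widehat G$ for $r$ rounds. In each round draw $L$ independent uniform starting points on the unit sphere of $\mathbb R^r$, apply $N$ updates $\theta\mapsto G(I,\theta,\theta)/\|G(I,\theta,\theta)\|$ to each (with $G$ the current tensor), take an end point with the largest $G(\theta,\theta,\theta)$, apply $N$ further updates to get $\hat v_q$, set $\hat\lambda_q=G(\hat v_q,\hat v_q,\hat v_q)$, and replace $G$ by $G-\hat\lambda_q\hat v_q^{\otimes3}$. 4. Output $\widehat\Pi=[\hat\pi_1\cdots\hat\pi_r]=\widehat U\widehat\Sigma^{1/2}[\hat v_1\cdots\hat v_r]\,\mathrm{diag}(\hat\lambda)$ and $\hat w_q=\hat\lambda_q^{-2}$. Ties in these steps (non-unique eigenvectors, minimizers, decompositions, maximizers) may be broken arbitrarily, where the choices in steps 1–2 do not depend on the random starting points, and those in step 1 only on $x_1,\dots,x_m$;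 an output always exists. **Post-processing** with accuracy $\varepsilon_M>0$ and constant $C_3$: let $\varepsilon_w=C_3\varepsilon_M/\sqrt{w_{\min}}$ and $\varepsilon_\pi=C_3\,\varepsilon_M\sqrt{\sigma_1 r(1+\varepsilon_M\sigma_r)/w_{\min}}$. Put $\tilde w'_q=\max(\hat w_q,\varepsilon_w)$, $\tilde w_q=\tilde w'_q/\sum_{q'}\tilde w'_{q'}$, $\tilde\pi'^{(i)}_{q,j}=\max(\hat\pi^{(i)}_{q,j},\varepsilon_\pi)$, $\tilde\pi^{(i)}_{q,j}=\tilde\pi'^{(i)}_{q,j}/\sum_{j'}\tilde\pi'^{(i)}_{q,j'}$. Let $\widehat X$ be the $r$-mixture of product distributions with parameters $\tilde w,\tilde\pi$. **Corollary (KL-divergence bound).** There are universal constants $C,C_0,\dots,C_6,c>0$ such that the following holds for all $r,n,\ell$, all $X$, $\mu$ as above and all $\eta,\delta\in(0,1)$. Suppose that $$n\ \ge\ \frac{C_0\,\sigma_1^{4.5}\mu^4r^{3.5}}{\sigma_r^{4.5}},\qquad |\mathcal S|\ \ge\ \frac{C\,n^7r^7\mu^6\sigma_1^7\ell^{12}\,w_{\max}\log(n/\delta)}{\sigma_r^9\,\eta^6\,w_{\min}^2},$$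 and put $$\varepsilon^\star=c\,\eta^2\min\Big\{\frac{w_{\min}^{1/2}}{n^2\ell^6(\sigma_1w_{\max}r)^{1/2}},\ \eta\Big\}.$$ Then $\varepsilon_M=\varepsilon^\star$ satisfies $$0<\varepsilon_M\le\frac{C_1}{\sqrt{r+\ell}},\qquad |\mathcal S|\ \ge\ C_2\,\frac{\mu^6r^6}{w_{\min}}\,\frac{\sigma_1^6n^3}{\sigma_r^9}\,\frac{\log(n/\delta)}{\varepsilon_M^2}.\tag{$*$}$$ Moreover, for $\varepsilon_M=\varepsilon^\star$, and for every smaller $\varepsilon_M>0$ that satisfies $(*)$, and for all positive integers $T$, $L$ and all integers $N\ge0$ with $$T\ge C_4\log\frac{2\|M_2\|_F}{\varepsilon_M\sigma_rw_{\min}},\qquad N\ge C_5\Big(\log r+\log\log\frac1{\varepsilon_M\sqrt{w_{\min}}}\Big),\qquad L\ge C_6\,r^{C_6}\log\frac2\delta,$$ Spectral-Dist with the above post-processing produces a valid $r$-mixture distribution $\widehat X$ such that, with probability at least $1-\delta$ over the samples and the random starting points, $$D_{\mathrm{KL}}(X\,\|\,\widehat X)=\sum_x\mathbb P(X=x)\log\frac{\mathbb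 P(X=x)}{\mathbb P(\widehat X=x)}\ \le\ \eta .$$ -/

import Mathlib

open MeasureTheory Matrix

noncomputable section

namespace ProductMixtureLearning

/-! ### Mixtures of discrete product distributions -/

/-- A mixture of `r` product distributions on `{1, …, ℓ}ⁿ`: `weight q` is `w_q`, and `prob q i j` is
the probability that the `i`-th coordinate equals `j` given that the sample has type `q`. -/
structure ProductMixture (r n ℓ : ℕ) where
  weight : Fin r → ℝ
  prob : Fin r → Fin n → Fin ℓ → ℝ
  weight_nonneg : ∀ q, 0 ≤ weight q
  weight_sum : ∑ q, weight q = 1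
  prob_nonneg : ∀ q i j, 0 ≤ prob q i j
  prob_sum : ∀ q i, ∑ j, prob q i j = 1

/-- Rows of `Π` and entries of the binary encoding: the pair `(i, j)` stands for the index
`(i - 1) ℓ + j` of `[ℓ n]`, so that the `i`-th block consists of the pairs `(i, ·)`. -/
abbrev Idx (n ℓ : ℕ) := Fin n × Fin ℓ

/-- Tensors of order three with indices in `ι`. -/
abbrev Tensor3 (ι : Type) := ι → ι → ι → ℝ

/-- The law of one sample `y ∈ {1, …, ℓ}ⁿ` (the binary vector `x` is an injective encoding of it):
draw the type `q` with probability `w_q`, then the coordinates independently. -/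
def ProductMixture.law {r n ℓ : ℕ} (X : ProductMixture r n ℓ) : Measure (Fin n → Fin ℓ) :=
  ∑ q, ENNReal.ofReal (X.weight q) •
    Measure.pi (fun i => ∑ j, ENNReal.ofReal (X.prob q i j) • Measure.dirac j)

/-- The matrix `Π` with columns `π_q`. -/
def ProductMixture.Pi {r n ℓ : ℕ} (X : ProductMixture r n ℓ) : Matrix (Idx n ℓ) (Fin r) ℝ :=
  Matrix.of fun p q => X.prob q p.1 p.2

/-- `M₂ = Π W Πᵀ`. -/
def ProductMixture.M2 {r n ℓ : ℕ} (X : ProductMixture r n ℓ) : Matrix (Idx n ℓ) (Idx n ℓ) ℝ :=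
  X.Pi * Matrix.diagonal X.weight * X.Piᵀ

/-! ### Linear algebra -/

/-- The `k`-th largest singular value, `k ≥ 1`. -/
def sigma {ι : Type} [Fintype ι] [DecidableEq ι] (A : Matrix ι ι ℝ) (k : ℕ) : ℝ :=
  (Matrix.toEuclideanLin A).singularValues (k - 1)

/-- The squared Frobenius norm of a matrix. -/
def frobSq {ι κ : Type} [Fintype ι] [Fintype κ] (A : Matrix ι κ ℝ) : ℝ :=
  ∑ i, ∑ j, A i j ^ 2

/-- The squared Frobenius norm of a tensor. -/
def tensorFrobSq {ι : Type} [Fintype ι] (A : Tensor3 ι) : ℝ :=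
  ∑ i, ∑ j, ∑ k, A i j k ^ 2

/-- `A = U diag(s) Vᵀ` is a singular value decomposition with `r` singular values, in decreasing
order. -/
def IsSVD {ι : Type} [Fintype ι] {r : ℕ} (A : Matrix ι ι ℝ)
    (U : Matrix ι (Fin r) ℝ) (s : Fin r → ℝ) (V : Matrix ι (Fin r) ℝ) : Prop :=
  Uᵀ * U = 1 ∧ Vᵀ * V = 1 ∧ Antitone s ∧ (∀ q, 0 ≤ s q) ∧ A = U * Matrix.diagonal s * Vᵀ

/-- The `i`-th `ℓ × r` block of `U`. -/
def block {n ℓ r : ℕ} (U : Matrix (Idx n ℓ) (Fin r) ℝ) (i : Fin n) : Matrix (Fin ℓ) (Fin r) ℝ :=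
  Matrix.of fun a q => U (i, a) q

open scoped Matrix.Norms.L2Operator in
/-- `A` (of rank `r`) is `μ`-block-incoherent: the spectral norm of every block of its left singular
factor is at most `μ √(r / n)`. -/
def IsBlockIncoherent {n ℓ : ℕ} (r : ℕ) (A : Matrix (Idx n ℓ) (Idx n ℓ) ℝ) (μ : ℝ) : Prop :=
  ∃ (U : Matrix (Idx n ℓ) (Fin r) ℝ) (s : Fin r → ℝ) (V : Matrix (Idx n ℓ) (Fin r) ℝ),
    IsSVD A U s V ∧ ∀ i, ‖block U i‖ ≤ μ * √((r : ℝ) / n)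

/-- The masking operator `P_{Ω₂}`: keep the entries outside the diagonal blocks. -/
def mask2 {n ℓ : ℕ} (A : Matrix (Idx n ℓ) (Idx n ℓ) ℝ) : Matrix (Idx n ℓ) (Idx n ℓ) ℝ :=
  Matrix.of fun p q => if p.1 ≠ q.1 then A p q else 0

/-- The masking operator `P_{Ω₃}`: keep the entries whose three block indices are distinct. -/
def mask3 {n ℓ : ℕ} (A : Tensor3 (Idx n ℓ)) : Tensor3 (Idx n ℓ) :=
  fun p q s => if p.1 ≠ q.1 ∧ q.1 ≠ s.1 ∧ s.1 ≠ p.1 then A p q s else 0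

/-- `T[R, R, R]`. -/
def tensorApply {ι κ : Type} [Fintype ι] (T : Tensor3 ι) (R : Matrix ι κ ℝ) : Tensor3 κ :=
  fun a b c => ∑ i, ∑ j, ∑ k, T i j k * R i a * R j b * R k c

/-! ### Sample moments -/

/-- The binary encoding `x ∈ {0,1}^{ℓ n}` of a sample `y ∈ {1, …, ℓ}ⁿ`. -/
def encode {n ℓ : ℕ} (y : Fin n → Fin ℓ) : Idx n ℓ → ℝ :=
  fun p => if y p.1 = p.2 then 1 else 0

/-- The empirical second moment of `m` samples. -/
def sampleM2 {n ℓ m : ℕ} (y : Fin m → Fin n → Fin ℓ) : Matrix (Idx n ℓ) (Idx n ℓ) ℝ :=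
  Matrix.of fun p q => (m : ℝ)⁻¹ * ∑ t, encode (y t) p * encode (y t) q

/-- The empirical third moment of `m` samples. -/
def sampleM3 {n ℓ m : ℕ} (y : Fin m → Fin n → Fin ℓ) : Tensor3 (Idx n ℓ) :=
  fun p q s => (m : ℝ)⁻¹ * ∑ t, encode (y t) p * encode (y t) q * encode (y t) s

/-! ### MatrixAltMin -/

/-- The columns of `U` are orthonormal eigenvectors of the symmetric matrix `A` for its `r` largest
eigenvalues. -/
def IsTopEigenvectors {ι : Type} [Fintype ι] {r : ℕ} (A : Matrix ι ι ℝ)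
    (U : Matrix ι (Fin r) ℝ) : Prop :=
  Uᵀ * U = 1 ∧ ∃ d : Fin r → ℝ, A * U = U * Matrix.diagonal d ∧
    ∀ x : ι → ℝ, Uᵀ *ᵥ x = 0 → ∀ q, x ⬝ᵥ (A *ᵥ x) ≤ d q * (x ⬝ᵥ x)

/-- `U'` minimizes `‖P_{Ω₂}(S) - P_{Ω₂}(U' Uᵀ)‖_F²`. -/
def IsLeastSquaresUpdate {n ℓ r : ℕ} (S : Matrix (Idx n ℓ) (Idx n ℓ) ℝ)
    (U U' : Matrix (Idx n ℓ) (Fin r) ℝ) : Prop :=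
  ∀ V : Matrix (Idx n ℓ) (Fin r) ℝ,
    frobSq (mask2 S - mask2 (U' * Uᵀ)) ≤ frobSq (mask2 S - mask2 (V * Uᵀ))

/-- `A = Q R` is a QR decomposition. -/
def IsQR {ι : Type} [Fintype ι] {r : ℕ} (A Q : Matrix ι (Fin r) ℝ)
    (R : Matrix (Fin r) (Fin r) ℝ) : Prop :=
  A = Q * R ∧ Qᵀ * Q = 1 ∧ R.BlockTriangular id

/-- `M` is an output of alternating minimization on `S` after `T` least squares updates; here `U τ`
are the orthonormalized iterates and `Uhat τ` the least squares solutions. -/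
def IsAltMinOutput {n ℓ : ℕ} (r T : ℕ) (S M : Matrix (Idx n ℓ) (Idx n ℓ) ℝ) : Prop :=
  ∃ U Uhat : ℕ → Matrix (Idx n ℓ) (Fin r) ℝ,
    IsTopEigenvectors (mask2 S) (U 0) ∧
    (∀ τ < T, IsLeastSquaresUpdate S (U τ) (Uhat (τ + 1)) ∧
      ∃ R, IsQR (Uhat (τ + 1)) (U (τ + 1)) R) ∧
    M = Uhat T * (U (T - 1))ᵀ

/-- `U` and `s` are the left singular vectors and the singular values of an output `M̂₂` of
alternating minimization on `S`. -/
def IsSecondMomentEstimate {n ℓ r : ℕ} (T : ℕ) (S : Matrix (Idx n ℓ) (Idx n ℓ) ℝ)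
    (U : Matrix (Idx n ℓ) (Fin r) ℝ) (s : Fin r → ℝ) : Prop :=
  ∃ M V, IsAltMinOutput r T S M ∧ IsSVD M U s V

/-! ### TensorLS -/

/-- `U Σ^{-1/2}`. -/
def whiten {n ℓ r : ℕ} (U : Matrix (Idx n ℓ) (Fin r) ℝ) (s : Fin r → ℝ) :
    Matrix (Idx n ℓ) (Fin r) ℝ :=
  U * Matrix.diagonal fun q => (√(s q))⁻¹

/-- `U Σ^{1/2}`. -/
def unwhiten {n ℓ r : ℕ} (U : Matrix (Idx n ℓ) (Fin r) ℝ) (s : Fin r → ℝ) :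
    Matrix (Idx n ℓ) (Fin r) ℝ :=
  U * Matrix.diagonal fun q => √(s q)

/-- The operator `ν̂`. -/
def nuHat {n ℓ r : ℕ} (U : Matrix (Idx n ℓ) (Fin r) ℝ) (s : Fin r → ℝ) (Z : Tensor3 (Fin r)) :
    Tensor3 (Idx n ℓ) :=
  mask3 (tensorApply Z (unwhiten U s)ᵀ)

/-- The operator `Â`. -/
def AHat {n ℓ r : ℕ} (U : Matrix (Idx n ℓ) (Fin r) ℝ) (s : Fin r → ℝ) (Z : Tensor3 (Fin r)) :
    Tensor3 (Fin r) :=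
  tensorApply (nuHat U s Z) (whiten U s)

/-- `G` minimizes `‖Â(Z) - P_{Ω₃}(S₃)[U Σ^{-1/2}, U Σ^{-1/2}, U Σ^{-1/2}]‖_F²`. -/
def IsTensorLSOutput {n ℓ r : ℕ} (S₃ : Tensor3 (Idx n ℓ)) (U : Matrix (Idx n ℓ) (Fin r) ℝ)
    (s : Fin r → ℝ) (G : Tensor3 (Fin r)) : Prop :=
  ∀ Z : Tensor3 (Fin r),
    tensorFrobSq (AHat U s G - tensorApply (mask3 S₃) (whiten U s)) ≤
      tensorFrobSq (AHat U s Z - tensorApply (mask3 S₃) (whiten U s))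

/-! ### Robust tensor power method -/

/-- The uniform distribution on the unit sphere of `ℝʳ`. -/
def uniformSphere (r : ℕ) : Measure (Metric.sphere (0 : EuclideanSpace ℝ (Fin r)) 1) :=
  ((volume : Measure (EuclideanSpace ℝ (Fin r))).toSphere Set.univ)⁻¹ •
    (volume : Measure (EuclideanSpace ℝ (Fin r))).toSphere

/-- The vector `G(I, θ, θ)`. -/
def contract {r : ℕ} (G : Tensor3 (Fin r)) (θ : EuclideanSpace ℝ (Fin r)) :
    EuclideanSpace ℝ (Fin r) :=
  WithLp.toLp 2 fun a => ∑ b, ∑ c, G a b c * θ b * θ c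

/-- The number `G(θ, θ, θ)`. -/
def cubic {r : ℕ} (G : Tensor3 (Fin r)) (θ : EuclideanSpace ℝ (Fin r)) : ℝ :=
  ∑ a, ∑ b, ∑ c, G a b c * θ a * θ b * θ c

/-- One power update `θ ↦ G(I, θ, θ) / ‖G(I, θ, θ)‖`. -/
def powerStep {r : ℕ} (G : Tensor3 (Fin r)) (θ : EuclideanSpace ℝ (Fin r)) :
    EuclideanSpace ℝ (Fin r) :=
  ‖contract G θ‖⁻¹ • contract G θ

/-- `(v, lam)` is the pair returned by the robust power method on `G` with starting points `θ`:
run `N` power updates from each of the `L` starting points, keep an end point of largest value of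
`G(·, ·, ·)`, and run `N` further updates from it. -/
def IsPowerMethodPair {r L : ℕ} (N : ℕ) (G : Tensor3 (Fin r))
    (θ : Fin L → EuclideanSpace ℝ (Fin r)) (v : EuclideanSpace ℝ (Fin r)) (lam : ℝ) : Prop :=
  ∃ τ : Fin L,
    (∀ τ', cubic G ((powerStep G)^[N] (θ τ')) ≤ cubic G ((powerStep G)^[N] (θ τ))) ∧
    v = (powerStep G)^[N] ((powerStep G)^[N] (θ τ)) ∧ lam = cubic G v

/-- `G - ∑_{p < q} lam_p v_p ⊗ v_p ⊗ v_p`. -/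
def deflate {r : ℕ} (G : Tensor3 (Fin r)) (v : Fin r → EuclideanSpace ℝ (Fin r)) (lam : Fin r → ℝ)
    (q : Fin r) : Tensor3 (Fin r) :=
  fun a b c => G a b c - ∑ p ∈ Finset.Iio q, lam p * v p a * v p b * v p c

/-- `(v_q, lam_q)`, `q ∈ [r]`, are obtained from `G` by `r` rounds of the robust power method with
deflation, where the `q`-th round uses the starting points `θ q`. -/
def IsPowerDecomposition {r L : ℕ} (N : ℕ) (G : Tensor3 (Fin r))
    (θ : Fin r → Fin L → EuclideanSpace ℝ (Fin r))
    (v : Fin r → EuclideanSpace ℝ (Fin r)) (lam : Fin r → ℝ) : Prop :=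
  ∀ q, IsPowerMethodPair N (deflate G v lam q) (θ q) (v q) (lam q)

/-! ### Output of the spectral algorithm and its post-processing -/

/-- `ŵ_q = (λ̂_q)⁻²`. -/
def wHat {r : ℕ} (lam : Fin r → ℝ) (q : Fin r) : ℝ := (lam q ^ 2)⁻¹

/-- `Π̂ = Û Σ̂^{1/2} V̂ Λ̂`, where `V̂` has the columns `v_q`; this is the entry of `π̂_q` at `(i, j)`. -/
def piHat {n ℓ r : ℕ} (U : Matrix (Idx n ℓ) (Fin r) ℝ) (s : Fin r → ℝ)
    (v : Fin r → EuclideanSpace ℝ (Fin r)) (lam : Fin r → ℝ)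
    (q : Fin r) (i : Fin n) (j : Fin ℓ) : ℝ :=
  (unwhiten U s * (Matrix.of fun a p => v p a) * Matrix.diagonal lam) (i, j) q

/-- Replace entries below `ε` by `ε`, then divide by the sum. -/
def thresholdNormalize {k : ℕ} (ε : ℝ) (u : Fin k → ℝ) (a : Fin k) : ℝ :=
  (if ε ≤ u a then u a else ε) / ∑ b, (if ε ≤ u b then u b else ε)

end ProductMixtureLearning

end

/-! The divergence is controlled by the errors of the parameters. By the log sum inequality, the
divergence of two mixtures with matched types is at most the divergence of the weights plus the
average of the coordinate divergences (`sum_pmf_log_le`). Flooring an estimate at its error bound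
`ε` makes the divergence of a distribution on `k` points at most `3kε`, even where probabilities
vanish (`sum_log_thresholdNormalize_le`). Hence it suffices to recover all weights and all entries
of `Π`, up to one permutation of the types, within the two thresholds of the post-processing;
`ParamBounds.divergence_le` checks that `ε⋆` is small enough for `η`.

Without noise and masks the recovery is exact. Put `A = Π W^{1/2}` and let `D` be the diagonal
tensor with entries `w_q^{-1/2}`. Coordinates are independent given the type, so away from
coinciding block indices the moments are those of `M₂ = A Aᵀ` and `D[Aᵀ, Aᵀ, Aᵀ]`. If `M₂ = U Σ Uᵀ`,
then `O = Σ^{-1/2} Uᵀ A` is orthogonal and the whitened third moment is `∑ w_q^{-1/2} v_q ⊗ v_q ⊗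
v_q` with `v_q` the columns of `O`. The power method finds the pairs `(v_q, w_q^{-1/2})`, and `U
Σ^{1/2} v_q w_q^{-1/2} = π_q`. The work lies in the stability of each step.

Masking: the block diagonal part of `Y Zᵀ` acts on `W` as `Y_i (Z_iᵀ W_i)` in block `i`, which is
small as soon as two of the three factors have small blocks. So the normal equations of a least
squares update say that it is the exact power step `M₂ V` up to sampling noise and a small multiple
of the angle between `V` and the range of `M₂`; orthonormalizing halves that angle up to noise
(`update_error`, `qr_error`, `altMin_error`). Iterates close to the range inherit its incoherence,
so no truncation is needed. In the same way `Â` is within `1/2` of the identity, tensor least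
squares solves its equation exactly, and `G` is close to `D[Oᵀ, Oᵀ, Oᵀ]` for an honest orthogonal
matrix `O` (`tensorLS_error`, `exists_rotation`).

Power method: a uniform starting point has its coordinate along `v_i` ahead of all others by a
factor `1 + 1/r` with probability at least `1/(6r)`. From there the coordinate ratios decay one by
one, and once the component orthogonal to `v_i` is small as a whole, its ratio to the leading
coordinate is essentially squared in every step. Deflating with a component known up to `O(ε)`
perturbs the map at `θ` by `O(ε |⟨v, θ⟩|)`. The total is `O(r ε)` at worst but only `O(ε)` near
another component, so one last step restores the error `6ε` in every round and errors do not
accumulate (`powerDecomposition_error`).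

Probability: bounded differences and a second moment bound give concentration of the empirical
moments in Frobenius norm, without a factor for the dimension. The basis `v` depends only on the
samples, whose space is finite, so the bound for the starting points may be applied for each sample
separately (`measure_prod_le_add`), with no measurability asked of the tie breaking. -/

namespace ProductMixtureLearning
open scoped Matrix.Norms.L2Operator
set_option linter.unusedSectionVars false

/-! ### Frobenius norm, Euclidean operator norm and orthonormal columns. -/

section Norms

variable {ι κ ν : Type} [Fintype ι] [Fintype κ] [Fintype ν]

/-- The Frobenius norm. -/
noncomputable def fro (A : Matrix ι κ ℝ) : ℝ := √(frobSq A)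

lemma frobSq_nonneg (A : Matrix ι κ ℝ) : 0 ≤ frobSq A :=
  Finset.sum_nonneg fun _ _ => Finset.sum_nonneg fun _ _ => sq_nonneg _

lemma fro_nonneg (A : Matrix ι κ ℝ) : 0 ≤ fro A := Real.sqrt_nonneg _

lemma fro_sq (A : Matrix ι κ ℝ) : fro A ^ 2 = frobSq A := Real.sq_sqrt (frobSq_nonneg A)

lemma fro_eq_norm (A : Matrix ι κ ℝ) :
    fro A = ‖(WithLp.toLp 2 fun p : ι × κ => A p.1 p.2 : EuclideanSpace ℝ (ι × κ))‖ := by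
  rw [EuclideanSpace.norm_eq, fro, frobSq, Fintype.sum_prod_type]
  simp

lemma fro_add_le (A B : Matrix ι κ ℝ) : fro (A + B) ≤ fro A + fro B := by
  simp only [fro_eq_norm]
  exact norm_add_le (WithLp.toLp 2 fun p : ι × κ => A p.1 p.2 : EuclideanSpace ℝ (ι × κ))
    (WithLp.toLp 2 fun p : ι × κ => B p.1 p.2)

lemma fro_neg (A : Matrix ι κ ℝ) : fro (-A) = fro A := by simp [fro, frobSq]

lemma fro_sub_le (A B : Matrix ι κ ℝ) : fro (A - B) ≤ fro A + fro B := by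
  rw [sub_eq_add_neg]
  exact (fro_add_le _ _).trans_eq (by rw [fro_neg])

lemma fro_sub_comm (A B : Matrix ι κ ℝ) : fro (A - B) = fro (B - A) := by
  rw [← fro_neg, neg_sub]

@[simp] lemma fro_zero : fro (0 : Matrix ι κ ℝ) = 0 := by simp [fro, frobSq]

lemma fro_transpose (A : Matrix ι κ ℝ) : fro Aᵀ = fro A := by
  rw [fro, fro, frobSq, frobSq, Finset.sum_comm]; rfl

lemma abs_apply_le_fro (A : Matrix ι κ ℝ) (i : ι) (j : κ) : |A i j| ≤ fro A := by
  rw [← Real.sqrt_sq_eq_abs]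
  refine Real.sqrt_le_sqrt ?_
  refine le_trans ?_ (Finset.single_le_sum (f := fun i => ∑ j, A i j ^ 2)
    (fun _ _ => Finset.sum_nonneg fun _ _ => sq_nonneg _) (Finset.mem_univ i))
  exact Finset.single_le_sum (f := fun j => A i j ^ 2) (fun _ _ => sq_nonneg _) (Finset.mem_univ j)

lemma fro_eq_zero {A : Matrix ι κ ℝ} (h : fro A = 0) : A = 0 := by
  ext i j
  exact abs_nonpos_iff.mp ((abs_apply_le_fro A i j).trans h.le)

lemma frobSq_eq_sum_col (A : Matrix ι κ ℝ) : frobSq A = ∑ j, (fun i => A i j) ⬝ᵥ (fun i => A i j) := by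
  rw [frobSq, Finset.sum_comm]
  simp [dotProduct, sq]

lemma frobSq_eq_trace (A : Matrix ι κ ℝ) : frobSq A = (Aᵀ * A).trace := by
  rw [frobSq_eq_sum_col]; rfl

lemma dot_self_eq_norm_sq (x : ι → ℝ) :
    x ⬝ᵥ x = ‖(WithLp.toLp 2 x : EuclideanSpace ℝ ι)‖ ^ 2 := by
  rw [EuclideanSpace.norm_sq_eq]; simp [dotProduct, sq]

lemma dot_self_nonneg (x : ι → ℝ) : 0 ≤ x ⬝ᵥ x := by
  rw [dot_self_eq_norm_sq]; positivity

lemma abs_dot_le (x y : ι → ℝ) : |x ⬝ᵥ y| ≤ √(x ⬝ᵥ x) * √(y ⬝ᵥ y) := by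
  rw [dot_self_eq_norm_sq, dot_self_eq_norm_sq, Real.sqrt_sq (norm_nonneg _),
    Real.sqrt_sq (norm_nonneg _)]
  have := abs_real_inner_le_norm (WithLp.toLp 2 y : EuclideanSpace ℝ ι) (WithLp.toLp 2 x)
  rw [EuclideanSpace.inner_toLp_toLp] at this
  simpa [mul_comm] using this

lemma dot_mulVec_transpose (A : Matrix ι κ ℝ) (x : ι → ℝ) (y : κ → ℝ) :
    x ⬝ᵥ (A *ᵥ y) = (Aᵀ *ᵥ x) ⬝ᵥ y := by
  rw [dotProduct_mulVec, mulVec_transpose]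

variable [DecidableEq ι] [DecidableEq κ] [DecidableEq ν]

lemma dot_mulVec_le (A : Matrix ι κ ℝ) (x : κ → ℝ) :
    (A *ᵥ x) ⬝ᵥ (A *ᵥ x) ≤ ‖A‖ ^ 2 * (x ⬝ᵥ x) := by
  rw [dot_self_eq_norm_sq, dot_self_eq_norm_sq, ← mul_pow]
  exact pow_le_pow_left₀ (norm_nonneg _) (A.l2_opNorm_mulVec (WithLp.toLp 2 x)) 2

lemma opNorm_le_of {A : Matrix ι κ ℝ} {c : ℝ} (hc : 0 ≤ c)
    (h : ∀ x, (A *ᵥ x) ⬝ᵥ (A *ᵥ x) ≤ c ^ 2 * (x ⬝ᵥ x)) : ‖A‖ ≤ c := by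
  rw [l2_opNorm_def]
  refine ContinuousLinearMap.opNorm_le_bound _ hc fun x => ?_
  have := h x.ofLp
  rw [dot_self_eq_norm_sq, dot_self_eq_norm_sq, ← mul_pow] at this
  exact le_of_sq_le_sq this (by positivity)

lemma opNorm_transpose (A : Matrix ι κ ℝ) : ‖Aᵀ‖ = ‖A‖ := by
  rw [← conjTranspose_eq_transpose_of_trivial, l2_opNorm_conjTranspose]

lemma fro_mul_le (A : Matrix ι κ ℝ) (B : Matrix κ ν ℝ) : fro (A * B) ≤ ‖A‖ * fro B := by
  refine le_of_sq_le_sq ?_ (mul_nonneg (norm_nonneg _) (fro_nonneg _))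
  rw [mul_pow, fro_sq, fro_sq, frobSq_eq_sum_col, frobSq_eq_sum_col, Finset.mul_sum]
  exact Finset.sum_le_sum fun j _ => dot_mulVec_le A fun i => B i j

lemma fro_mul_le' (A : Matrix ι κ ℝ) (B : Matrix κ ν ℝ) : fro (A * B) ≤ fro A * ‖B‖ := by
  rw [← fro_transpose, transpose_mul, mul_comm, ← opNorm_transpose, ← fro_transpose A]
  exact fro_mul_le _ _

/-- A matrix with one column is a vector, on which the Frobenius norm is the Euclidean norm. This
turns the Frobenius bounds for block diagonal parts into an operator norm bound. -/
lemma opNorm_le_of_fro {A : Matrix ι κ ℝ} {c : ℝ} (hc : 0 ≤ c)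
    (h : ∀ B : Matrix κ (Fin 1) ℝ, fro (A * B) ≤ c * fro B) : ‖A‖ ≤ c := by
  refine opNorm_le_of hc fun x => ?_
  have h1 := pow_le_pow_left₀ (fro_nonneg _) (h (Matrix.of fun i _ => x i)) 2
  rw [mul_pow, fro_sq, fro_sq, frobSq_eq_sum_col, frobSq_eq_sum_col] at h1
  simp only [Finset.univ_unique, Finset.sum_singleton] at h1
  exact h1

lemma opNorm_le_fro (A : Matrix ι κ ℝ) : ‖A‖ ≤ fro A := by
  refine opNorm_le_of (fro_nonneg _) fun x => ?_
  rw [fro_sq, frobSq, Finset.sum_mul, dotProduct]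
  refine Finset.sum_le_sum fun i _ => ?_
  have := Finset.sum_mul_sq_le_sq_mul_sq Finset.univ (A i) x
  simpa [mulVec, dotProduct, sq] using this

lemma dot_mulVec_of_orthonormal {U : Matrix ι κ ℝ} (hU : Uᵀ * U = 1) (x : κ → ℝ) :
    (U *ᵥ x) ⬝ᵥ (U *ᵥ x) = x ⬝ᵥ x := by
  rw [dot_mulVec_transpose, mulVec_mulVec, hU, one_mulVec]

lemma opNorm_le_one_of_orthonormal {U : Matrix ι κ ℝ} (hU : Uᵀ * U = 1) : ‖U‖ ≤ 1 :=
  opNorm_le_of zero_le_one fun x => by rw [dot_mulVec_of_orthonormal hU]; simp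

lemma fro_orthonormal_mul {U : Matrix ι κ ℝ} (hU : Uᵀ * U = 1) (A : Matrix κ ν ℝ) :
    fro (U * A) = fro A := by
  rw [fro, fro, frobSq_eq_trace, frobSq_eq_trace, transpose_mul, Matrix.mul_assoc,
    ← Matrix.mul_assoc Uᵀ, hU, Matrix.one_mul]

lemma fro_mul_orthonormal_transpose {U : Matrix ι κ ℝ} (hU : Uᵀ * U = 1) (A : Matrix ν κ ℝ) :
    fro (A * Uᵀ) = fro A := by
  rw [← fro_transpose, transpose_mul, transpose_transpose, fro_orthonormal_mul hU, fro_transpose]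

lemma fro_le_sqrt_of_orthonormal {r : ℕ} {U : Matrix ι (Fin r) ℝ} (hU : Uᵀ * U = 1) :
    fro U = √r := by
  rw [fro, frobSq_eq_trace, hU]; simp

lemma opNorm_diagonal_le {d : κ → ℝ} {c : ℝ} (hc : 0 ≤ c) (h : ∀ i, |d i| ≤ c) :
    ‖(Matrix.diagonal d : Matrix κ κ ℝ)‖ ≤ c := by
  rw [l2_opNorm_diagonal, pi_norm_le_iff_of_nonneg hc]
  exact h

/-- The projection onto the orthogonal complement of the range of `U` is a contraction. -/
lemma opNorm_one_sub_le {U : Matrix ι κ ℝ} (hU : Uᵀ * U = 1) : ‖(1 : Matrix ι ι ℝ) - U * Uᵀ‖ ≤ 1 := by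
  refine opNorm_le_of zero_le_one fun x => ?_
  rw [one_pow, one_mul]
  have h1 : (1 - U * Uᵀ)ᵀ * (1 - U * Uᵀ) = 1 - U * Uᵀ := by
    simp only [transpose_sub, transpose_one, transpose_mul, transpose_transpose, Matrix.sub_mul,
      Matrix.mul_sub, Matrix.one_mul, Matrix.mul_one]
    rw [Matrix.mul_assoc U Uᵀ (U * Uᵀ), ← Matrix.mul_assoc Uᵀ U, hU, Matrix.one_mul]
    simp
  have h2 : ((1 - U * Uᵀ) *ᵥ x) ⬝ᵥ ((1 - U * Uᵀ) *ᵥ x) = x ⬝ᵥ x - (Uᵀ *ᵥ x) ⬝ᵥ (Uᵀ *ᵥ x) := by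
    rw [dot_mulVec_transpose, mulVec_mulVec, h1, sub_mulVec, one_mulVec, sub_dotProduct,
      ← mulVec_mulVec, dotProduct_comm, dot_mulVec_transpose, dotProduct_comm,
      transpose_transpose]
  rw [h2]
  linarith [dot_self_nonneg (Uᵀ *ᵥ x)]

/-- The two ways to measure the angle between subspaces of equal dimension. -/
lemma fro_proj_comm {U V : Matrix ι κ ℝ} (hU : Uᵀ * U = 1) (hV : Vᵀ * V = 1) :
    fro (V - U * (Uᵀ * V)) = fro (U - V * (Vᵀ * U)) := by
  -- Both squared norms equal the number of columns minus `‖Uᵀ V‖_F²`, which does not change when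
  -- `U` and `V` are exchanged.
  have key : ∀ {U V : Matrix ι κ ℝ}, Uᵀ * U = 1 → Vᵀ * V = 1 →
      frobSq (V - U * (Uᵀ * V)) = Fintype.card κ - frobSq (Uᵀ * V) := by
    intro U V hU hV
    rw [frobSq_eq_trace, frobSq_eq_trace]
    have : (V - U * (Uᵀ * V))ᵀ * (V - U * (Uᵀ * V)) = 1 - (Uᵀ * V)ᵀ * (Uᵀ * V) := by
      simp only [transpose_sub, transpose_mul, transpose_transpose, Matrix.sub_mul, Matrix.mul_sub,
        hV, Matrix.mul_assoc]
      rw [← Matrix.mul_assoc Uᵀ U, hU, Matrix.one_mul]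
      simp
    rw [this, trace_sub, trace_one]
  rw [fro, fro, key hU hV, key hV hU]
  congr 2
  have := fro_transpose (Vᵀ * U)
  rw [transpose_mul, transpose_transpose] at this
  rw [← fro_sq, ← fro_sq, this]

lemma opNorm_mul_le (A : Matrix ι κ ℝ) (B : Matrix κ ν ℝ) : ‖A * B‖ ≤ ‖A‖ * ‖B‖ :=
  l2_opNorm_mul A B

end Norms

/-- A unit vector of `ℝʳ` on which `r - 1` linear forms vanish. -/
lemma exists_unit_mulVec_eq_zero {r : ℕ} (B : Matrix (Fin r) (Fin r) ℝ) (q : Fin r) :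
    ∃ y : Fin r → ℝ, y ⬝ᵥ y = 1 ∧ ∀ p ≠ q, (B *ᵥ y) p = 0 := by
  -- Zeroing row `q` makes the matrix singular, and a kernel vector satisfies the other `r - 1`
  -- equations. This replaces the dimension count of the min-max principle in the bounds for
  -- eigenvalues and singular values below.
  obtain ⟨y, hy0, hy⟩ : ∃ y : Fin r → ℝ, y ≠ 0 ∧
      (B.updateRow q 0) *ᵥ y = 0 := by
    rw [Matrix.exists_mulVec_eq_zero_iff]
    exact Matrix.det_eq_zero_of_row_eq_zero q (by simp)
  have hpos : 0 < y ⬝ᵥ y := by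
    rw [dot_self_eq_norm_sq]
    have : (WithLp.toLp 2 y : EuclideanSpace ℝ (Fin r)) ≠ 0 := by simpa using hy0
    positivity
  refine ⟨(√(y ⬝ᵥ y))⁻¹ • y, ?_, fun p hp => ?_⟩
  · rw [smul_dotProduct, dotProduct_smul, smul_eq_mul, smul_eq_mul, ← mul_assoc, ← mul_inv,
      Real.mul_self_sqrt hpos.le, inv_mul_cancel₀ hpos.ne']
  · have := congrFun hy p
    rw [mulVec_smul, Pi.smul_apply]
    simp only [mulVec, updateRow_ne hp] at this ⊢
    simp [this]

/-! ### Blocks of rows and the block diagonal part of a low rank product. -/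

section Blocks

variable {n ℓ : ℕ} {κ ν ρ : Type} [Fintype κ] [Fintype ν] [DecidableEq κ] [DecidableEq ν]
  [Fintype ρ] [DecidableEq ρ]

/-- The `i`-th block of rows. -/
def rowBlock (A : Matrix (Idx n ℓ) κ ℝ) (i : Fin n) : Matrix (Fin ℓ) κ ℝ :=
  Matrix.of fun a k => A (i, a) k

omit [DecidableEq κ] in
lemma frobSq_eq_sum_rowBlock (A : Matrix (Idx n ℓ) κ ℝ) : frobSq A = ∑ i, frobSq (rowBlock A i) := by
  simp only [frobSq, Fintype.sum_prod_type]; rfl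

omit [Fintype ν] [DecidableEq ν] [DecidableEq κ] in
lemma rowBlock_mul (A : Matrix (Idx n ℓ) κ ℝ) (B : Matrix κ ν ℝ) (i : Fin n) :
    rowBlock (A * B) i = rowBlock A i * B := by ext; simp [rowBlock, mul_apply]

omit [Fintype κ] [DecidableEq κ] in
lemma rowBlock_add (A B : Matrix (Idx n ℓ) κ ℝ) (i : Fin n) :
    rowBlock (A + B) i = rowBlock A i + rowBlock B i := rfl

/-- The block diagonal part. -/
def blockDiag (A : Matrix (Idx n ℓ) (Idx n ℓ) ℝ) : Matrix (Idx n ℓ) (Idx n ℓ) ℝ :=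
  Matrix.of fun p q => if p.1 = q.1 then A p q else 0

lemma mask2_eq_sub (A : Matrix (Idx n ℓ) (Idx n ℓ) ℝ) : mask2 A = A - blockDiag A := by
  ext p q; by_cases h : p.1 = q.1 <;> simp [mask2, blockDiag, h]

lemma blockDiag_sub (A B : Matrix (Idx n ℓ) (Idx n ℓ) ℝ) :
    blockDiag (A - B) = blockDiag A - blockDiag B := by
  ext p q; by_cases h : p.1 = q.1 <;> simp [blockDiag, h]

lemma mask2_sub (A B : Matrix (Idx n ℓ) (Idx n ℓ) ℝ) :
    mask2 (A - B) = mask2 A - mask2 B := by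
  ext p q; by_cases h : p.1 = q.1 <;> simp [mask2, h]

omit [DecidableEq κ] [Fintype ν] [DecidableEq ν] in
-- The identity behind every estimate of the mask on matrices: only the small matrix `Z_iᵀ W_i`
-- separates block `i` of the result from `Y_i`, and its norm is a product of two block norms.
lemma rowBlock_blockDiag_mul (Y Z : Matrix (Idx n ℓ) κ ℝ) (W : Matrix (Idx n ℓ) ν ℝ) (i : Fin n) :
    rowBlock (blockDiag (Y * Zᵀ) * W) i = rowBlock Y i * ((rowBlock Z i)ᵀ * rowBlock W i) := by
  rw [← Matrix.mul_assoc]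
  ext a q
  simp only [rowBlock, blockDiag, of_apply, mul_apply, Fintype.sum_prod_type, transpose_apply,
    ite_mul, zero_mul]
  rw [Finset.sum_eq_single i (fun j _ hj => by simp [Ne.symm hj]) (by simp)]
  simp

lemma fro_rowBlock_le (A : Matrix (Idx n ℓ) κ ℝ) (i : Fin n) : fro (rowBlock A i) ≤ fro A := by
  refine Real.sqrt_le_sqrt ?_
  rw [frobSq_eq_sum_rowBlock A]
  exact Finset.single_le_sum (f := fun i => frobSq (rowBlock A i)) (fun _ _ => frobSq_nonneg _)
    (Finset.mem_univ i)

omit [DecidableEq κ] [DecidableEq ν] in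
/-- Compare Frobenius norms block by block. -/
lemma fro_le_of_rowBlock {A : Matrix (Idx n ℓ) κ ℝ} {B : Matrix (Idx n ℓ) ν ℝ} {c : ℝ} (hc : 0 ≤ c)
    (h : ∀ i, fro (rowBlock A i) ≤ c * fro (rowBlock B i)) : fro A ≤ c * fro B := by
  refine le_of_sq_le_sq ?_ (mul_nonneg hc (fro_nonneg _))
  rw [mul_pow, fro_sq, fro_sq, frobSq_eq_sum_rowBlock, frobSq_eq_sum_rowBlock B, Finset.mul_sum]
  refine Finset.sum_le_sum fun i _ => ?_
  rw [← fro_sq, ← fro_sq, ← mul_pow]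
  exact pow_le_pow_left₀ (fro_nonneg _) (h i) 2

/-- This and the two lemmas after it differ in which of `Y`, `Z`, `W` is measured in Frobenius norm;
the other two only need small blocks. The squares of the blocks of that one factor add up, so no
factor `n` is lost. -/
lemma fro_blockDiag_mul_le_left {Y Z : Matrix (Idx n ℓ) κ ℝ} {W : Matrix (Idx n ℓ) ν ℝ} {b c : ℝ}
    (hb : 0 ≤ b) (hZ : ∀ i, ‖rowBlock Z i‖ ≤ b) (hW : ∀ i, ‖rowBlock W i‖ ≤ c) :
    fro (blockDiag (Y * Zᵀ) * W) ≤ b * c * fro Y := by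
  rcases isEmpty_or_nonempty (Fin n) with hn | ⟨⟨i₀⟩⟩
  · have : ∀ A : Matrix (Idx n ℓ) ν ℝ, fro A = 0 := fun A => by simp [fro, frobSq]
    have : ∀ A : Matrix (Idx n ℓ) κ ℝ, fro A = 0 := fun A => by simp [fro, frobSq]
    simp [*]
  have hc : 0 ≤ c := (norm_nonneg _).trans (hW i₀)
  refine fro_le_of_rowBlock (by positivity) fun i => ?_
  rw [rowBlock_blockDiag_mul]
  calc fro (rowBlock Y i * ((rowBlock Z i)ᵀ * rowBlock W i))
      ≤ fro (rowBlock Y i) * (‖(rowBlock Z i)ᵀ‖ * ‖rowBlock W i‖) :=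
        (fro_mul_le' _ _).trans (mul_le_mul_of_nonneg_left (opNorm_mul_le _ _) (fro_nonneg _))
    _ ≤ fro (rowBlock Y i) * (b * c) := by
        rw [opNorm_transpose]
        refine mul_le_mul_of_nonneg_left ?_ (fro_nonneg _)
        exact mul_le_mul (hZ i) (hW i) (norm_nonneg _) hb
    _ = b * c * fro (rowBlock Y i) := by ring

lemma fro_blockDiag_mul_le_mid {Y Z : Matrix (Idx n ℓ) κ ℝ} {W : Matrix (Idx n ℓ) ν ℝ} {b c : ℝ}
    (hb : 0 ≤ b) (hY : ∀ i, ‖rowBlock Y i‖ ≤ b) (hW : ∀ i, ‖rowBlock W i‖ ≤ c) :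
    fro (blockDiag (Y * Zᵀ) * W) ≤ b * c * fro Z := by
  rcases isEmpty_or_nonempty (Fin n) with hn | ⟨⟨i₀⟩⟩
  · have : ∀ A : Matrix (Idx n ℓ) ν ℝ, fro A = 0 := fun A => by simp [fro, frobSq]
    have : ∀ A : Matrix (Idx n ℓ) κ ℝ, fro A = 0 := fun A => by simp [fro, frobSq]
    simp [*]
  have hc : 0 ≤ c := (norm_nonneg _).trans (hW i₀)
  refine fro_le_of_rowBlock (by positivity) fun i => ?_
  rw [rowBlock_blockDiag_mul]
  calc fro (rowBlock Y i * ((rowBlock Z i)ᵀ * rowBlock W i))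
      ≤ ‖rowBlock Y i‖ * (fro (rowBlock Z i) * ‖rowBlock W i‖) := by
        refine (fro_mul_le _ _).trans (mul_le_mul_of_nonneg_left ?_ (norm_nonneg _))
        exact (fro_mul_le' _ _).trans_eq (by rw [fro_transpose])
    _ ≤ b * (fro (rowBlock Z i) * c) := by
        refine mul_le_mul (hY i) ?_ (mul_nonneg (fro_nonneg _) (norm_nonneg _)) hb
        exact mul_le_mul_of_nonneg_left (hW i) (fro_nonneg _)
    _ = b * c * fro (rowBlock Z i) := by ring

lemma fro_blockDiag_mul_le_right {Y Z : Matrix (Idx n ℓ) κ ℝ} {W : Matrix (Idx n ℓ) ν ℝ} {b c : ℝ}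
    (hb : 0 ≤ b) (hc : 0 ≤ c) (hY : ∀ i, ‖rowBlock Y i‖ ≤ b) (hZ : ∀ i, ‖rowBlock Z i‖ ≤ c) :
    fro (blockDiag (Y * Zᵀ) * W) ≤ b * c * fro W := by
  refine fro_le_of_rowBlock (by positivity) fun i => ?_
  rw [rowBlock_blockDiag_mul]
  calc fro (rowBlock Y i * ((rowBlock Z i)ᵀ * rowBlock W i))
      ≤ ‖rowBlock Y i‖ * (‖(rowBlock Z i)ᵀ‖ * fro (rowBlock W i)) :=
        (fro_mul_le _ _).trans (mul_le_mul_of_nonneg_left (fro_mul_le _ _) (norm_nonneg _))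
    _ ≤ b * (c * fro (rowBlock W i)) := by
        rw [opNorm_transpose]
        refine mul_le_mul (hY i) ?_ (mul_nonneg (norm_nonneg _) (fro_nonneg _)) hb
        exact mul_le_mul_of_nonneg_right (hZ i) (fro_nonneg _)
    _ = b * c * fro (rowBlock W i) := by ring

end Blocks

/-! ### Alternating minimization for an incoherent positive semidefinite matrix. -/

/-- A symmetric matrix `M = U K Uᵀ` of rank `r` with spectrum in `[σᵣ, σ₁]` on the range of `U`,
whose factor `U` has blocks of norm at most `b`. -/
structure IncoherentFactorization {n ℓ r : ℕ} (M : Matrix (Idx n ℓ) (Idx n ℓ) ℝ)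
    (U : Matrix (Idx n ℓ) (Fin r) ℝ) (K : Matrix (Fin r) (Fin r) ℝ) (σ₁ σᵣ b : ℝ) : Prop where
  orth : Uᵀ * U = 1
  eq : M = U * K * Uᵀ
  symm : Kᵀ = K
  norm_le : ‖K‖ ≤ σ₁
  lower : ∀ y, σᵣ * (y ⬝ᵥ y) ≤ y ⬝ᵥ (K *ᵥ y)
  block_le : ∀ i, ‖rowBlock U i‖ ≤ b
  b_nonneg : 0 ≤ b
  pos : 0 < σᵣ
  le : σᵣ ≤ σ₁

section Aux

variable {ι κ ν : Type} [Fintype ι] [Fintype κ] [Fintype ν] [DecidableEq ι] [DecidableEq κ]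
  [DecidableEq ν]

lemma le_fro_mul_diagonal {d : κ → ℝ} {c : ℝ} (hc : 0 ≤ c) (h : ∀ q, c ≤ d q) (X : Matrix ι κ ℝ) :
    c * fro X ≤ fro (X * Matrix.diagonal d) := by
  refine le_of_sq_le_sq ?_ (fro_nonneg _)
  rw [mul_pow, fro_sq, fro_sq, frobSq, frobSq, Finset.mul_sum]
  refine Finset.sum_le_sum fun i _ => ?_
  rw [Finset.mul_sum]
  refine Finset.sum_le_sum fun j _ => ?_
  rw [mul_diagonal, mul_pow, mul_comm]
  exact mul_le_mul_of_nonneg_left (pow_le_pow_left₀ hc (h j) 2) (sq_nonneg _)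

/-- If `‖R x‖ ≥ c ‖x‖` for all `x`, then `‖X R‖_F ≥ c ‖X‖_F`. -/
lemma le_fro_mul_of_lower {R : Matrix κ κ ℝ} {c : ℝ} (hc : 0 < c)
    (h : ∀ x, c ^ 2 * (x ⬝ᵥ x) ≤ (R *ᵥ x) ⬝ᵥ (R *ᵥ x)) (X : Matrix ι κ ℝ) :
    c * fro X ≤ fro (X * R) := by
  have hinj : Function.Injective R.mulVec := by
    refine (injective_iff_map_eq_zero R.mulVecLin).mpr fun x hx => ?_
    have h1 := h x
    rw [show R *ᵥ x = 0 from hx] at h1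
    simp only [dotProduct_zero] at h1
    have h2 : x ⬝ᵥ x ≤ 0 := by
      by_contra! h3
      have : 0 < c ^ 2 * (x ⬝ᵥ x) := by positivity
      linarith
    exact dotProduct_self_eq_zero.mp (le_antisymm h2 (dot_self_nonneg x))
  have hu : IsUnit R := Matrix.mulVec_injective_iff_isUnit.mp hinj
  have hdet : IsUnit R.det := (Matrix.isUnit_iff_isUnit_det R).mp hu
  have hinv : ‖R⁻¹‖ ≤ c⁻¹ := by
    refine opNorm_le_of (inv_nonneg.mpr hc.le) fun x => ?_
    have h1 := h (R⁻¹ *ᵥ x)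
    rw [mulVec_mulVec, Matrix.mul_nonsing_inv _ hdet, one_mulVec] at h1
    rw [inv_pow, inv_mul_eq_div, le_div_iff₀ (by positivity)]
    linarith
  have h1 : X = X * R * R⁻¹ := by
    rw [Matrix.mul_assoc, Matrix.mul_nonsing_inv _ hdet, Matrix.mul_one]
  calc c * fro X = c * fro (X * R * R⁻¹) := by rw [← h1]
    _ ≤ c * (fro (X * R) * c⁻¹) := by
        refine mul_le_mul_of_nonneg_left ?_ hc.le
        exact (fro_mul_le' _ _).trans (mul_le_mul_of_nonneg_left hinv (fro_nonneg _))
    _ = fro (X * R) := by field_simp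

lemma dot_add_le (x y : ι → ℝ) : (x + y) ⬝ᵥ (x + y) ≤ 2 * (x ⬝ᵥ x) + 2 * (y ⬝ᵥ y) := by
  have := dot_self_nonneg (x - y)
  simp only [sub_dotProduct, dotProduct_sub, add_dotProduct, dotProduct_add] at this ⊢
  linarith

lemma dot_mulVec_self_abs_le (A : Matrix ι ι ℝ) (x : ι → ℝ) :
    |x ⬝ᵥ (A *ᵥ x)| ≤ ‖A‖ * (x ⬝ᵥ x) := by
  refine (abs_dot_le _ _).trans ?_
  calc √(x ⬝ᵥ x) * √((A *ᵥ x) ⬝ᵥ (A *ᵥ x)) ≤ √(x ⬝ᵥ x) * √(‖A‖ ^ 2 * (x ⬝ᵥ x)) :=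
        mul_le_mul_of_nonneg_left (Real.sqrt_le_sqrt (dot_mulVec_le A x)) (Real.sqrt_nonneg _)
    _ = ‖A‖ * (x ⬝ᵥ x) := by
        rw [Real.sqrt_mul (sq_nonneg _), Real.sqrt_sq (norm_nonneg _), mul_left_comm,
          Real.mul_self_sqrt (dot_self_nonneg x)]

end Aux

namespace IncoherentFactorization

variable {n ℓ r : ℕ} {M : Matrix (Idx n ℓ) (Idx n ℓ) ℝ}
    {U : Matrix (Idx n ℓ) (Fin r) ℝ} {K : Matrix (Fin r) (Fin r) ℝ} {σ₁ σᵣ b : ℝ}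

lemma one_nonneg (h : IncoherentFactorization M U K σ₁ σᵣ b) : 0 ≤ σ₁ := h.pos.le.trans h.le

/-- Expand `0 ≤ ‖K y - σᵣ y‖²` and use the lower bound for the quadratic form twice; `K` need not be
diagonalized. -/
lemma sq_lower (h : IncoherentFactorization M U K σ₁ σᵣ b) (y : Fin r → ℝ) :
    σᵣ ^ 2 * (y ⬝ᵥ y) ≤ (K *ᵥ y) ⬝ᵥ (K *ᵥ y) := by
  have h1 := h.lower y
  have h2 := dot_self_nonneg (K *ᵥ y - σᵣ • y)
  simp only [sub_dotProduct, dotProduct_sub, smul_dotProduct, dotProduct_smul, smul_eq_mul] at h2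
  rw [dotProduct_comm (K *ᵥ y) y] at h2
  nlinarith [h.pos]

lemma symm_M (h : IncoherentFactorization M U K σ₁ σᵣ b) : Mᵀ = M := by
  rw [h.eq]; simp [transpose_mul, h.symm, Matrix.mul_assoc]

lemma proj_mul (h : IncoherentFactorization M U K σ₁ σᵣ b) : U * (Uᵀ * M) = M := by
  conv_lhs => rw [h.eq]
  rw [Matrix.mul_assoc U K, ← Matrix.mul_assoc Uᵀ U, h.orth, Matrix.one_mul, ← Matrix.mul_assoc,
    ← h.eq]

lemma one_sub_proj_mul (h : IncoherentFactorization M U K σ₁ σᵣ b) : (1 - U * Uᵀ) * M = 0 := by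
  rw [Matrix.sub_mul, Matrix.one_mul, Matrix.mul_assoc, h.proj_mul, sub_self]

lemma mulVec_U (h : IncoherentFactorization M U K σ₁ σᵣ b) (y : Fin r → ℝ) :
    M *ᵥ (U *ᵥ y) = U *ᵥ (K *ᵥ y) := by
  conv_lhs => rw [h.eq]
  rw [mulVec_mulVec, Matrix.mul_assoc, h.orth, Matrix.mul_one, mulVec_mulVec]

lemma norm_M_le (h : IncoherentFactorization M U K σ₁ σᵣ b) : ‖M‖ ≤ σ₁ := by
  rw [h.eq]
  have h1 := opNorm_le_one_of_orthonormal h.orth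
  have h2 : ‖Uᵀ‖ ≤ 1 := by rw [opNorm_transpose]; exact h1
  calc ‖U * K * Uᵀ‖ ≤ ‖U‖ * ‖K‖ * ‖Uᵀ‖ :=
        (opNorm_mul_le _ _).trans (mul_le_mul_of_nonneg_right (opNorm_mul_le _ _) (norm_nonneg _))
    _ ≤ 1 * σ₁ * 1 := by
        have := h.norm_le
        have := h.one_nonneg
        gcongr
    _ = σ₁ := by ring

/-- This is the bias caused by the mask. Both factors of `M = (U K) Uᵀ` have small blocks, whence
the square of `b`. -/
lemma norm_blockDiag_le (h : IncoherentFactorization M U K σ₁ σᵣ b) :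
    ‖blockDiag M‖ ≤ b ^ 2 * σ₁ := by
  have hb := h.b_nonneg
  have hσ := h.one_nonneg
  refine opNorm_le_of_fro (by positivity) fun B => ?_
  rw [h.eq]
  have := fro_blockDiag_mul_le_right (Y := U * K) (Z := U) (W := B) (b := b * σ₁) (c := b)
    (by positivity) hb (fun i => ?_) h.block_le
  · exact this.trans_eq (by ring)
  · rw [rowBlock_mul]
    exact (opNorm_mul_le _ _).trans
      (mul_le_mul (h.block_le i) h.norm_le (norm_nonneg _) hb)

/-- The deviation of a matrix `V` from the range of `U`. -/
lemma rowBlock_le (h : IncoherentFactorization M U K σ₁ σᵣ b) {κ : Type} [Fintype κ] [DecidableEq κ]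
    {V : Matrix (Idx n ℓ) κ ℝ} (hV : Vᵀ * V = 1) (i : Fin n) :
    ‖rowBlock V i‖ ≤ b + fro (V - U * (Uᵀ * V)) := by
  -- The part of `V` in the range of `U` has blocks as small as those of `U`, and the rest is
  -- bounded by the angle. So every iterate near the range of `U` is incoherent automatically.
  have h1 : rowBlock V i = rowBlock U i * (Uᵀ * V) + rowBlock (V - U * (Uᵀ * V)) i := by
    rw [← rowBlock_mul, ← rowBlock_add, add_sub_cancel]
  rw [h1]
  refine (norm_add_le _ _).trans (add_le_add ?_ ((opNorm_le_fro _).trans (fro_rowBlock_le _ _)))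
  have h2 : ‖Uᵀ * V‖ ≤ 1 := by
    refine (opNorm_mul_le _ _).trans ?_
    rw [opNorm_transpose]
    exact mul_le_one₀ (opNorm_le_one_of_orthonormal h.orth) (norm_nonneg _)
      (opNorm_le_one_of_orthonormal hV)
  calc ‖rowBlock U i * (Uᵀ * V)‖ ≤ ‖rowBlock U i‖ * ‖Uᵀ * V‖ := opNorm_mul_le _ _
    _ ≤ b * 1 := mul_le_mul (h.block_le i) h2 (norm_nonneg _) h.b_nonneg
    _ = b := mul_one b

/-- The error of the spectral initialization. -/
lemma init_error (h : IncoherentFactorization M U K σ₁ σᵣ b) {S : Matrix (Idx n ℓ) (Idx n ℓ) ℝ}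
    (hS : (mask2 S)ᵀ = mask2 S) {e : ℝ} (he : fro (mask2 (S - M)) ≤ e)
    {U₀ : Matrix (Idx n ℓ) (Fin r) ℝ} (hU₀ : IsTopEigenvectors (mask2 S) U₀)
    (hsmall : b ^ 2 * σ₁ + e ≤ σᵣ) :
    (σᵣ - (b ^ 2 * σ₁ + e)) * fro (U₀ - U * (Uᵀ * U₀)) ≤ (b ^ 2 * σ₁ + e) * √r := by
  obtain ⟨horth, d, hd, hmax⟩ := hU₀
  -- The matrix that is diagonalized is `M` plus sampling noise minus the bias of the mask.
  set E := mask2 (S - M) - blockDiag M with hE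
  have hSE : mask2 S = M + E := by
    rw [hE, mask2_sub, mask2_eq_sub M]; abel
  have hEn : ‖E‖ ≤ b ^ 2 * σ₁ + e := by
    refine (norm_sub_le _ _).trans ?_
    have := (opNorm_le_fro (mask2 (S - M))).trans he
    linarith [h.norm_blockDiag_le]
  -- Weyl's inequality by a test vector: a unit vector `x` in the range of `U` whose image under
  -- `U₀ᵀ` has only the entry `q`. Its Rayleigh quotient for the masked `S` is at most `d q`, since
  -- `x` splits into a multiple of the `q`-th eigenvector and a vector orthogonal to all columns of
  -- `U₀`; for `M` it is at least `σᵣ`.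
  have hdq : ∀ q, σᵣ - (b ^ 2 * σ₁ + e) ≤ d q := by
    intro q
    obtain ⟨y, hy, hyp⟩ := exists_unit_mulVec_eq_zero (U₀ᵀ * U) q
    set x := U *ᵥ y with hx
    have hxx : x ⬝ᵥ x = 1 := by rw [hx, dot_mulVec_of_orthonormal h.orth, hy]
    set w : Fin r → ℝ := U₀ᵀ *ᵥ x with hw
    have hwp : ∀ p ≠ q, w p = 0 := by
      intro p hp; rw [hw, hx, mulVec_mulVec]; exact hyp p hp
    set z := x - U₀ *ᵥ w with hz
    have hz0 : U₀ᵀ *ᵥ z = 0 := by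
      rw [hz, mulVec_sub, ← hw, mulVec_mulVec, horth, one_mulVec, sub_self]
    have hSw : mask2 S *ᵥ (U₀ *ᵥ w) = d q • (U₀ *ᵥ w) := by
      rw [mulVec_mulVec, hd, ← mulVec_mulVec, ← mulVec_smul]
      congr 1
      ext p
      rw [mulVec_diagonal]
      by_cases hp : p = q
      · rw [hp]; rfl
      · simp [hwp p hp]
    have hzw : z ⬝ᵥ (U₀ *ᵥ w) = 0 := by rw [dot_mulVec_transpose, hz0, zero_dotProduct]
    have hwz : (U₀ *ᵥ w) ⬝ᵥ (mask2 S *ᵥ z) = 0 := by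
      rw [dot_mulVec_transpose, hS, hSw, smul_dotProduct, dotProduct_comm, hzw, smul_zero]
    have hxz : x = z + U₀ *ᵥ w := by rw [hz]; abel
    have h1 : x ⬝ᵥ (mask2 S *ᵥ x) = z ⬝ᵥ (mask2 S *ᵥ z) + d q * ((U₀ *ᵥ w) ⬝ᵥ (U₀ *ᵥ w)) := by
      rw [hxz, mulVec_add, hSw, dotProduct_add, add_dotProduct, add_dotProduct, hwz,
        dotProduct_smul, dotProduct_smul, hzw]
      simp
    have h2 : x ⬝ᵥ x = z ⬝ᵥ z + (U₀ *ᵥ w) ⬝ᵥ (U₀ *ᵥ w) := by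
      conv_lhs => rw [hxz]
      rw [dotProduct_add, add_dotProduct, add_dotProduct, hzw, dotProduct_comm (U₀ *ᵥ w) z, hzw]
      ring
    have h3 : x ⬝ᵥ (mask2 S *ᵥ x) ≤ d q := by
      rw [h1]
      have := hmax z hz0 q
      rw [hxx] at h2
      have h3 : d q = d q * (z ⬝ᵥ z) + d q * ((U₀ *ᵥ w) ⬝ᵥ (U₀ *ᵥ w)) := by
        rw [← mul_add, ← h2, mul_one]
      linarith
    have h4 : σᵣ ≤ x ⬝ᵥ (M *ᵥ x) := by
      rw [hx, h.mulVec_U, dot_mulVec_transpose, mulVec_mulVec, h.orth, one_mulVec]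
      simpa [hy] using h.lower y
    have h5 := dot_mulVec_self_abs_le E x
    rw [hxx, mul_one] at h5
    rw [hSE, add_mulVec, dotProduct_add] at h3
    have := (abs_le.mp h5).1
    linarith
  -- The Davis–Kahan argument: the projection off the range of `U` kills `M`, so only `E` remains.
  have h6 : (U₀ - U * (Uᵀ * U₀)) * Matrix.diagonal d = (1 - U * Uᵀ) * (E * U₀) := by
    have h7 : U₀ - U * (Uᵀ * U₀) = (1 - U * Uᵀ) * U₀ := by
      rw [Matrix.sub_mul, Matrix.one_mul, Matrix.mul_assoc]
    rw [h7, Matrix.mul_assoc, ← hd, hSE, Matrix.add_mul, Matrix.mul_add, ← Matrix.mul_assoc _ M,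
      h.one_sub_proj_mul, Matrix.zero_mul, zero_add]
  refine (le_fro_mul_diagonal (by linarith) hdq _).trans ?_
  rw [h6]
  refine (fro_mul_le _ _).trans ?_
  refine (mul_le_of_le_one_left (fro_nonneg _) (opNorm_one_sub_le h.orth)).trans ?_
  refine (fro_mul_le _ _).trans ?_
  rw [fro_le_sqrt_of_orthonormal horth]
  exact mul_le_mul_of_nonneg_right hEn (Real.sqrt_nonneg _)

end IncoherentFactorization

/-- The normal equations of a least squares update. -/
lemma IsLeastSquaresUpdate.normal_eq {n ℓ r : ℕ} {S : Matrix (Idx n ℓ) (Idx n ℓ) ℝ}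
    {U U' : Matrix (Idx n ℓ) (Fin r) ℝ} (h : IsLeastSquaresUpdate S U U') :
    mask2 S * U = mask2 (U' * Uᵀ) * U := by
  set A := mask2 S - mask2 (U' * Uᵀ) with hA
  -- `G` is minus half the gradient of the objective at `U'`, so the normal equations say `G = 0`;
  -- the objective is now expanded along `U' + t G`.
  set G := A * U with hG
  set B := mask2 (G * Uᵀ) with hB
  have hAB : ∑ i, ∑ j, A i j * B i j = frobSq G := by
    have h1 : ∀ i j, A i j * B i j = A i j * (G * Uᵀ) i j := by
      intro i j
      by_cases hij : i.1 = j.1 <;> simp [hA, hB, mask2, hij]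
    simp only [h1, frobSq, mul_apply, transpose_apply, Finset.mul_sum]
    refine Finset.sum_congr rfl fun i _ => ?_
    rw [Finset.sum_comm]
    refine Finset.sum_congr rfl fun q _ => ?_
    have h2 : G i q = ∑ j, A i j * U j q := mul_apply
    calc ∑ j, A i j * (G i q * U j q) = G i q * ∑ j, A i j * U j q := by
          rw [Finset.mul_sum]
          exact Finset.sum_congr rfl fun j _ => by ring
      _ = G i q ^ 2 := by rw [← h2, sq]
  have hexp : ∀ t : ℝ, frobSq (mask2 S - mask2 ((U' + t • G) * Uᵀ)) =
      frobSq A - 2 * t * frobSq G + t ^ 2 * frobSq B := by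
    intro t
    have h1 : mask2 S - mask2 ((U' + t • G) * Uᵀ) = A - t • B := by
      rw [hA, hB, Matrix.add_mul, Matrix.smul_mul]
      ext i j
      by_cases hij : i.1 = j.1 <;> simp [mask2, hij]
      ring
    rw [h1, ← hAB]
    simp only [frobSq, Matrix.sub_apply, Matrix.smul_apply, smul_eq_mul, Finset.mul_sum,
      ← Finset.sum_sub_distrib, ← Finset.sum_add_distrib]
    exact Finset.sum_congr rfl fun i _ => Finset.sum_congr rfl fun j _ => by ring
  have hG0 : frobSq G = 0 := by
    refine le_antisymm ?_ (frobSq_nonneg _)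
    by_contra! hpos
    -- The best step length would be `‖G‖² / ‖B‖²`; the summand `1` avoids a division by zero and
    -- still gives a strict decrease.
    have h1 := h (U' + (frobSq G / (frobSq B + 1)) • G)
    rw [hexp, ← hA] at h1
    have hB0 := frobSq_nonneg B
    have h2 : 2 * (frobSq G / (frobSq B + 1)) * frobSq G ≤
      (frobSq G / (frobSq B + 1)) ^ 2 * frobSq B := by linarith
    rw [div_pow, mul_div_assoc', div_mul_eq_mul_div, div_mul_eq_mul_div,
      div_le_div_iff₀ (by positivity) (by positivity)] at h2
    have h3 : 0 < frobSq G ^ 2 := by positivity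
    nlinarith [mul_nonneg h3.le hB0, mul_nonneg h3.le (sq_nonneg (frobSq B))]
  have h0 : G = 0 := fro_eq_zero (by rw [fro, hG0, Real.sqrt_zero])
  rw [hG, hA, Matrix.sub_mul, sub_eq_zero] at h0
  exact h0

namespace IncoherentFactorization

variable {n ℓ r : ℕ} {M S : Matrix (Idx n ℓ) (Idx n ℓ) ℝ}
    {U V V' : Matrix (Idx n ℓ) (Fin r) ℝ} {K : Matrix (Fin r) (Fin r) ℝ} {σ₁ σᵣ b e : ℝ}

/-- Split `M = M V Vᵀ + M (1 - V Vᵀ)`. The first term compares `V'` with the exact power step `M V`;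
the second is small with the angle and keeps the incoherent left factor `U`. -/
lemma residual_eq (h : IncoherentFactorization M U K σ₁ σᵣ b) :
    V' * Vᵀ - M = (V' - M * V) * Vᵀ - U * ((U - V * (Vᵀ * U)) * K)ᵀ := by
  simp only [transpose_mul, transpose_sub, transpose_transpose, h.symm, Matrix.sub_mul,
    Matrix.mul_sub]
  have h1 : U * (K * (Uᵀ * V * Vᵀ)) = M * V * Vᵀ := by
    conv_rhs => rw [h.eq]
    simp only [Matrix.mul_assoc]
  rw [h1, ← Matrix.mul_assoc U K, ← h.eq]
  abel

lemma fro_residual_le (h : IncoherentFactorization M U K σ₁ σᵣ b) (hV : Vᵀ * V = 1) :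
    fro ((U - V * (Vᵀ * U)) * K) ≤ σ₁ * fro (V - U * (Uᵀ * V)) := by
  refine (fro_mul_le' _ _).trans ?_
  rw [fro_proj_comm hV h.orth, mul_comm]
  exact mul_le_mul_of_nonneg_right h.norm_le (fro_nonneg _)

/-- The error of one least squares update. -/
lemma update_error (h : IncoherentFactorization M U K σ₁ σᵣ b) (he : fro (mask2 (S - M)) ≤ e)
    (hV : Vᵀ * V = 1) (hb : b + fro (V - U * (Uᵀ * V)) ≤ 1 / 2) (hls : IsLeastSquaresUpdate S V V') :
    fro (V' - M * V) ≤ b * σ₁ * fro (V - U * (Uᵀ * V)) + 2 * e := by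
  set Y := V' - M * V with hY
  set Z := (U - V * (Vᵀ * U)) * K with hZ
  -- The normal equations with the mask written as identity minus block diagonal part. The identity
  -- part contributes `V' - M V`, which turns them into a fixed point equation for `Y`.
  have hYeq : Y = blockDiag (Y * Vᵀ) * V - blockDiag (U * Zᵀ) * V + mask2 (S - M) * V := by
    have h1 := hls.normal_eq
    have h2 : mask2 (V' * Vᵀ) * V = V' - blockDiag (V' * Vᵀ) * V := by
      rw [mask2_eq_sub, Matrix.sub_mul, Matrix.mul_assoc, hV, Matrix.mul_one]
    have h3 : mask2 (S - M) * V = mask2 S * V - M * V + blockDiag M * V := by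
      rw [mask2_sub, Matrix.sub_mul, mask2_eq_sub M, Matrix.sub_mul]; abel
    rw [← Matrix.sub_mul, ← blockDiag_sub, ← h.residual_eq, blockDiag_sub, Matrix.sub_mul, h3, h1,
      h2, hY]
    abel
  have hVb : ∀ i, ‖rowBlock V i‖ ≤ 1 / 2 := fun i => (h.rowBlock_le hV i).trans hb
  have h1 : fro (blockDiag (Y * Vᵀ) * V) ≤ 1 / 2 * (1 / 2) * fro Y :=
    fro_blockDiag_mul_le_left (by norm_num) hVb hVb
  have h2 : fro (blockDiag (U * Zᵀ) * V) ≤ b * (1 / 2) * fro Z :=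
    fro_blockDiag_mul_le_mid h.b_nonneg h.block_le hVb
  have h3 : fro (mask2 (S - M) * V) ≤ e :=
    (fro_mul_le' _ _).trans
      ((mul_le_of_le_one_right (fro_nonneg _) (opNorm_le_one_of_orthonormal hV)).trans he)
  -- The term `‖Y‖ / 4` on the right is absorbed into the left side. The term with `Z` carries the
  -- factor `b` from the blocks of `U`, and this is what makes the update a contraction in the
  -- angle.
  have h4 : fro Y ≤ 1 / 2 * (1 / 2) * fro Y + b * (1 / 2) * fro Z + e := by
    conv_lhs => rw [hYeq]
    refine (fro_add_le _ _).trans (add_le_add ((fro_sub_le _ _).trans (add_le_add h1 h2)) h3)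
  have h5 : b * fro Z ≤ b * (σ₁ * fro (V - U * (Uᵀ * V))) :=
    mul_le_mul_of_nonneg_left (h.fro_residual_le hV) h.b_nonneg
  have h6 := fro_nonneg Z
  have h7 := mul_nonneg h.b_nonneg h6
  have h8 : 0 ≤ e := (fro_nonneg _).trans he
  linarith [fro_nonneg Y]

/-- Orthonormalizing an accurate update. -/
lemma qr_error (h : IncoherentFactorization M U K σ₁ σᵣ b) (hV : Vᵀ * V = 1)
    (hd : fro (V - U * (Uᵀ * V)) ≤ 1 / 2) (hY : fro (V' - M * V) ≤ σᵣ / 4)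
    {V₁ : Matrix (Idx n ℓ) (Fin r) ℝ} {R : Matrix (Fin r) (Fin r) ℝ} (hqr : IsQR V' V₁ R) :
    σᵣ / 2 * fro (V₁ - U * (Uᵀ * V₁)) ≤ fro (V' - M * V) := by
  obtain ⟨hR, horth, -⟩ := hqr
  have hσ := h.pos
  -- `R` cannot shrink vectors by more than `σᵣ / 2`: `‖R x‖ = ‖V' x‖`, at least `3/4` of `‖x‖²`
  -- lies in the component along `U`, where `M` stretches by `σᵣ`, and `V'` differs from `M V` by at
  -- most `σᵣ / 4`. Numerically `3/8 - 1/16 ≥ 1/4`.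
  have hlow : ∀ x, (σᵣ / 2) ^ 2 * (x ⬝ᵥ x) ≤ (R *ᵥ x) ⬝ᵥ (R *ᵥ x) := by
    intro x
    have h1 : (R *ᵥ x) ⬝ᵥ (R *ᵥ x) = (V' *ᵥ x) ⬝ᵥ (V' *ᵥ x) := by
      rw [hR, ← mulVec_mulVec, dot_mulVec_of_orthonormal horth]
    set w := (Uᵀ * V) *ᵥ x with hw
    have h2 : (M *ᵥ (V *ᵥ x)) = U *ᵥ (K *ᵥ w) := by
      conv_lhs => rw [h.eq]
      rw [hw]
      simp only [mulVec_mulVec, Matrix.mul_assoc]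
    have h3 : x ⬝ᵥ x = ((V - U * (Uᵀ * V)) *ᵥ x) ⬝ᵥ ((V - U * (Uᵀ * V)) *ᵥ x) + w ⬝ᵥ w := by
      have h4 : (V *ᵥ x) = (V - U * (Uᵀ * V)) *ᵥ x + U *ᵥ w := by
        rw [hw, sub_mulVec, mulVec_mulVec]; abel
      have h5 : ((V - U * (Uᵀ * V)) *ᵥ x) ⬝ᵥ (U *ᵥ w) = 0 := by
        rw [dot_mulVec_transpose, mulVec_mulVec, Matrix.mul_sub, ← Matrix.mul_assoc, h.orth,
          Matrix.one_mul, sub_self, zero_mulVec, zero_dotProduct]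
      rw [← dot_mulVec_of_orthonormal hV, h4, add_dotProduct, dotProduct_add, dotProduct_add,
        dotProduct_comm (U *ᵥ w) (_ *ᵥ x), h5, dot_mulVec_of_orthonormal h.orth]
      ring
    have h6 := dot_mulVec_le (V - U * (Uᵀ * V)) x
    have h7 : ‖V - U * (Uᵀ * V)‖ ^ 2 ≤ (1 / 2) ^ 2 :=
      pow_le_pow_left₀ (norm_nonneg _) ((opNorm_le_fro _).trans hd) 2
    have hx := dot_self_nonneg x
    have h8 : 3 / 4 * (x ⬝ᵥ x) ≤ w ⬝ᵥ w := by nlinarith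
    have h9 := h.sq_lower w
    have h10 : (M *ᵥ (V *ᵥ x)) ⬝ᵥ (M *ᵥ (V *ᵥ x)) = (K *ᵥ w) ⬝ᵥ (K *ᵥ w) := by
      rw [h2, dot_mulVec_of_orthonormal h.orth]
    have h11 := dot_add_le (V' *ᵥ x) ((-(V' - M * V)) *ᵥ x)
    have h12 : V' *ᵥ x + (-(V' - M * V)) *ᵥ x = M *ᵥ (V *ᵥ x) := by
      rw [← add_mulVec, mulVec_mulVec]; congr 1; abel
    have h13 := dot_mulVec_le (-(V' - M * V)) x
    have h14 : ‖-(V' - M * V)‖ ^ 2 ≤ (σᵣ / 4) ^ 2 := by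
      rw [norm_neg]
      exact pow_le_pow_left₀ (norm_nonneg _) ((opNorm_le_fro _).trans hY) 2
    rw [h12, h10] at h11
    rw [h1]
    nlinarith [mul_le_mul_of_nonneg_right h14 hx, mul_le_mul_of_nonneg_left h8 (sq_nonneg σᵣ),
      mul_nonneg (sq_nonneg σᵣ) hx]
  refine (le_fro_mul_of_lower (by positivity) hlow _).trans ?_
  -- Off the range of `U` the exact power step `M V` vanishes, so only the error of the update is
  -- divided by `R`.
  have h1 : (V₁ - U * (Uᵀ * V₁)) * R = (1 - U * Uᵀ) * (V' - M * V) := by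
    rw [Matrix.mul_sub, ← Matrix.mul_assoc _ M, h.one_sub_proj_mul, Matrix.zero_mul, sub_zero, hR]
    simp only [Matrix.sub_mul, Matrix.one_mul, Matrix.mul_assoc]
  rw [h1]
  exact (fro_mul_le _ _).trans
    (mul_le_of_le_one_left (fro_nonneg _) (opNorm_one_sub_le h.orth))

/-- The error of alternating minimization. -/
theorem altMin_error (h : IncoherentFactorization M U K σ₁ σᵣ b) (hS : (mask2 S)ᵀ = mask2 S)
    (he : fro (mask2 (S - M)) ≤ e) (hr : 1 ≤ r) (hb : b * σ₁ ≤ σᵣ / 4)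
    (hinit : √r * (b ^ 2 * σ₁ + e) ≤ σᵣ / 8) (he' : e ≤ σᵣ / 128) {T : ℕ} (hT : 1 ≤ T)
    {M' : Matrix (Idx n ℓ) (Idx n ℓ) ℝ} (hM' : IsAltMinOutput r T S M') :
    fro (M' - M) ≤ σ₁ * (1 / 2) ^ T + 18 * σ₁ * e / σᵣ := by
  obtain ⟨V, V', h0, hstep, rfl⟩ := hM'
  have hσ := h.pos
  have hσ₁ := h.one_nonneg
  have hle := h.le
  have he0 : 0 ≤ e := (fro_nonneg _).trans he
  have hb0 := h.b_nonneg
  have hb4 : b ≤ 1 / 4 := by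
    have : b * σᵣ ≤ b * σ₁ := mul_le_mul_of_nonneg_left hle hb0
    by_contra! hlt
    nlinarith
  have hr1 : 1 ≤ √(r : ℝ) := Real.one_le_sqrt.mpr (by exact_mod_cast hr)
  have hτ0 : 0 ≤ b ^ 2 * σ₁ + e := by positivity
  have hτ : b ^ 2 * σ₁ + e ≤ σᵣ / 8 := (le_mul_of_one_le_left hτ0 hr1).trans hinit
  have hd0 : fro (V 0 - U * (Uᵀ * V 0)) ≤ 1 / 7 := by
    have h1 := h.init_error hS he h0 (by linarith)
    have h2 : 7 / 8 * σᵣ * fro (V 0 - U * (Uᵀ * V 0)) ≤ σᵣ / 8 := by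
      refine le_trans ?_ (h1.trans (by linarith))
      exact mul_le_mul_of_nonneg_right (by linarith) (fro_nonneg _)
    by_contra! hlt
    nlinarith
  have heσ : e / σᵣ ≤ 1 / 128 := by rw [div_le_iff₀ hσ]; linarith
  have heσ0 : 0 ≤ e / σᵣ := by positivity
  -- The recursion is `d ↦ d / 2 + 4 e / σᵣ`, whose fixed point is `8 e / σᵣ`; the initial value
  -- `1/7` comes from the spectral initialization.
  have hmain : ∀ τ ≤ T - 1, (V τ)ᵀ * V τ = 1 ∧
      fro (V τ - U * (Uᵀ * V τ)) ≤ 1 / 7 * (1 / 2) ^ τ + 8 * (e / σᵣ) := by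
    intro τ
    induction τ with
    | zero => intro _; exact ⟨h0.1, by linarith⟩
    | succ τ ih =>
      intro hτT
      obtain ⟨hV, hd⟩ := ih (by omega)
      obtain ⟨hls, R, hqr⟩ := hstep τ (by omega)
      have hp : ((1 : ℝ) / 2) ^ τ ≤ 1 := pow_le_one₀ (by norm_num) (by norm_num)
      have hd4 : fro (V τ - U * (Uᵀ * V τ)) ≤ 1 / 4 := by linarith
      have hY := h.update_error he hV (by linarith) hls
      have hY' : fro (V' (τ + 1) - M * V τ) ≤ σᵣ / 4 * fro (V τ - U * (Uᵀ * V τ)) + 2 * e := by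
        refine hY.trans ?_
        linarith [mul_le_mul_of_nonneg_right hb (fro_nonneg (V τ - U * (Uᵀ * V τ)))]
      have h1 := h.qr_error hV (by linarith) (by nlinarith) hqr
      refine ⟨hqr.2.1, ?_⟩
      have h2 : fro (V (τ + 1) - U * (Uᵀ * V (τ + 1))) ≤
          1 / 2 * fro (V τ - U * (Uᵀ * V τ)) + 4 * (e / σᵣ) := by
        have h3 : σᵣ / 2 * fro (V (τ + 1) - U * (Uᵀ * V (τ + 1))) ≤
            σᵣ / 2 * (1 / 2 * fro (V τ - U * (Uᵀ * V τ)) + 4 * (e / σᵣ)) := by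
          refine (h1.trans hY').trans_eq ?_
          field_simp; ring
        exact le_of_mul_le_mul_left h3 (by positivity)
      rw [pow_succ]
      linarith
  obtain ⟨hV, hd⟩ := hmain (T - 1) le_rfl
  obtain ⟨hls, -⟩ := hstep (T - 1) (by omega)
  rw [Nat.sub_add_cancel hT] at hls
  have hp : ((1 : ℝ) / 2) ^ (T - 1) ≤ 1 := pow_le_one₀ (by norm_num) (by norm_num)
  have hY := h.update_error he hV (by linarith) hls
  -- The output pairs the update number `T` with the iterate number `T - 1`, so the angle of the
  -- latter enters and costs one factor `2`.
  have hpT : ((1 : ℝ) / 2) ^ (T - 1) = 2 * (1 / 2) ^ T := by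
    obtain ⟨k, rfl⟩ : ∃ k, T = k + 1 := ⟨T - 1, by omega⟩
    rw [Nat.add_sub_cancel, pow_succ]; ring
  rw [h.residual_eq]
  refine (fro_sub_le _ _).trans ?_
  rw [fro_mul_orthonormal_transpose hV, ← fro_transpose (U * _), transpose_mul, transpose_transpose,
    fro_mul_orthonormal_transpose h.orth]
  have h1 := h.fro_residual_le hV
  set d := fro (V (T - 1) - U * (Uᵀ * V (T - 1))) with hd_def
  have hd0' : 0 ≤ d := fro_nonneg _
  have h2 : b * σ₁ * d ≤ 1 / 4 * σ₁ * d := by gcongr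
  have h3 : e ≤ σ₁ * (e / σᵣ) := by
    rw [mul_div_assoc', le_div_iff₀ hσ]; nlinarith
  have h4 : σ₁ * d ≤ σ₁ * (1 / 7 * (1 / 2) ^ (T - 1) + 8 * (e / σᵣ)) :=
    mul_le_mul_of_nonneg_left hd hσ₁
  rw [hpT] at h4
  have h5 : 18 * σ₁ * e / σᵣ = 18 * (σ₁ * (e / σᵣ)) := by ring
  rw [h5]
  have h6 : 0 ≤ σ₁ * ((1 : ℝ) / 2) ^ T := by positivity
  linarith

end IncoherentFactorization

/-! ### Perturbation of the singular value decomposition, and whitening. -/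

/-- The spectral theorem with sorted eigenvalues. -/
lemma exists_sorted_spectral {ι : Type} [Fintype ι] [DecidableEq ι] {N : ℕ}
    (hN : Fintype.card ι = N) {A : Matrix ι ι ℝ} (hA : Aᵀ = A) :
    ∃ (W : Matrix ι (Fin N) ℝ) (d : Fin N → ℝ), Wᵀ * W = 1 ∧ W * Wᵀ = 1 ∧ Antitone d ∧
      A * W = W * Matrix.diagonal d := by
  have hsymm : (Matrix.toEuclideanLin A).IsSymmetric :=
    Matrix.isSymmetric_toEuclideanLin_iff.mpr
      (by rw [Matrix.IsHermitian, conjTranspose_eq_transpose_of_trivial, hA])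
  have hn : Module.finrank ℝ (EuclideanSpace ℝ ι) = N := by simpa using hN
  set B := hsymm.eigenvectorBasis hn with hB
  have hW : (Matrix.of fun i k => (B k) i)ᵀ * (Matrix.of fun i k => (B k) i) = 1 := by
    ext k l
    have := orthonormal_iff_ite.mp B.orthonormal l k
    rw [PiLp.inner_apply] at this
    simp only [mul_apply, transpose_apply, of_apply, one_apply]
    simpa [eq_comm] using this
  refine ⟨Matrix.of fun i k => (B k) i, hsymm.eigenvalues hn, hW, ?_,
    hsymm.eigenvalues_antitone hn, ?_⟩
  · exact (Matrix.mul_eq_one_comm_of_card_eq _ _ _ (by simpa using hN.symm)).mp hW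
  · ext i k
    have h1 := hsymm.apply_eigenvectorBasis hn k
    have h2 := congrArg (fun v => v.ofLp i) h1
    rw [mul_diagonal]
    rw [toLpLin_apply] at h2
    simp only [mulVec, dotProduct, PiLp.smul_apply, smul_eq_mul, RCLike.ofReal_real_eq_id, id] at h2
    simp only [mul_apply, of_apply]
    rw [h2, mul_comm]

/-- A nearly orthogonal matrix is close to an orthogonal one. -/
lemma exists_orthogonal_near {r : ℕ} {R : Matrix (Fin r) (Fin r) ℝ} (h : fro (R * Rᵀ - 1) < 1) :
    ∃ V : Matrix (Fin r) (Fin r) ℝ, Vᵀ * V = 1 ∧ fro (R - V) ≤ fro (R * Rᵀ - 1) := by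
  obtain ⟨W, d, hW, hW', -, hd⟩ := exists_sorted_spectral (ι := Fin r) (N := r) (by simp)
    (A := R * Rᵀ) (by simp)
  have hH : R * Rᵀ = W * Matrix.diagonal d * Wᵀ := by
    rw [← hd, Matrix.mul_assoc, hW', Matrix.mul_one]
  have hfro : fro (R * Rᵀ - 1) = fro (Matrix.diagonal fun i => d i - 1) := by
    have : R * Rᵀ - 1 = W * (Matrix.diagonal fun i => d i - 1) * Wᵀ := by
      have h2 : (Matrix.diagonal fun i => d i - 1) = Matrix.diagonal d - 1 := by
        rw [← diagonal_one, diagonal_sub]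
      rw [hH, h2, Matrix.mul_sub, Matrix.mul_one, Matrix.sub_mul, hW']
    rw [this, fro_mul_orthonormal_transpose hW, fro_orthonormal_mul hW]
  have hpos : ∀ i, 0 < d i := by
    intro i
    have h1 := abs_apply_le_fro (Matrix.diagonal fun i => d i - 1) i i
    rw [← hfro, diagonal_apply_eq] at h1
    linarith [(abs_lt.mp (h1.trans_lt h)).1]
  -- The polar factor `(R Rᵀ)^{-1/2} R`. The error bound then comes from `|√d - 1| ≤ |d - 1|` for
  -- the eigenvalues of `R Rᵀ`.
  set V := W * Matrix.diagonal (fun i => (√(d i))⁻¹) * Wᵀ * R with hV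
  have hVV : V * Vᵀ = 1 := by
    have h1 : V * Vᵀ = W * (Matrix.diagonal (fun i => (√(d i))⁻¹) * (Wᵀ * (R * Rᵀ * W) *
        Matrix.diagonal (fun i => (√(d i))⁻¹))) * Wᵀ := by
      rw [hV]; simp only [transpose_mul, transpose_transpose, diagonal_transpose, Matrix.mul_assoc]
    rw [h1, hd, ← Matrix.mul_assoc Wᵀ, hW, Matrix.one_mul, diagonal_mul_diagonal,
      diagonal_mul_diagonal]
    have h2 : (fun i => (√(d i))⁻¹ * (d i * (√(d i))⁻¹)) = fun _ => 1 := by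
      funext i
      have := Real.sqrt_pos.mpr (hpos i)
      field_simp
      exact (Real.sq_sqrt (hpos i).le).symm
    rw [h2, diagonal_one, Matrix.mul_one, hW']
  refine ⟨V, mul_eq_one_comm.mp hVV, ?_⟩
  have hR : R = W * Matrix.diagonal (fun i => √(d i)) * Wᵀ * V := by
    have h1 : W * Matrix.diagonal (fun i => √(d i)) * Wᵀ * V = W * (Matrix.diagonal (fun i => √(d i))
        * ((Wᵀ * W) * Matrix.diagonal (fun i => (√(d i))⁻¹))) * Wᵀ * R := by
      rw [hV]; simp only [Matrix.mul_assoc]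
    rw [h1, hW, Matrix.one_mul, diagonal_mul_diagonal]
    have h2 : (fun i => √(d i) * (√(d i))⁻¹) = fun _ => 1 := by
      funext i
      exact mul_inv_cancel₀ (Real.sqrt_pos.mpr (hpos i)).ne'
    rw [h2, diagonal_one, Matrix.mul_one, hW', Matrix.one_mul]
  have hRV : R - V = W * (Matrix.diagonal (fun i => √(d i) - 1)) * Wᵀ * V := by
    have h2 : (Matrix.diagonal fun i => √(d i) - 1) = Matrix.diagonal (fun i => √(d i)) - 1 := by
      rw [← diagonal_one, diagonal_sub]
    rw [h2, Matrix.mul_sub, Matrix.mul_one, Matrix.sub_mul, hW', Matrix.sub_mul, ← hR,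
      Matrix.one_mul]
  have hVt : (Vᵀ)ᵀ * Vᵀ = 1 := by rw [transpose_transpose, hVV]
  have h3 := fro_mul_orthonormal_transpose hVt (W * (Matrix.diagonal (fun i => √(d i) - 1)) * Wᵀ)
  rw [transpose_transpose] at h3
  rw [hRV, h3, fro_mul_orthonormal_transpose hW, fro_orthonormal_mul hW, hfro]
  refine Real.sqrt_le_sqrt (Finset.sum_le_sum fun i _ => Finset.sum_le_sum fun j _ => ?_)
  by_cases hij : i = j
  · subst hij
    rw [diagonal_apply_eq, diagonal_apply_eq]
    have h1 : d i - 1 = (√(d i) - 1) * (√(d i) + 1) := by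
      have := Real.sq_sqrt (hpos i).le
      linear_combination -this
    rw [h1, mul_pow]
    refine le_mul_of_one_le_right (sq_nonneg _) ?_
    nlinarith [Real.sqrt_nonneg (d i)]
  · simp [hij]

/-- The Frobenius inner product. -/
lemma trace_mul_le {ι κ : Type} [Fintype ι] [Fintype κ] [DecidableEq ι] [DecidableEq κ]
    (A B : Matrix ι κ ℝ) : (Aᵀ * B).trace ≤ fro A * fro B := by
  have h1 : (Aᵀ * B).trace = ∑ p : ι × κ, A p.1 p.2 * B p.1 p.2 := by
    rw [Fintype.sum_prod_type, Finset.sum_comm]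
    simp [trace, mul_apply]
  rw [h1, fro, fro, frobSq, frobSq, ← Fintype.sum_prod_type', ← Fintype.sum_prod_type']
  exact Real.sum_mul_le_sqrt_mul_sqrt _ _ _

/-- Lipschitz continuity of the square root of positive semidefinite matrices, in the case that one
of them is diagonal. -/
lemma fro_sub_diagonal_le {r : ℕ} {X : Matrix (Fin r) (Fin r) ℝ} {s : Fin r → ℝ} {c : ℝ}
    (hs : ∀ q, c ≤ s q) (hX : ∀ y, 0 ≤ y ⬝ᵥ (X *ᵥ y)) (hXs : Xᵀ = X) :
    c * fro (X - Matrix.diagonal s) ≤ fro (X * X - Matrix.diagonal s * Matrix.diagonal s) := by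
  set D := X - Matrix.diagonal s with hD
  have hDs : Dᵀ = D := by rw [hD, transpose_sub, hXs, diagonal_transpose]
  -- A Sylvester equation for `D`. In the pairing with `D`, the term `X D` contributes a nonnegative
  -- trace because `X` is positive semidefinite, and the term `D diag(s)` at least `c ‖D‖²`;
  -- Cauchy–Schwarz bounds the pairing from above.
  have h1 : X * X - Matrix.diagonal s * Matrix.diagonal s = X * D + D * Matrix.diagonal s := by
    rw [hD, Matrix.mul_sub, Matrix.sub_mul]; abel
  have h2 := trace_mul_le D (X * D + D * Matrix.diagonal s)
  rw [Matrix.mul_add, trace_add] at h2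
  have h3 : 0 ≤ (Dᵀ * (X * D)).trace := by
    refine Finset.sum_nonneg fun j _ => ?_
    have := hX (fun i => D i j)
    refine this.trans_eq ?_
    simp only [dotProduct, mulVec, diag_apply, mul_apply, transpose_apply]
  have h4 : c * fro D ^ 2 ≤ (Dᵀ * (D * Matrix.diagonal s)).trace := by
    rw [fro_sq, frobSq_eq_sum_col, ← Matrix.mul_assoc, Finset.mul_sum]
    refine Finset.sum_le_sum fun j _ => ?_
    rw [diag_apply, mul_diagonal]
    have h5 : (Dᵀ * D) j j = (fun i => D i j) ⬝ᵥ (fun i => D i j) := rfl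
    rw [h5, mul_comm]
    exact mul_le_mul_of_nonneg_left (hs j) (dot_self_nonneg _)
  rw [h1]
  rcases (fro_nonneg D).eq_or_lt with h0 | h0
  · rw [← h0, mul_zero]; exact fro_nonneg _
  · refine le_of_mul_le_mul_left ?_ h0
    nlinarith

namespace IncoherentFactorization

variable {n ℓ r : ℕ} {M M' : Matrix (Idx n ℓ) (Idx n ℓ) ℝ}
    {U V W : Matrix (Idx n ℓ) (Fin r) ℝ} {s : Fin r → ℝ}
    {K : Matrix (Fin r) (Fin r) ℝ} {σ₁ σᵣ b ρ : ℝ}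

lemma nonneg_M (h : IncoherentFactorization M U K σ₁ σᵣ b) (x : Idx n ℓ → ℝ) :
    σᵣ * ((Uᵀ *ᵥ x) ⬝ᵥ (Uᵀ *ᵥ x)) ≤ x ⬝ᵥ (M *ᵥ x) := by
  have h1 : x ⬝ᵥ (M *ᵥ x) = (Uᵀ *ᵥ x) ⬝ᵥ (K *ᵥ (Uᵀ *ᵥ x)) := by
    conv_lhs => rw [h.eq]
    rw [← mulVec_mulVec, ← mulVec_mulVec, dot_mulVec_transpose]
  rw [h1]
  exact h.lower _

lemma sq_M (h : IncoherentFactorization M U K σ₁ σᵣ b) (x : Idx n ℓ → ℝ) :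
    σᵣ * (x ⬝ᵥ (M *ᵥ x)) ≤ (M *ᵥ x) ⬝ᵥ (M *ᵥ x) := by
  set y := Uᵀ *ᵥ x with hy
  have h1 : x ⬝ᵥ (M *ᵥ x) = y ⬝ᵥ (K *ᵥ y) := by
    conv_lhs => rw [h.eq]
    rw [← mulVec_mulVec, ← mulVec_mulVec, dot_mulVec_transpose]
  have h2 : (M *ᵥ x) ⬝ᵥ (M *ᵥ x) = (K *ᵥ y) ⬝ᵥ (K *ᵥ y) := by
    conv_lhs => rw [h.eq]
    rw [← mulVec_mulVec, ← mulVec_mulVec, dot_mulVec_of_orthonormal h.orth]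
  rw [h1, h2]
  have h3 := h.sq_lower y
  have h4 := dot_self_nonneg (K *ᵥ y - σᵣ • y)
  simp only [sub_dotProduct, dotProduct_sub, smul_dotProduct, dotProduct_smul, smul_eq_mul] at h4
  rw [dotProduct_comm (K *ᵥ y) y] at h4
  linarith

/-- The singular values of a matrix that is close to `M`. -/
lemma svd_bounds (h : IncoherentFactorization M U K σ₁ σᵣ b) (hsvd : IsSVD M' V s W)
    (hM : fro (M' - M) ≤ ρ * σᵣ) (hρ : ρ ≤ 1 / 2) (q : Fin r) : σᵣ / 2 ≤ s q ∧ s q ≤ 2 * σ₁ := by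
  obtain ⟨hV, hW, -, hs, rfl⟩ := hsvd
  have hσ := h.pos
  have hle := h.le
  have hop : ‖V * Matrix.diagonal s * Wᵀ - M‖ ≤ ρ * σᵣ := (opNorm_le_fro _).trans hM
  have hρσ : ρ * σᵣ ≤ σᵣ / 2 := by nlinarith
  constructor
  -- The test vector of the min-max principle again: `x` is a unit vector in the range of `U` and
  -- `Vᵀ x` has only the entry `q`. So the transpose of `M'` stretches `x` by at most `s q`, while
  -- `M` stretches it by at least `σᵣ`.
  · obtain ⟨y, hy, hyp⟩ := exists_unit_mulVec_eq_zero (Vᵀ * U) q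
    set x := U *ᵥ y with hx
    set M' := V * Matrix.diagonal s * Wᵀ with hM'
    have h1 : (M'ᵀ *ᵥ x) ⬝ᵥ (M'ᵀ *ᵥ x) ≤ s q ^ 2 := by
      have h2 : M'ᵀ *ᵥ x = W *ᵥ (Matrix.diagonal s *ᵥ ((Vᵀ * U) *ᵥ y)) := by
        rw [hM', hx]
        simp only [transpose_mul, transpose_transpose, diagonal_transpose, mulVec_mulVec,
          Matrix.mul_assoc]
      rw [h2, dot_mulVec_of_orthonormal hW]
      have h3 : ((Vᵀ * U) *ᵥ y) ⬝ᵥ ((Vᵀ * U) *ᵥ y) ≤ 1 := by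
        refine (dot_mulVec_le _ _).trans ?_
        rw [hy, mul_one]
        refine pow_le_one₀ (norm_nonneg _) ((opNorm_mul_le _ _).trans ?_)
        rw [opNorm_transpose]
        exact mul_le_one₀ (opNorm_le_one_of_orthonormal hV) (norm_nonneg _)
          (opNorm_le_one_of_orthonormal h.orth)
      set w := (Vᵀ * U) *ᵥ y with hw
      have h4 : ∀ u v : Fin r → ℝ, (∀ p ≠ q, u p = 0) → u ⬝ᵥ v = u q * v q := by
        intro u v hu
        exact Finset.sum_eq_single q (fun p _ hp => by rw [hu p hp, zero_mul]) (by simp)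
      rw [h4 w w hyp] at h3
      rw [h4 _ _ (fun p hp => by rw [mulVec_diagonal, hyp p hp, mul_zero]), mulVec_diagonal]
      nlinarith [sq_nonneg (s q)]
    have h5 : (M *ᵥ x) ⬝ᵥ (M *ᵥ x) ≥ σᵣ ^ 2 := by
      rw [hx, h.mulVec_U, dot_mulVec_of_orthonormal h.orth]
      simpa [hy] using h.sq_lower y
    have h6 : √((M *ᵥ x) ⬝ᵥ (M *ᵥ x)) ≤ √((M'ᵀ *ᵥ x) ⬝ᵥ (M'ᵀ *ᵥ x)) + ρ * σᵣ := by
      have h7 : M *ᵥ x = M'ᵀ *ᵥ x - (M' - M)ᵀ *ᵥ x := by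
        rw [transpose_sub, h.symm_M, sub_mulVec]; abel
      have h8 : √(((M' - M)ᵀ *ᵥ x) ⬝ᵥ ((M' - M)ᵀ *ᵥ x)) ≤ ρ * σᵣ := by
        refine Real.sqrt_le_iff.mpr ⟨(norm_nonneg _).trans hop, (dot_mulVec_le _ _).trans ?_⟩
        rw [hx, dot_mulVec_of_orthonormal h.orth, hy, mul_one, opNorm_transpose]
        exact pow_le_pow_left₀ (norm_nonneg _) hop 2
      refine le_trans ?_ (add_le_add_right h8 _)
      rw [h7]
      simp only [dot_self_eq_norm_sq, Real.sqrt_sq (norm_nonneg _)]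
      exact norm_sub_le (WithLp.toLp 2 (M'ᵀ *ᵥ x)) (WithLp.toLp 2 ((M' - M)ᵀ *ᵥ x))
    have h9 : σᵣ ≤ √((M *ᵥ x) ⬝ᵥ (M *ᵥ x)) := Real.le_sqrt_of_sq_le h5
    have h10 : √((M'ᵀ *ᵥ x) ⬝ᵥ (M'ᵀ *ᵥ x)) ≤ s q := Real.sqrt_le_iff.mpr ⟨hs q, h1⟩
    linarith
  · have h1 : Matrix.diagonal s = Vᵀ * (V * Matrix.diagonal s * Wᵀ) * W := by
      have : Vᵀ * (V * Matrix.diagonal s * Wᵀ) * W = (Vᵀ * V) * Matrix.diagonal s * (Wᵀ * W) := by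
        simp only [Matrix.mul_assoc]
      rw [this, hV, hW, Matrix.one_mul, Matrix.mul_one]
    have h2 : ‖Matrix.diagonal s‖ ≤ ‖V * Matrix.diagonal s * Wᵀ‖ := by
      conv_lhs => rw [h1]
      refine (opNorm_mul_le _ _).trans ((mul_le_of_le_one_right (norm_nonneg _)
        (opNorm_le_one_of_orthonormal hW)).trans ((opNorm_mul_le _ _).trans ?_))
      rw [opNorm_transpose]
      exact mul_le_of_le_one_left (norm_nonneg _) (opNorm_le_one_of_orthonormal hV)
    have h3 : ‖V * Matrix.diagonal s * Wᵀ‖ ≤ σ₁ + ρ * σᵣ := by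
      have := norm_add_le M (V * Matrix.diagonal s * Wᵀ - M)
      rw [add_sub_cancel] at this
      linarith [h.norm_M_le]
    have h4 : s q ≤ ‖Matrix.diagonal s‖ := by
      rw [l2_opNorm_diagonal]
      exact (le_abs_self _).trans (norm_le_pi_norm s q)
    linarith

/-- Wedin's argument: multiplying `V - U Uᵀ V` by `diag(s)` gives `(1 - U Uᵀ)(M' - M) W`, since the
projection kills `M`, and all `s q` are at least `σᵣ / 2`. -/
lemma svd_left_error (h : IncoherentFactorization M U K σ₁ σᵣ b) (hsvd : IsSVD M' V s W)
    (hM : fro (M' - M) ≤ ρ * σᵣ) (hρ : ρ ≤ 1 / 2) : fro (V - U * (Uᵀ * V)) ≤ 2 * ρ := by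
  have hs := fun q => (h.svd_bounds hsvd hM hρ q).1
  obtain ⟨hV, hW, -, -, hM'⟩ := hsvd
  have hσ := h.pos
  have h1 := le_fro_mul_diagonal (c := σᵣ / 2) (by positivity) hs (V - U * (Uᵀ * V))
  have h2 : (V - U * (Uᵀ * V)) * Matrix.diagonal s = (1 - U * Uᵀ) * (M' - M) * W := by
    rw [Matrix.mul_sub, h.one_sub_proj_mul, sub_zero, hM']
    simp only [Matrix.mul_assoc, hW, Matrix.mul_one, Matrix.sub_mul, Matrix.one_mul]
  rw [h2] at h1
  have h3 : fro ((1 - U * Uᵀ) * (M' - M) * W) ≤ ρ * σᵣ := by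
    refine (fro_mul_le' _ _).trans ((mul_le_of_le_one_right (fro_nonneg _)
      (opNorm_le_one_of_orthonormal hW)).trans ((fro_mul_le _ _).trans ?_))
    exact (mul_le_of_le_one_left (fro_nonneg _) (opNorm_one_sub_le h.orth)).trans hM
  have h4 : σᵣ / 2 * fro (V - U * (Uᵀ * V)) ≤ σᵣ / 2 * (2 * ρ) := by linarith
  exact le_of_mul_le_mul_left h4 (by positivity)

/-- Here the projection is off the range of `V` and kills `M'` instead of `M`. -/
lemma fro_one_sub_mul (hsvd : IsSVD M' V s W) (hM : fro (M' - M) ≤ ρ * σᵣ) :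
    fro ((1 - V * Vᵀ) * M) ≤ ρ * σᵣ := by
  obtain ⟨hV, hW, -, -, hM'⟩ := hsvd
  have h1 : (1 - V * Vᵀ) * M' = 0 := by
    rw [hM', Matrix.sub_mul, Matrix.one_mul]
    have : V * Vᵀ * (V * Matrix.diagonal s * Wᵀ) = V * (Vᵀ * V) * Matrix.diagonal s * Wᵀ := by
      simp only [Matrix.mul_assoc]
    rw [this, hV, Matrix.mul_one, sub_self]
  have h2 : (1 - V * Vᵀ) * M = (1 - V * Vᵀ) * (M - M') := by
    rw [Matrix.mul_sub, h1, sub_zero]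
  rw [h2]
  refine (fro_mul_le _ _).trans ?_
  rw [fro_sub_comm]
  exact (mul_le_of_le_one_left (fro_nonneg _) (opNorm_one_sub_le hV)).trans hM

/-- The estimate `M'` need not be symmetric, so `W` may differ from `V` and `Vᵀ M V` cannot be
compared with `s` directly. The squares can: `Vᵀ M'` times its transpose is exactly `diag(s)²`, and
`Vᵀ M V Vᵀ` is close to `Vᵀ M'`. The Lipschitz bound `fro_sub_diagonal_le` for the square root
removes the squares. -/
lemma fro_core_error (h : IncoherentFactorization M U K σ₁ σᵣ b) (hsvd : IsSVD M' V s W)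
    (hM : fro (M' - M) ≤ ρ * σᵣ) (hρ : ρ ≤ 1 / 2) :
    fro (Vᵀ * M * V - Matrix.diagonal s) ≤ 12 * ρ * σ₁ := by
  have hs := fun q => h.svd_bounds hsvd hM hρ q
  have hproj := fro_one_sub_mul hsvd hM
  have hσ := h.pos
  have hσ₁ := h.one_nonneg
  obtain ⟨hV, hW, -, -, hM'⟩ := hsvd
  have hV1 := opNorm_le_one_of_orthonormal hV
  have hVt1 : ‖Vᵀ‖ ≤ 1 := by rw [opNorm_transpose]; exact hV1
  have h1 := fro_sub_diagonal_le (X := Vᵀ * M * V) (s := s) (c := σᵣ / 2)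
    (fun q => (hs q).1) (fun y => ?_) (by simp [transpose_mul, h.symm_M, Matrix.mul_assoc])
  swap
  · have h2 := h.nonneg_M (V *ᵥ y)
    have h3 : y ⬝ᵥ ((Vᵀ * M * V) *ᵥ y) = (V *ᵥ y) ⬝ᵥ (M *ᵥ (V *ᵥ y)) := by
      rw [← mulVec_mulVec, ← mulVec_mulVec, dot_mulVec_transpose, transpose_transpose]
    rw [h3]
    exact le_trans (mul_nonneg hσ.le (dot_self_nonneg _)) h2
  set a := Vᵀ * M' with ha
  set c := Vᵀ * M * V * Vᵀ with hc
  have haa : a * aᵀ = Matrix.diagonal s * Matrix.diagonal s := by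
    have h2 : a = Matrix.diagonal s * Wᵀ := by
      rw [ha, hM', ← Matrix.mul_assoc, ← Matrix.mul_assoc, hV, Matrix.one_mul]
    rw [h2, transpose_mul, transpose_transpose, diagonal_transpose, Matrix.mul_assoc,
      ← Matrix.mul_assoc Wᵀ, hW, Matrix.one_mul]
  have hcc : c * cᵀ = Vᵀ * M * V * (Vᵀ * M * V) := by
    have h2 : c * cᵀ = Vᵀ * M * V * (Vᵀ * V) * (Vᵀ * M * V) := by
      rw [hc]
      simp only [transpose_mul, transpose_transpose, h.symm_M, Matrix.mul_assoc]
    rw [h2, hV, Matrix.mul_one]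
  have hca : fro (c - a) ≤ 2 * (ρ * σᵣ) := by
    have h2 : c - a = - (Vᵀ * ((1 - V * Vᵀ) * M)ᵀ + Vᵀ * (M' - M)) := by
      rw [hc, ha]
      simp only [transpose_mul, transpose_sub, transpose_one, transpose_transpose, h.symm_M,
        Matrix.mul_sub, Matrix.mul_one, Matrix.mul_assoc]
      abel
    rw [h2, fro_neg]
    refine (fro_add_le _ _).trans ?_
    have h3 := (fro_mul_le Vᵀ ((1 - V * Vᵀ) * M)ᵀ).trans (mul_le_of_le_one_left (fro_nonneg _) hVt1)
    rw [fro_transpose] at h3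
    have h4 := (fro_mul_le Vᵀ (M' - M)).trans (mul_le_of_le_one_left (fro_nonneg _) hVt1)
    linarith
  have hcn : ‖c‖ ≤ σ₁ := by
    rw [hc]
    refine (opNorm_mul_le _ _).trans ((mul_le_of_le_one_right (norm_nonneg _) hVt1).trans ?_)
    refine (opNorm_mul_le _ _).trans ((mul_le_of_le_one_right (norm_nonneg _) hV1).trans ?_)
    exact (opNorm_mul_le _ _).trans ((mul_le_of_le_one_left (norm_nonneg _) hVt1).trans h.norm_M_le)
  have han : ‖aᵀ‖ ≤ 2 * σ₁ := by
    have h2 : aᵀ = W * Matrix.diagonal s := by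
      have : a = Matrix.diagonal s * Wᵀ := by
        rw [ha, hM', ← Matrix.mul_assoc, ← Matrix.mul_assoc, hV, Matrix.one_mul]
      rw [this, transpose_mul, transpose_transpose, diagonal_transpose]
    rw [h2]
    refine (opNorm_mul_le _ _).trans ((mul_le_of_le_one_left (norm_nonneg _)
      (opNorm_le_one_of_orthonormal hW)).trans ?_)
    refine opNorm_diagonal_le (by positivity) fun q => ?_
    rw [abs_of_nonneg (by linarith [(hs q).1])]
    exact (hs q).2
  have h5 : fro (c * cᵀ - a * aᵀ) ≤ 6 * ρ * σᵣ * σ₁ := by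
    have h6 : c * cᵀ - a * aᵀ = c * (c - a)ᵀ + (c - a) * aᵀ := by
      rw [transpose_sub, Matrix.mul_sub, Matrix.sub_mul]; abel
    rw [h6]
    refine (fro_add_le _ _).trans ?_
    have h7 := fro_mul_le c (c - a)ᵀ
    have h8 := fro_mul_le' (c - a) aᵀ
    rw [fro_transpose] at h7
    have h9 : ‖c‖ * fro (c - a) ≤ σ₁ * (2 * (ρ * σᵣ)) :=
      mul_le_mul hcn hca (fro_nonneg _) hσ₁
    have h10 : fro (c - a) * ‖aᵀ‖ ≤ (2 * (ρ * σᵣ)) * (2 * σ₁) :=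
      mul_le_mul hca han (norm_nonneg _) ((fro_nonneg _).trans hca)
    linarith
  rw [hcc, haa] at h5
  have h6 : σᵣ / 2 * fro (Vᵀ * M * V - Matrix.diagonal s) ≤ σᵣ / 2 * (12 * ρ * σ₁) := by linarith
  exact le_of_mul_le_mul_left h6 (by positivity)

/-- Multiplication by a square root `A` of `M`. -/
lemma fro_mul_sqrt_le (h : IncoherentFactorization M U K σ₁ σᵣ b) {A : Matrix (Idx n ℓ) (Fin r) ℝ}
    (hA : M = A * Aᵀ) {κ : Type} [Fintype κ] [DecidableEq κ] (Y : Matrix κ (Idx n ℓ) ℝ) :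
    √σᵣ * fro (Y * A) ≤ fro (Y * M) := by
  refine le_of_sq_le_sq ?_ (fro_nonneg _)
  rw [mul_pow, Real.sq_sqrt h.pos.le, fro_sq, fro_sq, ← fro_sq, ← fro_transpose, fro_sq,
    ← fro_sq (Y * M), ← fro_transpose (Y * M), fro_sq, frobSq_eq_sum_col, frobSq_eq_sum_col,
    Finset.mul_sum]
  refine Finset.sum_le_sum fun j _ => ?_
  have h1 : ∀ {ν : Type} [Fintype ν] (B : Matrix (Idx n ℓ) ν ℝ),
      (fun i => (Y * B)ᵀ i j) = Bᵀ *ᵥ (Y j) := by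
    intro ν _ B
    ext i
    simp [mul_apply, mulVec, dotProduct, mul_comm]
  rw [h1, h1, h.symm_M]
  have h2 := h.sq_M (Y j)
  have h3 : (Aᵀ *ᵥ Y j) ⬝ᵥ (Aᵀ *ᵥ Y j) = Y j ⬝ᵥ (M *ᵥ Y j) := by
    rw [hA, ← mulVec_mulVec, dot_mulVec_transpose A]
  rw [h3]
  exact h2

lemma opNorm_sqrt_le (h : IncoherentFactorization M U K σ₁ σᵣ b) {A : Matrix (Idx n ℓ) (Fin r) ℝ}
    (hA : M = A * Aᵀ) : ‖A‖ ≤ √σ₁ := by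
  rw [← opNorm_transpose]
  refine opNorm_le_of (Real.sqrt_nonneg _) fun x => ?_
  rw [Real.sq_sqrt h.one_nonneg]
  have h3 : (Aᵀ *ᵥ x) ⬝ᵥ (Aᵀ *ᵥ x) = x ⬝ᵥ (M *ᵥ x) := by
    rw [hA, ← mulVec_mulVec, dot_mulVec_transpose A]
  rw [h3]
  exact (le_abs_self _).trans ((dot_mulVec_self_abs_le M x).trans
    (mul_le_mul_of_nonneg_right h.norm_M_le (dot_self_nonneg x)))

lemma fro_one_sub_mul_sqrt (h : IncoherentFactorization M U K σ₁ σᵣ b)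
    {A : Matrix (Idx n ℓ) (Fin r) ℝ} (hA : M = A * Aᵀ) (hsvd : IsSVD M' V s W)
    (hM : fro (M' - M) ≤ ρ * σᵣ) : fro ((1 - V * Vᵀ) * A) ≤ ρ * √σᵣ := by
  have h1 := (h.fro_mul_sqrt_le hA (1 - V * Vᵀ)).trans (fro_one_sub_mul hsvd hM)
  have h2 : 0 < √σᵣ := Real.sqrt_pos.mpr h.pos
  have h3 : √σᵣ * fro ((1 - V * Vᵀ) * A) ≤ √σᵣ * (ρ * √σᵣ) := by
    rw [mul_left_comm, Real.mul_self_sqrt h.pos.le]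
    exact h1
  exact le_of_mul_le_mul_left h3 h2

lemma opNorm_whiten_le (h : IncoherentFactorization M U K σ₁ σᵣ b) (hsvd : IsSVD M' V s W)
    (hM : fro (M' - M) ≤ ρ * σᵣ) (hρ : ρ ≤ 1 / 2) : ‖whiten V s‖ ≤ √(2 / σᵣ) := by
  have hs := fun q => (h.svd_bounds hsvd hM hρ q).1
  have hσ := h.pos
  refine (opNorm_mul_le _ _).trans ((mul_le_of_le_one_left (norm_nonneg _)
    (opNorm_le_one_of_orthonormal hsvd.1)).trans ?_)
  refine opNorm_diagonal_le (Real.sqrt_nonneg _) fun q => ?_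
  rw [abs_of_nonneg (by positivity), ← Real.sqrt_inv]
  refine Real.sqrt_le_sqrt ?_
  rw [inv_le_comm₀ (by linarith [hs q]) (by positivity), inv_div]
  exact hs q

lemma opNorm_unwhiten_le (h : IncoherentFactorization M U K σ₁ σᵣ b) (hsvd : IsSVD M' V s W)
    (hM : fro (M' - M) ≤ ρ * σᵣ) (hρ : ρ ≤ 1 / 2) : ‖unwhiten V s‖ ≤ √(2 * σ₁) := by
  have hs := fun q => (h.svd_bounds hsvd hM hρ q).2
  refine (opNorm_mul_le _ _).trans ((mul_le_of_le_one_left (norm_nonneg _)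
    (opNorm_le_one_of_orthonormal hsvd.1)).trans ?_)
  refine opNorm_diagonal_le (Real.sqrt_nonneg _) fun q => ?_
  rw [abs_of_nonneg (by positivity)]
  exact Real.sqrt_le_sqrt (hs q)

/-- The whitened factor is nearly orthogonal. -/
lemma whitened_error (h : IncoherentFactorization M U K σ₁ σᵣ b)
    {A : Matrix (Idx n ℓ) (Fin r) ℝ} (hA : M = A * Aᵀ) (hsvd : IsSVD M' V s W)
    (hM : fro (M' - M) ≤ ρ * σᵣ) (hρ : ρ ≤ 1 / 2) :
    fro ((whiten V s)ᵀ * A * ((whiten V s)ᵀ * A)ᵀ - 1) ≤ 24 * ρ * σ₁ / σᵣ := by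
  have hs := fun q => (h.svd_bounds hsvd hM hρ q).1
  have hcore := h.fro_core_error hsvd hM hρ
  have hσ := h.pos
  set D : Matrix (Fin r) (Fin r) ℝ := Matrix.diagonal fun q => (√(s q))⁻¹ with hD
  have h1 : (whiten V s)ᵀ * A * ((whiten V s)ᵀ * A)ᵀ - 1 = D * (Vᵀ * M * V - Matrix.diagonal s) * D := by
    have h2 : D * Matrix.diagonal s * D = 1 := by
      rw [hD, diagonal_mul_diagonal, diagonal_mul_diagonal, ← diagonal_one]
      congr 1
      funext q
      have hq : 0 < s q := by linarith [hs q]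
      have := Real.sqrt_pos.mpr hq
      field_simp
      exact (Real.sq_sqrt hq.le).symm
    rw [Matrix.mul_sub, Matrix.sub_mul, h2, hA]
    simp only [whiten, ← hD, transpose_mul, transpose_transpose, Matrix.mul_assoc]
    rw [show Dᵀ = D from diagonal_transpose _]
  have hDn : ‖D‖ ≤ √(2 / σᵣ) := by
    refine opNorm_diagonal_le (Real.sqrt_nonneg _) fun q => ?_
    rw [abs_of_nonneg (by positivity), ← Real.sqrt_inv]
    refine Real.sqrt_le_sqrt ?_
    rw [inv_le_comm₀ (by linarith [hs q]) (by positivity), inv_div]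
    exact hs q
  rw [h1]
  calc fro (D * (Vᵀ * M * V - Matrix.diagonal s) * D)
      ≤ ‖D‖ * fro (Vᵀ * M * V - Matrix.diagonal s) * ‖D‖ :=
        (fro_mul_le' _ _).trans (mul_le_mul_of_nonneg_right (fro_mul_le _ _) (norm_nonneg _))
    _ ≤ √(2 / σᵣ) * (12 * ρ * σ₁) * √(2 / σᵣ) := by
        have := (fro_nonneg _).trans hcore
        gcongr
        exact fro_nonneg _
    _ = 24 * ρ * σ₁ / σᵣ := by
        rw [mul_right_comm, Real.mul_self_sqrt (by positivity)]; ring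

end IncoherentFactorization

/-! ### Existence of the outputs -/

/-- Linear least squares problems have solutions. -/
lemma exists_leastSquares {V E : Type} [AddCommGroup V] [Module ℝ V] [NormedAddCommGroup E]
    [InnerProductSpace ℝ E] [FiniteDimensional ℝ E] (L : V →ₗ[ℝ] E) (b : E) :
    ∃ x, ∀ z, ‖b - L x‖ ≤ ‖b - L z‖ := by
  obtain ⟨v, ⟨x, rfl⟩, hx⟩ := (LinearMap.range L).exists_norm_eq_iInf_of_complete_subspace
    (Submodule.complete_of_finiteDimensional _) b
  refine ⟨x, fun z => ?_⟩
  rw [hx]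
  exact ciInf_le ⟨0, by rintro _ ⟨w, rfl⟩; exact norm_nonneg _⟩
    (⟨L z, z, rfl⟩ : ((LinearMap.range L : Submodule ℝ E) : Set E))

lemma exists_isLeastSquaresUpdate {n ℓ r : ℕ} (S : Matrix (Idx n ℓ) (Idx n ℓ) ℝ)
    (U : Matrix (Idx n ℓ) (Fin r) ℝ) : ∃ U', IsLeastSquaresUpdate S U U' := by
  let L : Matrix (Idx n ℓ) (Fin r) ℝ →ₗ[ℝ] EuclideanSpace ℝ (Idx n ℓ × Idx n ℓ) :=
    { toFun := fun V => WithLp.toLp 2 fun p => mask2 (V * Uᵀ) p.1 p.2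
      map_add' := fun V W => by
        ext p
        by_cases hp : p.1.1 = p.2.1 <;> simp [mask2, hp, Matrix.add_mul]
      map_smul' := fun c V => by
        ext p
        by_cases hp : p.1.1 = p.2.1 <;> simp [mask2, hp] }
  obtain ⟨x, hx⟩ := exists_leastSquares L (WithLp.toLp 2 fun p => mask2 S p.1 p.2)
  have key : ∀ V, ‖(WithLp.toLp 2 fun p => mask2 S p.1 p.2 : EuclideanSpace ℝ _) - L V‖ =
      fro (mask2 S - mask2 (V * Uᵀ)) := fun V => by
    rw [fro_eq_norm]; rfl
  refine ⟨x, fun V => ?_⟩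
  have h := hx V
  rw [key, key] at h
  rw [← fro_sq, ← fro_sq]
  exact pow_le_pow_left₀ (fro_nonneg _) h 2

lemma AHat_add {n ℓ r : ℕ} (U : Matrix (Idx n ℓ) (Fin r) ℝ) (s : Fin r → ℝ)
    (Z Z' : Tensor3 (Fin r)) : AHat U s (Z + Z') = AHat U s Z + AHat U s Z' := by
  have h1 : nuHat U s (Z + Z') = nuHat U s Z + nuHat U s Z' := by
    funext p q t
    simp only [nuHat, mask3, Pi.add_apply, tensorApply]
    split_ifs
    · simp only [add_mul, Finset.sum_add_distrib]
    · simp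
  funext a b c
  simp only [AHat, h1, tensorApply, Pi.add_apply, add_mul, Finset.sum_add_distrib]

lemma AHat_smul {n ℓ r : ℕ} (U : Matrix (Idx n ℓ) (Fin r) ℝ) (s : Fin r → ℝ)
    (k : ℝ) (Z : Tensor3 (Fin r)) : AHat U s (k • Z) = k • AHat U s Z := by
  have h1 : nuHat U s (k • Z) = k • nuHat U s Z := by
    funext p q t
    simp only [nuHat, mask3, Pi.smul_apply, tensorApply, smul_eq_mul]
    split_ifs
    · simp only [mul_assoc, Finset.mul_sum]
    · simp
  funext a b c
  simp only [AHat, h1, tensorApply, Pi.smul_apply, smul_eq_mul, mul_assoc, Finset.mul_sum]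

lemma exists_isTensorLSOutput {n ℓ r : ℕ} (S₃ : Tensor3 (Idx n ℓ)) (U : Matrix (Idx n ℓ) (Fin r) ℝ)
    (s : Fin r → ℝ) : ∃ G, IsTensorLSOutput S₃ U s G := by
  let L : Tensor3 (Fin r) →ₗ[ℝ] EuclideanSpace ℝ (Fin r × Fin r × Fin r) :=
    { toFun := fun Z => WithLp.toLp 2 fun p => AHat U s Z p.1 p.2.1 p.2.2
      map_add' := fun V W => by ext p; simp [AHat_add]
      map_smul' := fun c V => by ext p; simp [AHat_smul] }
  set B := tensorApply (mask3 S₃) (whiten U s) with hB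
  obtain ⟨x, hx⟩ := exists_leastSquares L (WithLp.toLp 2 fun p => B p.1 p.2.1 p.2.2)
  have key : ∀ Z, ‖(WithLp.toLp 2 fun p => B p.1 p.2.1 p.2.2 : EuclideanSpace ℝ _) - L Z‖ ^ 2 =
      tensorFrobSq (AHat U s Z - B) := fun Z => by
    rw [EuclideanSpace.norm_sq_eq, tensorFrobSq]
    simp only [Fintype.sum_prod_type, L]
    refine Finset.sum_congr rfl fun a _ => Finset.sum_congr rfl fun b _ =>
      Finset.sum_congr rfl fun c _ => ?_
    simp only [LinearMap.coe_mk, AddHom.coe_mk, PiLp.sub_apply, Pi.sub_apply, Real.norm_eq_abs,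
      sq_abs]
    ring
  refine ⟨x, fun V => ?_⟩
  have h := pow_le_pow_left₀ (norm_nonneg _) (hx V) 2
  rwa [key, key] at h

section Spectral

variable {ι : Type} [Fintype ι] [DecidableEq ι] {r t : ℕ}

lemma exists_isTopEigenvectors (hN : Fintype.card ι = r + t) {A : Matrix ι ι ℝ} (hA : Aᵀ = A) :
    ∃ U : Matrix ι (Fin r) ℝ, IsTopEigenvectors A U := by
  obtain ⟨W, d, hW, hW', hd, hAW⟩ := exists_sorted_spectral hN hA
  refine ⟨W.submatrix id (Fin.castAdd t), ?_, fun q => d (Fin.castAdd t q), ?_, fun x hx q => ?_⟩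
  · ext p q
    have := congrFun (congrFun hW (Fin.castAdd t p)) (Fin.castAdd t q)
    simp only [mul_apply, transpose_apply, one_apply, submatrix_apply, id] at this ⊢
    rw [this]
    simp
  · ext i q
    have := congrFun (congrFun hAW i) (Fin.castAdd t q)
    rw [mul_diagonal] at this ⊢
    simpa [mul_apply] using this
  · have hAeq : A = W * Matrix.diagonal d * Wᵀ := by
      rw [← hAW, Matrix.mul_assoc, hW', Matrix.mul_one]
    set y := Wᵀ *ᵥ x with hy
    have h1 : x ⬝ᵥ (A *ᵥ x) = ∑ k, d k * y k ^ 2 := by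
      rw [hAeq, ← mulVec_mulVec, ← mulVec_mulVec, dot_mulVec_transpose]
      simp only [dotProduct, mulVec_diagonal]
      exact Finset.sum_congr rfl fun k _ => by rw [← hy]; ring
    have h2 : x ⬝ᵥ x = ∑ k, y k ^ 2 := by
      have : x ⬝ᵥ x = (Wᵀ *ᵥ x) ⬝ᵥ (Wᵀ *ᵥ x) := by
        rw [dot_mulVec_of_orthonormal (by rw [transpose_transpose, hW'])]
      rw [this, ← hy]
      simp [dotProduct, sq]
    rw [h1, h2, Finset.mul_sum]
    refine Finset.sum_le_sum fun k _ => ?_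
    refine Fin.addCases (fun p => ?_) (fun p => ?_) k
    · have : y (Fin.castAdd t p) = 0 := congrFun hx p
      simp [this]
    · refine mul_le_mul_of_nonneg_right (hd ?_) (sq_nonneg _)
      rw [Fin.le_def]
      simp only [Fin.val_castAdd, Fin.val_natAdd]
      omega

lemma exists_isQR (hN : Fintype.card ι = r + t) (A : Matrix ι (Fin r) ℝ) :
    ∃ Q R, IsQR A Q R := by
  have hn : Module.finrank ℝ (EuclideanSpace ℝ ι) = Fintype.card (Fin (r + t)) := by simpa using hN
  -- Zero vectors pad the columns to a family as long as the dimension. Then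
  -- `gramSchmidtOrthonormalBasis` returns orthonormal columns even if those of `A` are linearly
  -- dependent, and the coefficients at the `t` extra basis vectors vanish by triangularity.
  set f : Fin (r + t) → EuclideanSpace ℝ ι :=
    fun k => Fin.addCases (fun q => WithLp.toLp 2 fun i => A i q) (fun _ => 0) k with hf
  set B := InnerProductSpace.gramSchmidtOrthonormalBasis hn f with hB
  refine ⟨Matrix.of fun i q => B (Fin.castAdd t q) i,
    Matrix.of fun p q => inner ℝ (B (Fin.castAdd t p)) (f (Fin.castAdd t q)), ?_, ?_, ?_⟩
  · ext i q
    have h1 := B.sum_repr' (f (Fin.castAdd t q))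
    rw [Fin.sum_univ_add] at h1
    have h2 : ∀ k : Fin t, inner ℝ (B (Fin.natAdd r k)) (f (Fin.castAdd t q)) = (0 : ℝ) := fun k =>
      InnerProductSpace.gramSchmidtOrthonormalBasis_inv_triangular hn f (by
        rw [Fin.lt_def]
        simp only [Fin.val_castAdd, Fin.val_natAdd]
        omega)
    simp only [h2, zero_smul, Finset.sum_const_zero, add_zero] at h1
    have h3 := congrArg (fun v => v.ofLp i) h1
    have h4 : (f (Fin.castAdd t q)).ofLp i = A i q := by simp [hf]
    rw [← h4, ← h3, mul_apply]
    simp [mul_comm]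
  · ext p q
    have := orthonormal_iff_ite.mp B.orthonormal (Fin.castAdd t q) (Fin.castAdd t p)
    rw [PiLp.inner_apply] at this
    simp only [mul_apply, transpose_apply, of_apply, one_apply]
    simpa [eq_comm] using this
  · intro p q hpq
    exact InnerProductSpace.gramSchmidtOrthonormalBasis_inv_triangular hn f (by
        rw [Fin.lt_def]
        simpa using hpq)

/-- An eigenbasis `W` of `Aᵀ A` makes the columns of `A W` orthogonal with squared lengths `d`. The
nonzero ones are normalized and completed to an orthonormal basis, which supplies left vectors for
the zero singular values; the right vectors are `V W`. -/
lemma exists_isSVD (hN : Fintype.card ι = r + t) (A V : Matrix ι (Fin r) ℝ) (hV : Vᵀ * V = 1) :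
    ∃ (U : Matrix ι (Fin r) ℝ) (s : Fin r → ℝ) (V' : Matrix ι (Fin r) ℝ),
      IsSVD (A * Vᵀ) U s V' := by
  have hn : Module.finrank ℝ (EuclideanSpace ℝ ι) = Fintype.card (Fin (r + t)) := by simpa using hN
  obtain ⟨W, d, hW, hW', hd, hAW⟩ := exists_sorted_spectral (ι := Fin r) (N := r) (by simp)
    (A := Aᵀ * A) (by simp)
  set F := A * W with hF
  have hFF : Fᵀ * F = Matrix.diagonal d := by
    have : Fᵀ * F = Wᵀ * (Aᵀ * A * W) := by
      rw [hF]; simp only [transpose_mul, Matrix.mul_assoc]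
    rw [this, hAW, ← Matrix.mul_assoc, hW, Matrix.one_mul]
  have hFd : ∀ p q, ∑ i, F i p * F i q = if p = q then d p else 0 := by
    intro p q
    have := congrFun (congrFun hFF p) q
    rw [diagonal_apply] at this
    simpa [mul_apply] using this
  have hd0 : ∀ q, 0 ≤ d q := by
    intro q
    have := hFd q q
    rw [if_pos rfl] at this
    rw [← this]
    exact Finset.sum_nonneg fun i _ => mul_self_nonneg _
  set v : Fin (r + t) → EuclideanSpace ℝ ι :=
    fun k => Fin.addCases (fun q => WithLp.toLp 2 fun i => (√(d q))⁻¹ * F i q) (fun _ => 0) k with hv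
  have hvq : ∀ q, v (Fin.castAdd t q) = WithLp.toLp 2 fun i => (√(d q))⁻¹ * F i q := fun q => by
    simp [hv]
  set S : Set (Fin (r + t)) := {k | ∃ q : Fin r, k = Fin.castAdd t q ∧ d q ≠ 0} with hS
  have horth : Orthonormal ℝ (S.domRestrict v) := by
    rw [orthonormal_iff_ite]
    rintro ⟨_, p, rfl, hp⟩ ⟨_, q, rfl, hq⟩
    simp only [Set.domRestrict_apply, hvq]
    rw [EuclideanSpace.inner_toLp_toLp]
    have h1 : (fun i => (√(d q))⁻¹ * F i q) ⬝ᵥ star (fun i => (√(d p))⁻¹ * F i p) =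
        (√(d p))⁻¹ * (√(d q))⁻¹ * ∑ i, F i p * F i q := by
      simp only [dotProduct, star_trivial, Finset.mul_sum]
      exact Finset.sum_congr rfl fun i _ => by ring
    rw [h1, hFd]
    by_cases hpq : p = q
    · subst hpq
      simp only [if_true]
      have h2 : 0 < d p := lt_of_le_of_ne (hd0 p) (Ne.symm hp)
      have h3 := Real.sqrt_pos.mpr h2
      field_simp
      exact (Real.sq_sqrt h2.le).symm
    · simp [hpq]
  obtain ⟨B, hB⟩ := horth.exists_orthonormalBasis_extension_of_card_eq hn
  refine ⟨Matrix.of fun i q => B (Fin.castAdd t q) i, fun q => √(d q), V * W, ?_, ?_,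
    fun p q hpq => Real.sqrt_le_sqrt (hd hpq), fun q => Real.sqrt_nonneg _, ?_⟩
  · ext p q
    have := orthonormal_iff_ite.mp B.orthonormal (Fin.castAdd t q) (Fin.castAdd t p)
    rw [PiLp.inner_apply] at this
    simp only [mul_apply, transpose_apply, of_apply, one_apply]
    simpa [eq_comm] using this
  · rw [transpose_mul, Matrix.mul_assoc, ← Matrix.mul_assoc Vᵀ, hV, Matrix.one_mul, hW]
  · have hFU : F = (Matrix.of fun i q => B (Fin.castAdd t q) i) * Matrix.diagonal fun q => √(d q) := by
      ext i q
      rw [mul_diagonal, of_apply]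
      by_cases hq : d q = 0
      · have h1 := hFd q q
        rw [if_pos rfl, hq, Finset.sum_eq_zero_iff_of_nonneg fun _ _ => mul_self_nonneg _] at h1
        have h2 := h1 i (Finset.mem_univ i)
        rw [hq, Real.sqrt_zero, mul_zero]
        exact mul_self_eq_zero.mp h2
      · rw [hB _ ⟨q, rfl, hq⟩, hvq]
        have h2 : 0 < d q := lt_of_le_of_ne (hd0 q) (Ne.symm hq)
        have h3 := Real.sqrt_pos.mpr h2
        simp only
        field_simp
    rw [← hFU, hF, transpose_mul, Matrix.mul_assoc, ← Matrix.mul_assoc W, hW', Matrix.one_mul]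

end Spectral

lemma transpose_mask2_sampleM2 {n ℓ m : ℕ} (y : Fin m → Fin n → Fin ℓ) :
    (mask2 (sampleM2 y))ᵀ = mask2 (sampleM2 y) := by
  ext p q
  simp [mask2, sampleM2, mul_comm, eq_comm]

/-- The steps for the second moment have an output. -/
lemma exists_isSecondMomentEstimate {n ℓ r T : ℕ} (hr : r ≤ n * ℓ)
    {S : Matrix (Idx n ℓ) (Idx n ℓ) ℝ} (hS : (mask2 S)ᵀ = mask2 S) :
    ∃ (U : Matrix (Idx n ℓ) (Fin r) ℝ) (s : Fin r → ℝ), IsSecondMomentEstimate T S U s := by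
  obtain ⟨t, ht⟩ := Nat.exists_eq_add_of_le hr
  have hN : Fintype.card (Idx n ℓ) = r + t := by simpa using ht
  obtain ⟨U₀, hU₀⟩ := exists_isTopEigenvectors hN hS
  choose ls hls using fun V : Matrix (Idx n ℓ) (Fin r) ℝ => exists_isLeastSquaresUpdate S V
  choose Q R hQR using fun V : Matrix (Idx n ℓ) (Fin r) ℝ => exists_isQR hN V
  let U : ℕ → Matrix (Idx n ℓ) (Fin r) ℝ := fun τ => (fun V => Q (ls V))^[τ] U₀
  have hU : ∀ τ, U (τ + 1) = Q (ls (U τ)) := fun τ => Function.iterate_succ_apply' _ _ _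
  have horth : ∀ τ, (U τ)ᵀ * U τ = 1 := by
    intro τ
    cases τ with
    | zero => exact hU₀.1
    | succ τ => rw [hU]; exact (hQR _).2.1
  -- The solution number `τ + 1` is computed from the iterate `τ`. The value at `0`, which exists by
  -- truncated subtraction, is constrained by no update step.
  let U' : ℕ → Matrix (Idx n ℓ) (Fin r) ℝ := fun τ => ls (U (τ - 1))
  obtain ⟨A, s, V, hA⟩ := exists_isSVD hN (U' T) (U (T - 1)) (horth _)
  refine ⟨A, s, _, V, ⟨U, U', hU₀, fun τ _ => ⟨hls _, R (ls (U τ)), ?_⟩, rfl⟩, hA⟩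
  rw [hU]
  exact hQR _

/-! ### Singular values of the second moment matrix -/

/-- Singular values are defined through `T* T = T²`. If `T² x = σ² x`, then `T` maps `T x - σ x` to
`-σ` times itself, so that vector vanishes when `T` is positive semidefinite and `σ > 0`; for `σ =
0` already `T x = 0`. -/
lemma exists_sigma_eigenbasis {ι : Type} [Fintype ι] [DecidableEq ι] {N : ℕ}
    (hN : Fintype.card ι = N) {M : Matrix ι ι ℝ} (hM : Mᵀ = M) (hpos : ∀ x, 0 ≤ x ⬝ᵥ (M *ᵥ x)) :
    ∃ W : Matrix ι (Fin N) ℝ, Wᵀ * W = 1 ∧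
      M * W = W * Matrix.diagonal fun k : Fin N => sigma M (k + 1) := by
  set T := Matrix.toEuclideanLin M with hT
  have hn : Module.finrank ℝ (EuclideanSpace ℝ ι) = N := by simpa using hN
  have hsymm : T.IsSymmetric :=
    Matrix.isSymmetric_toEuclideanLin_iff.mpr
      (by rw [Matrix.IsHermitian, conjTranspose_eq_transpose_of_trivial, hM])
  have hadj : LinearMap.adjoint T = T := by
    rw [eq_comm, LinearMap.eq_adjoint_iff]
    exact hsymm
  have hTpos : ∀ x, 0 ≤ inner ℝ x (T x) := by
    intro x
    have h1 := hpos x.ofLp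
    rw [hT, toLpLin_apply, EuclideanSpace.inner_eq_star_dotProduct]
    simpa [dotProduct_comm] using h1
  set B := T.isSymmetric_adjoint_comp_self.eigenvectorBasis hn with hB
  have hTB : ∀ k, T (B k) = sigma M (k + 1) • B k := by
    intro k
    set σ := sigma M (k + 1) with hσ
    have hσ0 : 0 ≤ σ := T.singularValues_nonneg _
    have h1 : T (T (B k)) = σ ^ 2 • B k := by
      have := T.isSymmetric_adjoint_comp_self.apply_eigenvectorBasis hn k
      rw [← T.sq_singularValues_fin hn k, LinearMap.comp_apply, ← hB] at this
      have h2 := LinearMap.congr_fun hadj (T (B k))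
      rw [← h2, this]
      simp [hσ, sigma, hT]
    rcases hσ0.eq_or_lt with h0 | h0
    · rw [← h0, zero_smul]
      have h2 : inner ℝ (T (B k)) (T (B k)) = 0 := by
        rw [hsymm, h1, ← h0]; simp
      exact inner_self_eq_zero.mp h2
    · have h2 : T (T (B k) - σ • B k) = -(σ • (T (B k) - σ • B k)) := by
        rw [map_sub, h1, map_smul]; module
      have h3 := hTpos (T (B k) - σ • B k)
      rw [h2, inner_neg_right, inner_smul_right, real_inner_self_eq_norm_sq] at h3
      have h4 : ‖T (B k) - σ • B k‖ ^ 2 ≤ 0 := by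
        by_contra! h5
        have := mul_pos h0 h5
        linarith
      have h5 : ‖T (B k) - σ • B k‖ = 0 := by
        have := sq_nonneg ‖T (B k) - σ • B k‖
        exact pow_eq_zero_iff (two_ne_zero) |>.mp (le_antisymm h4 this)
      exact sub_eq_zero.mp (norm_eq_zero.mp h5)
  refine ⟨Matrix.of fun i k => B k i, ?_, ?_⟩
  · ext k l
    have := orthonormal_iff_ite.mp B.orthonormal l k
    rw [PiLp.inner_apply] at this
    simp only [mul_apply, transpose_apply, of_apply, one_apply]
    simpa [eq_comm] using this
  · ext i k
    have h2 := congrArg (fun v => v.ofLp i) (hTB k)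
    rw [hT, toLpLin_apply] at h2
    rw [mul_diagonal, mul_comm]
    simpa [mul_apply, mulVec, dotProduct] using h2

lemma sigma_antitone {ι : Type} [Fintype ι] [DecidableEq ι] (M : Matrix ι ι ℝ) {j k : ℕ}
    (h : j ≤ k) : sigma M k ≤ sigma M j :=
  LinearMap.singularValues_antitone _ (Nat.sub_le_sub_right h 1)

/-- A positive semidefinite matrix of rank `r` with a rank `r` singular value decomposition. -/
lemma exists_incoherentFactorization {n ℓ r : ℕ} {M : Matrix (Idx n ℓ) (Idx n ℓ) ℝ} {μ : ℝ}
    (hM : Mᵀ = M) (hpos : ∀ x, 0 ≤ x ⬝ᵥ (M *ᵥ x)) (hr : 1 ≤ r) (hσ : 0 < sigma M r)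
    (hinc : IsBlockIncoherent r M μ) (hμ : 0 ≤ μ * √((r : ℝ) / n)) :
    r ≤ n * ℓ ∧ (∃ (U : Matrix (Idx n ℓ) (Fin r) ℝ) (K : Matrix (Fin r) (Fin r) ℝ),
      IncoherentFactorization M U K (sigma M 1) (sigma M r) (μ * √((r : ℝ) / n))) ∧
      sigma M 1 ≤ fro M ∧ r * sigma M r ≤ M.trace ∧ ∀ x, x ⬝ᵥ (M *ᵥ x) ≤ sigma M 1 * (x ⬝ᵥ x) := by
  obtain ⟨U, s, V, ⟨hU, -, -, -, hMeq⟩, hblk⟩ := hinc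
  have hrN : r ≤ n * ℓ := by
    by_contra! hlt
    have h1 : (Matrix.toEuclideanLin M).singularValues (r - 1) = 0 :=
      LinearMap.singularValues_of_finrank_le _ (by simp; omega)
    rw [sigma, h1] at hσ
    exact lt_irrefl _ hσ
  refine ⟨hrN, ?_⟩
  obtain ⟨t, ht⟩ := Nat.exists_eq_add_of_le hrN
  have hN : Fintype.card (Idx n ℓ) = r + t := by simpa using ht
  obtain ⟨W', hW', hMW'⟩ := exists_sigma_eigenbasis hN hM hpos
  set W := W'.submatrix id (Fin.castAdd t) with hWdef
  set d : Fin r → ℝ := fun q => sigma M (q + 1) with hd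
  have hW : Wᵀ * W = 1 := by
    ext p q
    have := congrFun (congrFun hW' (Fin.castAdd t p)) (Fin.castAdd t q)
    simp only [hWdef, mul_apply, transpose_apply, one_apply, submatrix_apply, id] at this ⊢
    rw [this]
    simp
  have hMW : M * W = W * Matrix.diagonal d := by
    ext i q
    have := congrFun (congrFun hMW' i) (Fin.castAdd t q)
    rw [mul_diagonal] at this ⊢
    simpa [mul_apply, hWdef, hd] using this
  have hdlow : ∀ q, sigma M r ≤ d q := fun q => sigma_antitone M (by omega)
  have hdup : ∀ q, d q ≤ sigma M 1 := fun q => sigma_antitone M (by omega)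
  have hUM : U * (Uᵀ * M) = M := by
    conv_lhs => rw [hMeq]
    rw [← Matrix.mul_assoc Uᵀ, ← Matrix.mul_assoc Uᵀ, hU, Matrix.one_mul, ← Matrix.mul_assoc, ← hMeq]
  have hMU : M * (U * Uᵀ) = M := by
    have := congrArg Matrix.transpose hUM
    simpa [transpose_mul, hM, Matrix.mul_assoc] using this
  have hWeq : W = M * (W * Matrix.diagonal fun q => (d q)⁻¹) := by
    rw [← Matrix.mul_assoc, hMW, Matrix.mul_assoc, diagonal_mul_diagonal]
    have : (fun q => d q * (d q)⁻¹) = fun _ => 1 := by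
      funext q
      exact mul_inv_cancel₀ (hσ.trans_le (hdlow q)).ne'
    rw [this, diagonal_one, Matrix.mul_one]
  have hUW : U * (Uᵀ * W) = W := by
    conv_lhs => rw [hWeq]
    rw [← Matrix.mul_assoc Uᵀ, ← Matrix.mul_assoc, hUM, ← hWeq]
  -- `U` comes from the incoherence hypothesis and `W` consists of eigenvectors. Both have the same
  -- range, so they differ by the orthogonal matrix `O`, and `Uᵀ M U` is a conjugate of the diagonal
  -- of singular values which need not itself be diagonal.
  set O := Uᵀ * W with hO
  have hOO : Oᵀ * O = 1 := by
    rw [hO, transpose_mul, transpose_transpose, Matrix.mul_assoc, hUW, hW]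
  have hOO' : O * Oᵀ = 1 := mul_eq_one_comm.mp hOO
  have hUO : U = W * Oᵀ := by
    rw [← hUW, Matrix.mul_assoc, hOO', Matrix.mul_one]
  have hK : Uᵀ * M * U = O * Matrix.diagonal d * Oᵀ := by
    rw [Matrix.mul_assoc]
    conv_lhs => rw [hUO]
    rw [← Matrix.mul_assoc M, hMW, transpose_mul, transpose_transpose]
    have : O * Wᵀ * (W * Matrix.diagonal d * Oᵀ) = O * (Wᵀ * W) * Matrix.diagonal d * Oᵀ := by
      simp only [Matrix.mul_assoc]
    rw [this, hW, Matrix.mul_one]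
  have hMK : M = U * (Uᵀ * M * U) * Uᵀ := by
    have : U * (Uᵀ * M * U) * Uᵀ = U * (Uᵀ * (M * (U * Uᵀ))) := by simp only [Matrix.mul_assoc]
    rw [this, hMU, hUM]
  have hd1 : 0 ≤ sigma M 1 := hσ.le.trans (sigma_antitone M hr)
  have hOt : (Oᵀ)ᵀ * Oᵀ = 1 := by rw [transpose_transpose, hOO']
  have hfac : IncoherentFactorization M U (Uᵀ * M * U) (sigma M 1) (sigma M r)
      (μ * √((r : ℝ) / n)) := by
    refine ⟨hU, hMK, by simp [transpose_mul, hM, Matrix.mul_assoc], ?_, fun y => ?_, hblk, hμ, hσ,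
      sigma_antitone M hr⟩
    · rw [hK]
      have h1 : ‖Matrix.diagonal d‖ ≤ sigma M 1 := opNorm_diagonal_le hd1 fun q => by
        rw [abs_of_nonneg (hσ.le.trans (hdlow q))]; exact hdup q
      refine (opNorm_mul_le _ _).trans ((mul_le_of_le_one_right (norm_nonneg _)
        (opNorm_le_one_of_orthonormal hOt)).trans ?_)
      exact (opNorm_mul_le _ _).trans ((mul_le_of_le_one_left (norm_nonneg _)
        (opNorm_le_one_of_orthonormal hOO)).trans h1)
    · rw [hK, ← mulVec_mulVec, ← mulVec_mulVec, dot_mulVec_transpose]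
      rw [← dot_mulVec_of_orthonormal hOt]
      simp only [dotProduct, mulVec_diagonal, Finset.mul_sum]
      refine Finset.sum_le_sum fun q _ => ?_
      nlinarith [hdlow q, mul_self_nonneg ((Oᵀ *ᵥ y) q)]
  refine ⟨⟨U, _, hfac⟩, ?_, ?_, fun x => ?_⟩
  · have h1 : fro M = fro (Matrix.diagonal d) := by
      rw [hMK, fro_mul_orthonormal_transpose hU, fro_orthonormal_mul hU, hK,
        fro_mul_orthonormal_transpose hOO, fro_orthonormal_mul hOO]
    have h2 := abs_apply_le_fro (Matrix.diagonal d) ⟨0, hr⟩ ⟨0, hr⟩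
    rw [diagonal_apply_eq] at h2
    rw [h1]
    exact (le_abs_self _).trans h2
  · have h1 : M.trace = ∑ q, d q := by
      rw [hMK, Matrix.trace_mul_comm, ← Matrix.mul_assoc, hU, Matrix.one_mul, hK,
        Matrix.trace_mul_comm, ← Matrix.mul_assoc, hOO, Matrix.one_mul, trace_diagonal]
    rw [h1]
    have := Finset.card_nsmul_le_sum Finset.univ d (sigma M r) fun q _ => hdlow q
    simpa using this
  · exact (le_abs_self _).trans ((dot_mulVec_self_abs_le M x).trans
      (mul_le_mul_of_nonneg_right hfac.norm_M_le (dot_self_nonneg x)))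

/-! ### Frobenius norms of tensors under multilinear maps. -/

section Tensors

variable {ι κ ν ι' κ' ν' : Type} [Fintype ι] [Fintype κ] [Fintype ν] [Fintype ι'] [Fintype κ']
  [Fintype ν'] [DecidableEq ι] [DecidableEq κ] [DecidableEq ν] [DecidableEq ι'] [DecidableEq κ']
  [DecidableEq ν']

/-- The flattening of a tensor along its first mode. -/
def tmat (T : ι → κ → ν → ℝ) : Matrix ι (κ × ν) ℝ := Matrix.of fun i p => T i p.1 p.2

/-- The Frobenius norm of a tensor. -/
noncomputable def tnorm (T : ι → κ → ν → ℝ) : ℝ := fro (tmat T)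

lemma tnorm_nonneg (T : ι → κ → ν → ℝ) : 0 ≤ tnorm T := fro_nonneg _

lemma tnorm_sq (T : ι → κ → ν → ℝ) : tnorm T ^ 2 = ∑ i, ∑ j, ∑ k, T i j k ^ 2 := by
  rw [tnorm, fro_sq, frobSq]
  simp only [tmat, of_apply, Fintype.sum_prod_type]

lemma tnorm_sq_eq_tensorFrobSq (T : Tensor3 ι) : tnorm T ^ 2 = tensorFrobSq T := tnorm_sq T

lemma tnorm_add_le (S T : ι → κ → ν → ℝ) : tnorm (S + T) ≤ tnorm S + tnorm T := fro_add_le _ _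

lemma tnorm_sub_le (S T : ι → κ → ν → ℝ) : tnorm (S - T) ≤ tnorm S + tnorm T := fro_sub_le _ _

lemma tnorm_sub_comm (S T : ι → κ → ν → ℝ) : tnorm (S - T) = tnorm (T - S) :=
  fro_sub_comm (tmat S) (tmat T)

lemma eq_zero_of_tnorm {T : ι → κ → ν → ℝ} (h : tnorm T = 0) : T = 0 := by
  funext i j k
  exact congrFun (congrFun (fro_eq_zero h) i) (j, k)

/-- Cyclic rotation of the modes. -/
def rot (T : ι → κ → ν → ℝ) : κ → ν → ι → ℝ := fun j k i => T i j k

lemma tnorm_rot (T : ι → κ → ν → ℝ) : tnorm (rot T) = tnorm T := by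
  refine (pow_left_inj₀ (tnorm_nonneg _) (tnorm_nonneg _) two_ne_zero).mp ?_
  rw [tnorm_sq, tnorm_sq]
  calc ∑ j, ∑ k, ∑ i, rot T j k i ^ 2 = ∑ j, ∑ i, ∑ k, rot T j k i ^ 2 :=
        Finset.sum_congr rfl fun _ _ => Finset.sum_comm
    _ = _ := Finset.sum_comm

/-- Multiplication along the first mode. -/
def modeMul (T : ι → κ → ν → ℝ) (A : Matrix ι ι' ℝ) : ι' → κ → ν → ℝ :=
  fun a j k => ∑ i, T i j k * A i a

lemma tmat_modeMul (T : ι → κ → ν → ℝ) (A : Matrix ι ι' ℝ) : tmat (modeMul T A) = Aᵀ * tmat T := by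
  ext a p
  simp [tmat, modeMul, mul_apply, mul_comm]

lemma tnorm_modeMul_le (T : ι → κ → ν → ℝ) (A : Matrix ι ι' ℝ) :
    tnorm (modeMul T A) ≤ ‖A‖ * tnorm T := by
  rw [tnorm, tmat_modeMul, ← opNorm_transpose]
  exact fro_mul_le _ _

/-- `T[A, B, C]`. -/
def apply3 (T : ι → κ → ν → ℝ) (A : Matrix ι ι' ℝ) (B : Matrix κ κ' ℝ) (C : Matrix ν ν' ℝ) :
    ι' → κ' → ν' → ℝ :=
  fun a b c => ∑ i, ∑ j, ∑ k, T i j k * A i a * B j b * C k c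

/-- Rotations bring each mode to the front in turn, so that the norm bound for one mode, which is a
matrix inequality, serves for all three. -/
lemma apply3_eq_rot (T : ι → κ → ν → ℝ) (A : Matrix ι ι' ℝ) (B : Matrix κ κ' ℝ)
    (C : Matrix ν ν' ℝ) :
    apply3 T A B C = rot (modeMul (rot (modeMul (rot (modeMul T A)) B)) C) := by
  funext a b c
  simp only [apply3, rot, modeMul, Finset.sum_mul]
  calc ∑ i, ∑ j, ∑ k, T i j k * A i a * B j b * C k c
      = ∑ i, ∑ k, ∑ j, T i j k * A i a * B j b * C k c :=
        Finset.sum_congr rfl fun _ _ => Finset.sum_comm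
    _ = ∑ k, ∑ i, ∑ j, T i j k * A i a * B j b * C k c := Finset.sum_comm
    _ = _ := Finset.sum_congr rfl fun _ _ => Finset.sum_comm

/-- The first factor is deliberately not estimated: when it runs through the blocks of a matrix, the
squares of the remaining norms can be summed without loss. -/
lemma tnorm_apply3_le_modeMul (T : ι → κ → ν → ℝ) (A : Matrix ι ι' ℝ) (B : Matrix κ κ' ℝ)
    (C : Matrix ν ν' ℝ) : tnorm (apply3 T A B C) ≤ ‖C‖ * (‖B‖ * tnorm (modeMul T A)) := by
  rw [apply3_eq_rot, tnorm_rot]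
  refine (tnorm_modeMul_le _ _).trans (mul_le_mul_of_nonneg_left ?_ (norm_nonneg _))
  rw [tnorm_rot]
  refine (tnorm_modeMul_le _ _).trans_eq ?_
  rw [tnorm_rot]

lemma tnorm_apply3_le {T : ι → κ → ν → ℝ} {A : Matrix ι ι' ℝ} {B : Matrix κ κ' ℝ}
    {C : Matrix ν ν' ℝ} {a b c : ℝ} (hA : ‖A‖ ≤ a) (hB : ‖B‖ ≤ b) (hC : ‖C‖ ≤ c) :
    tnorm (apply3 T A B C) ≤ a * b * c * tnorm T := by
  have ha := (norm_nonneg _).trans hA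
  have hb := (norm_nonneg _).trans hB
  have hc := (norm_nonneg _).trans hC
  have hT := tnorm_nonneg T
  calc tnorm (apply3 T A B C) ≤ ‖C‖ * (‖B‖ * (‖A‖ * tnorm T)) := by
        refine (tnorm_apply3_le_modeMul T A B C).trans ?_
        gcongr
        exact tnorm_modeMul_le T A
    _ ≤ c * (b * (a * tnorm T)) := by gcongr
    _ = a * b * c * tnorm T := by ring

/-- On flattenings the other two factors act as a Kronecker product, which reduces the composition
of multilinear maps to `mul_kronecker_mul`. -/
lemma tmat_apply3 (T : ι → κ → ν → ℝ) (A : Matrix ι ι' ℝ) (B : Matrix κ κ' ℝ) (C : Matrix ν ν' ℝ) :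
    tmat (apply3 T A B C) = Aᵀ * tmat T * Matrix.kroneckerMap (fun x y => x * y) B C := by
  ext a ⟨b, c⟩
  simp only [tmat, apply3, mul_apply, of_apply, transpose_apply, Fintype.sum_prod_type,
    kroneckerMap_apply, Finset.sum_mul]
  rw [Finset.sum_comm]
  refine Finset.sum_congr rfl fun j _ => ?_
  rw [Finset.sum_comm]
  exact Finset.sum_congr rfl fun k _ => Finset.sum_congr rfl fun i _ => by ring

lemma tensorApply_tensorApply (T : Tensor3 ι) (R : Matrix ι κ ℝ) (Q : Matrix κ ν ℝ) :
    tensorApply (tensorApply T R) Q = tensorApply T (R * Q) := by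
  have h : tmat (apply3 (apply3 T R R R) Q Q Q) = tmat (apply3 T (R * Q) (R * Q) (R * Q)) := by
    rw [tmat_apply3, tmat_apply3, tmat_apply3, mul_kronecker_mul, transpose_mul]
    simp only [Matrix.mul_assoc]
  funext a b c
  exact congrFun (congrFun h a) (b, c)

lemma tensorApply_one (T : Tensor3 ι) : tensorApply T (1 : Matrix ι ι ℝ) = T := by
  funext a b c
  simp only [tensorApply, one_apply, mul_ite, mul_one, mul_zero]
  simp

lemma tnorm_tensorApply_le {T : Tensor3 ι} {R : Matrix ι κ ℝ} {a : ℝ} (hR : ‖R‖ ≤ a) :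
    tnorm (tensorApply T R) ≤ a ^ 3 * tnorm T :=
  (tnorm_apply3_le (T := T) hR hR hR).trans_eq (by ring)

lemma tensorApply_sub (S T : Tensor3 ι) (R : Matrix ι κ ℝ) :
    tensorApply (S - T) R = tensorApply S R - tensorApply T R := by
  funext a b c
  simp only [tensorApply, Pi.sub_apply, sub_mul, Finset.sum_sub_distrib]

lemma tnorm_tensorApply_sub_le {T : Tensor3 ι} {A B : Matrix ι κ ℝ} {a δ : ℝ} (hA : ‖A‖ ≤ a)
    (hB : ‖B‖ ≤ a) (hAB : ‖A - B‖ ≤ δ) :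
    tnorm (tensorApply T A - tensorApply T B) ≤ 3 * a ^ 2 * δ * tnorm T := by
  have h : tensorApply T A - tensorApply T B =
      apply3 T (A - B) A A + apply3 T B (A - B) A + apply3 T B B (A - B) := by
    funext x y z
    simp only [tensorApply, apply3, Pi.sub_apply, Pi.add_apply, ← Finset.sum_sub_distrib,
      ← Finset.sum_add_distrib, Matrix.sub_apply]
    refine Finset.sum_congr rfl fun i _ => Finset.sum_congr rfl fun j _ =>
      Finset.sum_congr rfl fun k _ => by ring
  rw [h]
  refine (tnorm_add_le _ _).trans ((add_le_add (tnorm_add_le _ _) le_rfl).trans ?_)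
  have h1 := tnorm_apply3_le (T := T) hAB hA hA
  have h2 := tnorm_apply3_le (T := T) hB hAB hA
  have h3 := tnorm_apply3_le (T := T) hB hB hAB
  linarith

end Tensors

/-! ### The mask on tensors and tensor least squares. -/

section Mask

variable {n ℓ r : ℕ}

lemma mask3_sub (S T : Tensor3 (Idx n ℓ)) : mask3 (S - T) = mask3 S - mask3 T := by
  funext p q s
  simp only [mask3, Pi.sub_apply]
  split_ifs <;> simp

lemma tnorm_mask3_le (T : Tensor3 (Idx n ℓ)) : tnorm (mask3 T) ≤ tnorm T := by
  refine le_of_sq_le_sq ?_ (tnorm_nonneg _)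
  rw [tnorm_sq, tnorm_sq]
  refine Finset.sum_le_sum fun p _ => Finset.sum_le_sum fun q _ => Finset.sum_le_sum fun s _ => ?_
  rw [mask3]
  split_ifs
  · exact le_rfl
  · simpa using sq_nonneg (T p q s)

/-- The part of `Z[uᵀ, uᵀ, uᵀ]` whose first two block indices agree. -/
lemma sum_block_eq_le (Z : Tensor3 (Fin r)) {u : Matrix (Idx n ℓ) (Fin r) ℝ} {a β : ℝ}
    (ha : ‖u‖ ≤ a) (hβ : ∀ i, ‖rowBlock u i‖ ≤ β) :
    ∑ p : Idx n ℓ, ∑ q : Idx n ℓ, ∑ s : Idx n ℓ,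
      (if p.1 = q.1 then tensorApply Z uᵀ p q s ^ 2 else 0) ≤ (a ^ 2 * β * tnorm Z) ^ 2 := by
  have ha0 : 0 ≤ a := (norm_nonneg _).trans ha
  have h1 : ∑ p : Idx n ℓ, ∑ q : Idx n ℓ, ∑ s : Idx n ℓ,
      (if p.1 = q.1 then tensorApply Z uᵀ p q s ^ 2 else 0) =
      ∑ i, tnorm (apply3 Z (rowBlock u i)ᵀ (rowBlock u i)ᵀ uᵀ) ^ 2 := by
    simp only [tnorm_sq]
    rw [Fintype.sum_prod_type]
    refine Finset.sum_congr rfl fun i _ => Finset.sum_congr rfl fun x _ => ?_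
    rw [Fintype.sum_prod_type, Finset.sum_eq_single i (fun j _ hj => by simp [hj.symm]) (by simp)]
    refine Finset.sum_congr rfl fun y _ => Finset.sum_congr rfl fun s _ => ?_
    rw [if_pos rfl]
    rfl
  -- One block factor is bounded by `β` and the full factor by `a`. The other block factor stays
  -- inside the Frobenius norm, so the sum over `i` recombines to `‖u Z‖²` instead of `n` times a
  -- maximum.
  have h2 : ∀ i, tnorm (apply3 Z (rowBlock u i)ᵀ (rowBlock u i)ᵀ uᵀ) ^ 2 ≤
      (a * β) ^ 2 * frobSq (rowBlock (u * tmat Z) i) := by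
    intro i
    rw [← fro_sq, ← mul_pow]
    refine pow_le_pow_left₀ (tnorm_nonneg _) ?_ 2
    refine (tnorm_apply3_le_modeMul _ _ _ _).trans ?_
    rw [tnorm, tmat_modeMul, transpose_transpose, rowBlock_mul, opNorm_transpose, opNorm_transpose,
      mul_assoc]
    have := (norm_nonneg _).trans (hβ i)
    have h3 := fro_nonneg (rowBlock u i * tmat Z)
    have := hβ i
    gcongr
  rw [h1]
  refine (Finset.sum_le_sum fun i _ => h2 i).trans ?_
  rw [← Finset.mul_sum, ← frobSq_eq_sum_rowBlock, ← fro_sq, ← mul_pow]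
  have h4 : fro (u * tmat Z) ≤ a * tnorm Z :=
    (fro_mul_le _ _).trans (mul_le_mul_of_nonneg_right ha (fro_nonneg _))
  rcases isEmpty_or_nonempty (Fin n) with hn | ⟨⟨i₀⟩⟩
  · have : fro (u * tmat Z) = 0 := by simp [fro, frobSq]
    rw [this]; simpa using sq_nonneg (a ^ 2 * β * tnorm Z)
  have hβ0 : 0 ≤ β := (norm_nonneg _).trans (hβ i₀)
  refine pow_le_pow_left₀ (mul_nonneg (by positivity) (fro_nonneg _)) ?_ 2
  calc a * β * fro (u * tmat Z) ≤ a * β * (a * tnorm Z) :=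
        mul_le_mul_of_nonneg_left h4 (by positivity)
    _ = a ^ 2 * β * tnorm Z := by ring

lemma tensorApply_rot {ι κ : Type} [Fintype ι] [Fintype κ] (Z : Tensor3 ι) (R : Matrix ι κ ℝ)
    (p q s : κ) : tensorApply (rot Z) R q s p = tensorApply Z R p q s := by
  simp only [tensorApply, rot]
  calc ∑ b, ∑ c, ∑ a, Z a b c * R b q * R c s * R a p
      = ∑ b, ∑ a, ∑ c, Z a b c * R b q * R c s * R a p :=
        Finset.sum_congr rfl fun _ _ => Finset.sum_comm
    _ = ∑ a, ∑ b, ∑ c, Z a b c * R b q * R c s * R a p := Finset.sum_comm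
    _ = _ := Finset.sum_congr rfl fun _ _ => Finset.sum_congr rfl fun _ _ =>
        Finset.sum_congr rfl fun _ _ => by ring

/-- The part of `Z[uᵀ, uᵀ, uᵀ]` that is removed by the mask. -/
lemma tnorm_sub_mask3_le (Z : Tensor3 (Fin r)) {u : Matrix (Idx n ℓ) (Fin r) ℝ} {a β : ℝ}
    (hβ0 : 0 ≤ β) (ha : ‖u‖ ≤ a) (hβ : ∀ i, ‖rowBlock u i‖ ≤ β) :
    tnorm (tensorApply Z uᵀ - mask3 (tensorApply Z uᵀ)) ≤ 2 * (a ^ 2 * β * tnorm Z) := by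
  have ha0 : 0 ≤ a := (norm_nonneg _).trans ha
  refine le_of_sq_le_sq ?_ (mul_nonneg zero_le_two (mul_nonneg (by positivity) (tnorm_nonneg _)))
  set Y := tensorApply Z uᵀ with hY
  rw [tnorm_sq]
  -- An entry removed by the mask has two equal block indices among three pairs. Rotating the tensor
  -- moves each pair to the first position, and the resulting factor `3` is rounded up to `2²`.
  have h1 : ∀ p q s : Idx n ℓ, (Y - mask3 Y) p q s ^ 2 ≤ (if p.1 = q.1 then Y p q s ^ 2 else 0) +
      (if q.1 = s.1 then Y p q s ^ 2 else 0) + (if s.1 = p.1 then Y p q s ^ 2 else 0) := by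
    intro p q s
    have hY2 := sq_nonneg (Y p q s)
    have n1 : 0 ≤ if p.1 = q.1 then Y p q s ^ 2 else 0 := by split_ifs <;> simp [hY2]
    have n2 : 0 ≤ if q.1 = s.1 then Y p q s ^ 2 else 0 := by split_ifs <;> simp [hY2]
    have n3 : 0 ≤ if s.1 = p.1 then Y p q s ^ 2 else 0 := by split_ifs <;> simp [hY2]
    by_cases h : p.1 ≠ q.1 ∧ q.1 ≠ s.1 ∧ s.1 ≠ p.1
    · have : (Y - mask3 Y) p q s = 0 := by simp only [Pi.sub_apply, mask3, if_pos h, sub_self]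
      rw [this]
      linarith
    · have : (Y - mask3 Y) p q s = Y p q s := by simp only [Pi.sub_apply, mask3, if_neg h, sub_zero]
      rw [this]
      by_cases e1 : p.1 = q.1
      · rw [if_pos e1]; linarith
      · by_cases e2 : q.1 = s.1
        · rw [if_pos e2]; linarith
        · have e3 : s.1 = p.1 := by
            by_contra e3
            exact h ⟨e1, e2, e3⟩
          rw [if_pos e3]; linarith
  refine (Finset.sum_le_sum fun p _ => Finset.sum_le_sum fun q _ => Finset.sum_le_sum fun s _ =>
    h1 p q s).trans ?_
  simp only [Finset.sum_add_distrib]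
  have h2 := sum_block_eq_le Z ha hβ
  have h3 := sum_block_eq_le (rot Z) ha hβ
  have h4 := sum_block_eq_le (rot (rot Z)) ha hβ
  simp only [tnorm_rot] at h3 h4
  have h5 : ∑ p : Idx n ℓ, ∑ q : Idx n ℓ, ∑ s : Idx n ℓ, (if q.1 = s.1 then Y p q s ^ 2 else 0) =
      ∑ q : Idx n ℓ, ∑ s : Idx n ℓ, ∑ p : Idx n ℓ,
        (if q.1 = s.1 then tensorApply (rot Z) uᵀ q s p ^ 2 else 0) := by
    simp only [tensorApply_rot, ← hY]
    rw [Finset.sum_comm]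
    exact Finset.sum_congr rfl fun q _ => Finset.sum_comm
  have h6 : ∑ p : Idx n ℓ, ∑ q : Idx n ℓ, ∑ s : Idx n ℓ, (if s.1 = p.1 then Y p q s ^ 2 else 0) =
      ∑ s : Idx n ℓ, ∑ p : Idx n ℓ, ∑ q : Idx n ℓ,
        (if s.1 = p.1 then tensorApply (rot (rot Z)) uᵀ s p q ^ 2 else 0) := by
    simp only [tensorApply_rot, ← hY]
    exact (Finset.sum_congr rfl fun p _ => Finset.sum_comm).trans Finset.sum_comm
  rw [h5, h6]
  nlinarith [sq_nonneg (a ^ 2 * β * tnorm Z)]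

lemma transpose_unwhiten_mul_whiten {U : Matrix (Idx n ℓ) (Fin r) ℝ} {s : Fin r → ℝ}
    (hU : Uᵀ * U = 1) (hs : ∀ q, 0 < s q) : (unwhiten U s)ᵀ * whiten U s = 1 := by
  simp only [unwhiten, whiten, transpose_mul, diagonal_transpose]
  rw [Matrix.mul_assoc, ← Matrix.mul_assoc Uᵀ, hU, Matrix.one_mul, diagonal_mul_diagonal,
    ← diagonal_one]
  congr 1
  funext q
  exact mul_inv_cancel₀ (Real.sqrt_pos.mpr (hs q)).ne'

lemma whiten_mul_transpose_unwhiten {U : Matrix (Idx n ℓ) (Fin r) ℝ} {s : Fin r → ℝ}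
    (hs : ∀ q, 0 < s q) : whiten U s * (unwhiten U s)ᵀ = U * Uᵀ := by
  simp only [unwhiten, whiten, transpose_mul, diagonal_transpose]
  rw [Matrix.mul_assoc, ← Matrix.mul_assoc (Matrix.diagonal _), diagonal_mul_diagonal]
  have : (fun q => (√(s q))⁻¹ * √(s q)) = fun _ => 1 := by
    funext q
    exact inv_mul_cancel₀ (Real.sqrt_pos.mpr (hs q)).ne'
  rw [this, diagonal_one, Matrix.one_mul]

variable {U : Matrix (Idx n ℓ) (Fin r) ℝ} {s : Fin r → ℝ} {a β c : ℝ}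

/-- Unwhitening followed by whitening is the identity, so without the mask `Â` would be the
identity. The difference is what the mask removes, whitened in three modes. -/
lemma tnorm_AHat_sub_le (hU : Uᵀ * U = 1) (hs : ∀ q, 0 < s q) (hβ0 : 0 ≤ β)
    (ha : ‖unwhiten U s‖ ≤ a) (hβ : ∀ i, ‖rowBlock (unwhiten U s) i‖ ≤ β) (hc : ‖whiten U s‖ ≤ c)
    (Z : Tensor3 (Fin r)) : tnorm (AHat U s Z - Z) ≤ 2 * c ^ 3 * a ^ 2 * β * tnorm Z := by
  have h1 : Z = tensorApply (tensorApply Z (unwhiten U s)ᵀ) (whiten U s) := by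
    rw [tensorApply_tensorApply, transpose_unwhiten_mul_whiten hU hs, tensorApply_one]
  have h2 : tnorm (AHat U s Z - Z) = tnorm (tensorApply (tensorApply Z (unwhiten U s)ᵀ -
      mask3 (tensorApply Z (unwhiten U s)ᵀ)) (whiten U s)) := by
    rw [tnorm_sub_comm, tensorApply_sub, ← h1]
    rfl
  rw [h2]
  have hc0 : 0 ≤ c := (norm_nonneg _).trans hc
  refine (tnorm_tensorApply_le hc).trans ?_
  calc c ^ 3 * tnorm (tensorApply Z (unwhiten U s)ᵀ - mask3 (tensorApply Z (unwhiten U s)ᵀ))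
      ≤ c ^ 3 * (2 * (a ^ 2 * β * tnorm Z)) :=
        mul_le_mul_of_nonneg_left (tnorm_sub_mask3_le Z hβ0 ha hβ) (by positivity)
    _ = _ := by ring

/-- If the operator `Â` is close to the identity, tensor least squares solves its equation
exactly. -/
lemma IsTensorLSOutput.eq {S₃ : Tensor3 (Idx n ℓ)} {G : Tensor3 (Fin r)}
    (hG : IsTensorLSOutput S₃ U s G) (h : ∀ Z, tnorm (AHat U s Z - Z) ≤ 1 / 2 * tnorm Z) :
    AHat U s G = tensorApply (mask3 S₃) (whiten U s) := by
  let L : Tensor3 (Fin r) →ₗ[ℝ] Tensor3 (Fin r) :=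
    { toFun := AHat U s, map_add' := AHat_add U s, map_smul' := AHat_smul U s }
  have hinj : Function.Injective L := by
    refine (injective_iff_map_eq_zero L).mpr fun Z hZ => eq_zero_of_tnorm ?_
    have h1 := h Z
    rw [show AHat U s Z = 0 from hZ, tnorm_sub_comm, sub_zero] at h1
    linarith [tnorm_nonneg Z]
  -- In finite dimension an injective `Â` is surjective, so some `Z` has residual zero and the
  -- minimizer has residual zero as well.
  obtain ⟨Z, hZ⟩ := LinearMap.injective_iff_surjective.mp hinj
    (tensorApply (mask3 S₃) (whiten U s))
  have h1 := hG Z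
  rw [show AHat U s Z = _ from hZ, sub_self, ← tnorm_sq_eq_tensorFrobSq,
    ← tnorm_sq_eq_tensorFrobSq] at h1
  have h2 : tnorm (0 : Tensor3 (Fin r)) = 0 := fro_zero
  rw [h2] at h1
  have h3 : tnorm (AHat U s G - tensorApply (mask3 S₃) (whiten U s)) = 0 := by
    have := sq_nonneg (tnorm (AHat U s G - tensorApply (mask3 S₃) (whiten U s)))
    exact pow_eq_zero_iff two_ne_zero |>.mp (le_antisymm (by simpa using h1) this)
  exact sub_eq_zero.mp (eq_zero_of_tnorm h3)

/-- The error of tensor least squares. -/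
lemma IsTensorLSOutput.error {S₃ : Tensor3 (Idx n ℓ)} {G : Tensor3 (Fin r)}
    (hG : IsTensorLSOutput S₃ U s G) (hU : Uᵀ * U = 1) (hs : ∀ q, 0 < s q)
    (h : ∀ Z, tnorm (AHat U s Z - Z) ≤ 1 / 2 * tnorm Z) (hc : ‖whiten U s‖ ≤ c)
    {D : Tensor3 (Fin r)} {A : Matrix (Idx n ℓ) (Fin r) ℝ} {e k δ : ℝ}
    (he : tnorm (mask3 (S₃ - tensorApply D Aᵀ)) ≤ e) (hA : ‖A‖ ≤ k)
    (hδ : ‖(1 - U * Uᵀ) * A‖ ≤ δ) :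
    tnorm (G - tensorApply D ((whiten U s)ᵀ * A)ᵀ) ≤ 2 * c ^ 3 * (e + 3 * k ^ 2 * δ * tnorm D) := by
  set Z := tensorApply D ((whiten U s)ᵀ * A)ᵀ with hZ
  have hc0 : 0 ≤ c := (norm_nonneg _).trans hc
  have h1 : AHat U s (G - Z) = AHat U s G - AHat U s Z := by
    have := AHat_add U s (G - Z) Z
    rw [sub_add_cancel] at this
    rw [this, add_sub_cancel_right]
  have h2 := h (G - Z)
  have h3 : tnorm (G - Z) ≤ tnorm (AHat U s (G - Z)) + tnorm (AHat U s (G - Z) - (G - Z)) := by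
    have := tnorm_sub_le (AHat U s (G - Z)) (AHat U s (G - Z) - (G - Z))
    rwa [sub_sub_cancel] at this
  -- Unwhitening the target gives back the moment tensor with `A` projected to the range of `U`.
  -- Hence the error consists of sampling noise and the part of `A` outside this range.
  have h4 : AHat U s Z = tensorApply (mask3 (tensorApply D (Aᵀ * (U * Uᵀ)))) (whiten U s) := by
    have h5 : tensorApply Z (unwhiten U s)ᵀ = tensorApply D (Aᵀ * (U * Uᵀ)) := by
      rw [hZ, tensorApply_tensorApply, transpose_mul, transpose_transpose, Matrix.mul_assoc,
        whiten_mul_transpose_unwhiten hs]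
    rw [← h5]; rfl
  have h5 : mask3 S₃ - mask3 (tensorApply D (Aᵀ * (U * Uᵀ))) =
      mask3 (S₃ - tensorApply D Aᵀ) + mask3 (tensorApply D Aᵀ - tensorApply D (Aᵀ * (U * Uᵀ))) := by
    rw [mask3_sub, mask3_sub]; abel
  have hP : ‖U * Uᵀ‖ ≤ 1 := by
    refine (opNorm_mul_le _ _).trans ?_
    rw [opNorm_transpose]
    exact mul_le_one₀ (opNorm_le_one_of_orthonormal hU) (norm_nonneg _)
      (opNorm_le_one_of_orthonormal hU)
  have h6 : tnorm (tensorApply D Aᵀ - tensorApply D (Aᵀ * (U * Uᵀ))) ≤ 3 * k ^ 2 * δ * tnorm D := by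
    refine tnorm_tensorApply_sub_le ?_ ?_ ?_
    · rwa [opNorm_transpose]
    · refine (opNorm_mul_le _ _).trans ((mul_le_of_le_one_right (norm_nonneg _) hP).trans ?_)
      rwa [opNorm_transpose]
    · rw [← opNorm_transpose]
      convert hδ using 2
      simp [transpose_mul, Matrix.sub_mul, Matrix.mul_assoc]
  have h7 : tnorm (AHat U s (G - Z)) ≤ c ^ 3 * (e + 3 * k ^ 2 * δ * tnorm D) := by
    rw [h1, hG.eq h, h4, ← tensorApply_sub, h5]
    refine (tnorm_tensorApply_le hc).trans (mul_le_mul_of_nonneg_left ?_ (by positivity))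
    exact (tnorm_add_le _ _).trans (add_le_add he ((tnorm_mask3_le _).trans h6))
  linarith

end Mask

/-! ### From an accurate second moment to a rotated diagonal tensor. -/

namespace IncoherentFactorization

variable {n ℓ r : ℕ} {M M' : Matrix (Idx n ℓ) (Idx n ℓ) ℝ}
    {U V W : Matrix (Idx n ℓ) (Fin r) ℝ} {s : Fin r → ℝ}
    {K : Matrix (Fin r) (Fin r) ℝ} {σ₁ σᵣ b ρ : ℝ}

lemma rowBlock_unwhiten_le (h : IncoherentFactorization M U K σ₁ σᵣ b) (hsvd : IsSVD M' V s W)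
    (hM : fro (M' - M) ≤ ρ * σᵣ) (hρ : ρ ≤ 1 / 2) (i : Fin n) :
    ‖rowBlock (unwhiten V s) i‖ ≤ (b + 2 * ρ) * √(2 * σ₁) := by
  have hs := fun q => (h.svd_bounds hsvd hM hρ q).2
  have h1 := (h.rowBlock_le hsvd.1 i).trans (add_le_add_right (h.svd_left_error hsvd hM hρ) b)
  rw [unwhiten, rowBlock_mul]
  refine (opNorm_mul_le _ _).trans (mul_le_mul h1 ?_ (norm_nonneg _) ((norm_nonneg _).trans h1))
  refine opNorm_diagonal_le (Real.sqrt_nonneg _) fun q => ?_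
  rw [abs_of_nonneg (by positivity)]
  exact Real.sqrt_le_sqrt (hs q)

/-- The whitened third moment is close to an orthogonally decomposable tensor. -/
theorem tensorLS_error (h : IncoherentFactorization M U K σ₁ σᵣ b)
    {A : Matrix (Idx n ℓ) (Fin r) ℝ} (hA : M = A * Aᵀ) (hsvd : IsSVD M' V s W)
    (hM : fro (M' - M) ≤ ρ * σᵣ) (hρ : 24 * ρ * (σ₁ / σᵣ) ≤ 1 / 2)
    (hb : 16 * (σ₁ / σᵣ) ^ 2 * (b + 2 * ρ) ≤ 1 / 2)
    {S₃ : Tensor3 (Idx n ℓ)} {G D : Tensor3 (Fin r)} (hG : IsTensorLSOutput S₃ V s G) {e : ℝ}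
    (he : tnorm (mask3 (S₃ - tensorApply D Aᵀ)) ≤ e) :
    ∃ O : Matrix (Fin r) (Fin r) ℝ, Oᵀ * O = 1 ∧
      tnorm (G - tensorApply D Oᵀ) ≤ 6 * e / (σᵣ * √σᵣ) + 306 * (σ₁ / σᵣ) * ρ * tnorm D ∧
      fro (A - unwhiten V s * O) ≤ 35 * ρ * (σ₁ / σᵣ) * √σ₁ := by
  have hσ := h.pos
  have hσ₁ := hσ.trans_le h.le
  have hκ : 1 ≤ σ₁ / σᵣ := (one_le_div hσ).mpr h.le
  have hρ0 : 0 ≤ ρ := by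
    by_contra! hlt
    have := (fro_nonneg _).trans hM
    nlinarith
  have hρ' : ρ ≤ 1 / 2 := by nlinarith
  have hb0 := h.b_nonneg
  have hsq : √(2 / σᵣ) * √(2 * σ₁) = 2 * √(σ₁ / σᵣ) := by
    rw [← Real.sqrt_mul (by positivity), show 2 / σᵣ * (2 * σ₁) = 2 ^ 2 * (σ₁ / σᵣ) by ring,
      Real.sqrt_mul (by positivity), Real.sqrt_sq (by norm_num)]
  have hκs : √(σ₁ / σᵣ) ≤ σ₁ / σᵣ := by
    rw [Real.sqrt_le_left (by positivity)]
    nlinarith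
  have hop := h.opNorm_whiten_le hsvd hM hρ'
  have hop' := h.opNorm_unwhiten_le hsvd hM hρ'
  have hs : ∀ q, 0 < s q := fun q => by linarith [(h.svd_bounds hsvd hM hρ' q).1]
  have hAhat : ∀ Z, tnorm (AHat V s Z - Z) ≤ 1 / 2 * tnorm Z := by
    intro Z
    refine (tnorm_AHat_sub_le hsvd.1 hs (by positivity) hop' (h.rowBlock_unwhiten_le hsvd hM hρ')
      hop Z).trans (mul_le_mul_of_nonneg_right ?_ (tnorm_nonneg Z))
    calc 2 * √(2 / σᵣ) ^ 3 * √(2 * σ₁) ^ 2 * ((b + 2 * ρ) * √(2 * σ₁))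
        = 2 * (√(2 / σᵣ) * √(2 * σ₁)) ^ 3 * (b + 2 * ρ) := by ring
      _ = 16 * (√(σ₁ / σᵣ) ^ 2 * √(σ₁ / σᵣ)) * (b + 2 * ρ) := by rw [hsq]; ring
      _ ≤ 16 * ((σ₁ / σᵣ) * (σ₁ / σᵣ)) * (b + 2 * ρ) := by
          rw [Real.sq_sqrt (by positivity)]
          gcongr
      _ = 16 * (σ₁ / σᵣ) ^ 2 * (b + 2 * ρ) := by ring
      _ ≤ 1 / 2 := hb
  have hproj := h.fro_one_sub_mul_sqrt hA hsvd hM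
  have herr := hG.error hsvd.1 hs hAhat hop he (h.opNorm_sqrt_le hA)
    ((opNorm_le_fro _).trans hproj)
  have hwh := h.whitened_error hA hsvd hM hρ'
  have hwh' : 24 * ρ * σ₁ / σᵣ = 24 * ρ * (σ₁ / σᵣ) := by ring
  rw [hwh'] at hwh
  -- The whitened factor is only nearly orthogonal, while the power method is analysed for an
  -- exactly orthonormal basis; its polar factor provides one.
  obtain ⟨O, hO, hRO⟩ := exists_orthogonal_near (hwh.trans_lt (by linarith))
  have hRO' := hRO.trans hwh
  set R := (whiten V s)ᵀ * A with hR
  have hO1 := opNorm_le_one_of_orthonormal hO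
  have hR2 : ‖R‖ ≤ 2 := by
    have := norm_add_le O (R - O)
    rw [add_sub_cancel] at this
    linarith [(opNorm_le_fro (R - O)).trans hRO']
  refine ⟨O, hO, ?_, ?_⟩
  · have h1 : tnorm (tensorApply D Rᵀ - tensorApply D Oᵀ) ≤
        3 * 2 ^ 2 * (24 * ρ * (σ₁ / σᵣ)) * tnorm D := by
      refine tnorm_tensorApply_sub_le (by rwa [opNorm_transpose])
        (by rw [opNorm_transpose]; linarith) ?_
      rw [← transpose_sub, opNorm_transpose]
      exact (opNorm_le_fro _).trans hRO'
    have h2 : tnorm (G - tensorApply D Oᵀ) ≤ tnorm (G - tensorApply D Rᵀ) +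
        tnorm (tensorApply D Rᵀ - tensorApply D Oᵀ) := by
      have := tnorm_add_le (G - tensorApply D Rᵀ) (tensorApply D Rᵀ - tensorApply D Oᵀ)
      rwa [sub_add_sub_cancel] at this
    have h3 : √(2 / σᵣ) ^ 3 * √σᵣ ≤ 3 / σᵣ := by
      have h4 : √(2 / σᵣ) * √σᵣ = √2 := by
        rw [← Real.sqrt_mul (by positivity), div_mul_cancel₀ _ hσ.ne']
      have h5 : √(2 / σᵣ) ^ 3 * √σᵣ = √(2 / σᵣ) ^ 2 * (√(2 / σᵣ) * √σᵣ) := by ring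
      rw [h5, h4, Real.sq_sqrt (by positivity), div_mul_eq_mul_div]
      gcongr
      have : √2 ≤ 3 / 2 := by
        rw [Real.sqrt_le_left (by norm_num)]; norm_num
      linarith
    have hsr := Real.sqrt_pos.mpr hσ
    have h3' : √(2 / σᵣ) ^ 3 ≤ 3 / (σᵣ * √σᵣ) := by
      rw [← div_div, le_div_iff₀ hsr]; exact h3
    have he0 := (tnorm_nonneg _).trans he
    have hD := tnorm_nonneg D
    -- The constant `306` is `18` from the part of `A` outside the range of `V`, plus `3 · 2² · 24 =
    -- 288` from replacing `R` by `O`.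
    have h6 : 2 * √(2 / σᵣ) ^ 3 * (e + 3 * √σ₁ ^ 2 * (ρ * √σᵣ) * tnorm D) ≤
        6 * e / (σᵣ * √σᵣ) + 18 * (σ₁ / σᵣ) * ρ * tnorm D := by
      rw [Real.sq_sqrt hσ₁.le]
      calc 2 * √(2 / σᵣ) ^ 3 * (e + 3 * σ₁ * (ρ * √σᵣ) * tnorm D)
          = 2 * √(2 / σᵣ) ^ 3 * e + 6 * σ₁ * ρ * tnorm D * (√(2 / σᵣ) ^ 3 * √σᵣ) := by ring
        _ ≤ 2 * (3 / (σᵣ * √σᵣ)) * e + 6 * σ₁ * ρ * tnorm D * (3 / σᵣ) := by gcongr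
        _ = _ := by ring
    linarith
  · have h1 : A - unwhiten V s * O = (1 - V * Vᵀ) * A + unwhiten V s * (R - O) := by
      have h2 : V * Vᵀ = unwhiten V s * (whiten V s)ᵀ := by
        have := congrArg Matrix.transpose (whiten_mul_transpose_unwhiten (U := V) hs)
        simpa [transpose_mul] using this.symm
      rw [h2, hR, Matrix.mul_sub, Matrix.sub_mul, Matrix.one_mul, Matrix.mul_assoc]
      abel
    rw [h1]
    refine (fro_add_le _ _).trans ?_
    have h3 : fro (unwhiten V s * (R - O)) ≤ √(2 * σ₁) * (24 * ρ * (σ₁ / σᵣ)) :=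
      (fro_mul_le _ _).trans (mul_le_mul hop' hRO' (fro_nonneg _) (Real.sqrt_nonneg _))
    -- A rational bound for `√2` for which `24 · 17/12 = 34`; with the projection error this gives
    -- `35`.
    have h4 : √(2 * σ₁) ≤ 17 / 12 * √σ₁ := by
      rw [Real.sqrt_mul (by norm_num)]
      refine mul_le_mul_of_nonneg_right ?_ (Real.sqrt_nonneg _)
      rw [Real.sqrt_le_left (by norm_num)]; norm_num
    have h5 : √σᵣ ≤ √σ₁ := Real.sqrt_le_sqrt h.le
    have h6 : ρ * √σᵣ ≤ ρ * (σ₁ / σᵣ) * √σ₁ := by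
      rw [mul_assoc]
      refine mul_le_mul_of_nonneg_left ?_ hρ0
      nlinarith [Real.sqrt_nonneg σ₁]
    have h7 : √(2 * σ₁) * (24 * ρ * (σ₁ / σᵣ)) ≤ 17 / 12 * √σ₁ * (24 * ρ * (σ₁ / σᵣ)) := by
      gcongr
    linarith

end IncoherentFactorization

/-! ### Convergence of a perturbed power iteration for one orthogonal decomposition. -/

section PowerIteration

variable {r : ℕ} {v : OrthonormalBasis (Fin r) ℝ (EuclideanSpace ℝ (Fin r))} {lam : Fin r → ℝ}
  {A : Finset (Fin r)} {j : Fin r} {θ x : EuclideanSpace ℝ (Fin r)} {ν : ℝ}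

/-- The map `θ ↦ G(I, θ, θ)` of the tensor `G = ∑_{i ∈ A} λ_i v_i ⊗ v_i ⊗ v_i`. -/
noncomputable def odeco (v : OrthonormalBasis (Fin r) ℝ (EuclideanSpace ℝ (Fin r))) (lam : Fin r → ℝ)
    (A : Finset (Fin r)) (θ : EuclideanSpace ℝ (Fin r)) : EuclideanSpace ℝ (Fin r) :=
  ∑ i, (if i ∈ A then lam i * inner ℝ (v i) θ ^ 2 else 0) • v i

lemma inner_odeco (i : Fin r) : inner ℝ (v i) (odeco v lam A θ) =
    if i ∈ A then lam i * inner ℝ (v i) θ ^ 2 else 0 := by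
  rw [odeco, inner_sum]
  simp only [inner_smul_right, orthonormal_iff_ite.mp v.orthonormal]
  simp

/-- The component of `x` orthogonal to `v j`. -/
noncomputable def tail (v : OrthonormalBasis (Fin r) ℝ (EuclideanSpace ℝ (Fin r))) (j : Fin r)
    (x : EuclideanSpace ℝ (Fin r)) : EuclideanSpace ℝ (Fin r) := x - inner ℝ (v j) x • v j

lemma sum_inner_sq (v : OrthonormalBasis (Fin r) ℝ (EuclideanSpace ℝ (Fin r)))
    (x : EuclideanSpace ℝ (Fin r)) : ∑ i, inner ℝ (v i) x ^ 2 = ‖x‖ ^ 2 := by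
  rw [← v.sum_sq_norm_inner_right x]
  simp

lemma inner_tail (i : Fin r) : inner ℝ (v i) (tail v j x) = if i = j then 0 else inner ℝ (v i) x := by
  rw [tail, inner_sub_right, inner_smul_right, orthonormal_iff_ite.mp v.orthonormal]
  by_cases h : i = j <;> simp [h]

lemma norm_tail_sq : ‖tail v j x‖ ^ 2 = ‖x‖ ^ 2 - inner ℝ (v j) x ^ 2 := by
  rw [← sum_inner_sq v, ← sum_inner_sq v, ← Finset.add_sum_erase _ _ (Finset.mem_univ j),
    ← Finset.add_sum_erase _ (fun i => inner ℝ (v i) x ^ 2) (Finset.mem_univ j), inner_tail]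
  simp only [if_true, add_sub_cancel_left]
  rw [zero_pow two_ne_zero, zero_add]
  refine Finset.sum_congr rfl fun i hi => ?_
  rw [inner_tail, if_neg (Finset.ne_of_mem_erase hi)]

lemma norm_tail_le : ‖tail v j x‖ ≤ ‖x‖ := by
  refine le_of_sq_le_sq ?_ (norm_nonneg _)
  rw [norm_tail_sq]
  linarith [sq_nonneg (inner ℝ (v j) x)]

lemma tail_sub (x y : EuclideanSpace ℝ (Fin r)) : tail v j (x - y) = tail v j x - tail v j y := by
  simp only [tail, inner_sub_right, sub_smul]; abel

lemma tail_smul (c : ℝ) (x : EuclideanSpace ℝ (Fin r)) : tail v j (c • x) = c • tail v j x := by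
  simp only [tail, inner_smul_right, smul_sub, mul_smul]

lemma abs_inner_le_norm_tail {i : Fin r} (h : i ≠ j) : |inner ℝ (v i) x| ≤ ‖tail v j x‖ := by
  have h1 : inner ℝ (v i) x = inner ℝ (v i) (tail v j x) := by rw [inner_tail, if_neg h]
  rw [h1]
  refine (abs_real_inner_le_norm _ _).trans ?_
  rw [v.norm_eq_one, one_mul]

lemma norm_tail_odeco_le {L : ℝ} (hL : 0 ≤ L) (hlam0 : ∀ i, 0 ≤ lam i)
    (hlam : ∀ i ∈ A, lam i ≤ L) : ‖tail v j (odeco v lam A θ)‖ ≤ L * ‖tail v j θ‖ ^ 2 := by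
  refine le_of_sq_le_sq ?_ (by positivity)
  rw [← sum_inner_sq v, mul_pow, sq (‖tail v j θ‖ ^ 2), ← mul_assoc]
  calc ∑ i, inner ℝ (v i) (tail v j (odeco v lam A θ)) ^ 2
      ≤ ∑ i, L ^ 2 * ‖tail v j θ‖ ^ 2 * inner ℝ (v i) (tail v j θ) ^ 2 := by
        refine Finset.sum_le_sum fun i _ => ?_
        rw [inner_tail, inner_tail, inner_odeco]
        by_cases h : i = j
        · simp [h]
        · rw [if_neg h, if_neg h]
          have h1 : inner ℝ (v i) θ ^ 2 ≤ ‖tail v j θ‖ ^ 2 := by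
            rw [← sq_abs]
            exact pow_le_pow_left₀ (abs_nonneg _) (abs_inner_le_norm_tail h) 2
          split_ifs with hA
          · have h2 : lam i ^ 2 ≤ L ^ 2 := pow_le_pow_left₀ (hlam0 i) (hlam i hA) 2
            have h3 := sq_nonneg (inner ℝ (v i) θ)
            calc (lam i * inner ℝ (v i) θ ^ 2) ^ 2
                = lam i ^ 2 * inner ℝ (v i) θ ^ 2 * inner ℝ (v i) θ ^ 2 := by ring
              _ ≤ L ^ 2 * ‖tail v j θ‖ ^ 2 * inner ℝ (v i) θ ^ 2 := by gcongr
          · rw [zero_pow two_ne_zero]; positivity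
    _ = L ^ 2 * ‖tail v j θ‖ ^ 2 * ‖tail v j θ‖ ^ 2 := by rw [← Finset.mul_sum, sum_inner_sq]

/-- One normalized step of a map `f`. -/
noncomputable def normStep (f : EuclideanSpace ℝ (Fin r) → EuclideanSpace ℝ (Fin r))
    (θ : EuclideanSpace ℝ (Fin r)) : EuclideanSpace ℝ (Fin r) := ‖f θ‖⁻¹ • f θ

variable {f : EuclideanSpace ℝ (Fin r) → EuclideanSpace ℝ (Fin r)}

lemma norm_normStep (h : 0 < inner ℝ (v j) (f θ)) : ‖normStep f θ‖ = 1 := by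
  have h0 : f θ ≠ 0 := by rintro h0; rw [h0, inner_zero_right] at h; exact lt_irrefl _ h
  rw [normStep, norm_smul, norm_inv, norm_norm, inv_mul_cancel₀ (norm_ne_zero_iff.mpr h0)]

lemma abs_inner_sub_le {x y : EuclideanSpace ℝ (Fin r)} (h : ‖x - y‖ ≤ ν) (i : Fin r) :
    |inner ℝ (v i) x - inner ℝ (v i) y| ≤ ν := by
  rw [← inner_sub_right]
  refine (abs_real_inner_le_norm _ _).trans ?_
  rw [v.norm_eq_one, one_mul]
  exact h

/-- One step in the first stage, where coordinates are compared one by one. -/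
lemma normStep_coord {ρ ρ' κ : ℝ} (hθ : ‖θ‖ = 1) (hf : ‖f θ - odeco v lam A θ‖ ≤ ν)
    (hj : j ∈ A) (hlam0 : ∀ i, 0 ≤ lam i) (hlam : ∀ i ∈ A, lam i ≤ lam j) (hpos : 0 < lam j)
    (hρ1 : ρ ≤ 1) (hc : 0 < inner ℝ (v j) θ)
    (hρ : ∀ i ≠ j, |inner ℝ (v i) θ| ≤ ρ * inner ℝ (v j) θ) (hν : ν * r ≤ κ * lam j) (hκ : κ < 1)
    (hρ' : ρ ^ 2 + κ ≤ ρ' * (1 - κ)) (hρ'0 : 0 ≤ ρ') :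
    ‖normStep f θ‖ = 1 ∧ 0 < inner ℝ (v j) (normStep f θ) ∧
      ∀ i ≠ j, |inner ℝ (v i) (normStep f θ)| ≤ ρ' * inner ℝ (v j) (normStep f θ) := by
  set c := inner ℝ (v j) θ with hcdef
  -- The leading coordinate is the largest of `r` coordinates of a unit vector. This turns the
  -- absolute noise `ν` into noise relative to `λ_j c²`, the size of the new leading coordinate.
  have hr : 1 ≤ r * c ^ 2 := by
    have h1 := sum_inner_sq v θ
    rw [hθ, one_pow] at h1
    rw [← h1]
    have h2 : ∀ i ∈ Finset.univ, inner ℝ (v i) θ ^ 2 ≤ c ^ 2 := by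
      intro i _
      by_cases h : i = j
      · rw [h]
      · rw [← sq_abs]
        refine pow_le_pow_left₀ (abs_nonneg _) ((hρ i h).trans ?_) 2
        exact mul_le_of_le_one_left hc.le hρ1
    simpa using Finset.sum_le_card_nsmul _ _ _ h2
  have hr0 : (0 : ℝ) < r := by
    rcases Nat.eq_zero_or_pos r with h | h
    · rw [h] at hr; norm_num at hr
    · exact_mod_cast h
  have hνc : ν ≤ κ * (lam j * c ^ 2) := by
    have h1 : 0 ≤ ν := (norm_nonneg _).trans hf
    have h2 : ν ≤ ν * r * c ^ 2 := by nlinarith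
    nlinarith [sq_nonneg c]
  have hcj := abs_inner_sub_le (v := v) hf j
  rw [inner_odeco, if_pos hj] at hcj
  have hfj : (1 - κ) * (lam j * c ^ 2) ≤ inner ℝ (v j) (f θ) := by
    linarith [(abs_le.mp hcj).1]
  have hlc : 0 < lam j * c ^ 2 := by positivity
  have hfpos : 0 < inner ℝ (v j) (f θ) := lt_of_lt_of_le (mul_pos (by linarith) hlc) hfj
  have hn : 0 < ‖f θ‖⁻¹ := by
    have h0 : f θ ≠ 0 := by rintro h0; rw [h0, inner_zero_right] at hfpos; exact lt_irrefl _ hfpos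
    positivity
  refine ⟨norm_normStep hfpos, ?_, fun i hi => ?_⟩
  · rw [normStep, inner_smul_right]; positivity
  · rw [normStep, inner_smul_right, inner_smul_right, abs_mul, abs_of_pos hn, mul_left_comm]
    refine mul_le_mul_of_nonneg_left ?_ hn.le
    have h1 := abs_inner_sub_le (v := v) hf i
    rw [inner_odeco] at h1
    have h2 : |inner ℝ (v i) (f θ)| ≤ (ρ ^ 2 + κ) * (lam j * c ^ 2) := by
      have h3 : |if i ∈ A then lam i * inner ℝ (v i) θ ^ 2 else 0| ≤ ρ ^ 2 * (lam j * c ^ 2) := by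
        split_ifs with hA
        · rw [abs_of_nonneg (mul_nonneg (hlam0 i) (sq_nonneg _))]
          have h4 : inner ℝ (v i) θ ^ 2 ≤ (ρ * c) ^ 2 := by
            rw [← sq_abs]
            exact pow_le_pow_left₀ (abs_nonneg _) (hρ i hi) 2
          calc lam i * inner ℝ (v i) θ ^ 2 ≤ lam j * (ρ * c) ^ 2 :=
                mul_le_mul (hlam i hA) h4 (sq_nonneg _) hpos.le
            _ = ρ ^ 2 * (lam j * c ^ 2) := by ring
        · rw [abs_zero]; positivity
      have h4 := abs_sub_abs_le_abs_sub (inner ℝ (v i) (f θ))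
        (if i ∈ A then lam i * inner ℝ (v i) θ ^ 2 else 0)
      linarith
    refine h2.trans ?_
    calc (ρ ^ 2 + κ) * (lam j * c ^ 2) ≤ ρ' * (1 - κ) * (lam j * c ^ 2) := by gcongr
      _ = ρ' * ((1 - κ) * (lam j * c ^ 2)) := by ring
      _ ≤ ρ' * inner ℝ (v j) (f θ) := by gcongr

/-- One step in the second stage, where the tail is compared with the leading coordinate. -/
lemma normStep_tail {t : ℝ} (hθ : ‖θ‖ = 1) (hf : ‖f θ - odeco v lam A θ‖ ≤ ν)
    (hj : j ∈ A) (hlam0 : ∀ i, 0 ≤ lam i) (hlam : ∀ i ∈ A, lam i ≤ 11 / 10 * lam j)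
    (hpos : 0 < lam j) (ht0 : 0 ≤ t) (ht1 : t ≤ 1 / 2)
    (ht : ‖tail v j θ‖ ≤ t * inner ℝ (v j) θ) (hν : ν ≤ lam j / 40) :
    ‖normStep f θ‖ = 1 ∧ 0 < inner ℝ (v j) (normStep f θ) ∧
      ‖tail v j (normStep f θ)‖ ≤
        (6 / 5 * t ^ 2 + 3 / 2 * (ν / lam j)) * inner ℝ (v j) (normStep f θ) := by
  set c := inner ℝ (v j) θ with hcdef
  have hν0 : 0 ≤ ν := (norm_nonneg _).trans hf
  -- From `1 = c² + ‖tail‖²` and `‖tail‖ ≤ c / 2`.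
  have hc2 : 4 / 5 ≤ c ^ 2 := by
    have h1 := norm_tail_sq (v := v) (j := j) (x := θ)
    rw [hθ, ← hcdef] at h1
    have h2 := pow_le_pow_left₀ (norm_nonneg _) ht 2
    rw [mul_pow] at h2
    have h3 : t ^ 2 ≤ (1 / 2) ^ 2 := pow_le_pow_left₀ ht0 ht1 2
    nlinarith [sq_nonneg c]
  set β := ν / lam j with hβ
  have hνβ : ν = β * lam j := by rw [hβ, div_mul_cancel₀ _ hpos.ne']
  have hβ0 : 0 ≤ β := by positivity
  have hβ1 : β ≤ 1 / 40 := by rw [hβ, div_le_iff₀ hpos]; linarith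
  have hcj := abs_inner_sub_le (v := v) hf j
  rw [inner_odeco, if_pos hj] at hcj
  have hfj : lam j * (c ^ 2 - β) ≤ inner ℝ (v j) (f θ) := by
    have := (abs_le.mp hcj).1
    rw [hνβ] at this
    linarith
  have hfpos : 0 < inner ℝ (v j) (f θ) :=
    lt_of_lt_of_le (mul_pos hpos (by linarith)) hfj
  have hn : 0 < ‖f θ‖⁻¹ := by
    have h0 : f θ ≠ 0 := by rintro h0; rw [h0, inner_zero_right] at hfpos; exact lt_irrefl _ hfpos
    positivity
  refine ⟨norm_normStep hfpos, ?_, ?_⟩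
  · rw [normStep, inner_smul_right]; positivity
  · rw [normStep, inner_smul_right, tail_smul, norm_smul, Real.norm_of_nonneg hn.le, mul_left_comm]
    refine mul_le_mul_of_nonneg_left ?_ hn.le
    have h1 : ‖tail v j (f θ)‖ ≤ lam j * (11 / 10 * t ^ 2 * c ^ 2 + β) := by
      have h2 : tail v j (f θ) = tail v j (odeco v lam A θ) + tail v j (f θ - odeco v lam A θ) := by
        rw [tail_sub]; abel
      rw [h2]
      refine (norm_add_le _ _).trans ?_
      have h3 := norm_tail_odeco_le (v := v) (j := j) (θ := θ) (L := 11 / 10 * lam j) (by positivity)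
        hlam0 hlam
      have h4 : ‖tail v j θ‖ ^ 2 ≤ t ^ 2 * c ^ 2 := by
        rw [← mul_pow]; exact pow_le_pow_left₀ (norm_nonneg _) ht 2
      have h5 : 11 / 10 * lam j * ‖tail v j θ‖ ^ 2 ≤ 11 / 10 * lam j * (t ^ 2 * c ^ 2) := by gcongr
      have h6 := (norm_tail_le (v := v) (j := j) (x := f θ - odeco v lam A θ)).trans hf
      rw [hνβ] at h6
      linarith
    refine h1.trans ?_
    calc lam j * (11 / 10 * t ^ 2 * c ^ 2 + β) ≤ lam j * ((6 / 5 * t ^ 2 + 3 / 2 * β) * (c ^ 2 - β)) := by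
          refine mul_le_mul_of_nonneg_left ?_ hpos.le
          have ht2 : 0 ≤ t ^ 2 := sq_nonneg t
          have h7 : t ^ 2 * β ≤ t ^ 2 * (1 / 40) := by gcongr
          have h8 : β * β ≤ β * (1 / 40) := by gcongr
          have h9 : t ^ 2 * (4 / 5) ≤ t ^ 2 * c ^ 2 := by gcongr
          have h10 : β * (4 / 5) ≤ β * c ^ 2 := by gcongr
          nlinarith
      _ = (6 / 5 * t ^ 2 + 3 / 2 * β) * (lam j * (c ^ 2 - β)) := by ring
      _ ≤ (6 / 5 * t ^ 2 + 3 / 2 * β) * inner ℝ (v j) (f θ) := by gcongr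

/-- Convergence in the second stage. -/
lemma iterate_tail (hf : ∀ θ, ‖θ‖ = 1 → ‖f θ - odeco v lam A θ‖ ≤ ν)
    (hj : j ∈ A) (hlam0 : ∀ i, 0 ≤ lam i) (hlam : ∀ i ∈ A, lam i ≤ 11 / 10 * lam j)
    (hpos : 0 < lam j) (hν : ν ≤ lam j / 40) (hθ : ‖θ‖ = 1) (hc : 0 < inner ℝ (v j) θ)
    (ht : ‖tail v j θ‖ ≤ 5 / 36 * inner ℝ (v j) θ) (k : ℕ) :
    ‖(normStep f)^[k] θ‖ = 1 ∧ 0 < inner ℝ (v j) ((normStep f)^[k] θ) ∧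
      ‖tail v j ((normStep f)^[k] θ)‖ ≤
        (5 / 6 * (1 / 6) ^ (2 ^ k) + 9 / 2 * (ν / lam j)) * inner ℝ (v j) ((normStep f)^[k] θ) := by
  have hν0 : 0 ≤ ν := (norm_nonneg _).trans (hf θ hθ)
  have hβ0 : 0 ≤ ν / lam j := by positivity
  have hβ1 : ν / lam j ≤ 1 / 40 := by rw [div_le_iff₀ hpos]; linarith
  induction k with
  | zero =>
    refine ⟨hθ, hc, ht.trans ?_⟩
    simp only [pow_zero, pow_one, Function.iterate_zero, id]
    refine mul_le_mul_of_nonneg_right ?_ hc.le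
    linarith
  | succ k ih =>
    obtain ⟨h1, h2, h3⟩ := ih
    rw [Function.iterate_succ_apply']
    set y : ℝ := (1 / 6) ^ (2 ^ k) with hy
    have hy0 : 0 ≤ y := by positivity
    have hy1 : y ≤ 1 / 6 := by
      have : (1 / 6 : ℝ) ^ (2 ^ k) ≤ (1 / 6) ^ 1 :=
        pow_le_pow_of_le_one (by norm_num) (by norm_num) Nat.one_le_two_pow
      rwa [pow_one] at this
    -- The normalization `5/6` makes the main term an exact squaring, as `6/5 · (5/6 y)² = 5/6 y²`,
    -- and the starting ratio is `5/36 = 5/6 · 1/6`. The coefficient `9/2` of the noise leaves room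
    -- for the cross terms.
    obtain ⟨h4, h5, h6⟩ := normStep_tail h1 (hf _ h1) hj hlam0 hlam hpos
      (t := 5 / 6 * y + 9 / 2 * (ν / lam j)) (by positivity) (by linarith) h3 hν
    refine ⟨h4, h5, h6.trans (mul_le_mul_of_nonneg_right ?_ h5.le)⟩
    have hyy : (1 / 6 : ℝ) ^ (2 ^ (k + 1)) = y ^ 2 := by rw [hy, ← pow_mul, pow_succ]
    rw [hyy]
    set β := ν / lam j
    have h7 : y * β ≤ 1 / 6 * β := by gcongr
    have h8 : β * β ≤ 1 / 40 * β := by gcongr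
    nlinarith

/-- Convergence in the first stage: the gap grows to a constant. -/
lemma iterate_coord_gap (hf : ∀ θ, ‖θ‖ = 1 → ‖f θ - odeco v lam A θ‖ ≤ ν)
    (hj : j ∈ A) (hlam0 : ∀ i, 0 ≤ lam i) (hlam : ∀ i ∈ A, lam i ≤ lam j)
    (hpos : 0 < lam j) (hν : ν * r ≤ 1 / (400 * r) * lam j) (hr : 1 ≤ r) (hθ : ‖θ‖ = 1)
    (hc : 0 < inner ℝ (v j) θ)
    (hρ : ∀ i ≠ j, (1 + 1 / (r : ℝ)) * |inner ℝ (v i) θ| ≤ inner ℝ (v j) θ) (k : ℕ) :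
    ‖(normStep f)^[k] θ‖ = 1 ∧ 0 < inner ℝ (v j) ((normStep f)^[k] θ) ∧
      ∀ i ≠ j, |inner ℝ (v i) ((normStep f)^[k] θ)| ≤
        (1 - min (1 / 4 : ℝ) ((3 / 2) ^ k / (4 * (r : ℝ)))) * inner ℝ (v j) ((normStep f)^[k] θ) := by
  have hr1 : (1 : ℝ) ≤ r := by exact_mod_cast hr
  have hr0 : (0 : ℝ) < r := by linarith
  induction k with
  | zero =>
    refine ⟨hθ, hc, fun i hi => ?_⟩
    simp only [Function.iterate_zero, id, pow_zero]
    have h1 := hρ i hi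
    have h2 : |inner ℝ (v i) θ| ≤ (1 - 1 / (4 * (r : ℝ))) * inner ℝ (v j) θ := by
      have h3 : 1 ≤ (1 - 1 / (4 * (r : ℝ))) * (1 + 1 / r) := by
        have h4 : (1 - 1 / (4 * (r : ℝ))) * (1 + 1 / r) = 1 + (1 / r) * (3 / 4 - 1 / 4 * (1 / r)) := by
          field_simp; ring
        have h5 : 1 / (r : ℝ) ≤ 1 := by rw [div_le_one hr0]; exact hr1
        have h6 : 0 ≤ (1 / (r : ℝ)) * (3 / 4 - 1 / 4 * (1 / r)) :=
          mul_nonneg (by positivity) (by linarith)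
        linarith
      have h7 : 0 ≤ 1 - 1 / (4 * (r : ℝ)) := by
        rw [sub_nonneg, div_le_one (by positivity)]; linarith
      calc |inner ℝ (v i) θ| ≤ ((1 - 1 / (4 * (r : ℝ))) * (1 + 1 / r)) * |inner ℝ (v i) θ| :=
            le_mul_of_one_le_left (abs_nonneg _) h3
        _ = (1 - 1 / (4 * (r : ℝ))) * ((1 + 1 / r) * |inner ℝ (v i) θ|) := by ring
        _ ≤ _ := mul_le_mul_of_nonneg_left h1 h7
    refine h2.trans (mul_le_mul_of_nonneg_right ?_ hc.le)
    linarith [min_le_right (1 / 4 : ℝ) (1 / (4 * (r : ℝ)))]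
  | succ k ih =>
    obtain ⟨h1, h2, h3⟩ := ih
    rw [Function.iterate_succ_apply']
    -- A ratio `1 - g` is squared to `1 - 2g + g² ≤ 1 - 7/4 g` while `g ≤ 1/4`. The noise takes a
    -- small fraction of `g`, so the gap still grows by `3/2` in each step.
    set g : ℝ := min (1 / 4 : ℝ) ((3 / 2) ^ k / (4 * (r : ℝ))) with hg
    have hg4 : g ≤ 1 / 4 := min_le_left _ _
    have hgr : 1 / (4 * (r : ℝ)) ≤ g := by
      refine le_min ?_ ?_
      · rw [div_le_div_iff₀ (by positivity) (by norm_num)]; linarith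
      · have : (1 : ℝ) ≤ (3 / 2) ^ k := one_le_pow₀ (by norm_num)
        gcongr
    have hg' : min (1 / 4 : ℝ) ((3 / 2) ^ (k + 1) / (4 * (r : ℝ))) ≤ 3 / 2 * g := by
      rw [hg, mul_min_of_nonneg _ _ (by norm_num : (0 : ℝ) ≤ 3 / 2)]
      refine min_le_min (by norm_num) (le_of_eq ?_)
      rw [pow_succ]; ring
    have hκ : 1 / (400 * (r : ℝ)) ≤ 1 / 100 * g := by
      have : 1 / (400 * (r : ℝ)) = 1 / 100 * (1 / (4 * (r : ℝ))) := by field_simp; norm_num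
      rw [this]; gcongr
    have hg0 : 0 ≤ g := le_trans (by positivity) hgr
    have hκ0 : 0 ≤ 1 / (400 * (r : ℝ)) := by positivity
    have hm0 : (1 / 4 : ℝ) ≥ min (1 / 4 : ℝ) ((3 / 2) ^ (k + 1) / (4 * (r : ℝ))) := min_le_left _ _
    exact normStep_coord h1 (hf _ h1) hj hlam0 hlam hpos (by linarith) h2 h3 hν
      (by linarith) (by nlinarith) (by linarith)

/-- Convergence in the first stage: the ratios of the coordinates decay. -/
lemma iterate_coord_decay (hf : ∀ θ, ‖θ‖ = 1 → ‖f θ - odeco v lam A θ‖ ≤ ν)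
    (hj : j ∈ A) (hlam0 : ∀ i, 0 ≤ lam i) (hlam : ∀ i ∈ A, lam i ≤ lam j)
    (hpos : 0 < lam j) (hν : ν * r ≤ 1 / (400 * r) * lam j) (hr : 1 ≤ r) (hθ : ‖θ‖ = 1)
    (hc : 0 < inner ℝ (v j) θ)
    (hρ : ∀ i ≠ j, |inner ℝ (v i) θ| ≤ 3 / 4 * inner ℝ (v j) θ) (k : ℕ) :
    ‖(normStep f)^[k] θ‖ = 1 ∧ 0 < inner ℝ (v j) ((normStep f)^[k] θ) ∧
      ∀ i ≠ j, |inner ℝ (v i) ((normStep f)^[k] θ)| ≤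
        max (3 / 4 * (4 / 5) ^ k) (1 / (8 * (r : ℝ))) * inner ℝ (v j) ((normStep f)^[k] θ) := by
  have hr1 : (1 : ℝ) ≤ r := by exact_mod_cast hr
  have hr0 : (0 : ℝ) < r := by linarith
  induction k with
  | zero =>
    refine ⟨hθ, hc, fun i hi => (hρ i hi).trans ?_⟩
    simp only [Function.iterate_zero, id, pow_zero, mul_one]
    exact mul_le_mul_of_nonneg_right (le_max_left _ _) hc.le
  | succ k ih =>
    obtain ⟨h1, h2, h3⟩ := ih
    rw [Function.iterate_succ_apply']
    -- For ratios up to `3/4` squaring gains at least a factor `3/4`, and `4/5` leaves room for the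
    -- noise. The floor `1/(8r)` keeps the noise, of relative size `1/(400r)`, below a fixed
    -- fraction of `y`.
    set y : ℝ := max (3 / 4 * (4 / 5) ^ k) (1 / (8 * (r : ℝ))) with hy
    have hy1 : y ≤ 3 / 4 := by
      refine max_le ?_ ?_
      · have : (4 / 5 : ℝ) ^ k ≤ 1 := pow_le_one₀ (by norm_num) (by norm_num)
        linarith
      · rw [div_le_div_iff₀ (by positivity) (by norm_num)]; linarith
    have hyr : 1 / (8 * (r : ℝ)) ≤ y := le_max_right _ _
    have hy' : 4 / 5 * y ≤ max (3 / 4 * (4 / 5) ^ (k + 1)) (1 / (8 * (r : ℝ))) := by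
      rw [hy, mul_max_of_nonneg _ _ (by norm_num : (0 : ℝ) ≤ 4 / 5)]
      refine max_le_max (le_of_eq (by rw [pow_succ]; ring)) ?_
      have : 0 ≤ 1 / (8 * (r : ℝ)) := by positivity
      linarith
    have hκ : 1 / (400 * (r : ℝ)) ≤ 1 / 50 * y := by
      have : 1 / (400 * (r : ℝ)) = 1 / 50 * (1 / (8 * (r : ℝ))) := by field_simp; norm_num
      rw [this]; gcongr
    have hκ0 : 0 ≤ 1 / (400 * (r : ℝ)) := by positivity
    have hy0 : 0 ≤ y := le_trans (by positivity) hyr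
    obtain ⟨h4, h5, h6⟩ := normStep_coord (ρ' := 4 / 5 * y) h1 (hf _ h1) hj hlam0 hlam hpos
      (by linarith) h2 h3 hν (by linarith) (by nlinarith) (by positivity)
    exact ⟨h4, h5, fun i hi => (h6 i hi).trans (mul_le_mul_of_nonneg_right hy' h5.le)⟩

/-- The first run of the power method, from a good starting point. -/
lemma iterate_good_start (hf : ∀ θ, ‖θ‖ = 1 → ‖f θ - odeco v lam A θ‖ ≤ ν)
    (hj : j ∈ A) (hlam0 : ∀ i, 0 ≤ lam i) (hlam : ∀ i ∈ A, lam i ≤ lam j)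
    (hpos : 0 < lam j) (hν : ν * r ≤ 1 / (400 * r) * lam j) (hr : 1 ≤ r) (hθ : ‖θ‖ = 1)
    (hc : 0 < inner ℝ (v j) θ)
    (hρ : ∀ i ≠ j, (1 + 1 / (r : ℝ)) * |inner ℝ (v i) θ| ≤ inner ℝ (v j) θ) {k₁ k₂ k₃ : ℕ}
    (hk₁ : (r : ℝ) ≤ (3 / 2) ^ k₁) (hk₂ : 6 * (r : ℝ) * (4 / 5) ^ k₂ ≤ 1) :
    ‖(normStep f)^[k₁ + k₂ + k₃] θ‖ = 1 ∧ 0 < inner ℝ (v j) ((normStep f)^[k₁ + k₂ + k₃] θ) ∧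
      ‖tail v j ((normStep f)^[k₁ + k₂ + k₃] θ)‖ ≤
        (5 / 6 * (1 / 6) ^ (2 ^ k₃) + 9 / 2 * (ν / lam j)) *
          inner ℝ (v j) ((normStep f)^[k₁ + k₂ + k₃] θ) := by
  have hr1 : (1 : ℝ) ≤ r := by exact_mod_cast hr
  have hr0 : (0 : ℝ) < r := by linarith
  obtain ⟨h1, h2, h3⟩ := iterate_coord_gap hf hj hlam0 hlam hpos hν hr hθ hc hρ k₁
  have hmin : min (1 / 4 : ℝ) ((3 / 2) ^ k₁ / (4 * (r : ℝ))) = 1 / 4 := by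
    rw [min_eq_left]
    rw [div_le_div_iff₀ (by norm_num) (by positivity)]
    linarith
  rw [hmin] at h3
  obtain ⟨h4, h5, h6⟩ := iterate_coord_decay hf hj hlam0 hlam hpos hν hr h1 h2
    (fun i hi => (h3 i hi).trans_eq (by norm_num)) k₂
  rw [← Function.iterate_add_apply, add_comm k₂ k₁] at h4 h5 h6
  have hmax : max (3 / 4 * (4 / 5) ^ k₂) (1 / (8 * (r : ℝ))) = 1 / (8 * (r : ℝ)) := by
    rw [max_eq_right]
    rw [le_div_iff₀ (by positivity)]
    linarith
  rw [hmax] at h6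
  set ω := (normStep f)^[k₁ + k₂] θ with hω
  -- At most `r` coordinates, each with ratio `1/(8r)`, give `‖tail‖² ≤ c² / (64 r)`. Only now is
  -- the tail as a whole small enough for the quadratic stage; at the start it may exceed the
  -- leading coordinate.
  have htail : ‖tail v j ω‖ ≤ 5 / 36 * inner ℝ (v j) ω := by
    refine le_of_sq_le_sq ?_ (by positivity)
    have h7 : ‖tail v j ω‖ ^ 2 ≤ r * (1 / (8 * (r : ℝ)) * inner ℝ (v j) ω) ^ 2 := by
      rw [← sum_inner_sq v]
      have : ∀ i ∈ Finset.univ, inner ℝ (v i) (tail v j ω) ^ 2 ≤ (1 / (8 * (r : ℝ)) * inner ℝ (v j) ω) ^ 2 := by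
        intro i _
        rw [inner_tail]
        split_ifs with h
        · rw [zero_pow two_ne_zero]; positivity
        · rw [← sq_abs]
          exact pow_le_pow_left₀ (abs_nonneg _) (h6 i h) 2
      simpa using Finset.sum_le_card_nsmul _ _ _ this
    refine h7.trans ?_
    have h8 : r * (1 / (8 * (r : ℝ)) * inner ℝ (v j) ω) ^ 2 = 1 / (64 * r) * inner ℝ (v j) ω ^ 2 := by
      field_simp; norm_num
    rw [h8, mul_pow]
    refine mul_le_mul_of_nonneg_right ?_ (sq_nonneg _)
    rw [div_le_iff₀ (by positivity)]
    nlinarith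
  have hν' : ν ≤ lam j / 40 := by
    have hν0 : 0 ≤ ν := (norm_nonneg _).trans (hf θ hθ)
    have h7 : 1 / (400 * (r : ℝ)) ≤ 1 / 40 := by
      rw [div_le_div_iff₀ (by positivity) (by norm_num)]; linarith
    have h8 : ν ≤ ν * r := le_mul_of_one_le_right hν0 hr1
    have h9 : 1 / (400 * (r : ℝ)) * lam j ≤ 1 / 40 * lam j := by gcongr
    linarith
  have h7 := iterate_tail hf hj hlam0 (fun i hi => (hlam i hi).trans (by linarith)) hpos hν' h4 h5
    htail k₃
  rw [hω, ← Function.iterate_add_apply, add_comm k₃] at h7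
  exact h7

end PowerIteration

/-! ### Selection of an end point, refinement and deflation. -/

section PowerMethod

variable {r L N : ℕ}

lemma inner_eq_sum (x y : EuclideanSpace ℝ (Fin r)) : inner ℝ x y = ∑ a, x a * y a := by
  rw [PiLp.inner_apply]
  exact Finset.sum_congr rfl fun a _ => by simp [mul_comm]

lemma cubic_eq_inner (G : Tensor3 (Fin r)) (θ : EuclideanSpace ℝ (Fin r)) :
    cubic G θ = inner ℝ θ (contract G θ) := by
  rw [inner_eq_sum, cubic]
  refine Finset.sum_congr rfl fun a _ => ?_
  simp only [contract, Finset.mul_sum]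
  exact Finset.sum_congr rfl fun b _ => Finset.sum_congr rfl fun c _ => by ring

lemma contract_sub (G H : Tensor3 (Fin r)) (θ : EuclideanSpace ℝ (Fin r)) :
    contract (G - H) θ = contract G θ - contract H θ := by
  ext a
  simp only [contract, PiLp.sub_apply, Pi.sub_apply, sub_mul, Finset.sum_sub_distrib]

lemma norm_contract_le (E : Tensor3 (Fin r)) {θ : EuclideanSpace ℝ (Fin r)} (hθ : ‖θ‖ = 1) :
    ‖contract E θ‖ ≤ tnorm E := by
  refine le_of_sq_le_sq ?_ (tnorm_nonneg _)
  have h1 : ∑ b, θ b ^ 2 = 1 := by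
    rw [← one_pow 2, ← hθ, EuclideanSpace.norm_sq_eq]; simp
  rw [tnorm_sq_eq_tensorFrobSq, EuclideanSpace.norm_sq_eq, tensorFrobSq]
  refine Finset.sum_le_sum fun a _ => ?_
  simp only [contract, Real.norm_eq_abs, sq_abs]
  calc (∑ b, ∑ c, E a b c * θ b * θ c) ^ 2 = (∑ b, (∑ c, E a b c * θ c) * θ b) ^ 2 := by
        congr 1
        refine Finset.sum_congr rfl fun b _ => ?_
        rw [Finset.sum_mul]
        exact Finset.sum_congr rfl fun c _ => by ring
    _ ≤ (∑ b, (∑ c, E a b c * θ c) ^ 2) * ∑ b, θ b ^ 2 := Finset.sum_mul_sq_le_sq_mul_sq _ _ _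
    _ ≤ ∑ b, ∑ c, E a b c ^ 2 := by
        rw [h1, mul_one]
        refine Finset.sum_le_sum fun b _ => ?_
        refine (Finset.sum_mul_sq_le_sq_mul_sq _ _ _).trans ?_
        rw [h1, mul_one]

lemma contract_deflate (G : Tensor3 (Fin r)) (v : Fin r → EuclideanSpace ℝ (Fin r))
    (lam : Fin r → ℝ) (q : Fin r) (θ : EuclideanSpace ℝ (Fin r)) :
    contract (deflate G v lam q) θ =
      contract G θ - ∑ p ∈ Finset.Iio q, (lam p * inner ℝ (v p) θ ^ 2) • v p := by
  ext a
  simp only [contract, deflate, PiLp.sub_apply, WithLp.ofLp_sum, Finset.sum_apply, PiLp.smul_apply,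
    smul_eq_mul, sub_mul, Finset.sum_sub_distrib]
  congr 1
  simp only [Finset.sum_mul]
  rw [Finset.sum_congr rfl fun b _ => Finset.sum_comm, Finset.sum_comm]
  refine Finset.sum_congr rfl fun p _ => ?_
  rw [inner_eq_sum, sq, Finset.sum_mul_sum, Finset.mul_sum, Finset.sum_mul]
  refine Finset.sum_congr rfl fun b _ => ?_
  rw [Finset.mul_sum, Finset.sum_mul]
  exact Finset.sum_congr rfl fun c _ => by ring

lemma deflate_congr {G : Tensor3 (Fin r)} {v v' : Fin r → EuclideanSpace ℝ (Fin r)}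
    {lam lam' : Fin r → ℝ} {q : Fin r} (h : ∀ p < q, v p = v' p ∧ lam p = lam' p) :
    deflate G v lam q = deflate G v' lam' q := by
  funext a b c
  simp only [deflate]
  congr 1
  refine Finset.sum_congr rfl fun p hp => ?_
  obtain ⟨h1, h2⟩ := h p (Finset.mem_Iio.mp hp)
  rw [h1, h2]

lemma exists_isPowerMethodPair (N : ℕ) (hL : 1 ≤ L) (G : Tensor3 (Fin r))
    (θ : Fin L → EuclideanSpace ℝ (Fin r)) : ∃ v lam, IsPowerMethodPair N G θ v lam := by
  have : Nonempty (Fin L) := ⟨⟨0, hL⟩⟩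
  obtain ⟨τ, hτ⟩ := Finite.exists_max fun τ => cubic G ((powerStep G)^[N] (θ τ))
  exact ⟨_, _, τ, hτ, rfl, rfl⟩

lemma exists_isPowerDecomposition (N : ℕ) (hL : 1 ≤ L) (G : Tensor3 (Fin r))
    (θ : Fin r → Fin L → EuclideanSpace ℝ (Fin r)) : ∃ v lam, IsPowerDecomposition N G θ v lam := by
  have h : ∀ k ≤ r, ∃ v lam, ∀ q : Fin r, q.val < k →
      IsPowerMethodPair N (deflate G v lam q) (θ q) (v q) (lam q) := by
    intro k
    induction k with
    | zero => exact fun _ => ⟨0, 0, fun q hq => absurd hq (Nat.not_lt_zero _)⟩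
    | succ k ih =>
      intro hk
      obtain ⟨v, lam, h⟩ := ih (by omega)
      set q₀ : Fin r := ⟨k, hk⟩
      obtain ⟨v₀, lam₀, h₀⟩ := exists_isPowerMethodPair N hL (deflate G v lam q₀) (θ q₀)
      refine ⟨Function.update v q₀ v₀, Function.update lam q₀ lam₀, fun q hq => ?_⟩
      have hd : deflate G (Function.update v q₀ v₀) (Function.update lam q₀ lam₀) q =
          deflate G v lam q := by
        refine deflate_congr fun p hp => ?_
        have hne : p ≠ q₀ := by
          intro hp'
          have : p.val < q.val := hp
          rw [hp'] at this
          simp only [q₀] at this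
          omega
        exact ⟨Function.update_of_ne hne _ _, Function.update_of_ne hne _ _⟩
      rw [hd]
      by_cases hq' : q = q₀
      · rw [hq', Function.update_self, Function.update_self]; exact h₀
      · rw [Function.update_of_ne hq', Function.update_of_ne hq']
        refine h q ?_
        have : q.val ≠ k := fun h' => hq' (Fin.ext h')
        omega
  obtain ⟨v, lam, h⟩ := h r le_rfl
  exact ⟨v, lam, fun q => h q q.isLt⟩

/-- The error that an approximate component leaves after deflation. -/
lemma norm_deflation_term_le {v w θ : EuclideanSpace ℝ (Fin r)} {l l' ε η : ℝ}
    (hw : ‖w‖ = 1) (hθ : ‖θ‖ = 1) (hl : 1 ≤ l) (hvw : l * ‖w - v‖ ≤ 6 * ε) (hll : |l' - l| ≤ 6 * ε)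
    (hη : 6 * ε ≤ η) (hη1 : η ≤ 1) (hin : |inner ℝ v θ| ≤ η) :
    ‖(l * inner ℝ v θ ^ 2) • v - (l' * inner ℝ w θ ^ 2) • w‖ ≤ 48 * ε * η := by
  set a := inner ℝ v θ with ha
  set b := inner ℝ w θ with hb
  set d := ‖w - v‖ with hd
  have hd0 : 0 ≤ d := norm_nonneg _
  have hdε : d ≤ 6 * ε := (le_mul_of_one_le_left hd0 hl).trans hvw
  have hba : |b - a| ≤ d := by
    rw [ha, hb, ← inner_sub_left]
    refine (abs_real_inner_le_norm _ _).trans ?_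
    rw [hθ, mul_one]
  have hη0 : 0 ≤ η := (abs_nonneg _).trans hin
  have hb2 : |b| ≤ 2 * η := by
    have : |b| ≤ |a| + |b - a| := by
      have := abs_add_le a (b - a); rwa [add_sub_cancel] at this
    linarith
  -- Errors of direction, of the coordinate and of the eigenvalue contribute `6 + 18 + 24 = 48`
  -- times `ε η`. Each contains a factor `η`, the bound for the coordinate of `θ` along `v`, so a
  -- deflated component does little harm away from itself.
  have key : (l * a ^ 2) • v - (l' * b ^ 2) • w =
      (l * a ^ 2) • (v - w) + (l * ((a - b) * (a + b)) + (l - l') * b ^ 2) • w := by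
    have : (l * ((a - b) * (a + b)) + (l - l') * b ^ 2) = l * a ^ 2 - l' * b ^ 2 := by ring
    rw [this, sub_smul, smul_sub]; abel
  rw [key]
  refine (norm_add_le _ _).trans ?_
  rw [norm_smul, norm_smul, hw, mul_one, Real.norm_eq_abs, Real.norm_eq_abs, norm_sub_rev, ← hd]
  have e1 : |l * a ^ 2| * d ≤ 6 * ε * η := by
    rw [abs_mul, abs_of_nonneg (by linarith : 0 ≤ l), abs_of_nonneg (sq_nonneg a), ← sq_abs]
    have h2 : |a| ^ 2 ≤ η := by
      calc |a| ^ 2 = |a| * |a| := sq _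
        _ ≤ η * 1 := mul_le_mul hin (hin.trans hη1) (abs_nonneg _) hη0
        _ = η := mul_one _
    calc l * |a| ^ 2 * d = l * d * |a| ^ 2 := by ring
      _ ≤ 6 * ε * η := mul_le_mul hvw h2 (sq_nonneg _) (by linarith)
  have e2 : |l * ((a - b) * (a + b))| ≤ 18 * ε * η := by
    rw [abs_mul, abs_mul, abs_of_nonneg (by linarith : 0 ≤ l), abs_sub_comm a b]
    have h3 : |a + b| ≤ 3 * η := (abs_add_le a b).trans (by linarith)
    calc l * (|b - a| * |a + b|) = l * |b - a| * |a + b| := by ring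
      _ ≤ 6 * ε * (3 * η) := by
          refine mul_le_mul ?_ h3 (abs_nonneg _) (by linarith)
          exact (mul_le_mul_of_nonneg_left hba (by linarith)).trans hvw
      _ = 18 * ε * η := by ring
  have e3 : |(l - l') * b ^ 2| ≤ 24 * ε * η := by
    rw [abs_mul, abs_sub_comm, abs_of_nonneg (sq_nonneg b), ← sq_abs b]
    have h2 : |b| ^ 2 ≤ 4 * η := by
      calc |b| ^ 2 ≤ (2 * η) ^ 2 := pow_le_pow_left₀ (abs_nonneg _) hb2 2
        _ = 4 * (η * η) := by ring
        _ ≤ 4 * (η * 1) := by gcongr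
        _ = 4 * η := by ring
    calc |l' - l| * |b| ^ 2 ≤ 6 * ε * (4 * η) := mul_le_mul hll h2 (sq_nonneg _) (by linarith)
      _ = 24 * ε * η := by ring
  have := abs_add_le (l * ((a - b) * (a + b))) ((l - l') * b ^ 2)
  linarith

variable {v : OrthonormalBasis (Fin r) ℝ (EuclideanSpace ℝ (Fin r))} {lam : Fin r → ℝ}
  {A : Finset (Fin r)} {j : Fin r} {θ : EuclideanSpace ℝ (Fin r)} {ν ε : ℝ}
  {f : EuclideanSpace ℝ (Fin r) → EuclideanSpace ℝ (Fin r)}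

lemma inner_self_odeco :
    inner ℝ θ (odeco v lam A θ) = ∑ i ∈ A, lam i * inner ℝ (v i) θ ^ 3 := by
  rw [odeco, inner_sum, ← Finset.sum_filter_add_sum_filter_not Finset.univ (· ∈ A)]
  rw [Finset.sum_congr rfl (g := fun i => lam i * inner ℝ (v i) θ ^ 3),
    Finset.sum_eq_zero (s := Finset.univ.filter (· ∉ A)), add_zero]
  · exact Finset.sum_congr (by ext; simp) fun _ _ => rfl
  · intro i hi
    rw [if_neg (Finset.mem_filter.mp hi).2, zero_smul, inner_zero_right]
  · intro i hi
    rw [if_pos (Finset.mem_filter.mp hi).2, inner_smul_right, real_inner_comm]; ring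

/-- `v_j` is a critical point of the cubic form on the sphere, so the value deviates from `λ_j` only
quadratically in the tail. -/
lemma abs_inner_self_odeco_sub_le {t : ℝ} (hθ : ‖θ‖ = 1) (hj : j ∈ A) (hlam0 : ∀ i, 0 ≤ lam i)
    (hlam : ∀ i ∈ A, lam i ≤ 11 / 10 * lam j) (hc : 0 < inner ℝ (v j) θ)
    (ht : ‖tail v j θ‖ ≤ t) : |inner ℝ θ (odeco v lam A θ) - lam j| ≤ 4 * lam j * t ^ 2 := by
  set c := inner ℝ (v j) θ with hcd
  have hlj := hlam0 j
  have hts : ‖tail v j θ‖ ^ 2 = 1 - c ^ 2 := by rw [norm_tail_sq, hθ, one_pow]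
  have ht2 : 1 - c ^ 2 ≤ t ^ 2 := by rw [← hts]; exact pow_le_pow_left₀ (norm_nonneg _) ht 2
  have hc1 : c ≤ 1 := by
    have : c ^ 2 ≤ 1 := by nlinarith [sq_nonneg ‖tail v j θ‖]
    nlinarith
  rw [inner_self_odeco, ← Finset.add_sum_erase _ _ hj]
  have h1 : |∑ i ∈ A.erase j, lam i * inner ℝ (v i) θ ^ 3| ≤ 11 / 10 * lam j * (1 - c ^ 2) := by
    calc |∑ i ∈ A.erase j, lam i * inner ℝ (v i) θ ^ 3|
        ≤ ∑ i ∈ A.erase j, |lam i * inner ℝ (v i) θ ^ 3| := Finset.abs_sum_le_sum_abs _ _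
      _ ≤ ∑ i ∈ A.erase j, 11 / 10 * lam j * inner ℝ (v i) (tail v j θ) ^ 2 := by
          refine Finset.sum_le_sum fun i hi => ?_
          rw [inner_tail, if_neg (Finset.ne_of_mem_erase hi), abs_mul, abs_of_nonneg (hlam0 i)]
          refine mul_le_mul (hlam i (Finset.mem_of_mem_erase hi)) ?_ (abs_nonneg _) (by positivity)
          have h2 : |inner ℝ (v i) θ| ≤ 1 := by
            refine (abs_real_inner_le_norm _ _).trans ?_
            rw [v.norm_eq_one, hθ, one_mul]
          rw [pow_succ, abs_mul, abs_of_nonneg (sq_nonneg _)]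
          exact mul_le_of_le_one_right (sq_nonneg _) h2
      _ ≤ ∑ i, 11 / 10 * lam j * inner ℝ (v i) (tail v j θ) ^ 2 :=
          Finset.sum_le_sum_of_subset_of_nonneg (Finset.subset_univ _)
            fun i _ _ => by positivity
      _ = 11 / 10 * lam j * (1 - c ^ 2) := by rw [← Finset.mul_sum, sum_inner_sq, hts]
  have h2 : |lam j * c ^ 3 - lam j| ≤ lam j * (2 * (1 - c ^ 2)) := by
    rw [abs_sub_comm, abs_of_nonneg]
    · have h3 := mul_nonneg hc.le (sub_nonneg.mpr hc1)
      have h4 := mul_nonneg (sq_nonneg c) (sub_nonneg.mpr hc1)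
      have : 1 - c ^ 3 ≤ 2 * (1 - c ^ 2) := by nlinarith
      nlinarith
    · have : c ^ 3 ≤ 1 := pow_le_one₀ hc.le hc1
      nlinarith
  calc |lam j * c ^ 3 + ∑ i ∈ A.erase j, lam i * inner ℝ (v i) θ ^ 3 - lam j|
      = |(lam j * c ^ 3 - lam j) + ∑ i ∈ A.erase j, lam i * inner ℝ (v i) θ ^ 3| := by
        congr 1; ring
    _ ≤ lam j * (2 * (1 - c ^ 2)) + 11 / 10 * lam j * (1 - c ^ 2) :=
        (abs_add_le _ _).trans (add_le_add h2 h1)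
    _ = 31 / 10 * lam j * (1 - c ^ 2) := by ring
    _ ≤ 4 * lam j * (1 - c ^ 2) := by
        have : 0 ≤ 1 - c ^ 2 := by rw [← hts]; positivity
        gcongr; norm_num
    _ ≤ 4 * lam j * t ^ 2 := by gcongr

lemma norm_iterate_normStep (hθ : ‖θ‖ = 1) (k : ℕ) :
    ‖(normStep f)^[k] θ‖ = 1 ∨ (normStep f)^[k] θ = 0 := by
  cases k with
  | zero => exact Or.inl hθ
  | succ k =>
    rw [Function.iterate_succ_apply', normStep]
    by_cases h : f ((normStep f)^[k] θ) = 0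
    · right; rw [h, smul_zero]
    · left; rw [norm_smul, norm_inv, norm_norm, inv_mul_cancel₀ (norm_ne_zero_iff.mpr h)]

lemma abs_inner_sub_inner_odeco_le (hθ : ‖θ‖ = 1) (hf : ‖f θ - odeco v lam A θ‖ ≤ ν) :
    |inner ℝ θ (f θ) - inner ℝ θ (odeco v lam A θ)| ≤ ν := by
  rw [← inner_sub_right]
  refine (abs_real_inner_le_norm _ _).trans ?_
  rw [hθ, one_mul]
  exact hf

/-- An end point of large value is close to a component. -/
lemma exists_component_of_large_value (hθ : ‖θ‖ = 1) (hf : ‖f θ - odeco v lam A θ‖ ≤ ν) {l : ℝ}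
    (hlam1 : ∀ i, 1 ≤ lam i) (hlam : ∀ i ∈ A, lam i ≤ l) (hν : ν ≤ l / 1000)
    (hval : 999 / 1000 * l ≤ inner ℝ θ (f θ)) (hl : 0 < l) :
    ∃ i ∈ A, l ≤ 11 / 10 * lam i ∧ 0 < inner ℝ (v i) θ ∧
      ‖tail v i θ‖ ≤ 5 / 36 * inner ℝ (v i) θ := by
  have h1 := (abs_le.mp (abs_inner_sub_inner_odeco_le hθ hf)).2
  rw [inner_self_odeco] at h1
  -- The value `∑ λ_i c_i³` averages the numbers `λ_i c_i` with weights `c_i²` of total at most `1`,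
  -- so one of these numbers is nearly `l`. Then both `λ_i` is nearly `l` and `c_i` is nearly `1`.
  have hex : ∃ i ∈ A, 997 / 1000 * l ≤ lam i * inner ℝ (v i) θ := by
    by_contra! hcon
    have h2 : ∑ i ∈ A, lam i * inner ℝ (v i) θ ^ 3 ≤ 997 / 1000 * l := by
      calc ∑ i ∈ A, lam i * inner ℝ (v i) θ ^ 3
          ≤ ∑ i ∈ A, 997 / 1000 * l * inner ℝ (v i) θ ^ 2 := by
            refine Finset.sum_le_sum fun i hi => ?_
            have := mul_le_mul_of_nonneg_right (hcon i hi).le (sq_nonneg (inner ℝ (v i) θ))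
            linarith [this]
        _ ≤ ∑ i, 997 / 1000 * l * inner ℝ (v i) θ ^ 2 :=
            Finset.sum_le_sum_of_subset_of_nonneg (Finset.subset_univ _)
              fun i _ _ => by positivity
        _ = 997 / 1000 * l := by rw [← Finset.mul_sum, sum_inner_sq, hθ, one_pow, mul_one]
    linarith
  obtain ⟨i, hi, h3⟩ := hex
  set c := inner ℝ (v i) θ with hc
  have hli := hlam i hi
  have hli1 := hlam1 i
  have hc0 : 0 < c := by
    by_contra! h
    have := mul_nonpos_of_nonneg_of_nonpos (by linarith : 0 ≤ lam i) h
    linarith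
  have hc1 : 997 / 1000 ≤ c := by
    have : lam i * c ≤ l * c := by gcongr
    by_contra! h
    have : l * c < l * (997 / 1000) := by gcongr
    linarith
  have hts : ‖tail v i θ‖ ^ 2 = 1 - c ^ 2 := by rw [norm_tail_sq, hθ, one_pow]
  have hc2 : c ≤ 1 := by
    have : c ^ 2 ≤ 1 := by nlinarith [sq_nonneg ‖tail v i θ‖]
    nlinarith
  refine ⟨i, hi, ?_, hc0, ?_⟩
  · have : lam i * c ≤ lam i * 1 := by gcongr
    linarith
  · refine le_of_sq_le_sq ?_ (by positivity)
    rw [hts]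
    nlinarith

/-- The selected end point is close to a component. -/
lemma selection_error (hf : ∀ θ, ‖θ‖ = 1 → ‖f θ - odeco v lam A θ‖ ≤ 49 * r * ε)
    (hA : A.Nonempty) (hlam1 : ∀ i, 1 ≤ lam i) (hr : 1 ≤ r) (hε0 : 0 < ε)
    (hε : ε * (100000 * r ^ 3) ≤ 1) {θ : Fin L → EuclideanSpace ℝ (Fin r)} (hθ : ∀ τ, ‖θ τ‖ = 1)
    (hstart : ∀ i, ∃ τ, 0 < inner ℝ (v i) (θ τ) ∧
      ∀ k ≠ i, (1 + 1 / (r : ℝ)) * |inner ℝ (v k) (θ τ)| ≤ inner ℝ (v i) (θ τ))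
    {k₁ k₂ k₃ : ℕ} (hk₁ : (r : ℝ) ≤ (3 / 2) ^ k₁) (hk₂ : 6 * (r : ℝ) * (4 / 5) ^ k₂ ≤ 1)
    (hk₃ : ∀ i, (1 / 6) ^ (2 ^ k₃) * lam i ≤ ε) (hN : N = k₁ + k₂ + k₃ + 1) {τ : Fin L}
    (hmax : ∀ τ', inner ℝ ((normStep f)^[N] (θ τ')) (f ((normStep f)^[N] (θ τ'))) ≤
      inner ℝ ((normStep f)^[N] (θ τ)) (f ((normStep f)^[N] (θ τ)))) :
    ‖(normStep f)^[N] (θ τ)‖ = 1 ∧ ∃ i ∈ A, (∀ k ∈ A, lam k ≤ 11 / 10 * lam i) ∧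
      0 < inner ℝ (v i) ((normStep f)^[N] (θ τ)) ∧
      ‖tail v i ((normStep f)^[N] (θ τ))‖ ≤ 5 / 36 * inner ℝ (v i) ((normStep f)^[N] (θ τ)) := by
  have hr1 : (1 : ℝ) ≤ r := by exact_mod_cast hr
  have hr0 : (0 : ℝ) < r := by linarith
  have hlam0 : ∀ i, 0 ≤ lam i := fun i => by linarith [hlam1 i]
  have hrr2 : (1 : ℝ) ≤ r ^ 2 := one_le_pow₀ hr1
  have hrr3 : (r : ℝ) ^ 2 ≤ r ^ 3 := pow_le_pow_right₀ hr1 (by norm_num)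
  have hε2 : ε * (100000 * r ^ 2) ≤ 1 := le_trans (by gcongr) hε
  have hε1 : ε * 100000 ≤ 1 := by nlinarith
  have hrle2 : (r : ℝ) ≤ r ^ 2 := by nlinarith
  have hεr : r * ε * 100000 ≤ 1 := by
    have : ε * (100000 * r) ≤ ε * (100000 * r ^ 2) := by gcongr
    linarith
  -- A good starting point for the largest remaining eigenvalue reaches a value of nearly `λ_j`, and
  -- the selected end point does at least as well. It may belong to another component `i`, whose
  -- eigenvalue is then nearly as large; hence the tolerance `11/10`.
  obtain ⟨j, hj, hjmax⟩ := A.exists_max_image lam hA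
  have hlj := hlam1 j
  obtain ⟨τ₀, hs1, hs2⟩ := hstart j
  have hgood := iterate_good_start (k₃ := k₃ + 1) hf hj hlam0 hjmax (by linarith)
    (by
      have : 49 * r * ε * r * (400 * r) ≤ 1 := by nlinarith [pow_pos hr0 3]
      rw [div_mul_eq_mul_div, le_div_iff₀ (by positivity)]
      linarith) hr (hθ τ₀) hs1 hs2 hk₁ hk₂
  rw [← add_assoc, ← hN] at hgood
  set θ₀ := (normStep f)^[N] (θ τ₀) with hθ₀
  obtain ⟨g1, g2, g3⟩ := hgood
  have hy1 : (1 / 6 : ℝ) ^ (2 ^ (k₃ + 1)) ≤ ε := by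
    refine le_trans ?_ ((le_mul_of_one_le_right (by positivity) hlj).trans (hk₃ j))
    exact pow_le_pow_of_le_one (by norm_num) (by norm_num)
      (Nat.pow_le_pow_right (by norm_num) (by omega))
  have hbase : ∀ i, 0 < inner ℝ (v i) θ₀ → inner ℝ (v i) θ₀ ≤ 1 := fun i _ => by
    refine (le_abs_self _).trans ((abs_real_inner_le_norm _ _).trans ?_)
    rw [v.norm_eq_one, g1, one_mul]
  have hdiv : ∀ i, 49 * r * ε / lam i ≤ 49 * r * ε := fun i =>
    div_le_self (by positivity) (hlam1 i)
  have g4 : ‖tail v j θ₀‖ ≤ 1 / 100 := by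
    refine g3.trans ((mul_le_of_le_one_right (by positivity) (hbase j g2)).trans ?_)
    have h2 := hdiv j
    linarith
  have g5 : 999 / 1000 * lam j ≤ inner ℝ θ₀ (f θ₀) := by
    have h1 := (abs_le.mp (abs_inner_self_odeco_sub_le g1 hj hlam0
      (fun i hi => (hjmax i hi).trans (by linarith)) g2 g4)).1
    have h2 := (abs_le.mp (abs_inner_sub_inner_odeco_le g1 (hf _ g1))).1
    linarith
  set θ₁ := (normStep f)^[N] (θ τ) with hθ₁
  have hval := g5.trans (hmax τ₀)
  -- The iteration sends a vector whose image vanishes to `0`, by the convention for the inverse of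
  -- `0`; the positive value excludes this.
  have n1 : ‖θ₁‖ = 1 := by
    rcases norm_iterate_normStep (f := f) (hθ τ) N with h | h
    · exact h
    · rw [← hθ₁] at h
      rw [h, inner_zero_left] at hval
      linarith
  obtain ⟨i, hi, hli, hci, hti⟩ := exists_component_of_large_value n1 (hf _ n1) hlam1 hjmax
    (by linarith) hval (by linarith)
  exact ⟨n1, i, hi, fun k hk => (hjmax k hk).trans hli, hci, hti⟩

/-- The second run of the power method. -/
lemma refinement_error (hf : ∀ θ, ‖θ‖ = 1 → ‖f θ - odeco v lam A θ‖ ≤ 49 * r * ε) {i : Fin r}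
    (hf' : ∀ θ, ‖θ‖ = 1 → ‖tail v i θ‖ ≤ 1 / (48 * r) → ‖f θ - odeco v lam A θ‖ ≤ 2 * ε)
    (hi : i ∈ A) (hlam1 : ∀ i, 1 ≤ lam i) (hlami : ∀ k ∈ A, lam k ≤ 11 / 10 * lam i) (hr : 1 ≤ r)
    (hε0 : 0 < ε) (hε : ε * (100000 * r ^ 3) ≤ 1) (n1 : ‖θ‖ = 1) (hci : 0 < inner ℝ (v i) θ)
    (hti : ‖tail v i θ‖ ≤ 5 / 36 * inner ℝ (v i) θ) {k : ℕ} (hk : (1 / 6) ^ (2 ^ k) * lam i ≤ ε) :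
    ‖(normStep f)^[k + 1] θ‖ = 1 ∧ 0 < inner ℝ (v i) ((normStep f)^[k + 1] θ) ∧
      ‖tail v i ((normStep f)^[k + 1] θ)‖ ≤ 4 * (ε / lam i) := by
  have hr1 : (1 : ℝ) ≤ r := by exact_mod_cast hr
  have hr0 : (0 : ℝ) < r := by linarith
  have hlam0 : ∀ i, 0 ≤ lam i := fun i => by linarith [hlam1 i]
  have hrr2 : (1 : ℝ) ≤ r ^ 2 := one_le_pow₀ hr1
  have hrr3 : (r : ℝ) ^ 2 ≤ r ^ 3 := pow_le_pow_right₀ hr1 (by norm_num)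
  have hε2 : ε * (100000 * r ^ 2) ≤ 1 := le_trans (by gcongr) hε
  have hε1 : ε * 100000 ≤ 1 := by nlinarith
  have hrle2 : (r : ℝ) ≤ r ^ 2 := by nlinarith
  have hεr : r * ε * 100000 ≤ 1 := by
    have : ε * (100000 * r) ≤ ε * (100000 * r ^ 2) := by gcongr
    linarith
  have hli1 := hlam1 i
  obtain ⟨s1, s2, s3⟩ := iterate_tail hf hi hlam0 hlami (by linarith)
    (by linarith) n1 hci hti k
  set θ₂ := (normStep f)^[k] θ with hθ₂
  set β := ε / lam i with hβ
  have hβ0 : 0 < β := by positivity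
  have hβε : β ≤ ε := div_le_self hε0.le hli1
  have hy2 : (1 / 6 : ℝ) ^ (2 ^ (k)) ≤ β := by
    rw [hβ, le_div_iff₀ (by linarith)]; exact hk
  set t : ℝ := 5 / 6 * (1 / 6) ^ (2 ^ (k)) + 9 / 2 * (49 * r * ε / lam i) with ht
  have hβr : β ≤ r * β := le_mul_of_one_le_left hβ0.le hr1
  have ht1 : t ≤ 222 * (r * β) := by
    have : 49 * r * ε / lam i = 49 * (r * β) := by rw [hβ]; ring
    rw [ht, this]
    linarith
  have ht0 : 0 ≤ t := by positivity
  have hrβ : 222 * (r * β) ≤ 1 / (48 * r) := by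
    rw [le_div_iff₀ (by positivity)]
    have : β * r ^ 2 ≤ ε * r ^ 2 := by gcongr
    nlinarith
  have hc2 : inner ℝ (v i) θ₂ ≤ 1 := by
    refine (le_abs_self _).trans ((abs_real_inner_le_norm _ _).trans ?_)
    rw [v.norm_eq_one, s1, one_mul]
  have htail2 : ‖tail v i θ₂‖ ≤ 1 / (48 * r) :=
    s3.trans ((mul_le_of_le_one_right ht0 hc2).trans (ht1.trans hrβ))
  have hhalf : 1 / (48 * (r : ℝ)) ≤ 1 / 2 := by
    rw [div_le_div_iff₀ (by positivity) (by norm_num)]; linarith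
  -- Under the coarse noise `49 r ε` the tail has become `O(r ε / λ_i)`, hence at most `1/(48 r)`.
  -- There the finer noise bound `2ε` is available, and one more step brings the tail to `4 ε /
  -- λ_i`.
  obtain ⟨u1, u2, u3⟩ := normStep_tail (ν := 2 * ε) s1 (hf' _ s1 htail2) hi hlam0 hlami (by linarith) ht0
    (by linarith) s3 (by linarith)
  rw [Function.iterate_succ_apply', ← hθ₂]
  set w := normStep f θ₂ with hw
  have hcw : inner ℝ (v i) w ≤ 1 := by
    refine (le_abs_self _).trans ((abs_real_inner_le_norm _ _).trans ?_)
    rw [v.norm_eq_one, u1, one_mul]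
  refine ⟨u1, u2, ?_⟩
  · refine u3.trans ((mul_le_of_le_one_right (by positivity) hcw).trans ?_)
    have h1 : t ^ 2 ≤ (222 * (r * β)) ^ 2 := pow_le_pow_left₀ ht0 ht1 2
    have h2 : β * (100000 * r ^ 2) ≤ 1 := le_trans (by gcongr) hε2
    have h3 : (222 * (r * β)) ^ 2 = 49284 * (β * r ^ 2) * β := by ring
    have h4 : 49284 * (β * r ^ 2) * β ≤ 49284 / 100000 * β := by
      refine mul_le_mul_of_nonneg_right ?_ hβ0.le
      linarith
    have h5 : 2 * ε / lam i = 2 * β := by rw [hβ]; ring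
    rw [h5]
    linarith

/-- One round of the power method. -/
lemma round_error (hf : ∀ θ, ‖θ‖ = 1 → ‖f θ - odeco v lam A θ‖ ≤ 49 * r * ε)
    (hf' : ∀ j ∈ A, ∀ θ, ‖θ‖ = 1 → ‖tail v j θ‖ ≤ 1 / (48 * r) → ‖f θ - odeco v lam A θ‖ ≤ 2 * ε)
    (hA : A.Nonempty) (hlam1 : ∀ i, 1 ≤ lam i) (hr : 1 ≤ r) (hε0 : 0 < ε)
    (hε : ε * (100000 * r ^ 3) ≤ 1) {θ : Fin L → EuclideanSpace ℝ (Fin r)} (hθ : ∀ τ, ‖θ τ‖ = 1)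
    (hstart : ∀ i, ∃ τ, 0 < inner ℝ (v i) (θ τ) ∧
      ∀ k ≠ i, (1 + 1 / (r : ℝ)) * |inner ℝ (v k) (θ τ)| ≤ inner ℝ (v i) (θ τ))
    {k₁ k₂ k₃ : ℕ} (hk₁ : (r : ℝ) ≤ (3 / 2) ^ k₁) (hk₂ : 6 * (r : ℝ) * (4 / 5) ^ k₂ ≤ 1)
    (hk₃ : ∀ i, (1 / 6) ^ (2 ^ k₃) * lam i ≤ ε) (hN : N = k₁ + k₂ + k₃ + 1) {τ : Fin L}
    (hmax : ∀ τ', inner ℝ ((normStep f)^[N] (θ τ')) (f ((normStep f)^[N] (θ τ'))) ≤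
      inner ℝ ((normStep f)^[N] (θ τ)) (f ((normStep f)^[N] (θ τ))))
    {w : EuclideanSpace ℝ (Fin r)} (hw : w = (normStep f)^[N] ((normStep f)^[N] (θ τ))) :
    ∃ i ∈ A, ‖w‖ = 1 ∧ lam i * ‖w - v i‖ ≤ 6 * ε ∧ |inner ℝ w (f w) - lam i| ≤ 6 * ε := by
  obtain ⟨n1, i, hi, hlami, hci, hti⟩ := selection_error hf hA hlam1 hr hε0 hε hθ hstart hk₁ hk₂ hk₃ hN
    hmax
  have hlam0 : ∀ i, 0 ≤ lam i := fun i => by linarith [hlam1 i]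
  have hli1 := hlam1 i
  -- The second run starts inside the quadratic stage, so all its steps but the last count for that
  -- stage.
  have hk : (1 / 6) ^ (2 ^ (k₁ + k₂ + k₃)) * lam i ≤ ε := by
    refine le_trans (mul_le_mul_of_nonneg_right ?_ (hlam0 i)) (hk₃ i)
    exact pow_le_pow_of_le_one (by norm_num) (by norm_num)
      (Nat.pow_le_pow_right (by norm_num) (by omega))
  obtain ⟨u1, u2, htw⟩ := refinement_error hf (hf' i hi) hi hlam1 hlami hr hε0 hε n1 hci hti hk
  rw [← hN, ← hw] at u1 u2 htw
  set β := ε / lam i with hβ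
  have hβ0 : 0 < β := by positivity
  have hβε : β ≤ ε := div_le_self hε0.le hli1
  have hr1 : (1 : ℝ) ≤ r := by exact_mod_cast hr
  have hr0 : (0 : ℝ) < r := by linarith
  have hε4 : ε * (100000 * r) ≤ 1 := by
    refine le_trans ?_ hε
    have : (r : ℝ) ≤ r ^ 3 := le_self_pow₀ hr1 (by norm_num)
    gcongr
  have hε1 : ε * 100000 ≤ 1 := le_trans (by gcongr; linarith) hε4
  have htw' : ‖tail v i w‖ ≤ 1 / (48 * r) := by
    rw [le_div_iff₀ (by positivity)]
    calc ‖tail v i w‖ * (48 * r) ≤ 4 * ε * (48 * r) := by gcongr; linarith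
      _ ≤ 1 := by linarith
  refine ⟨i, hi, u1, ?_, ?_⟩
  · have h1 : ‖w - v i‖ ^ 2 ≤ (6 * β) ^ 2 := by
      rw [norm_sub_sq_real, u1, v.norm_eq_one, real_inner_comm]
      have h2 := norm_tail_sq (v := v) (j := i) (x := w)
      rw [u1] at h2
      have h3 : ‖tail v i w‖ ^ 2 ≤ (4 * β) ^ 2 := pow_le_pow_left₀ (norm_nonneg _) htw 2
      nlinarith
    have h4 := le_of_sq_le_sq h1 (by positivity)
    calc lam i * ‖w - v i‖ ≤ lam i * (6 * β) := by gcongr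
      _ = 6 * ε := by rw [hβ]; field_simp
  · have h1 := abs_inner_self_odeco_sub_le u1 hi hlam0 hlami u2 htw
    have h2 := abs_inner_sub_inner_odeco_le u1 (hf' i hi _ u1 htw')
    have h3 : 4 * lam i * (4 * β) ^ 2 = 64 * ε * β := by rw [hβ]; field_simp; norm_num
    rw [h3] at h1
    have h4 : 64 * ε * β ≤ 1 * ε := by nlinarith
    calc |inner ℝ w (f w) - lam i| = |(inner ℝ w (f w) - inner ℝ w (odeco v lam A w)) +
          (inner ℝ w (odeco v lam A w) - lam i)| := by congr 1; ring
      _ ≤ 2 * ε + 64 * ε * β := (abs_add_le _ _).trans (add_le_add h2 h1)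
      _ ≤ 6 * ε := by linarith

/-- The power method with deflation recovers all components of a perturbed orthogonally
decomposable tensor, if there are good starting points. -/
theorem powerDecomposition_error {G : Tensor3 (Fin r)}
    (hG : ∀ θ, ‖θ‖ = 1 → ‖contract G θ - odeco v lam Finset.univ θ‖ ≤ ε)
    (hlam1 : ∀ i, 1 ≤ lam i) (hε0 : 0 < ε) (hε : ε * (100000 * r ^ 3) ≤ 1)
    {θ : Fin r → Fin L → EuclideanSpace ℝ (Fin r)} (hθ : ∀ q τ, ‖θ q τ‖ = 1)
    (hstart : ∀ q i, ∃ τ, 0 < inner ℝ (v i) (θ q τ) ∧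
      ∀ k ≠ i, (1 + 1 / (r : ℝ)) * |inner ℝ (v k) (θ q τ)| ≤ inner ℝ (v i) (θ q τ))
    {k₁ k₂ k₃ : ℕ} (hk₁ : (r : ℝ) ≤ (3 / 2) ^ k₁) (hk₂ : 6 * (r : ℝ) * (4 / 5) ^ k₂ ≤ 1)
    (hk₃ : ∀ i, (1 / 6) ^ (2 ^ k₃) * lam i ≤ ε) (hN : N = k₁ + k₂ + k₃ + 1)
    {w : Fin r → EuclideanSpace ℝ (Fin r)} {l : Fin r → ℝ} (h : IsPowerDecomposition N G θ w l) :
    ∃ π : Equiv.Perm (Fin r), ∀ q, ‖w q‖ = 1 ∧ lam (π q) * ‖w q - v (π q)‖ ≤ 6 * ε ∧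
      |l q - lam (π q)| ≤ 6 * ε := by
  -- Induction on the number of rounds; injectivity of the matching on the finished rounds ensures
  -- that some component is left to be found.
  suffices hk : ∀ k ≤ r, ∃ π : Fin r → Fin r,
      (∀ p p' : Fin r, p.val < k → p'.val < k → π p = π p' → p = p') ∧
      ∀ q : Fin r, q.val < k → ‖w q‖ = 1 ∧ lam (π q) * ‖w q - v (π q)‖ ≤ 6 * ε ∧
        |l q - lam (π q)| ≤ 6 * ε by
    obtain ⟨π, h1, h2⟩ := hk r le_rfl
    have hinj : Function.Injective π := fun p p' hp => h1 p p' p.isLt p'.isLt hp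
    exact ⟨Equiv.ofBijective π (Finite.injective_iff_bijective.mp hinj), fun q => h2 q q.isLt⟩
  intro k
  induction k with
  | zero => exact fun _ => ⟨id, fun p _ hp => absurd hp (Nat.not_lt_zero _),
      fun q hq => absurd hq (Nat.not_lt_zero _)⟩
  | succ k ih =>
    intro hk
    obtain ⟨π, hinj, hπ⟩ := ih (by omega)
    have hr : 1 ≤ r := by omega
    have hr1 : (1 : ℝ) ≤ r := by exact_mod_cast hr
    have hr0 : (0 : ℝ) < r := by linarith
    set q₀ : Fin r := ⟨k, hk⟩ with hq₀
    have hlt : ∀ p ∈ Finset.Iio q₀, p.val < k := fun p hp =>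
      (Finset.mem_Iio.mp hp : p < q₀)
    set A : Finset (Fin r) := ((Finset.Iio q₀).image π)ᶜ with hA
    have hinjOn : Set.InjOn π (Finset.Iio q₀ : Finset (Fin r)) := fun p hp p' hp' hpp =>
      hinj p p' (hlt p hp) (hlt p' hp') hpp
    have hAne : A.Nonempty := by
      rw [← Finset.card_pos, hA, Finset.card_compl, Finset.card_image_of_injOn hinjOn]
      simp [hq₀]
      try omega
    have hsum : ∀ x, odeco v lam Finset.univ x = odeco v lam A x +
        ∑ p ∈ Finset.Iio q₀, (lam (π p) * inner ℝ (v (π p)) x ^ 2) • v (π p) := by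
      intro x
      rw [← Finset.sum_image (f := fun i => (lam i * inner ℝ (v i) x ^ 2) • v i) hinjOn]
      simp only [odeco, ite_smul, zero_smul, Finset.sum_ite_mem, Finset.univ_inter]
      rw [hA, add_comm, Finset.sum_add_sum_compl]
    have hdecomp : ∀ x, contract (deflate G w l q₀) x - odeco v lam A x =
        (contract G x - odeco v lam Finset.univ x) + ∑ p ∈ Finset.Iio q₀,
          ((lam (π p) * inner ℝ (v (π p)) x ^ 2) • v (π p) - (l p * inner ℝ (w p) x ^ 2) • w p) := by
      intro x
      rw [contract_deflate, hsum, Finset.sum_sub_distrib]; abel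
    have hrr2 : (1 : ℝ) ≤ r ^ 2 := one_le_pow₀ hr1
    have hrr3 : (r : ℝ) ^ 2 ≤ r ^ 3 := pow_le_pow_right₀ hr1 (by norm_num)
    have hrle : (r : ℝ) ≤ r ^ 3 := by nlinarith
    have hεr : ε * (100000 * r) ≤ 1 := le_trans (by gcongr) hε
    have hcard : ((Finset.Iio q₀).card : ℝ) ≤ r := by
      simp [hq₀]; exact_mod_cast (by omega : k ≤ r)
    -- Used twice: `η = 1` gives noise `49 r ε` everywhere, and `η = 1/(48 r)`, valid near a
    -- component not yet found, gives noise `2ε` independent of the number of deflations.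
    have hterm : ∀ η : ℝ, 6 * ε ≤ η → η ≤ 1 → ∀ x, ‖x‖ = 1 →
        (∀ p ∈ Finset.Iio q₀, |inner ℝ (v (π p)) x| ≤ η) →
        ‖contract (deflate G w l q₀) x - odeco v lam A x‖ ≤ ε + r * (48 * ε * η) := by
      intro η hη hη1 x hx hin
      rw [hdecomp]
      refine (norm_add_le _ _).trans (add_le_add (hG x hx) ((norm_sum_le _ _).trans ?_))
      refine (Finset.sum_le_card_nsmul _ _ (48 * ε * η) fun p hp => ?_).trans ?_
      · obtain ⟨h1, h2, h3⟩ := hπ p (hlt p hp)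
        exact norm_deflation_term_le h1 hx (hlam1 _) h2 h3 hη hη1 (hin p hp)
      · rw [nsmul_eq_mul]
        have : 0 ≤ 48 * ε * η := by
          have : 0 ≤ η := by linarith
          positivity
        gcongr
    obtain ⟨τ, hmax, hw, hl⟩ := h q₀
    have hε1 : ε * 100000 ≤ 1 := by nlinarith
    obtain ⟨i, hi, h1, h2, h3⟩ := round_error (f := contract (deflate G w l q₀))
      (fun x hx => by
        refine (hterm 1 (by linarith) le_rfl x hx fun p _ => ?_).trans ?_
        · refine (abs_real_inner_le_norm _ _).trans ?_
          rw [v.norm_eq_one, hx, one_mul]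
        · nlinarith)
      (fun j hj x hx htail => by
        refine (hterm (1 / (48 * r)) ?_ ?_ x hx fun p hp => ?_).trans ?_
        · rw [le_div_iff₀ (by positivity)]; linarith
        · rw [div_le_one (by positivity)]; linarith
        · refine (abs_inner_le_norm_tail (j := j) ?_).trans htail
          rintro rfl
          rw [hA, Finset.mem_compl] at hj
          exact hj (Finset.mem_image_of_mem _ hp)
        · have : r * (48 * ε * (1 / (48 * (r : ℝ)))) = ε := by field_simp
          rw [this]; linarith)
      hAne hlam1 hr hε0 hε (hθ q₀) (hstart q₀) hk₁ hk₂ hk₃ hN (τ := τ) (w := w q₀)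
      (fun τ' => by
        have := hmax τ'
        rw [cubic_eq_inner, cubic_eq_inner] at this
        exact this) hw
    refine ⟨Function.update π q₀ i, fun p p' hp hp' hpp => ?_, fun q hq => ?_⟩
    · have hAi : ∀ p : Fin r, p.val < k → π p ≠ i := by
        rintro p hp rfl
        rw [hA, Finset.mem_compl] at hi
        exact hi (Finset.mem_image_of_mem _ (Finset.mem_Iio.mpr hp))
      have hne : ∀ p : Fin r, p.val < k + 1 → p ≠ q₀ → p.val < k := fun p hp h' => by
        have : p.val ≠ k := fun h'' => h' (Fin.ext h'')
        omega
      by_cases e : p = q₀ <;> by_cases e' : p' = q₀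
      · rw [e, e']
      · rw [e, Function.update_self, Function.update_of_ne e'] at hpp
        exact absurd hpp.symm (hAi p' (hne p' hp' e'))
      · rw [e', Function.update_self, Function.update_of_ne e] at hpp
        exact absurd hpp (hAi p (hne p hp e))
      · rw [Function.update_of_ne e, Function.update_of_ne e'] at hpp
        exact hinj p p' (hne p hp e) (hne p' hp' e') hpp
    · by_cases e : q = q₀
      · rw [e, Function.update_self]
        refine ⟨h1, h2, ?_⟩
        rw [hl, cubic_eq_inner]
        exact h3
      · rw [Function.update_of_ne e]
        refine hπ q ?_
        have : q.val ≠ k := fun h'' => e (Fin.ext h'')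
        omega

/-- The tensor with orthonormal components given by the columns of an orthogonal matrix. -/
lemma contract_tensorApply_diagonal {O : Matrix (Fin r) (Fin r) ℝ} {D : Tensor3 (Fin r)}
    (hD : ∀ a b c, D a b c = if a = b ∧ b = c then lam a else 0)
    (hv : ∀ q a, v q a = O a q) (θ : EuclideanSpace ℝ (Fin r)) :
    contract (tensorApply D Oᵀ) θ = odeco v lam Finset.univ θ := by
  have hT : ∀ a b c, tensorApply D Oᵀ a b c = ∑ i, lam i * v i a * v i b * v i c := by
    intro a b c
    simp only [tensorApply, hD, Matrix.transpose_apply, hv]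
    refine Finset.sum_congr rfl fun i _ => ?_
    rw [Finset.sum_eq_single i, Finset.sum_eq_single i]
    · simp
    · intro k _ hk; simp [Ne.symm hk]
    · simp
    · intro j _ hj
      exact Finset.sum_eq_zero fun k _ => by simp [Ne.symm hj]
    · simp
  ext a
  simp only [contract, hT, odeco, Finset.mem_univ, if_true, WithLp.ofLp_sum, Finset.sum_apply,
    PiLp.smul_apply, smul_eq_mul, Finset.sum_mul]
  rw [Finset.sum_congr rfl fun b _ => Finset.sum_comm, Finset.sum_comm]
  refine Finset.sum_congr rfl fun p _ => ?_
  rw [inner_eq_sum, sq, Finset.sum_mul_sum, Finset.mul_sum, Finset.sum_mul]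
  refine Finset.sum_congr rfl fun b _ => ?_
  rw [Finset.mul_sum, Finset.sum_mul]
  exact Finset.sum_congr rfl fun c _ => by ring

end PowerMethod

/-! ### Random starting points hit every cone. -/

section StartingPoints

open Metric
open scoped Pointwise

variable {r : ℕ}

/-- The vectors whose coordinate `i` in the basis `v` exceeds all others by the factor `g`. -/
def cone (v : OrthonormalBasis (Fin r) ℝ (EuclideanSpace ℝ (Fin r))) (i : Fin r) (g : ℝ) :
    Set (EuclideanSpace ℝ (Fin r)) :=
  {x | 0 < inner ℝ (v i) x ∧ ∀ k ≠ i, g * |inner ℝ (v k) x| ≤ inner ℝ (v i) x}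

variable (v : OrthonormalBasis (Fin r) ℝ (EuclideanSpace ℝ (Fin r))) (i : Fin r)

lemma measurableSet_cone (g : ℝ) : MeasurableSet (cone v i g) := by
  have h : cone v i g = {x | 0 < inner ℝ (v i) x} ∩
      ⋂ k, ⋂ _ : k ≠ i, {x | g * |inner ℝ (v k) x| ≤ inner ℝ (v i) x} := by
    ext x; simp [cone]
  rw [h]
  refine (measurableSet_lt measurable_const (by fun_prop)).inter
    (MeasurableSet.iInter fun k => MeasurableSet.iInter fun _ => measurableSet_le ?_ (by fun_prop))
  exact (Continuous.measurable (by fun_prop))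

/-- The isometry that swaps `v i` and `v j` exchanges the cones. -/
lemma volume_cone_le (j : Fin r) (g : ℝ) :
    volume (cone v j g ∩ ball 0 1) ≤ volume (cone v i g ∩ ball 0 1) := by
  set e := v.equiv v (Equiv.swap i j)
  have he : ∀ k x, inner ℝ (v k) (e x) = inner ℝ (v (Equiv.swap i j k)) x := by
    intro k x
    have : v k = e (v (Equiv.swap i j k)) := by simp [e]
    rw [this, e.inner_map_map]
  rw [← e.measurePreserving.measure_preimage
    ((measurableSet_cone v j g).inter measurableSet_ball).nullMeasurableSet]
  refine measure_mono fun x hx => ?_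
  obtain ⟨⟨h1, h2⟩, h3⟩ := hx
  refine ⟨⟨?_, fun k hk => ?_⟩, ?_⟩
  · rwa [he, Equiv.swap_apply_right] at h1
  · have hk' : Equiv.swap i j k ≠ j := by
      intro h
      exact hk ((Equiv.swap i j).injective (by rw [h, Equiv.swap_apply_left]))
    have := h2 _ hk'
    rwa [he, he, Equiv.swap_apply_self, Equiv.swap_apply_right] at this
  · simpa using h3

/-- Every nonzero vector, up to sign, lies in the cone of a coordinate of largest modulus, so `2r`
congruent copies cover the ball. -/
lemma volume_ball_le_cone :
    volume (ball (0 : EuclideanSpace ℝ (Fin r)) 1) ≤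
      2 * r * volume (cone v i 1 ∩ ball 0 1) := by
  have : Nonempty (Fin r) := ⟨i⟩
  have hsub : ball (0 : EuclideanSpace ℝ (Fin r)) 1 ⊆ {0} ∪ ⋃ j, ((cone v j 1 ∩ ball 0 1) ∪
      -(cone v j 1 ∩ ball 0 1)) := by
    intro x hx
    by_cases hx0 : x = 0
    · exact Or.inl hx0
    right
    obtain ⟨j, hj⟩ := Finite.exists_max fun k => |inner ℝ (v k) x|
    have hjne : inner ℝ (v j) x ≠ 0 := by
      intro h0
      refine hx0 (norm_eq_zero.mp (pow_eq_zero_iff two_ne_zero |>.mp ?_))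
      rw [← sum_inner_sq v]
      refine Finset.sum_eq_zero fun k _ => ?_
      have := hj k
      rw [h0, abs_zero] at this
      rw [abs_nonpos_iff.mp this, zero_pow two_ne_zero]
    refine Set.mem_iUnion.mpr ⟨j, ?_⟩
    rcases lt_or_gt_of_ne hjne with h | h
    · right
      refine ⟨⟨?_, fun k _ => ?_⟩, ?_⟩
      · rw [inner_neg_right]; linarith
      · rw [inner_neg_right, inner_neg_right, abs_neg, one_mul, ← abs_of_neg h]
        exact hj k
      · simpa using hx
    · left
      refine ⟨⟨h, fun k _ => ?_⟩, hx⟩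
      rw [one_mul]
      exact (hj k).trans_eq (abs_of_pos h)
  refine (measure_mono hsub).trans ((measure_union_le _ _).trans ?_)
  rw [measure_singleton, zero_add]
  refine (measure_iUnion_fintype_le _ _).trans ?_
  calc ∑ j, volume ((cone v j 1 ∩ ball 0 1) ∪ -(cone v j 1 ∩ ball 0 1))
      ≤ ∑ _j : Fin r, 2 * volume (cone v i 1 ∩ ball 0 1) := by
        refine Finset.sum_le_sum fun j _ => (measure_union_le _ _).trans ?_
        rw [Measure.measure_neg, two_mul]
        exact add_le_add (volume_cone_le v i j 1) (volume_cone_le v i j 1)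
    _ = 2 * r * volume (cone v i 1 ∩ ball 0 1) := by
        rw [Finset.sum_const, Finset.card_univ, Fintype.card_fin, nsmul_eq_mul]; ring

lemma one_add_one_div_pow_le (hr : 1 ≤ r) : (1 + 1 / (r : ℝ)) ^ (r - 1) ≤ 3 := by
  have hr0 : (0 : ℝ) < r := by exact_mod_cast hr
  calc (1 + 1 / (r : ℝ)) ^ (r - 1) ≤ (1 + 1 / (r : ℝ)) ^ r :=
        pow_le_pow_right₀ (by simp) (Nat.sub_le _ _)
    _ ≤ Real.exp (1 / r) ^ r := by
        refine pow_le_pow_left₀ (by positivity) ?_ r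
        rw [add_comm]; exact Real.add_one_le_exp _
    _ = Real.exp 1 := by
        rw [← Real.exp_nat_mul]; congr 1; field_simp
    _ ≤ 3 := by linarith [Real.exp_one_lt_d9]

/-- Shrinking all coordinates except `i` by `1 + 1/r` maps the cone without gap into the one with
the gap and stays in the ball. The determinant of this map is at least `1/3`. -/
lemma volume_cone_one_le (hr : 1 ≤ r) :
    volume (cone v i 1 ∩ ball 0 1) ≤ 3 * volume (cone v i (1 + 1 / (r : ℝ)) ∩ ball 0 1) := by
  have hr0 : (0 : ℝ) < r := by exact_mod_cast hr
  set g : ℝ := 1 + 1 / (r : ℝ) with hg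
  have hg0 : 0 < g := by positivity
  have hg1 : g⁻¹ ≤ 1 := inv_le_one_of_one_le₀ (by rw [hg]; simp)
  set d : Fin r → ℝ := fun k => if k = i then 1 else g⁻¹ with hd
  set S := Matrix.toLin v.toBasis v.toBasis (Matrix.diagonal d) with hS
  have hSv : ∀ k, S (v k) = d k • v k := by
    intro k
    have h := Matrix.toLin_self v.toBasis v.toBasis (Matrix.diagonal d) k
    rw [v.coe_toBasis] at h
    rw [hS, h, Finset.sum_eq_single k]
    · rw [Matrix.diagonal_apply_eq]
    · intro b _ hb; rw [Matrix.diagonal_apply_ne _ hb, zero_smul]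
    · simp
  have hSx : ∀ k x, inner ℝ (v k) (S x) = d k * inner ℝ (v k) x := by
    intro k x
    conv_lhs => rw [← v.sum_repr' x, map_sum, inner_sum]
    simp only [map_smul, hSv, inner_smul_right, orthonormal_iff_ite.mp v.orthonormal]
    simp [mul_comm]
  have hdet : LinearMap.det S = g⁻¹ ^ (r - 1) := by
    rw [hS, LinearMap.det_toLin, Matrix.det_diagonal, ← Finset.mul_prod_erase _ _ (Finset.mem_univ i)]
    simp only [hd, if_true, one_mul]
    rw [Finset.prod_congr rfl fun k hk => if_neg (Finset.ne_of_mem_erase hk), Finset.prod_const,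
      Finset.card_erase_of_mem (Finset.mem_univ i), Finset.card_univ, Fintype.card_fin]
  have hsub : S '' (cone v i 1 ∩ ball 0 1) ⊆ cone v i g ∩ ball 0 1 := by
    rintro _ ⟨x, ⟨⟨h1, h2⟩, h3⟩, rfl⟩
    refine ⟨⟨?_, fun k hk => ?_⟩, ?_⟩
    · rw [hSx]; simpa [hd] using h1
    · rw [hSx, hSx, abs_mul]
      simp only [hd, if_neg hk, if_true, one_mul]
      rw [abs_of_pos (inv_pos.mpr hg0), ← mul_assoc, mul_inv_cancel₀ hg0.ne']
      exact h2 k hk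
    · rw [mem_ball_zero_iff] at h3 ⊢
      refine lt_of_le_of_lt (le_of_sq_le_sq ?_ (norm_nonneg _)) h3
      rw [← sum_inner_sq v, ← sum_inner_sq v]
      refine Finset.sum_le_sum fun k _ => ?_
      rw [hSx, mul_pow]
      refine mul_le_of_le_one_left (sq_nonneg _) (pow_le_one₀ ?_ ?_)
      · simp only [hd]; split_ifs <;> positivity
      · simp only [hd]; split_ifs
        · exact le_rfl
        · exact hg1
  have h1 := measure_mono (μ := volume) hsub
  rw [Measure.addHaar_image_linearMap, hdet, abs_of_pos (by positivity)] at h1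
  have h2 : (1 : ENNReal) ≤ 3 * ENNReal.ofReal (g⁻¹ ^ (r - 1)) := by
    have : (3 : ENNReal) = ENNReal.ofReal 3 := by simp
    rw [this, ← ENNReal.ofReal_mul (by norm_num), ← ENNReal.ofReal_one]
    refine ENNReal.ofReal_le_ofReal ?_
    rw [inv_pow, ← div_eq_mul_inv, le_div_iff₀ (by positivity), one_mul]
    exact one_add_one_div_pow_le hr
  calc volume (cone v i 1 ∩ ball 0 1) = 1 * volume (cone v i 1 ∩ ball 0 1) := (one_mul _).symm
    _ ≤ 3 * ENNReal.ofReal (g⁻¹ ^ (r - 1)) * volume (cone v i 1 ∩ ball 0 1) := by gcongr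
    _ = 3 * (ENNReal.ofReal (g⁻¹ ^ (r - 1)) * volume (cone v i 1 ∩ ball 0 1)) := mul_assoc _ _ _
    _ ≤ 3 * volume (cone v i g ∩ ball 0 1) := by gcongr

lemma isProbabilityMeasure_uniformSphere (hr : 1 ≤ r) : IsProbabilityMeasure (uniformSphere r) := by
  have : Nonempty (Fin r) := ⟨⟨0, hr⟩⟩
  refine ⟨?_⟩
  rw [uniformSphere, Measure.smul_apply, smul_eq_mul]
  refine ENNReal.inv_mul_cancel ?_ (measure_ne_top _ _)
  rw [Measure.measure_univ_ne_zero]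
  exact Measure.toSphere_ne_zero _

/-- The good starting points for the component `i`. -/
def startSet : Set (sphere (0 : EuclideanSpace ℝ (Fin r)) 1) :=
  {θ | (θ : EuclideanSpace ℝ (Fin r)) ∈ cone v i (1 + 1 / (r : ℝ))}

lemma measurableSet_startSet : MeasurableSet (startSet v i) :=
  measurable_subtype_coe (measurableSet_cone v i _)

/-- Surface measure is proportional to the volume of the cone over a set inside the ball, so the
factors `2r` and `3` of the two volume comparisons multiply. -/
lemma uniformSphere_startSet_ge (hr : 1 ≤ r) :
    ENNReal.ofReal (1 / (6 * r)) ≤ uniformSphere r (startSet v i) := by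
  have : Nonempty (Fin r) := ⟨i⟩
  have hr0 : (0 : ℝ) < r := by exact_mod_cast hr
  set g : ℝ := 1 + 1 / (r : ℝ) with hg
  rw [uniformSphere, Measure.smul_apply, smul_eq_mul, Measure.toSphere_apply_univ,
    Measure.toSphere_apply' _ (measurableSet_startSet v i)]
  have hcone : cone v i g ∩ ball 0 1 ⊆
      Set.Ioo (0 : ℝ) 1 • ((↑) '' startSet v i : Set (EuclideanSpace ℝ (Fin r))) := by
    rintro x ⟨⟨h1, h2⟩, h3⟩
    have hx0 : x ≠ 0 := by rintro rfl; rw [inner_zero_right] at h1; exact lt_irrefl _ h1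
    have hn : 0 < ‖x‖ := norm_pos_iff.mpr hx0
    have hn' : 0 < ‖x‖⁻¹ := inv_pos.mpr hn
    refine Set.mem_smul.mpr ⟨‖x‖, ⟨hn, by simpa using h3⟩, ‖x‖⁻¹ • x, ⟨⟨‖x‖⁻¹ • x, ?_⟩, ?_, rfl⟩, ?_⟩
    · rw [mem_sphere_zero_iff_norm, norm_smul, norm_inv, norm_norm, inv_mul_cancel₀ hn.ne']
    · refine ⟨?_, fun k hk => ?_⟩
      · rw [inner_smul_right]; positivity
      · rw [inner_smul_right, inner_smul_right, abs_mul, abs_of_pos hn', mul_left_comm]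
        exact mul_le_mul_of_nonneg_left (h2 k hk) hn'.le
    · rw [smul_smul, mul_inv_cancel₀ hn.ne', one_smul]
  set V := volume (Set.Ioo (0 : ℝ) 1 • ((↑) '' startSet v i : Set (EuclideanSpace ℝ (Fin r)))) with hV
  set B := volume (ball (0 : EuclideanSpace ℝ (Fin r)) 1) with hB
  have hBV : B ≤ ENNReal.ofReal (6 * r) * V := by
    have h6 : ENNReal.ofReal (6 * r) = 2 * r * 3 := by
      rw [ENNReal.ofReal_mul (by norm_num), ENNReal.ofReal_natCast]
      norm_num; ring
    rw [h6]
    calc B ≤ 2 * r * volume (cone v i 1 ∩ ball 0 1) := volume_ball_le_cone v i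
      _ ≤ 2 * r * (3 * volume (cone v i g ∩ ball 0 1)) := by gcongr; exact volume_cone_one_le v i hr
      _ ≤ 2 * r * (3 * V) := by gcongr; exact measure_mono hcone
      _ = 2 * r * 3 * V := by ring
  have hB0 : B ≠ 0 := (measure_ball_pos _ _ one_pos).ne'
  have hBt : B ≠ ⊤ := measure_ball_lt_top.ne
  have hdim : ((Module.finrank ℝ (EuclideanSpace ℝ (Fin r)) : ℕ) : ENNReal) = r := by simp
  rw [hdim]
  have hrne : (r : ENNReal) ≠ 0 := by simp; omega
  rw [← ENNReal.div_eq_inv_mul, ENNReal.mul_div_mul_left _ _ hrne (ENNReal.natCast_ne_top r),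
    ENNReal.le_div_iff_mul_le (Or.inl hB0) (Or.inl hBt)]
  calc ENNReal.ofReal (1 / (6 * r)) * B ≤ ENNReal.ofReal (1 / (6 * r)) * (ENNReal.ofReal (6 * r) * V) := by
        gcongr
    _ = V := by
        rw [← mul_assoc, ← ENNReal.ofReal_mul (by positivity), one_div,
          inv_mul_cancel₀ (by positivity), ENNReal.ofReal_one, one_mul]

/-- All rounds have good starting points for all components with high probability. -/
lemma measure_no_start_le {L : ℕ} {δ : ℝ} (hδ : 0 < δ) (hδ1 : δ < 1)
    (hL : 24 * (r : ℝ) ^ 2 * Real.log (2 / δ) ≤ L) :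
    (Measure.pi fun _ : Fin r => Measure.pi fun _ : Fin L => uniformSphere r)
      {θ | ∃ q i, ∀ τ, θ q τ ∉ startSet v i} ≤ ENNReal.ofReal (δ / 2) := by
  rcases Nat.eq_zero_or_pos r with h0 | hr
  · subst h0
    have : {θ : Fin 0 → Fin L → sphere (0 : EuclideanSpace ℝ (Fin 0)) 1 |
        ∃ q i, ∀ τ, θ q τ ∉ startSet v i} = ∅ := by
      ext θ; simp
    rw [this]; simp
  have hr1 : (1 : ℝ) ≤ r := by exact_mod_cast hr
  have hr0 : (0 : ℝ) < r := by linarith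
  have := isProbabilityMeasure_uniformSphere (r := r) hr
  set p : ℝ := 1 / (6 * r) with hp
  have hp1 : p ≤ 1 := by rw [hp, div_le_one (by positivity)]; linarith
  have hp0 : 0 < p := by positivity
  have hone : ∀ q i, (Measure.pi fun _ : Fin r => Measure.pi fun _ : Fin L => uniformSphere r)
      {θ | ∀ τ, θ q τ ∉ startSet v i} ≤ ENNReal.ofReal (Real.exp (-(p * L))) := by
    intro q i
    have hset : {θ : Fin r → Fin L → sphere (0 : EuclideanSpace ℝ (Fin r)) 1 |
        ∀ τ, θ q τ ∉ startSet v i} =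
        Function.eval q ⁻¹' (Set.univ.pi fun _ : Fin L => (startSet v i)ᶜ) := by
      ext θ; simp [Set.mem_pi]
    have hmeas : MeasurableSet (Set.univ.pi fun _ : Fin L => (startSet v i)ᶜ) :=
      MeasurableSet.univ_pi fun _ => (measurableSet_startSet v i).compl
    rw [hset, (measurePreserving_eval _ q).measure_preimage hmeas.nullMeasurableSet,
      Measure.pi_pi, Finset.prod_const, Finset.card_univ, Fintype.card_fin,
      prob_compl_eq_one_sub (measurableSet_startSet v i)]
    have h1 : 1 - uniformSphere r (startSet v i) ≤ ENNReal.ofReal (1 - p) := by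
      rw [ENNReal.ofReal_sub _ hp0.le, ENNReal.ofReal_one]
      exact tsub_le_tsub_left (uniformSphere_startSet_ge v i hr) _
    refine (pow_le_pow_left' h1 L).trans ?_
    rw [← ENNReal.ofReal_pow (by linarith)]
    refine ENNReal.ofReal_le_ofReal ?_
    calc (1 - p) ^ L ≤ Real.exp (-p) ^ L :=
          pow_le_pow_left₀ (by linarith) (by linarith [Real.add_one_le_exp (-p)]) L
      _ = Real.exp (-(p * L)) := by rw [← Real.exp_nat_mul]; congr 1; ring
  have hsub : {θ : Fin r → Fin L → sphere (0 : EuclideanSpace ℝ (Fin r)) 1 |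
      ∃ q i, ∀ τ, θ q τ ∉ startSet v i} ⊆ ⋃ qi : Fin r × Fin r,
        {θ | ∀ τ, θ qi.1 τ ∉ startSet v qi.2} := by
    rintro θ ⟨q, i, h⟩
    exact Set.mem_iUnion.mpr ⟨(q, i), h⟩
  refine (measure_mono hsub).trans ((measure_iUnion_fintype_le _ _).trans ?_)
  refine (Finset.sum_le_sum fun qi _ => hone qi.1 qi.2).trans ?_
  rw [Finset.sum_const, Finset.card_univ, Fintype.card_prod, Fintype.card_fin, nsmul_eq_mul,
    ← ENNReal.ofReal_natCast, ← ENNReal.ofReal_mul (by positivity)]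
  refine ENNReal.ofReal_le_ofReal ?_
  have hlog2 : 1 / 2 ≤ Real.log (2 / δ) := by
    have h1 : Real.log 2 ≤ Real.log (2 / δ) :=
      Real.log_le_log (by norm_num) (by rw [le_div_iff₀ hδ]; linarith)
    linarith [Real.log_two_gt_d9]
  -- A single round and component fails with probability at most `exp(-L/(6r))`; this exponent pays
  -- for the union bound over `r²` pairs and for `2/δ`.
  have hpL : 4 * r * Real.log (2 / δ) ≤ p * L := by
    calc 4 * r * Real.log (2 / δ) = p * (24 * (r : ℝ) ^ 2 * Real.log (2 / δ)) := by
          rw [hp]; field_simp; norm_num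
      _ ≤ p * L := by gcongr
  have hkey : Real.log ((r : ℝ) * r * (2 / δ)) ≤ p * L := by
    rw [Real.log_mul (by positivity) (by positivity), Real.log_mul hr0.ne' hr0.ne']
    have h1 := Real.log_le_sub_one_of_pos hr0
    nlinarith
  have h2 : (r : ℝ) * r * (2 / δ) ≤ Real.exp (p * L) := by
    rw [← Real.log_le_iff_le_exp (by positivity)]; exact hkey
  push_cast
  rw [Real.exp_neg, ← div_eq_mul_inv, div_le_iff₀ (Real.exp_pos _)]
  calc (r : ℝ) * r = δ / 2 * (r * r * (2 / δ)) := by field_simp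
    _ ≤ δ / 2 * Real.exp (p * L) := by gcongr

/-- A bound for a product with a finite probability space, fibre by fibre. -/
lemma measure_prod_le_add {α β : Type*} [Fintype α] [MeasurableSpace α]
    [MeasurableSingletonClass α] [MeasurableSpace β] (P : Measure α) [IsProbabilityMeasure P]
    (Q : Measure β) [IsProbabilityMeasure Q] {S : Set (α × β)} {B : Set α} {T : α → Set β}
    {a b : ENNReal} (hB : P B ≤ a) (hT : ∀ x, Q (T x) ≤ b)
    (hS : ∀ ω ∈ S, ω.1 ∈ B ∨ ω.2 ∈ T ω.1) : (P.prod Q) S ≤ a + b := by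
  -- The cover consists of finitely many rectangles, and the product measure of a rectangle is known
  -- for arbitrary sides. So neither `S` nor the sets `T x` have to be measurable.
  have hsub : S ⊆ (B ×ˢ Set.univ) ∪ ⋃ x, ({x} : Set α) ×ˢ T x := by
    intro ω hω
    rcases hS ω hω with h | h
    · exact Or.inl ⟨h, trivial⟩
    · exact Or.inr (Set.mem_iUnion.mpr ⟨ω.1, rfl, h⟩)
  refine (measure_mono hsub).trans ((measure_union_le _ _).trans (add_le_add ?_ ?_))
  · rw [Measure.prod_prod, measure_univ, mul_one]; exact hB
  · refine (measure_iUnion_fintype_le _ _).trans ?_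
    calc ∑ x, (P.prod Q) (({x} : Set α) ×ˢ T x) ≤ ∑ x, P {x} * b := by
          refine Finset.sum_le_sum fun x _ => ?_
          rw [Measure.prod_prod]
          gcongr
          exact hT x
      _ = b := by
          rw [← Finset.sum_mul, sum_measure_singleton, Finset.coe_univ, measure_univ, one_mul]

end StartingPoints

/-! ### Bounded differences and concentration of vector valued means. -/

section Concentration

variable {Ω : Type*} [Fintype Ω] [MeasurableSpace Ω] [MeasurableSingletonClass Ω]
  (P : Measure Ω) [IsProbabilityMeasure P]

/-- Hoeffding's lemma on the interval of length `2c` around any one value of `g`. The optimal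
exponent would be four times smaller, which only affects constants. -/
lemma integral_exp_sub_le (g : Ω → ℝ) {c : ℝ} (hg : ∀ x y, |g x - g y| ≤ c) (u : ℝ) :
    ∫ x, Real.exp (u * (g x - ∫ y, g y ∂P)) ∂P ≤ Real.exp (c ^ 2 * u ^ 2 / 2) := by
  obtain ⟨x₀⟩ : Nonempty Ω := P.nonempty_of_neZero
  have h := (ProbabilityTheory.hasSubgaussianMGF_of_mem_Icc (μ := P) (X := g) (a := g x₀ - c)
    (b := g x₀ + c) (Measurable.of_discrete.aemeasurable) (ae_of_all _ fun x => by
      have := abs_le.mp (hg x x₀)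
      exact ⟨by linarith, by linarith⟩)).mgf_le u
  refine h.trans (le_of_eq ?_)
  congr 3
  have h2 : g x₀ + c - (g x₀ - c) = 2 * c := by ring
  push_cast
  rw [h2, Real.norm_eq_abs, div_pow, sq_abs]
  ring

/-- The bounded differences inequality on a finite probability space. -/
lemma integral_exp_bounded_differences {m : ℕ} {c : ℝ} (f : (Fin m → Ω) → ℝ)
    (hf : ∀ t y x, |f (Function.update y t x) - f y| ≤ c) (u : ℝ) :
    ∫ y, Real.exp (u * (f y - ∫ z, f z ∂Measure.pi fun _ => P)) ∂Measure.pi (fun _ => P) ≤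
      Real.exp (m * c ^ 2 * u ^ 2 / 2) := by
  induction m with
  | zero =>
    have h : ∀ y, f y = f default := fun y => congrArg f (Subsingleton.elim _ _)
    simp [h]
  | succ m ih =>
    have hint : ∀ F : (Fin (m + 1) → Ω) → ℝ, ∫ y, F y ∂Measure.pi (fun _ => P) =
        ∫ x, ∫ y, F (Fin.cons x y) ∂Measure.pi (fun _ : Fin m => P) ∂P := by
      intro F
      have h := (measurePreserving_piFinSuccAbove (fun _ : Fin (m + 1) => P) 0).symm.integral_comp' F
      rw [← h, integral_prod _ Integrable.of_finite]
      refine integral_congr_ae (ae_of_all _ fun x => integral_congr_ae (ae_of_all _ fun y => ?_))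
      simp [MeasurableEquiv.piFinSuccAbove_symm_apply, Fin.insertNthEquiv]
    -- The mean conditional on the first coordinate. It inherits the differences `c`, so the
    -- exponential moment factors into one for `g` and, by induction, one for the remaining
    -- coordinates.
    set g : Ω → ℝ := fun x => ∫ y, f (Fin.cons x y) ∂Measure.pi (fun _ : Fin m => P) with hg
    have hgd : ∀ x x', |g x - g x'| ≤ c := by
      intro x x'
      rw [hg]
      simp only
      rw [← integral_sub Integrable.of_finite Integrable.of_finite]
      refine abs_integral_le_integral_abs.trans ?_
      have h1 : ∀ y : Fin m → Ω, |f (Fin.cons x y) - f (Fin.cons x' y)| ≤ c := fun y => by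
        have := hf 0 (Fin.cons x' y) x
        rwa [Fin.update_cons_zero] at this
      refine (integral_mono Integrable.of_finite (integrable_const c) h1).trans ?_
      simp
    rw [hint, hint f]
    have hinner : ∀ x, ∫ y, Real.exp (u * (f (Fin.cons x y) - ∫ x, g x ∂P))
        ∂Measure.pi (fun _ : Fin m => P) ≤
        Real.exp (u * (g x - ∫ x, g x ∂P)) * Real.exp (m * c ^ 2 * u ^ 2 / 2) := by
      intro x
      have h1 := ih (fun y => f (Fin.cons x y)) (fun t y x' => by
        have := hf t.succ (Fin.cons x y) x'
        rwa [← Fin.cons_update] at this)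
      refine le_trans (le_of_eq ?_) (mul_le_mul_of_nonneg_left h1 (Real.exp_nonneg _))
      rw [← integral_const_mul]
      congr 1
      funext y
      rw [← Real.exp_add]
      congr 1
      ring
    refine (integral_mono Integrable.of_finite Integrable.of_finite hinner).trans ?_
    rw [integral_mul_const]
    refine (mul_le_mul_of_nonneg_right (integral_exp_sub_le P g hgd u) (Real.exp_nonneg _)).trans ?_
    rw [← Real.exp_add]
    refine le_of_eq (congrArg _ ?_)
    push_cast
    ring

lemma measure_bounded_differences {m : ℕ} {c : ℝ} (f : (Fin m → Ω) → ℝ)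
    (hf : ∀ t y x, |f (Function.update y t x) - f y| ≤ c) {s : ℝ} (hs : 0 ≤ s) :
    (Measure.pi fun _ => P).real {y | s ≤ f y - ∫ z, f z ∂Measure.pi fun _ => P} ≤
      Real.exp (-s ^ 2 / (2 * (m * c ^ 2))) := by
  have h : ProbabilityTheory.HasSubgaussianMGF
      (fun y => f y - ∫ z, f z ∂Measure.pi fun _ => P) (⟨m * c ^ 2, by positivity⟩ : NNReal)
      (Measure.pi fun _ => P) :=
    ⟨fun t => Integrable.of_finite, fun t => integral_exp_bounded_differences P f hf t⟩
  exact h.measure_ge_le hs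

lemma sq_integral_le (g : Ω → ℝ) : (∫ x, g x ∂P) ^ 2 ≤ ∫ x, g x ^ 2 ∂P := by
  have h := ProbabilityTheory.variance_nonneg g P
  rw [ProbabilityTheory.variance_eq_sub .of_discrete] at h
  simpa using h

variable {κ : Type*} [Fintype κ] {m : ℕ}

/-- Variances of independent summands add coordinate by coordinate, so the mean square error is at
most `B² / m` whatever the dimension; Jensen's inequality passes to the norm. -/
lemma integral_norm_mean_sub_le (hm : 1 ≤ m) {φ : Ω → EuclideanSpace ℝ κ} {B : ℝ} (hB : 0 ≤ B)
    (hφ : ∀ ω, ‖φ ω‖ ≤ B) {e : EuclideanSpace ℝ κ} (he : ∀ k, e k = ∫ ω, φ ω k ∂P) :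
    ∫ y, ‖(m : ℝ)⁻¹ • ∑ t : Fin m, φ (y t) - e‖ ∂Measure.pi (fun _ => P) ≤ B / √m := by
  have hm0 : (0 : ℝ) < m := by exact_mod_cast hm
  refine le_of_sq_le_sq ((sq_integral_le _ _).trans ?_) (by positivity)
  have hcoord : ∀ k, ∫ y, ((m : ℝ)⁻¹ * ∑ t : Fin m, φ (y t) k - e k) ^ 2 ∂Measure.pi (fun _ => P) ≤
      (m : ℝ)⁻¹ * ∫ ω, φ ω k ^ 2 ∂P := by
    intro k
    have hv := ProbabilityTheory.variance_sum_pi (μ := fun _ : Fin m => P)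
      (X := fun _ ω => φ ω k) (fun _ => .of_discrete)
    rw [Finset.sum_const, Finset.card_univ, Fintype.card_fin, nsmul_eq_mul] at hv
    have hmean : ∫ y, (∑ t : Fin m, fun y : Fin m → Ω => φ (y t) k) y ∂Measure.pi (fun _ => P) =
        m * e k := by
      simp only [Finset.sum_apply]
      rw [integral_finsetSum _ fun _ _ => Integrable.of_finite]
      have : ∀ t : Fin m, ∫ y, φ (y t) k ∂Measure.pi (fun _ => P) = e k := by
        intro t
        rw [he k]
        have h1 := (measurePreserving_eval (fun _ : Fin m => P) t)
        have h2 := integral_map (μ := Measure.pi fun _ : Fin m => P) (f := fun ω => φ ω k) h1.measurable.aemeasurable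
          StronglyMeasurable.of_discrete.aestronglyMeasurable
        rw [h1.map_eq] at h2
        exact h2.symm
      simp [this]
    rw [ProbabilityTheory.variance_eq_integral (Measurable.of_discrete.aemeasurable), hmean] at hv
    have h2 : ∀ y : Fin m → Ω, ((m : ℝ)⁻¹ * ∑ t : Fin m, φ (y t) k - e k) ^ 2 =
        ((m : ℝ)⁻¹) ^ 2 * ((∑ t : Fin m, fun y : Fin m → Ω => φ (y t) k) y - m * e k) ^ 2 := by
      intro y
      rw [← mul_pow, mul_sub, ← mul_assoc, inv_mul_cancel₀ hm0.ne', one_mul, Finset.sum_apply]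
    simp only [h2]
    rw [integral_const_mul, hv]
    have h3 : ProbabilityTheory.variance (fun ω => φ ω k) P ≤ ∫ ω, φ ω k ^ 2 ∂P := by
      rw [ProbabilityTheory.variance_eq_sub .of_discrete]
      have := sq_nonneg (∫ ω, φ ω k ∂P)
      simp only [Pi.pow_apply]
      linarith
    calc ((m : ℝ)⁻¹) ^ 2 * (m * ProbabilityTheory.variance (fun ω => φ ω k) P)
        = (m : ℝ)⁻¹ * ProbabilityTheory.variance (fun ω => φ ω k) P := by field_simp
      _ ≤ _ := by gcongr
  calc ∫ y, ‖(m : ℝ)⁻¹ • ∑ t : Fin m, φ (y t) - e‖ ^ 2 ∂Measure.pi (fun _ => P)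
      = ∑ k, ∫ y, ((m : ℝ)⁻¹ * ∑ t : Fin m, φ (y t) k - e k) ^ 2 ∂Measure.pi (fun _ => P) := by
        rw [← integral_finsetSum _ fun _ _ => Integrable.of_finite]
        congr 1
        funext y
        rw [EuclideanSpace.norm_sq_eq]
        refine Finset.sum_congr rfl fun k _ => ?_
        rw [Real.norm_eq_abs, sq_abs]
        simp [WithLp.ofLp_sum]
    _ ≤ ∑ k, (m : ℝ)⁻¹ * ∫ ω, φ ω k ^ 2 ∂P := Finset.sum_le_sum fun k _ => hcoord k
    _ = (m : ℝ)⁻¹ * ∫ ω, ‖φ ω‖ ^ 2 ∂P := by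
        rw [← Finset.mul_sum, ← integral_finsetSum _ fun _ _ => Integrable.of_finite]
        congr 2
        funext ω
        rw [EuclideanSpace.norm_sq_eq]
        exact Finset.sum_congr rfl fun k _ => by rw [Real.norm_eq_abs, sq_abs]
    _ ≤ (m : ℝ)⁻¹ * B ^ 2 := by
        gcongr
        refine (integral_mono Integrable.of_finite (integrable_const (B ^ 2))
          fun ω => pow_le_pow_left₀ (norm_nonneg _) (hφ ω) 2).trans ?_
        simp
    _ = (B / √m) ^ 2 := by rw [div_pow, Real.sq_sqrt hm0.le]; ring

/-- Concentration of the mean of bounded vectors. -/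
theorem measure_norm_mean_sub_le (hm : 1 ≤ m) {φ : Ω → EuclideanSpace ℝ κ} {B : ℝ} (hB : 0 < B)
    (hφ : ∀ ω, ‖φ ω‖ ≤ B) {e : EuclideanSpace ℝ κ} (he : ∀ k, e k = ∫ ω, φ ω k ∂P) {s : ℝ}
    (hs : 0 ≤ s) :
    (Measure.pi fun _ : Fin m => P) {y | ¬ ‖(m : ℝ)⁻¹ • ∑ t, φ (y t) - e‖ ≤ B * (1 + √(8 * s)) / √m}
      ≤ ENNReal.ofReal (Real.exp (-s)) := by
  have hm0 : (0 : ℝ) < m := by exact_mod_cast hm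
  have hsm : 0 < √(m : ℝ) := Real.sqrt_pos.mpr hm0
  set f : (Fin m → Ω) → ℝ := fun y => ‖(m : ℝ)⁻¹ • ∑ t, φ (y t) - e‖ with hf
  have hbd : ∀ t y x, |f (Function.update y t x) - f y| ≤ 2 * B / m := by
    intro t y x
    refine (abs_norm_sub_norm_le _ _).trans ?_
    have h1 : (m : ℝ)⁻¹ • ∑ t', φ (Function.update y t x t') - e - ((m : ℝ)⁻¹ • ∑ t', φ (y t') - e) =
        (m : ℝ)⁻¹ • (φ x - φ (y t)) := by
      rw [sub_sub_sub_cancel_right, ← smul_sub, ← Finset.sum_sub_distrib, Finset.sum_eq_single t]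
      · rw [Function.update_self]
      · intro b _ hb; rw [Function.update_of_ne hb, sub_self]
      · simp
    rw [h1, norm_smul, Real.norm_of_nonneg (by positivity), div_eq_inv_mul]
    refine mul_le_mul_of_nonneg_left ?_ (by positivity)
    linarith [norm_sub_le (φ x) (φ (y t)), hφ x, hφ (y t)]
  -- Replacing one sample moves the norm by at most `2B/m`; this deviation makes the exponent
  -- exactly `-s`.
  have h := measure_bounded_differences P f hbd (s := B * √(8 * s) / √m) (by positivity)
  have hE := integral_norm_mean_sub_le P hm hB.le hφ he
  rw [← ofReal_measureReal]
  refine ENNReal.ofReal_le_ofReal (le_trans (measureReal_mono fun y hy => ?_) (h.trans_eq ?_))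
  · have hy' := not_le.mp hy
    simp only [Set.mem_ofPred_eq]
    have : B * (1 + √(8 * s)) / √m = B / √m + B * √(8 * s) / √m := by ring
    simp only [hf] at hE ⊢
    linarith
  · congr 1
    rw [div_pow, mul_pow, Real.sq_sqrt (by positivity), Real.sq_sqrt hm0.le]
    field_simp
    ring

end Concentration

/-! ### Moments of the encoded samples. -/

section Moments

variable {r n ℓ m : ℕ} (X : ProductMixture r n ℓ)

/-- The law of one coordinate. -/
noncomputable def coordLaw (X : ProductMixture r n ℓ) (q : Fin r) (i : Fin n) : Measure (Fin ℓ) :=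
  ∑ j, ENNReal.ofReal (X.prob q i j) • Measure.dirac j

lemma coordLaw_singleton (q : Fin r) (i : Fin n) (j : Fin ℓ) :
    coordLaw X q i {j} = ENNReal.ofReal (X.prob q i j) := by
  rw [coordLaw, Measure.finsetSum_apply, Finset.sum_eq_single j]
  · simp
  · intro b _ hb
    simp [hb]
  · simp

instance (q : Fin r) (i : Fin n) : IsProbabilityMeasure (coordLaw X q i) := by
  refine ⟨?_⟩
  rw [coordLaw, Measure.finsetSum_apply]
  simp only [Measure.smul_apply, measure_univ, smul_eq_mul, mul_one]
  rw [← ENNReal.ofReal_sum_of_nonneg fun j _ => X.prob_nonneg q i j, X.prob_sum, ENNReal.ofReal_one]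

instance : IsProbabilityMeasure X.law := by
  refine ⟨?_⟩
  rw [ProductMixture.law, Measure.finsetSum_apply]
  have : ∀ q, Measure.pi (fun i => ∑ j, ENNReal.ofReal (X.prob q i j) • Measure.dirac j)
      (Set.univ : Set (Fin n → Fin ℓ)) = 1 := fun q =>
    measure_univ (μ := Measure.pi fun i => coordLaw X q i)
  simp only [Measure.smul_apply, this, smul_eq_mul, mul_one]
  rw [← ENNReal.ofReal_sum_of_nonneg fun q _ => X.weight_nonneg q, X.weight_sum, ENNReal.ofReal_one]

/-- The probability mass function of a mixture. -/
noncomputable def pmf (X : ProductMixture r n ℓ) (y : Fin n → Fin ℓ) : ℝ :=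
  ∑ q, X.weight q * ∏ i, X.prob q i (y i)

lemma law_singleton (y : Fin n → Fin ℓ) : X.law {y} = ENNReal.ofReal (pmf X y) := by
  rw [ProductMixture.law, Measure.finsetSum_apply, pmf, ENNReal.ofReal_sum_of_nonneg
    fun q _ => mul_nonneg (X.weight_nonneg q) (Finset.prod_nonneg fun i _ => X.prob_nonneg q i _)]
  refine Finset.sum_congr rfl fun q _ => ?_
  have h : Measure.pi (fun i => ∑ j, ENNReal.ofReal (X.prob q i j) • Measure.dirac j) {y} =
      ∏ i, ENNReal.ofReal (X.prob q i (y i)) := by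
    have := Measure.pi_singleton (fun i => coordLaw X q i) y
    simp only [coordLaw_singleton] at this
    exact this
  rw [Measure.smul_apply, h, smul_eq_mul, ENNReal.ofReal_mul (X.weight_nonneg q),
    ENNReal.ofReal_prod_of_nonneg fun i _ => X.prob_nonneg q i _]

lemma pmf_nonneg (y : Fin n → Fin ℓ) : 0 ≤ pmf X y :=
  Finset.sum_nonneg fun q _ => mul_nonneg (X.weight_nonneg q)
    (Finset.prod_nonneg fun i _ => X.prob_nonneg q i _)

lemma integral_law (f : (Fin n → Fin ℓ) → ℝ) : ∫ y, f y ∂X.law = ∑ y, pmf X y * f y := by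
  rw [integral_fintype Integrable.of_finite]
  refine Finset.sum_congr rfl fun y _ => ?_
  rw [measureReal_def, law_singleton, ENNReal.toReal_ofReal (pmf_nonneg X y), smul_eq_mul]

/-- The joint distribution of finitely many coordinates. -/
lemma integral_law_prod_indicator (s : Finset (Fin n)) (a : Fin n → Fin ℓ) :
    ∫ y, ∏ i ∈ s, (if y i = a i then (1 : ℝ) else 0) ∂X.law =
      ∑ q, X.weight q * ∏ i ∈ s, X.prob q i (a i) := by
  rw [integral_law]
  simp only [pmf, Finset.sum_mul]
  rw [Finset.sum_comm]
  refine Finset.sum_congr rfl fun q _ => ?_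
  simp only [mul_assoc]
  rw [← Finset.mul_sum]
  congr 1
  have h1 : ∀ y : Fin n → Fin ℓ, (∏ i, X.prob q i (y i)) * ∏ i ∈ s, (if y i = a i then (1 : ℝ) else 0) =
      ∏ i, (X.prob q i (y i) * if i ∈ s then (if y i = a i then (1 : ℝ) else 0) else 1) := by
    intro y
    rw [Finset.prod_mul_distrib, Finset.prod_ite_mem, Finset.univ_inter]
  simp only [h1]
  have h2 := Finset.prod_univ_sum (fun _ : Fin n => (Finset.univ : Finset (Fin ℓ)))
    (fun i j => X.prob q i j * if i ∈ s then (if j = a i then (1 : ℝ) else 0) else 1)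
  rw [Fintype.piFinset_univ] at h2
  rw [← h2]
  have h3 : ∀ i, ∑ j, X.prob q i j * (if i ∈ s then (if j = a i then (1 : ℝ) else 0) else 1) =
      if i ∈ s then X.prob q i (a i) else 1 := by
    intro i
    split_ifs
    · simp
    · simp [X.prob_sum]
  simp only [h3]
  rw [Finset.prod_ite_mem, Finset.univ_inter]

/-- Distinct coordinates are independent given the type. Inside a diagonal block both entries come
from the same coordinate and the formula may fail, which is the reason for the masks. -/
lemma integral_encode_mul {p q : Idx n ℓ} (h : p.1 ≠ q.1) :
    ∫ y, encode y p * encode y q ∂X.law = X.M2 p q := by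
  have h1 := integral_law_prod_indicator X {p.1, q.1} (fun i => if i = p.1 then p.2 else q.2)
  simp only [Finset.prod_pair h, if_true, if_neg h.symm] at h1
  simp only [encode]
  rw [h1]
  rw [ProductMixture.M2, Matrix.mul_apply]
  simp only [Matrix.mul_diagonal, Matrix.transpose_apply, ProductMixture.Pi, Matrix.of_apply]
  exact Finset.sum_congr rfl fun _ _ => by ring

lemma integral_encode_mul_mul {p q s : Idx n ℓ} (h : p.1 ≠ q.1) (h' : q.1 ≠ s.1) (h'' : s.1 ≠ p.1) :
    ∫ y, encode y p * encode y q * encode y s ∂X.law =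
      ∑ k, X.weight k * X.Pi p k * X.Pi q k * X.Pi s k := by
  have h1 := integral_law_prod_indicator X {p.1, q.1, s.1}
    (fun i => if i = p.1 then p.2 else if i = q.1 then q.2 else s.2)
  have hmem : p.1 ∉ ({q.1, s.1} : Finset (Fin n)) := by
    simp [h, h''.symm]
  simp only [Finset.prod_insert hmem, Finset.prod_pair h', if_true, if_neg h.symm, if_neg h'',
    if_neg h'.symm] at h1
  simp only [encode, mul_assoc]
  rw [h1]
  simp only [ProductMixture.Pi, Matrix.of_apply]

lemma sum_encode_sq (y : Fin n → Fin ℓ) : ∑ p, encode y p ^ 2 = n := by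
  rw [Fintype.sum_prod_type]
  simp [encode]

/-- The empirical second moment is close to the second moment outside of the diagonal blocks. -/
lemma measure_sampleM2 (hm : 1 ≤ m) (hn : 1 ≤ n) {s : ℝ} (hs : 0 ≤ s) :
    (Measure.pi fun _ : Fin m => X.law)
      {y | ¬ fro (mask2 (sampleM2 y - X.M2)) ≤ n * (1 + √(8 * s)) / √m} ≤
      ENNReal.ofReal (Real.exp (-s)) := by
  have hn0 : (0 : ℝ) < n := by exact_mod_cast hn
  set φ : (Fin n → Fin ℓ) → EuclideanSpace ℝ (Idx n ℓ × Idx n ℓ) := fun y =>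
    WithLp.toLp 2 fun k => if k.1.1 ≠ k.2.1 then encode y k.1 * encode y k.2 else 0 with hφ
  set e : EuclideanSpace ℝ (Idx n ℓ × Idx n ℓ) :=
    WithLp.toLp 2 fun k => mask2 X.M2 k.1 k.2 with he
  -- A sample has `n` ones, so its masked second moment has Frobenius norm at most `n`,
  -- independently of `ℓ`.
  have h := measure_norm_mean_sub_le X.law hm hn0 (φ := φ) (e := e) (fun y => by
    refine le_of_sq_le_sq ?_ hn0.le
    rw [EuclideanSpace.norm_sq_eq, Fintype.sum_prod_type]
    calc ∑ p, ∑ q, ‖φ y (p, q)‖ ^ 2 ≤ ∑ p, ∑ q, encode y p ^ 2 * encode y q ^ 2 := by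
          refine Finset.sum_le_sum fun p _ => Finset.sum_le_sum fun q _ => ?_
          simp only [hφ, Real.norm_eq_abs, sq_abs]
          split_ifs
          · rw [mul_pow]
          · rw [zero_pow two_ne_zero]; positivity
      _ = (n : ℝ) ^ 2 := by
          rw [← Finset.sum_mul_sum, sum_encode_sq, sq]) (fun k => by
    simp only [he, hφ, mask2, Matrix.of_apply]
    split_ifs with hk
    · rw [integral_encode_mul X hk]
    · simp) hs
  have heq : ∀ y : Fin m → Fin n → Fin ℓ, fro (mask2 (sampleM2 y - X.M2)) =
      ‖(m : ℝ)⁻¹ • ∑ t, φ (y t) - e‖ := by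
    intro y
    rw [fro_eq_norm]
    congr 1
    ext k
    simp only [hφ, he, mask2, sampleM2, Matrix.of_apply, Matrix.sub_apply, PiLp.sub_apply,
      PiLp.smul_apply, smul_eq_mul, WithLp.ofLp_sum, Finset.sum_apply]
    split_ifs <;> simp
  simpa only [heq] using h

/-- The third moment of the mixture. -/
noncomputable def moment3 (X : ProductMixture r n ℓ) : Tensor3 (Idx n ℓ) := fun p q s =>
  ∑ k, X.weight k * X.Pi p k * X.Pi q k * X.Pi s k

/-- The empirical third moment is close to the third moment outside of the diagonal blocks. -/
lemma measure_sampleM3 (hm : 1 ≤ m) (hn : 1 ≤ n) {s : ℝ} (hs : 0 ≤ s) :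
    (Measure.pi fun _ : Fin m => X.law)
      {y | ¬ tnorm (mask3 (sampleM3 y - moment3 X)) ≤ n * √n * (1 + √(8 * s)) / √m} ≤
      ENNReal.ofReal (Real.exp (-s)) := by
  have hn0 : (0 : ℝ) < n := by exact_mod_cast hn
  have hsn : 0 < √(n : ℝ) := Real.sqrt_pos.mpr hn0
  set φ : (Fin n → Fin ℓ) → EuclideanSpace ℝ (Idx n ℓ × Idx n ℓ × Idx n ℓ) := fun y =>
    WithLp.toLp 2 fun k => if k.1.1 ≠ k.2.1.1 ∧ k.2.1.1 ≠ k.2.2.1 ∧ k.2.2.1 ≠ k.1.1 then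
      encode y k.1 * encode y k.2.1 * encode y k.2.2 else 0 with hφ
  set e : EuclideanSpace ℝ (Idx n ℓ × Idx n ℓ × Idx n ℓ) :=
    WithLp.toLp 2 fun k => mask3 (moment3 X) k.1 k.2.1 k.2.2 with he
  have h := measure_norm_mean_sub_le X.law hm (B := n * √n) (by positivity) (φ := φ) (e := e)
    (fun y => by
    refine le_of_sq_le_sq ?_ (by positivity)
    rw [EuclideanSpace.norm_sq_eq]
    simp only [Fintype.sum_prod_type (f := fun k : Idx n ℓ × Idx n ℓ × Idx n ℓ => ‖φ y k‖ ^ 2)]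
    simp only [Fintype.sum_prod_type (α₁ := Idx n ℓ) (α₂ := Idx n ℓ)]
    calc ∑ p, ∑ q, ∑ s, ‖φ y (p, q, s)‖ ^ 2
        ≤ ∑ p, ∑ q, ∑ s, encode y p ^ 2 * (encode y q ^ 2 * encode y s ^ 2) := by
          refine Finset.sum_le_sum fun p _ => Finset.sum_le_sum fun q _ =>
            Finset.sum_le_sum fun s _ => ?_
          simp only [hφ, Real.norm_eq_abs, sq_abs]
          split_ifs
          · rw [mul_pow, mul_pow, mul_assoc]
          · rw [zero_pow two_ne_zero]; positivity
      _ = (n * √n) ^ 2 := by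
          simp only [← Finset.mul_sum, ← Finset.sum_mul]
          rw [sum_encode_sq, mul_pow, Real.sq_sqrt hn0.le]; ring) (fun k => by
    simp only [he, hφ, mask3]
    split_ifs with hk
    · rw [integral_encode_mul_mul X hk.1 hk.2.1 hk.2.2, moment3]
    · simp) hs
  have heq : ∀ y : Fin m → Fin n → Fin ℓ, tnorm (mask3 (sampleM3 y - moment3 X)) =
      ‖(m : ℝ)⁻¹ • ∑ t, φ (y t) - e‖ := by
    intro y
    refine (sq_eq_sq₀ (tnorm_nonneg _) (norm_nonneg _)).mp ?_
    rw [tnorm_sq, EuclideanSpace.norm_sq_eq]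
    simp only [Fintype.sum_prod_type (α₁ := Idx n ℓ)]
    refine Finset.sum_congr rfl fun p _ => Finset.sum_congr rfl fun q _ =>
      Finset.sum_congr rfl fun s _ => ?_
    rw [Real.norm_eq_abs, sq_abs]
    congr 1
    simp only [hφ, he, mask3, sampleM3, Pi.sub_apply, PiLp.sub_apply,
      PiLp.smul_apply, smul_eq_mul, WithLp.ofLp_sum, Finset.sum_apply]
    split_ifs <;> simp
  simpa only [heq] using h

end Moments

/-! ### Divergence bounds for thresholded estimates and for mixtures. -/

section KullbackLeibler

/-- The Kullback–Leibler divergence on a finite space. -/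
lemma klDiv_eq_sum {Ω : Type*} [Fintype Ω] [MeasurableSpace Ω] [MeasurableSingletonClass Ω]
    {μ ν : Measure Ω} [IsProbabilityMeasure μ] [IsProbabilityMeasure ν] {p q : Ω → ℝ}
    (hp : ∀ x, 0 ≤ p x) (hq : ∀ x, 0 < q x) (hμ : ∀ x, μ {x} = ENNReal.ofReal (p x))
    (hν : ∀ x, ν {x} = ENNReal.ofReal (q x)) :
    InformationTheory.klDiv μ ν = ENNReal.ofReal (∑ x, p x * Real.log (p x / q x)) := by
  have hwd : μ = ν.withDensity fun x => ENNReal.ofReal (p x / q x) := by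
    refine Measure.ext_of_singleton fun x => ?_
    rw [withDensity_apply _ (measurableSet_singleton x), Measure.restrict_singleton,
      lintegral_smul_measure, lintegral_dirac, smul_eq_mul, hν, hμ,
      ← ENNReal.ofReal_mul (hq x).le, mul_div_cancel₀ _ (hq x).ne']
  have hac : μ ≪ ν := by rw [hwd]; exact withDensity_absolutelyContinuous _ _
  have hrn : ∀ x, μ.rnDeriv ν x = ENNReal.ofReal (p x / q x) := by
    intro x
    have h := Measure.rnDeriv_withDensity ν (f := fun x => ENNReal.ofReal (p x / q x)) .of_discrete
    rw [← hwd] at h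
    by_contra hne
    have h0 : ν {x} = 0 := measure_mono_null (Set.singleton_subset_iff.mpr hne) h
    rw [hν, ENNReal.ofReal_eq_zero] at h0
    exact absurd (hq x) (not_lt.mpr h0)
  rw [InformationTheory.klDiv_of_ac_of_integrable hac Integrable.of_finite,
    integral_fintype Integrable.of_finite]
  congr 1
  simp only [probReal_univ, add_sub_cancel_right]
  refine Finset.sum_congr rfl fun x _ => ?_
  rw [measureReal_def, hμ, ENNReal.toReal_ofReal (hp x), llr, hrn,
    ENNReal.toReal_ofReal (div_nonneg (hp x) (hq x).le), smul_eq_mul]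

/-- The log sum inequality. -/
lemma log_sum_le {ι : Type*} [Fintype ι] {a b : ι → ℝ} (ha : ∀ i, 0 ≤ a i) (hb : ∀ i, 0 < b i) :
    (∑ i, a i) * Real.log ((∑ i, a i) / ∑ i, b i) ≤ ∑ i, a i * Real.log (a i / b i) := by
  set A := ∑ i, a i with hA
  set B := ∑ i, b i with hB
  have hA0 : 0 ≤ A := Finset.sum_nonneg fun i _ => ha i
  rcases hA0.eq_or_lt with h0 | hpos
  · rw [← h0, zero_mul]
    have : ∀ i, a i = 0 := fun i =>
      (Finset.sum_eq_zero_iff_of_nonneg fun i _ => ha i).mp (hA ▸ h0.symm) i (Finset.mem_univ i)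
    simp [this]
  have hne : Nonempty ι := by
    by_contra h
    rw [not_nonempty_iff] at h
    rw [hA, Finset.univ_eq_empty, Finset.sum_empty] at hpos
    exact lt_irrefl _ hpos
  have hB0 : 0 < B := Finset.sum_pos (fun i _ => hb i) Finset.univ_nonempty
  -- The inequality `1 - 1/x ≤ log x` for `x` the quotient of `a i / b i` by `A / B`. Summed over
  -- `i`, the left sides cancel.
  have hterm : ∀ i, a i - b i * (A / B) ≤ a i * Real.log (a i / b i) - a i * Real.log (A / B) := by
    intro i
    rcases (ha i).eq_or_lt with h0 | hi
    · rw [← h0]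
      have := mul_pos (hb i) (div_pos hpos hB0)
      simp only [zero_mul]
      linarith
    · have h1 := Real.one_sub_inv_le_log_of_pos (div_pos (div_pos hi (hb i)) (div_pos hpos hB0))
      rw [Real.log_div (div_pos hi (hb i)).ne' (div_pos hpos hB0).ne'] at h1
      have h2 := mul_le_mul_of_nonneg_left h1 hi.le
      refine le_trans (le_of_eq ?_) (h2.trans_eq (mul_sub _ _ _))
      have := (hb i).ne'
      field_simp
  have hsum := Finset.sum_le_sum fun i (_ : i ∈ Finset.univ) => hterm i
  rw [Finset.sum_sub_distrib, Finset.sum_sub_distrib, ← Finset.sum_mul, ← Finset.sum_mul, ← hA, ← hB,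
    mul_div_cancel₀ _ hB0.ne'] at hsum
  linarith

section Threshold

variable {k : ℕ} {ε : ℝ} {u û : Fin k → ℝ}

lemma thresholdNormalize_eq (ε : ℝ) (û : Fin k → ℝ) (a : Fin k) :
    thresholdNormalize ε û a = max (û a) ε / ∑ b, max (û b) ε := by
  have h : ∀ b, (if ε ≤ û b then û b else ε) = max (û b) ε := fun b => by
    split_ifs with h
    · exact (max_eq_left h).symm
    · exact (max_eq_right (not_le.mp h).le).symm
  simp only [thresholdNormalize, h]

lemma thresholdNormalize_pos (hε : 0 < ε) (a : Fin k) : 0 < thresholdNormalize ε û a := by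
  have h : ∀ b, 0 < max (û b) ε := fun b => lt_max_of_lt_right hε
  rw [thresholdNormalize_eq]
  exact div_pos (h a) (Finset.sum_pos (fun b _ => h b) ⟨a, Finset.mem_univ a⟩)

lemma sum_thresholdNormalize (hε : 0 < ε) (hk : 0 < k) : ∑ a, thresholdNormalize ε û a = 1 := by
  have h : ∀ b, 0 < max (û b) ε := fun b => lt_max_of_lt_right hε
  simp only [thresholdNormalize_eq]
  rw [← Finset.sum_div, div_self]
  exact (Finset.sum_pos (fun b _ => h b) ⟨⟨0, hk⟩, Finset.mem_univ _⟩).ne'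

/-- Thresholding bounds the divergence linearly in the error. -/
lemma sum_log_thresholdNormalize_le (hε : 0 < ε) (σ : Equiv.Perm (Fin k)) (hu : ∀ a, 0 ≤ u a)
    (hsum : ∑ a, u a = 1) (h : ∀ a, |û (σ a) - u a| ≤ ε) :
    ∑ a, u a * Real.log (u a / thresholdNormalize ε û (σ a)) ≤ 3 * k * ε := by
  have hk : 0 < k := by
    rcases Nat.eq_zero_or_pos k with h0 | h0
    · subst h0; simp at hsum
    · exact h0
  have hpos : ∀ b, 0 < max (û b) ε := fun b => lt_max_of_lt_right hε
  have hle : ∀ a, max (û (σ a)) ε ≤ u a + ε := fun a =>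
    max_le (by linarith [(abs_le.mp (h a)).2]) (by linarith [hu a])
  have hge : ∀ a, u a - ε ≤ max (û (σ a)) ε := fun a =>
    le_max_of_le_left (by linarith [(abs_le.mp (h a)).1])
  set S := ∑ b, max (û b) ε with hS
  have hS0 : 0 < S := Finset.sum_pos (fun b _ => hpos b) ⟨⟨0, hk⟩, Finset.mem_univ _⟩
  have hS1 : S ≤ 1 + k * ε := by
    rw [hS, ← Equiv.sum_comp σ]
    refine (Finset.sum_le_sum fun a _ => hle a).trans_eq ?_
    rw [Finset.sum_add_distrib, hsum]; simp
  have hlogS : Real.log S ≤ k * ε := by linarith [Real.log_le_sub_one_of_pos hS0]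
  calc ∑ a, u a * Real.log (u a / thresholdNormalize ε û (σ a))
      ≤ ∑ a, (2 * ε + u a * Real.log S) := by
        refine Finset.sum_le_sum fun a _ => ?_
        rcases (hu a).eq_or_lt with h0 | h0
        · rw [← h0]; simp only [zero_mul]; linarith
        rw [thresholdNormalize_eq, div_div_eq_mul_div, mul_div_right_comm,
          Real.log_mul (div_pos h0 (hpos _)).ne' hS0.ne', mul_add]
        refine add_le_add_left ?_ _
        have h1 := Real.log_le_sub_one_of_pos (div_pos h0 (hpos (σ a)))
        set t := max (û (σ a)) ε with ht
        have htε : ε ≤ t := le_max_right _ _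
        have ht0 : 0 < t := hpos (σ a)
        have h2 : u a / t - 1 ≤ ε / t := by
          rw [div_sub_one ht0.ne']
          exact div_le_div_of_nonneg_right (by linarith [hge a]) ht0.le
        -- `u ≤ t + ε ≤ 2t` because the threshold forces `t ≥ ε`. Each entry thus costs at most
        -- `2ε`, and the normalization by `S ≤ 1 + kε` costs another `kε` in total.
        calc u a * Real.log (u a / t) ≤ u a * (ε / t) := by gcongr; linarith
          _ ≤ (2 * t) * (ε / t) := by gcongr; linarith [hge a]
          _ = 2 * ε := by field_simp
    _ = k * (2 * ε) + Real.log S := by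
        have : ∑ a, u a * Real.log S = Real.log S := by rw [← Finset.sum_mul, hsum, one_mul]
        rw [Finset.sum_add_distrib, this]; simp
    _ ≤ 3 * k * ε := by linarith

end Threshold

variable {r n ℓ : ℕ}

lemma sum_prod_mul (π : Fin n → Fin ℓ → ℝ) (hπ : ∀ i, ∑ j, π i j = 1) (i : Fin n) (h : Fin ℓ → ℝ) :
    ∑ y : Fin n → Fin ℓ, (∏ k, π k (y k)) * h (y i) = ∑ j, π i j * h j := by
  have h1 : ∀ y : Fin n → Fin ℓ, (∏ k, π k (y k)) * h (y i) =
      ∏ k, (π k (y k) * if k = i then h (y k) else 1) := by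
    intro y
    rw [Finset.prod_mul_distrib, Finset.prod_ite_eq' Finset.univ i]
    simp
  simp only [h1]
  have h2 := Finset.prod_univ_sum (fun _ : Fin n => (Finset.univ : Finset (Fin ℓ)))
    (fun k j => π k j * if k = i then h j else 1)
  rw [Fintype.piFinset_univ] at h2
  rw [← h2, ← Finset.mul_prod_erase _ _ (Finset.mem_univ i)]
  simp only [if_true]
  rw [Finset.prod_eq_one, mul_one]
  intro k hk
  simp [Finset.ne_of_mem_erase hk, hπ]

lemma sum_prod_eq_one (π : Fin n → Fin ℓ → ℝ) (hπ : ∀ i, ∑ j, π i j = 1) :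
    ∑ y : Fin n → Fin ℓ, ∏ k, π k (y k) = 1 := by
  have h2 := Finset.prod_univ_sum (fun _ : Fin n => (Finset.univ : Finset (Fin ℓ))) π
  rw [Fintype.piFinset_univ] at h2
  rw [← h2]
  exact Finset.prod_eq_one fun i _ => hπ i

/-- The divergence of mixtures is bounded by the divergences of the parameters. -/
lemma sum_pmf_log_le (X Y : ProductMixture r n ℓ) (σ : Equiv.Perm (Fin r))
    (hw : ∀ q, 0 < Y.weight q) (hp : ∀ q i j, 0 < Y.prob q i j) :
    ∑ y, pmf X y * Real.log (pmf X y / pmf Y y) ≤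
      ∑ q, X.weight q * Real.log (X.weight q / Y.weight (σ q)) +
        ∑ q, X.weight q * ∑ i, ∑ j, X.prob q i j *
          Real.log (X.prob q i j / Y.prob (σ q) i j) := by
  have hYσ : ∀ y, pmf Y y = ∑ q, Y.weight (σ q) * ∏ i, Y.prob (σ q) i (y i) := fun y =>
    (Equiv.sum_comp σ fun q => Y.weight q * ∏ i, Y.prob q i (y i)).symm
  have hterm : ∀ q (y : Fin n → Fin ℓ), X.weight q * (∏ i, X.prob q i (y i)) *
      Real.log (X.weight q * (∏ i, X.prob q i (y i)) /
        (Y.weight (σ q) * ∏ i, Y.prob (σ q) i (y i))) =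
      X.weight q * ((∏ i, X.prob q i (y i)) * Real.log (X.weight q / Y.weight (σ q)) +
        ∑ i, (∏ k, X.prob q k (y k)) * Real.log (X.prob q i (y i) / Y.prob (σ q) i (y i))) := by
    intro q y
    -- Terms of probability zero vanish on both sides; otherwise all factors are nonzero and the
    -- logarithm of the product splits.
    by_cases h0 : X.weight q * ∏ i, X.prob q i (y i) = 0
    · rw [← Finset.mul_sum, ← mul_add, ← mul_assoc, h0, zero_mul, zero_mul]
    obtain ⟨h1, h2⟩ := mul_ne_zero_iff.mp h0
    rw [mul_div_mul_comm, ← Finset.prod_div_distrib, ← Finset.mul_sum, ← mul_add, mul_assoc]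
    congr 2
    rw [Finset.prod_ne_zero_iff] at h2
    have h3 : ∀ i ∈ Finset.univ, X.prob q i (y i) / Y.prob (σ q) i (y i) ≠ 0 := fun i hi =>
      div_ne_zero (h2 i hi) (hp _ _ _).ne'
    rw [Real.log_mul (div_ne_zero h1 (hw _).ne') (Finset.prod_ne_zero_iff.mpr h3), Real.log_prod h3]
  calc ∑ y, pmf X y * Real.log (pmf X y / pmf Y y)
      ≤ ∑ y : Fin n → Fin ℓ, ∑ q, X.weight q * (∏ i, X.prob q i (y i)) *
          Real.log (X.weight q * (∏ i, X.prob q i (y i)) /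
            (Y.weight (σ q) * ∏ i, Y.prob (σ q) i (y i))) := by
        refine Finset.sum_le_sum fun y _ => ?_
        rw [hYσ y]
        exact log_sum_le (fun q => mul_nonneg (X.weight_nonneg q)
          (Finset.prod_nonneg fun i _ => X.prob_nonneg q i _))
          (fun q => mul_pos (hw _) (Finset.prod_pos fun i _ => hp _ _ _))
    _ = ∑ q, X.weight q * (Real.log (X.weight q / Y.weight (σ q)) + ∑ i, ∑ j, X.prob q i j *
          Real.log (X.prob q i j / Y.prob (σ q) i j)) := by
        rw [Finset.sum_comm]
        refine Finset.sum_congr rfl fun q _ => ?_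
        simp only [hterm]
        rw [← Finset.mul_sum, Finset.sum_add_distrib, ← Finset.sum_mul,
          sum_prod_eq_one _ (X.prob_sum q), one_mul, Finset.sum_comm]
        congr 2
        refine Finset.sum_congr rfl fun i _ => ?_
        exact sum_prod_mul _ (X.prob_sum q) i fun j => Real.log (X.prob q i j / Y.prob (σ q) i j)
    _ = _ := by simp only [mul_add, Finset.sum_add_distrib]

/-- The divergence after post-processing of approximate parameters. -/
theorem exists_mixture_klDiv_le (X : ProductMixture r n ℓ) {w : Fin r → ℝ}
    {p : Fin r → Fin n → Fin ℓ → ℝ} {εw επ : ℝ} (hεw : 0 < εw) (hεπ : 0 < επ)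
    (σ : Equiv.Perm (Fin r)) (hw : ∀ q, |w (σ q) - X.weight q| ≤ εw)
    (hp : ∀ q i j, |p (σ q) i j - X.prob q i j| ≤ επ) :
    ∃ Y : ProductMixture r n ℓ, Y.weight = thresholdNormalize εw w ∧
      (∀ q i, Y.prob q i = thresholdNormalize επ (p q i)) ∧
      InformationTheory.klDiv X.law Y.law ≤ ENNReal.ofReal (3 * r * εw + 3 * n * ℓ * επ) := by
  have hr : 0 < r := by
    rcases Nat.eq_zero_or_pos r with h0 | h0
    · subst h0; have := X.weight_sum; simp at this
    · exact h0
  have hℓ : ∀ _ : Fin n, 0 < ℓ := by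
    intro i
    rcases Nat.eq_zero_or_pos ℓ with h0 | h0
    · subst h0; have := X.prob_sum ⟨0, hr⟩ i; simp at this
    · exact h0
  let Y : ProductMixture r n ℓ :=
    { weight := thresholdNormalize εw w
      prob := fun q i => thresholdNormalize επ (p q i)
      weight_nonneg := fun q => (thresholdNormalize_pos hεw q).le
      weight_sum := sum_thresholdNormalize hεw hr
      prob_nonneg := fun q i j => (thresholdNormalize_pos hεπ j).le
      prob_sum := fun q i => sum_thresholdNormalize hεπ (hℓ i) }
  refine ⟨Y, rfl, fun _ _ => rfl, ?_⟩
  have hYw : ∀ q, 0 < Y.weight q := thresholdNormalize_pos hεw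
  have hYp : ∀ q i j, 0 < Y.prob q i j := fun q i => thresholdNormalize_pos hεπ
  have hpos : ∀ y, 0 < pmf Y y := fun y =>
    Finset.sum_pos (fun q _ => mul_pos (hYw q) (Finset.prod_pos fun i _ => hYp q i _))
      ⟨⟨0, hr⟩, Finset.mem_univ _⟩
  rw [klDiv_eq_sum (pmf_nonneg X) hpos (law_singleton X) (law_singleton Y)]
  refine ENNReal.ofReal_le_ofReal ((sum_pmf_log_le X Y σ hYw hYp).trans (add_le_add ?_ ?_))
  · exact sum_log_thresholdNormalize_le hεw σ X.weight_nonneg X.weight_sum hw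
  · calc ∑ q, X.weight q * ∑ i, ∑ j, X.prob q i j * Real.log (X.prob q i j / Y.prob (σ q) i j)
        ≤ ∑ q, X.weight q * ∑ _i : Fin n, 3 * ℓ * επ := by
          refine Finset.sum_le_sum fun q _ => mul_le_mul_of_nonneg_left ?_ (X.weight_nonneg q)
          refine Finset.sum_le_sum fun i _ => ?_
          exact sum_log_thresholdNormalize_le hεπ (Equiv.refl _) (X.prob_nonneg q i) (X.prob_sum q i)
            (hp q i)
      _ = 3 * n * ℓ * επ := by
          rw [← Finset.sum_mul, X.weight_sum, Finset.sum_const, Finset.card_univ, Fintype.card_fin,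
            nsmul_eq_mul]; ring

end KullbackLeibler

/-! ### Relations between the parameters of a mixture. -/

section MixtureFacts

variable {r n ℓ : ℕ} (X : ProductMixture r n ℓ)

/-- The factor `Π W^{1/2}` of the second moment. -/
noncomputable def factor (X : ProductMixture r n ℓ) : Matrix (Idx n ℓ) (Fin r) ℝ :=
  X.Pi * Matrix.diagonal fun q => √(X.weight q)

/-- The diagonal tensor with entries `w_q^{-1/2}`. -/
noncomputable def weightTensor (X : ProductMixture r n ℓ) : Tensor3 (Fin r) := fun a b c =>
  if a = b ∧ b = c then (√(X.weight a))⁻¹ else 0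

lemma factor_apply (p : Idx n ℓ) (q : Fin r) : factor X p q = X.prob q p.1 p.2 * √(X.weight q) := by
  rw [factor, Matrix.mul_diagonal]; rfl

lemma M2_eq_factor : X.M2 = factor X * (factor X)ᵀ := by
  rw [factor, transpose_mul, diagonal_transpose, Matrix.mul_assoc, ← Matrix.mul_assoc (diagonal _),
    diagonal_mul_diagonal, ProductMixture.M2, ← Matrix.mul_assoc]
  simp only [Real.mul_self_sqrt (X.weight_nonneg _)]

lemma M2_apply (p q : Idx n ℓ) :
    X.M2 p q = ∑ k, X.weight k * (X.prob k p.1 p.2 * X.prob k q.1 q.2) := by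
  rw [M2_eq_factor, Matrix.mul_apply]
  refine Finset.sum_congr rfl fun k _ => ?_
  rw [Matrix.transpose_apply, factor_apply, factor_apply]
  have := Real.mul_self_sqrt (X.weight_nonneg k)
  calc _ = (√(X.weight k) * √(X.weight k)) * (X.prob k p.1 p.2 * X.prob k q.1 q.2) := by ring
    _ = _ := by rw [this]

lemma M2_transpose : X.M2ᵀ = X.M2 := by rw [M2_eq_factor, transpose_mul, transpose_transpose]

lemma M2_nonneg (x : Idx n ℓ → ℝ) : 0 ≤ x ⬝ᵥ (X.M2 *ᵥ x) := by
  rw [M2_eq_factor, ← mulVec_mulVec, dotProduct_mulVec, ← mulVec_transpose]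
  exact dot_self_nonneg _

lemma moment3_eq (hw : ∀ q, 0 < X.weight q) : moment3 X = tensorApply (weightTensor X) (factor X)ᵀ := by
  funext p q s
  rw [moment3, tensorApply]
  refine Finset.sum_congr rfl fun k _ => ?_
  rw [Finset.sum_eq_single k, Finset.sum_eq_single k]
  · simp only [weightTensor, and_self, if_true, Matrix.transpose_apply, factor_apply,
      ProductMixture.Pi, Matrix.of_apply]
    have h1 := Real.mul_self_sqrt (hw k).le
    have h2 := (Real.sqrt_pos.mpr (hw k)).ne'
    calc X.weight k * X.prob k p.1 p.2 * X.prob k q.1 q.2 * X.prob k s.1 s.2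
        = (√(X.weight k) * √(X.weight k)) * X.prob k p.1 p.2 * X.prob k q.1 q.2 * X.prob k s.1 s.2 := by
          rw [h1]
      _ = _ := by field_simp
  · intro c _ hc; simp [weightTensor, hc.symm]
  · simp
  · intro b _ hb
    exact Finset.sum_eq_zero fun c _ => by simp [weightTensor, hb.symm]
  · simp

lemma tnorm_weightTensor_le {w : ℝ} (hw0 : 0 < w) (hw : ∀ q, w ≤ X.weight q) :
    tnorm (weightTensor X) ≤ √r / √w := by
  refine le_of_sq_le_sq ?_ (by positivity)
  rw [tnorm_sq, div_pow, Real.sq_sqrt (Nat.cast_nonneg r), Real.sq_sqrt hw0.le]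
  calc ∑ a, ∑ b, ∑ c, weightTensor X a b c ^ 2 = ∑ a, (√(X.weight a))⁻¹ ^ 2 := by
        refine Finset.sum_congr rfl fun a _ => ?_
        rw [Finset.sum_eq_single a, Finset.sum_eq_single a]
        · simp [weightTensor]
        · intro c _ hc; simp [weightTensor, hc.symm]
        · simp
        · intro b _ hb
          exact Finset.sum_eq_zero fun c _ => by simp [weightTensor, hb.symm]
        · simp
    _ ≤ ∑ _a : Fin r, w⁻¹ := by
        refine Finset.sum_le_sum fun a _ => ?_
        rw [inv_pow, Real.sq_sqrt (X.weight_nonneg a)]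
        exact inv_anti₀ hw0 (hw a)
    _ = r / w := by simp [div_eq_mul_inv]

lemma prob_le_one (q : Fin r) (i : Fin n) (j : Fin ℓ) : X.prob q i j ≤ 1 := by
  rw [← X.prob_sum q i]
  exact Finset.single_le_sum (fun j _ => X.prob_nonneg q i j) (Finset.mem_univ j)

lemma trace_M2_le : X.M2.trace ≤ n := by
  rw [Matrix.trace]
  simp only [Matrix.diag_apply, M2_apply]
  rw [Finset.sum_comm]
  calc ∑ k, ∑ p : Idx n ℓ, X.weight k * (X.prob k p.1 p.2 * X.prob k p.1 p.2)
      ≤ ∑ k, X.weight k * n := by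
        refine Finset.sum_le_sum fun k _ => ?_
        rw [← Finset.mul_sum]
        refine mul_le_mul_of_nonneg_left ?_ (X.weight_nonneg k)
        rw [Fintype.sum_prod_type]
        calc ∑ i, ∑ j, X.prob k i j * X.prob k i j ≤ ∑ i, ∑ j, X.prob k i j :=
              Finset.sum_le_sum fun i _ => Finset.sum_le_sum fun j _ =>
                mul_le_of_le_one_left (X.prob_nonneg k i j) (prob_le_one X k i j)
          _ = n := by simp [X.prob_sum]
    _ = n := by rw [← Finset.sum_mul, X.weight_sum, one_mul]

/-- Since the all ones vector has squared norm `n ℓ`, this gives the lower bound `σ₁ ≥ n / ℓ`. -/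
lemma ones_dot_M2 : (fun _ => (1 : ℝ)) ⬝ᵥ (X.M2 *ᵥ fun _ => 1) = (n : ℝ) ^ 2 := by
  simp only [dotProduct, Matrix.mulVec, M2_apply, one_mul, mul_one]
  rw [Finset.sum_congr rfl fun _ _ => Finset.sum_comm, Finset.sum_comm]
  have h : ∀ k, ∑ p : Idx n ℓ, X.prob k p.1 p.2 = n := fun k => by
    rw [Fintype.sum_prod_type]; simp [X.prob_sum]
  calc ∑ k, ∑ p : Idx n ℓ, ∑ q : Idx n ℓ, X.weight k * (X.prob k p.1 p.2 * X.prob k q.1 q.2)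
      = ∑ k, X.weight k * (n : ℝ) ^ 2 := by
        refine Finset.sum_congr rfl fun k _ => ?_
        simp only [← Finset.mul_sum]
        rw [← Finset.sum_mul, h, sq]
    _ = (n : ℝ) ^ 2 := by rw [← Finset.sum_mul, X.weight_sum, one_mul]

/-- Bounds for the parameters of a mixture. -/
structure ParamBounds (r n ℓ : ℕ) (σ₁ σᵣ μ w wmax : ℝ) : Prop where
  one_le_r : 1 ≤ r
  one_le_n : 1 ≤ n
  one_le_l : 1 ≤ ℓ
  σᵣ_pos : 0 < σᵣ
  σᵣ_le : σᵣ ≤ σ₁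
  r_mul_σᵣ : r * σᵣ ≤ n
  n_le_σ₁ : n ≤ σ₁ * ℓ
  μ_pos : 0 < μ
  one_le_μ : 1 ≤ μ ^ 2 * r
  w_pos : 0 < w
  w_le_one : w ≤ 1
  w_le : w ≤ wmax
  one_le_wmax : 1 ≤ r * wmax
  n_ge : 4096 * σ₁ ^ 4 * μ ^ 4 * r ^ 3 ≤ n * σᵣ ^ 4
  r_le : (r : ℝ) ^ 3 ≤ n ^ 2
  two_le_n : (2 : ℝ) ≤ n

/-- The squared Frobenius norm of `U` is `r`, and each of its `n` blocks contributes at most `b² r`.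
With `b = μ √(r/n)` this forces `μ² r ≥ 1`. -/
lemma IncoherentFactorization.card_le {M : Matrix (Idx n ℓ) (Idx n ℓ) ℝ} {U : Matrix (Idx n ℓ) (Fin r) ℝ}
    {K : Matrix (Fin r) (Fin r) ℝ} {σ₁ σᵣ b : ℝ} (h : IncoherentFactorization M U K σ₁ σᵣ b) :
    (r : ℝ) ≤ n * (b ^ 2 * r) := by
  have h1 : frobSq U = r := by rw [frobSq_eq_trace, h.orth, Matrix.trace_one]; simp
  have h2 : frobSq (1 : Matrix (Fin r) (Fin r) ℝ) = r := by
    rw [frobSq_eq_trace]; simp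
  rw [frobSq_eq_sum_rowBlock] at h1
  refine h1.symm.trans_le ((Finset.sum_le_sum (g := fun _ => b ^ 2 * (r : ℝ)) fun i _ => ?_).trans_eq
    (by simp))
  have h3 := fro_mul_le (rowBlock U i) (1 : Matrix (Fin r) (Fin r) ℝ)
  rw [Matrix.mul_one] at h3
  have h4 := pow_le_pow_left₀ (fro_nonneg _) h3 2
  rw [mul_pow, fro_sq, fro_sq, h2] at h4
  exact h4.trans (mul_le_mul_of_nonneg_right
    (pow_le_pow_left₀ (norm_nonneg _) (h.block_le i) 2) (Nat.cast_nonneg r))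

/-- Collects what later estimates need from the spectrum and the lower bound on `n`, in particular
with integer exponents in place of `4.5` and `3.5`. -/
lemma exists_paramBounds {μ σ₁ σᵣ w wmax C₀ : ℝ} (hσ₁ : σ₁ = sigma X.M2 1) (hσᵣ : σᵣ = sigma X.M2 r)
    (hw : w = ⨅ q, X.weight q) (hwmax : wmax = ⨆ q, X.weight q) (hw0 : 0 < w) (hσ : 0 < σᵣ)
    (hinc : IsBlockIncoherent r X.M2 μ) (hC₀ : 4096 ≤ C₀)
    (hn : C₀ * σ₁ ^ (4.5 : ℝ) * μ ^ 4 * (r : ℝ) ^ (3.5 : ℝ) / σᵣ ^ (4.5 : ℝ) ≤ n) :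
    ParamBounds r n ℓ σ₁ σᵣ μ w wmax ∧ r ≤ n * ℓ ∧ (∀ q, w ≤ X.weight q) ∧ σ₁ ≤ fro X.M2 ∧
      ∃ (U : Matrix (Idx n ℓ) (Fin r) ℝ) (K : Matrix (Fin r) (Fin r) ℝ),
        IncoherentFactorization X.M2 U K σ₁ σᵣ (μ * √((r : ℝ) / n)) := by
  have hr : 1 ≤ r := by
    rcases Nat.eq_zero_or_pos r with h0 | h0
    · subst h0; have := X.weight_sum; simp at this
    · exact h0
  have hr1 : (1 : ℝ) ≤ r := by exact_mod_cast hr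
  have hr0 : (0 : ℝ) < r := by linarith
  have : Nonempty (Fin r) := ⟨⟨0, hr⟩⟩
  have hbb : BddBelow (Set.range X.weight) := Set.finite_range _ |>.bddBelow
  have hba : BddAbove (Set.range X.weight) := Set.finite_range _ |>.bddAbove
  have hwq : ∀ q, w ≤ X.weight q := fun q => hw ▸ ciInf_le hbb q
  have hwq' : ∀ q, X.weight q ≤ wmax := fun q => hwmax ▸ le_ciSup hba q
  -- The sign of `μ` is not assumed: it follows from the norm of any block, and for `n = 0` the
  -- square root is `0` by the convention for division.
  have hμb : 0 ≤ μ * √((r : ℝ) / n) := by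
    rcases Nat.eq_zero_or_pos n with h0 | h0
    · subst h0; simp
    · obtain ⟨U, s, V, -, hblk⟩ := hinc
      exact (norm_nonneg _).trans (hblk ⟨0, h0⟩)
  obtain ⟨hrn, ⟨U, K, h⟩, hfro, htr, hquad⟩ := exists_incoherentFactorization (M2_transpose X)
    (M2_nonneg X) hr (hσᵣ ▸ hσ) hinc hμb
  rw [← hσ₁] at h hfro hquad
  rw [← hσᵣ] at h htr
  have hn1 : 1 ≤ n := by
    rcases Nat.eq_zero_or_pos n with h0 | h0
    · rw [h0] at hrn; omega
    · exact h0
  have hℓ1 : 1 ≤ ℓ := by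
    rcases Nat.eq_zero_or_pos ℓ with h0 | h0
    · rw [h0] at hrn; omega
    · exact h0
  have hn0 : (0 : ℝ) < n := by exact_mod_cast hn1
  have hle := h.le
  have hσ₁0 : 0 < σ₁ := hσ.trans_le hle
  have hμr : 1 ≤ μ ^ 2 * r := by
    have h1 := h.card_le
    rw [mul_pow, Real.sq_sqrt (by positivity)] at h1
    have h2 : (n : ℝ) * (μ ^ 2 * (r / n) * r) = (μ ^ 2 * r) * r := by field_simp
    rw [h2] at h1
    by_contra! hlt
    have : μ ^ 2 * r * r < 1 * r := by gcongr
    linarith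
  have hμ0 : 0 < μ := by
    have h1 : 0 < √((r : ℝ) / n) := Real.sqrt_pos.mpr (by positivity)
    have h2 : 0 ≤ μ := nonneg_of_mul_nonneg_left hμb h1
    rcases h2.eq_or_lt with h3 | h3
    · rw [← h3] at hμr; norm_num at hμr
    · exact h3
  set κ := σ₁ / σᵣ with hκ
  have hκ1 : 1 ≤ κ := (one_le_div hσ).mpr hle
  have hn' : 4096 * κ ^ 4 * μ ^ 4 * (r : ℝ) ^ (3.5 : ℝ) ≤ n := by
    refine le_trans ?_ hn
    have h1 : C₀ * σ₁ ^ (4.5 : ℝ) * μ ^ 4 * (r : ℝ) ^ (3.5 : ℝ) / σᵣ ^ (4.5 : ℝ) =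
        C₀ * κ ^ (4.5 : ℝ) * μ ^ 4 * (r : ℝ) ^ (3.5 : ℝ) := by
      rw [hκ, Real.div_rpow hσ₁0.le hσ.le]; ring
    rw [h1]
    have h2 : κ ^ 4 ≤ κ ^ (4.5 : ℝ) := by
      rw [← Real.rpow_natCast]
      exact Real.rpow_le_rpow_of_exponent_le hκ1 (by norm_num)
    gcongr
  have hr35 : (r : ℝ) ^ 3 ≤ (r : ℝ) ^ (3.5 : ℝ) := by
    rw [← Real.rpow_natCast]
    exact Real.rpow_le_rpow_of_exponent_le hr1 (by norm_num)
  have hμ4 : 1 ≤ μ ^ 4 * r ^ 2 := by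
    have : μ ^ 4 * (r : ℝ) ^ 2 = (μ ^ 2 * r) ^ 2 := by ring
    rw [this]; exact one_le_pow₀ hμr
  have hκ4 : 1 ≤ κ ^ 4 := one_le_pow₀ hκ1
  have hr15 : (r : ℝ) ^ (1.5 : ℝ) * 4096 ≤ n := by
    refine le_trans ?_ hn'
    have h1 : (r : ℝ) ^ (3.5 : ℝ) = r ^ (1.5 : ℝ) * r ^ 2 := by
      rw [← Real.rpow_natCast, ← Real.rpow_add hr0]; norm_num
    rw [h1]
    have h2 : (0 : ℝ) ≤ r ^ (1.5 : ℝ) := by positivity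
    calc (r : ℝ) ^ (1.5 : ℝ) * 4096 = 4096 * 1 * 1 * r ^ (1.5 : ℝ) := by ring
      _ ≤ 4096 * κ ^ 4 * (μ ^ 4 * r ^ 2) * r ^ (1.5 : ℝ) := by gcongr
      _ = 4096 * κ ^ 4 * μ ^ 4 * (r ^ (1.5 : ℝ) * r ^ 2) := by ring
  have hr15' : 1 ≤ (r : ℝ) ^ (1.5 : ℝ) := Real.one_le_rpow hr1 (by norm_num)
  refine ⟨⟨hr, hn1, hℓ1, hσ, hle, htr.trans (trace_M2_le X), ?_, hμ0, hμr, hw0, ?_, ?_, ?_, ?_, ?_, ?_⟩,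
    hrn, hwq, hfro, U, K, h⟩
  · have h1 := hquad fun _ => 1
    rw [ones_dot_M2] at h1
    have h2 : ((fun _ => (1 : ℝ)) ⬝ᵥ fun _ : Idx n ℓ => (1 : ℝ)) = n * ℓ := by
      simp [dotProduct]
    rw [h2] at h1
    by_contra! hlt
    have : σ₁ * ℓ * n < n * n := by gcongr
    nlinarith
  · calc w ≤ X.weight ⟨0, hr⟩ := hwq _
      _ ≤ ∑ q, X.weight q := Finset.single_le_sum (fun q _ => X.weight_nonneg q) (Finset.mem_univ _)
      _ = 1 := X.weight_sum
  · exact (hwq ⟨0, hr⟩).trans (hwq' _)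
  · rw [← X.weight_sum]
    refine (Finset.sum_le_sum fun q _ => hwq' q).trans_eq (by simp)
  · have h1 : 4096 * κ ^ 4 * μ ^ 4 * (r : ℝ) ^ 3 ≤ n := le_trans (by gcongr) hn'
    have h2 : 4096 * σ₁ ^ 4 * μ ^ 4 * (r : ℝ) ^ 3 = 4096 * κ ^ 4 * μ ^ 4 * (r : ℝ) ^ 3 * σᵣ ^ 4 := by
      rw [hκ, div_pow]; field_simp
    rw [h2]
    gcongr
  · have h1 : (r : ℝ) ^ 3 = ((r : ℝ) ^ (1.5 : ℝ)) ^ 2 := by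
      rw [← Real.rpow_natCast, ← Real.rpow_natCast, ← Real.rpow_mul hr0.le]; norm_num
    rw [h1]
    exact pow_le_pow_left₀ (by positivity) (by linarith) 2
  · linarith

end MixtureFacts

/-! ### Numerical consequences of the choice of accuracy and sample size. -/

namespace ParamBounds

variable {r n ℓ m : ℕ} {σ₁ σᵣ μ w wmax ε η δ : ℝ}

lemma one_le_r' (h : ParamBounds r n ℓ σ₁ σᵣ μ w wmax) : (1 : ℝ) ≤ r := by exact_mod_cast h.one_le_r

lemma one_le_n' (h : ParamBounds r n ℓ σ₁ σᵣ μ w wmax) : (1 : ℝ) ≤ n := by exact_mod_cast h.one_le_n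

lemma one_le_l' (h : ParamBounds r n ℓ σ₁ σᵣ μ w wmax) : (1 : ℝ) ≤ ℓ := by exact_mod_cast h.one_le_l

lemma σ₁_pos (h : ParamBounds r n ℓ σ₁ σᵣ μ w wmax) : 0 < σ₁ := h.σᵣ_pos.trans_le h.σᵣ_le

lemma wmax_pos (h : ParamBounds r n ℓ σ₁ σᵣ μ w wmax) : 0 < wmax := h.w_pos.trans_le h.w_le

lemma σᵣ_le_n (h : ParamBounds r n ℓ σ₁ σᵣ μ w wmax) : σᵣ ≤ n :=
  (le_mul_of_one_le_left h.σᵣ_pos.le h.one_le_r').trans h.r_mul_σᵣ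

lemma r_le_n (h : ParamBounds r n ℓ σ₁ σᵣ μ w wmax) : (r : ℝ) ≤ n := by
  refine le_of_sq_le_sq ((pow_le_pow_right₀ h.one_le_r' (by norm_num)).trans h.r_le) (by positivity)

/-- From `σ₁ ℓ ≥ n ≥ 1` and `r w_max ≥ 1`. The factor can therefore be dropped from the denominator
of `ε⋆` when only powers of `n` matter. -/
lemma one_le_l_mul (h : ParamBounds r n ℓ σ₁ σᵣ μ w wmax) : 1 ≤ (ℓ : ℝ) ^ 6 * √(σ₁ * wmax * r) := by
  have hℓ := h.one_le_l'
  have hn := h.one_le_n'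
  have hσ := h.σ₁_pos
  have hw := h.wmax_pos
  have h1 : 1 ≤ (ℓ : ℝ) * √(σ₁ * wmax * r) := by
    refine le_of_sq_le_sq ?_ (by positivity)
    rw [mul_pow, Real.sq_sqrt (by positivity)]
    have h2 : 1 ≤ σ₁ * ℓ := hn.trans h.n_le_σ₁
    have h3 := h.one_le_wmax
    calc (1 : ℝ) ^ 2 = 1 * 1 * 1 := by norm_num
      _ ≤ ℓ * (σ₁ * ℓ) * (r * wmax) := by gcongr
      _ = ℓ ^ 2 * (σ₁ * wmax * r) := by ring
  refine h1.trans (mul_le_mul_of_nonneg_right ?_ (Real.sqrt_nonneg _))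
  exact le_self_pow₀ hℓ (by norm_num)

lemma sqrt_w_le_one (h : ParamBounds r n ℓ σ₁ σᵣ μ w wmax) : √w ≤ 1 := by
  rw [← Real.sqrt_one]; exact Real.sqrt_le_sqrt h.w_le_one

/-- The accuracy is small compared with all parameters. -/
lemma accuracy_le (h : ParamBounds r n ℓ σ₁ σᵣ μ w wmax)
    (hε : ε ≤ 1 / 100000 * η ^ 2 * min (√w / ((n : ℝ) ^ 2 * (ℓ : ℝ) ^ 6 * √(σ₁ * wmax * r))) η) :
    ε * (100000 * (n ^ 2 * (ℓ ^ 6 * √(σ₁ * wmax * r)))) ≤ η ^ 2 * √w := by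
  have hQ : 0 < (ℓ : ℝ) ^ 6 * √(σ₁ * wmax * r) := lt_of_lt_of_le one_pos h.one_le_l_mul
  have hn := h.one_le_n'
  set Q := (ℓ : ℝ) ^ 6 * √(σ₁ * wmax * r) with hQd
  have h1 : ε ≤ 1 / 100000 * η ^ 2 * (√w / (n ^ 2 * Q)) := by
    refine hε.trans ?_
    rw [hQd, ← mul_assoc]
    gcongr
    exact min_le_left _ _
  calc ε * (100000 * (n ^ 2 * Q)) ≤ 1 / 100000 * η ^ 2 * (√w / (n ^ 2 * Q)) * (100000 * (n ^ 2 * Q)) := by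
        gcongr
    _ = η ^ 2 * √w := by field_simp

lemma accuracy_n (h : ParamBounds r n ℓ σ₁ σᵣ μ w wmax) (hη0 : 0 < η) (hη1 : η < 1) (hε0 : 0 < ε)
    (hε : ε ≤ 1 / 100000 * η ^ 2 * min (√w / ((n : ℝ) ^ 2 * (ℓ : ℝ) ^ 6 * √(σ₁ * wmax * r))) η) :
    ε * (100000 * n ^ 2) ≤ η * √w := by
  calc ε * (100000 * n ^ 2) = ε * (100000 * (n ^ 2 * 1)) := by ring
    _ ≤ ε * (100000 * (n ^ 2 * (ℓ ^ 6 * √(σ₁ * wmax * r)))) := by gcongr; exact h.one_le_l_mul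
    _ ≤ η ^ 2 * √w := h.accuracy_le hε
    _ ≤ η * √w := by gcongr; nlinarith

lemma accuracy_r (h : ParamBounds r n ℓ σ₁ σᵣ μ w wmax) (hη0 : 0 < η) (hη1 : η < 1) (hε0 : 0 < ε)
    (hε : ε ≤ 1 / 100000 * η ^ 2 * min (√w / ((n : ℝ) ^ 2 * (ℓ : ℝ) ^ 6 * √(σ₁ * wmax * r))) η) :
    ε * (100000 * r ^ 3) ≤ √w := by
  have h1 := h.accuracy_n hη0 hη1 hε0 hε
  have h2 := h.r_le
  have h3 : η * √w ≤ √w := mul_le_of_le_one_left (Real.sqrt_nonneg _) hη1.le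
  refine le_trans ?_ (h1.trans h3)
  gcongr

/-- The left side is the bound of `exists_mixture_klDiv_le` at the two thresholds; the weights and
the coordinates receive `η / 2` each. -/
lemma divergence_le (h : ParamBounds r n ℓ σ₁ σᵣ μ w wmax) (hη0 : 0 < η) (hη1 : η < 1) (hε0 : 0 < ε)
    (hε : ε ≤ 1 / 100000 * η ^ 2 * min (√w / ((n : ℝ) ^ 2 * (ℓ : ℝ) ^ 6 * √(σ₁ * wmax * r))) η) :
    3 * r * (18 * ε / √w) + 3 * n * ℓ * (18 * ε * √(σ₁ * r * (1 + ε * σᵣ) / w)) ≤ η := by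
  have hr := h.one_le_r'
  have hn := h.one_le_n'
  have hℓ := h.one_le_l'
  have hσ := h.σᵣ_pos
  have hσ₁ := h.σ₁_pos
  have hw0 := h.w_pos
  have hwm := h.wmax_pos
  have hsw : 0 < √w := Real.sqrt_pos.mpr hw0
  have hsw1 := h.sqrt_w_le_one
  have h1 := h.accuracy_n hη0 hη1 hε0 hε
  have h2 := h.accuracy_le hε
  have hrn := h.r_le_n
  have hηw : 0 < η * √w := by positivity
  have hnn : (n : ℝ) ≤ n ^ 2 := le_self_pow₀ hn (by norm_num)
  have e1 : 3 * r * (18 * ε / √w) ≤ η / 2 := by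
    have : 3 * r * (18 * ε / √w) = 54 * (ε * r) / √w := by ring
    rw [this, div_le_iff₀ hsw]
    have : ε * r ≤ ε * n ^ 2 := by gcongr; linarith
    linarith
  have hεσ : ε * σᵣ ≤ 1 := by
    have h3 : ε * σᵣ ≤ ε * n ^ 2 := by gcongr; exact h.σᵣ_le_n.trans hnn
    have h4 : η * √w ≤ 1 := mul_le_one₀ hη1.le hsw.le hsw1
    nlinarith
  set Q := √(σ₁ * wmax * r) with hQ
  have hroot : √(σ₁ * r * (1 + ε * σᵣ) / w) ≤ 2 * Q * r / √w := by
    refine le_of_sq_le_sq ?_ (by positivity)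
    rw [Real.sq_sqrt (by positivity), div_pow, mul_pow, mul_pow, Real.sq_sqrt hw0.le, hQ,
      Real.sq_sqrt (by positivity)]
    refine div_le_div_of_nonneg_right ?_ hw0.le
    calc σ₁ * r * (1 + ε * σᵣ) ≤ σ₁ * r * 2 := by gcongr; linarith
      _ = σ₁ * r * 2 * 1 * 1 := by ring
      _ ≤ σ₁ * r * 2 * (r * wmax) * (2 * r) := by gcongr; exacts [h.one_le_wmax, by linarith]
      _ = 2 ^ 2 * (σ₁ * wmax * r) * r ^ 2 := by ring
  have e2 : 3 * n * ℓ * (18 * ε * √(σ₁ * r * (1 + ε * σᵣ) / w)) ≤ η / 2 := by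
    calc 3 * n * ℓ * (18 * ε * √(σ₁ * r * (1 + ε * σᵣ) / w))
        ≤ 3 * n * ℓ * (18 * ε * (2 * Q * n / √w)) := by
          gcongr
          exact hroot.trans (by gcongr)
      _ = 108 * (ε * (n ^ 2 * (ℓ * Q))) / √w := by ring
      _ ≤ η / 2 := by
          rw [div_le_iff₀ hsw]
          have h3 : ε * (n ^ 2 * (ℓ * Q)) ≤ ε * (n ^ 2 * (ℓ ^ 6 * Q)) := by
            gcongr; exact le_self_pow₀ hℓ (by norm_num)
          have h4 : η ^ 2 * √w ≤ η * √w := by gcongr; nlinarith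
          linarith
  linarith

lemma one_le_mu_r (h : ParamBounds r n ℓ σ₁ σᵣ μ w wmax) : 1 ≤ μ ^ 6 * (r : ℝ) ^ 6 := by
  have h1 : μ ^ 6 * (r : ℝ) ^ 6 = (μ ^ 2 * r) ^ 3 * r ^ 3 := by ring
  rw [h1]
  exact one_le_mul_of_one_le_of_one_le (one_le_pow₀ h.one_le_μ) (one_le_pow₀ h.one_le_r')

lemma log_pos (h : ParamBounds r n ℓ σ₁ σᵣ μ w wmax) (hδ0 : 0 < δ) (hδ1 : δ < 1) :
    69 / 100 ≤ Real.log (n / δ) ∧ Real.log (4 / δ) ≤ 2 * Real.log (n / δ) ∧ 0 ≤ Real.log (4 / δ) := by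
  have h1 : 2 / δ ≤ n / δ := by gcongr; exact h.two_le_n
  have h2 : Real.log (2 / δ) ≤ Real.log (n / δ) := Real.log_le_log (by positivity) h1
  have h3 : Real.log 2 ≤ Real.log (2 / δ) :=
    Real.log_le_log (by norm_num) (by rw [le_div_iff₀ hδ0]; linarith)
  refine ⟨by linarith [Real.log_two_gt_d9], ?_, Real.log_nonneg ?_⟩
  · have h4 : Real.log (4 / δ) ≤ Real.log ((2 / δ) ^ 2) := by
      refine Real.log_le_log (by positivity) ?_
      rw [div_pow, div_le_div_iff₀ hδ0 (by positivity)]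
      nlinarith
    rw [Real.log_pow] at h4
    push_cast at h4
    linarith
  · rw [le_div_iff₀ hδ0]; linarith

lemma sq_one_add_sqrt_le (h : ParamBounds r n ℓ σ₁ σᵣ μ w wmax) (hδ0 : 0 < δ) (hδ1 : δ < 1) :
    (1 + √(8 * Real.log (4 / δ))) ^ 2 ≤ 35 * Real.log (n / δ) := by
  obtain ⟨h1, h2, h3⟩ := h.log_pos hδ0 hδ1
  have h4 := Real.sq_sqrt (by positivity : 0 ≤ 8 * Real.log (4 / δ))
  nlinarith [sq_nonneg (1 - √(8 * Real.log (4 / δ)))]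

/-- The sample bound without denominators. -/
lemma sample_le (h : ParamBounds r n ℓ σ₁ σᵣ μ w wmax) (hδ0 : 0 < δ) (hδ1 : δ < 1) (hε0 : 0 < ε)
    (hm : 10 ^ 11 * (μ ^ 6 * (r : ℝ) ^ 6 / w) * (σ₁ ^ 6 * (n : ℝ) ^ 3 / σᵣ ^ 9)
      * (Real.log (n / δ) / ε ^ 2) ≤ 2 * (m : ℝ)) :
    5 * 10 ^ 10 * σ₁ ^ 6 * n ^ 3 * Real.log (n / δ) ≤ m * w * σᵣ ^ 9 * ε ^ 2 := by
  have hσ := h.σᵣ_pos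
  have hσ₁ := h.σ₁_pos
  have hw0 := h.w_pos
  have hL := (h.log_pos hδ0 hδ1).1
  have h1 := mul_le_mul_of_nonneg_right hm (by positivity : 0 ≤ w * σᵣ ^ 9 * ε ^ 2)
  have h2 : 10 ^ 11 * (μ ^ 6 * (r : ℝ) ^ 6 / w) * (σ₁ ^ 6 * (n : ℝ) ^ 3 / σᵣ ^ 9)
      * (Real.log (n / δ) / ε ^ 2) * (w * σᵣ ^ 9 * ε ^ 2) =
      (μ ^ 6 * (r : ℝ) ^ 6) * (10 ^ 11 * σ₁ ^ 6 * n ^ 3 * Real.log (n / δ)) := by field_simp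
  rw [h2] at h1
  have h3 : 1 * (10 ^ 11 * σ₁ ^ 6 * n ^ 3 * Real.log (n / δ)) ≤
      (μ ^ 6 * (r : ℝ) ^ 6) * (10 ^ 11 * σ₁ ^ 6 * n ^ 3 * Real.log (n / δ)) :=
    mul_le_mul_of_nonneg_right h.one_le_mu_r (by positivity)
  linarith

lemma one_le_m (h : ParamBounds r n ℓ σ₁ σᵣ μ w wmax) (hδ0 : 0 < δ) (hδ1 : δ < 1) (hε0 : 0 < ε)
    (hm : 10 ^ 11 * (μ ^ 6 * (r : ℝ) ^ 6 / w) * (σ₁ ^ 6 * (n : ℝ) ^ 3 / σᵣ ^ 9)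
      * (Real.log (n / δ) / ε ^ 2) ≤ 2 * (m : ℝ)) : 1 ≤ m := by
  have hσ₁ := h.σ₁_pos
  have hn := h.one_le_n'
  have hL := (h.log_pos hδ0 hδ1).1
  rcases Nat.eq_zero_or_pos m with h0 | h0
  · have h1 := h.sample_le hδ0 hδ1 hε0 hm
    rw [h0] at h1
    have : 0 < 5 * 10 ^ 10 * σ₁ ^ 6 * n ^ 3 * Real.log (n / δ) := by positivity
    simp only [Nat.cast_zero, zero_mul] at h1
    linarith
  · exact h0

/-- The left side is the deviation of the empirical second moment at confidence `δ / 4`, the right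
side the precision that `exists_rotation` asks for. -/
lemma error2_le (h : ParamBounds r n ℓ σ₁ σᵣ μ w wmax) (hδ0 : 0 < δ) (hδ1 : δ < 1) (hε0 : 0 < ε)
    (hm : 10 ^ 11 * (μ ^ 6 * (r : ℝ) ^ 6 / w) * (σ₁ ^ 6 * (n : ℝ) ^ 3 / σᵣ ^ 9)
      * (Real.log (n / δ) / ε ^ 2) ≤ 2 * (m : ℝ)) :
    n * (1 + √(8 * Real.log (4 / δ))) / √m ≤ ε * √w * σᵣ ^ 4 / (36000 * σ₁ ^ 3 * √r) := by
  have hm0 : (0 : ℝ) < m := by exact_mod_cast h.one_le_m hδ0 hδ1 hε0 hm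
  have h1 := h.sample_le hδ0 hδ1 hε0 hm
  have h2 := h.sq_one_add_sqrt_le hδ0 hδ1
  have hσ := h.σᵣ_pos
  have hσ₁ := h.σ₁_pos
  have hw0 := h.w_pos
  have hr := h.one_le_r'
  have hn := h.one_le_n'
  have hL := (h.log_pos hδ0 hδ1).1
  refine le_of_sq_le_sq ?_ (by positivity)
  rw [div_pow, div_pow, mul_pow, mul_pow, mul_pow, mul_pow, mul_pow, Real.sq_sqrt hm0.le,
    Real.sq_sqrt hw0.le, Real.sq_sqrt (by positivity), div_le_div_iff₀ hm0 (by positivity)]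
  refine le_of_mul_le_mul_right ?_ hσ
  calc n ^ 2 * (1 + √(8 * Real.log (4 / δ))) ^ 2 * (36000 ^ 2 * (σ₁ ^ 3) ^ 2 * r) * σᵣ
      ≤ n ^ 2 * (35 * Real.log (n / δ)) * (36000 ^ 2 * (σ₁ ^ 3) ^ 2 * r) * σᵣ := by gcongr
    -- `35 · 36000²`, which is below `5 · 10¹⁰`; this fixes the constant `10¹¹` in the admissibility
    -- condition for `2m` samples.
    _ = 45360000000 * σ₁ ^ 6 * n ^ 2 * Real.log (n / δ) * (r * σᵣ) := by ring
    _ ≤ 50000000000 * σ₁ ^ 6 * n ^ 2 * Real.log (n / δ) * n := by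
        gcongr
        · norm_num
        · exact h.r_mul_σᵣ
    _ = 5 * 10 ^ 10 * σ₁ ^ 6 * n ^ 3 * Real.log (n / δ) := by ring
    _ ≤ m * w * σᵣ ^ 9 * ε ^ 2 := h1
    _ = ε ^ 2 * w * (σᵣ ^ 4) ^ 2 * m * σᵣ := by ring

lemma error3_le (h : ParamBounds r n ℓ σ₁ σᵣ μ w wmax) (hδ0 : 0 < δ) (hδ1 : δ < 1) (hε0 : 0 < ε)
    (hm : 10 ^ 11 * (μ ^ 6 * (r : ℝ) ^ 6 / w) * (σ₁ ^ 6 * (n : ℝ) ^ 3 / σᵣ ^ 9)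
      * (Real.log (n / δ) / ε ^ 2) ≤ 2 * (m : ℝ)) :
    n * √n * (1 + √(8 * Real.log (4 / δ))) / √m ≤ ε * (σᵣ * √σᵣ) / 12 := by
  have hm0 : (0 : ℝ) < m := by exact_mod_cast h.one_le_m hδ0 hδ1 hε0 hm
  have h1 := h.sample_le hδ0 hδ1 hε0 hm
  have h2 := h.sq_one_add_sqrt_le hδ0 hδ1
  have hσ := h.σᵣ_pos
  have hσ₁ := h.σ₁_pos
  have hw0 := h.w_pos
  have hn := h.one_le_n'
  have hL := (h.log_pos hδ0 hδ1).1
  refine le_of_sq_le_sq ?_ (by positivity)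
  rw [div_pow, div_pow, mul_pow, mul_pow, mul_pow, mul_pow, Real.sq_sqrt hm0.le,
    Real.sq_sqrt (by positivity), Real.sq_sqrt hσ.le, div_le_div_iff₀ hm0 (by positivity)]
  refine le_of_mul_le_mul_right ?_ (pow_pos hσ 6)
  calc (n : ℝ) ^ 2 * n * (1 + √(8 * Real.log (4 / δ))) ^ 2 * 12 ^ 2 * σᵣ ^ 6
      ≤ (n : ℝ) ^ 2 * n * (35 * Real.log (n / δ)) * 12 ^ 2 * σ₁ ^ 6 := by
        gcongr; exact h.σᵣ_le
    _ = 5040 * σ₁ ^ 6 * n ^ 3 * Real.log (n / δ) := by ring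
    _ ≤ 50000000000 * σ₁ ^ 6 * n ^ 3 * Real.log (n / δ) := by gcongr; norm_num
    _ = 5 * 10 ^ 10 * σ₁ ^ 6 * n ^ 3 * Real.log (n / δ) := by ring
    _ ≤ m * w * σᵣ ^ 9 * ε ^ 2 := h1
    _ ≤ m * 1 * σᵣ ^ 9 * ε ^ 2 := by gcongr; exact h.w_le_one
    _ = ε ^ 2 * (σᵣ ^ 2 * σᵣ) * m * σᵣ ^ 6 := by ring

/-- The error of alternating minimization after `T` steps. -/
lemma iteration_le (h : ParamBounds r n ℓ σ₁ σᵣ μ w wmax) (hε0 : 0 < ε)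
    (hεr : ε * (100000 * r ^ 3) ≤ √w) {F : ℝ} (hF : σ₁ ≤ F) {T : ℕ}
    (hT : 5 * Real.log (2 * F / (ε * σᵣ * w)) ≤ T) :
    σ₁ * (1 / 2) ^ T ≤ ε * √w * σᵣ ^ 3 / (2000 * σ₁ ^ 2 * √r) := by
  have hσ := h.σᵣ_pos
  have hσ₁ := h.σ₁_pos
  have hw0 := h.w_pos
  have hw1 := h.w_le_one
  have hr := h.one_le_r'
  have hsw1 := h.sqrt_w_le_one
  have hr3 : (r : ℝ) ≤ r ^ 3 := le_self_pow₀ hr (by norm_num)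
  have hεr1 : ε * (100000 * r) ≤ 1 := le_trans (by gcongr) (hεr.trans hsw1)
  have hε1 : ε ≤ 1 := by nlinarith
  set y := 2 * F / (ε * σᵣ * w) with hy
  have hy2 : 2 * σ₁ / (ε * σᵣ * w) ≤ y := by rw [hy]; gcongr
  have hy1 : 1 ≤ y := by
    refine le_trans ?_ hy2
    rw [le_div_iff₀ (by positivity), one_mul]
    calc ε * σᵣ * w ≤ 1 * σ₁ * 1 := by gcongr; exact h.σᵣ_le
      _ ≤ 2 * σ₁ := by linarith
  have hlogy : 0 ≤ Real.log y := Real.log_nonneg hy1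
  -- Because `5 log 2 ≥ 3`. The cube leaves enough powers of `ε`, `σᵣ / σ₁` and `w` for the required
  -- precision.
  have hpow : y ^ 3 ≤ 2 ^ T := by
    rw [← Real.log_le_log_iff (by positivity) (by positivity), Real.log_pow, Real.log_pow]
    push_cast
    have := Real.log_two_gt_d9
    nlinarith
  have hz : (2 * σ₁ / (ε * σᵣ * w)) ^ 3 ≤ 2 ^ T := le_trans (by gcongr) hpow
  have hhalf : (1 / 2 : ℝ) ^ T ≤ (ε * σᵣ * w) ^ 3 / (2 * σ₁) ^ 3 := by
    rw [div_pow] at hz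
    rw [one_div, inv_pow, ← one_div, div_le_div_iff₀ (by positivity) (by positivity)]
    rw [div_le_iff₀ (by positivity)] at hz
    linarith
  calc σ₁ * (1 / 2) ^ T ≤ σ₁ * ((ε * σᵣ * w) ^ 3 / (2 * σ₁) ^ 3) := by gcongr
    _ = ε * σᵣ ^ 3 / σ₁ ^ 2 * (ε ^ 2 * w ^ 3 / 8) := by field_simp; norm_num
    _ ≤ ε * σᵣ ^ 3 / σ₁ ^ 2 * (√w / (2000 * √r)) := by
        gcongr ε * σᵣ ^ 3 / σ₁ ^ 2 * ?_
        have hsr : √(r : ℝ) ≤ r := by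
          rw [Real.sqrt_le_left (by positivity)]; nlinarith
        have hw3 : w ^ 3 ≤ √w := by
          calc w ^ 3 ≤ w := pow_le_of_le_one hw0.le hw1 (by norm_num)
            _ = √w * √w := (Real.mul_self_sqrt hw0.le).symm
            _ ≤ √w * 1 := by gcongr
            _ = √w := mul_one _
        rw [div_le_div_iff₀ (by norm_num) (by positivity)]
        calc ε ^ 2 * w ^ 3 * (2000 * √r) ≤ ε * 1 * √w * (2000 * r) := by
              rw [sq]; gcongr
          _ = √w * (2000 * (ε * r)) := by ring
          _ ≤ √w * 8 := by gcongr; linarith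
    _ = ε * √w * σᵣ ^ 3 / (2000 * σ₁ ^ 2 * √r) := by field_simp

/-- The number of power iterations splits into three stages. -/
lemma exists_stages (h : ParamBounds r n ℓ σ₁ σᵣ μ w wmax) (hε0 : 0 < ε)
    (hεr : ε * (100000 * r ^ 3) ≤ √w) {N : ℕ}
    (hN : 20 * (Real.log r + Real.log (Real.log (1 / (ε * √w)))) ≤ N) :
    ∃ k₁ k₂ k₃ : ℕ, (r : ℝ) ≤ (3 / 2) ^ k₁ ∧ 6 * (r : ℝ) * (4 / 5) ^ k₂ ≤ 1 ∧
      (1 / 6 : ℝ) ^ (2 ^ k₃) ≤ ε * √w ∧ N = k₁ + k₂ + k₃ + 1 := by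
  have hr := h.one_le_r'
  have hr0 : (0 : ℝ) < r := by linarith
  have hw0 := h.w_pos
  have hsw : 0 < √w := Real.sqrt_pos.mpr hw0
  have hsw1 := h.sqrt_w_le_one
  have he := Real.exp_one_lt_d9
  have he' := Real.exp_one_gt_d9
  set z := ε * √w with hz
  have hz0 : 0 < z := by positivity
  have hz1 : z ≤ 1 / 100000 := by
    have h1 : (1 : ℝ) ≤ r ^ 3 := one_le_pow₀ hr
    have h2 : z ≤ ε := mul_le_of_le_one_right hε0.le hsw1
    nlinarith
  have hlog3 : (3 : ℝ) ≤ Real.log (1 / z) := by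
    rw [Real.le_log_iff_exp_le (by positivity), le_div_iff₀ hz0]
    have h1 : Real.exp 3 = Real.exp 1 ^ 3 := by rw [← Real.exp_nat_mul]; norm_num
    have h2 : Real.exp 1 ^ 3 ≤ 3 ^ 3 := pow_le_pow_left₀ (Real.exp_nonneg _) (by linarith) 3
    nlinarith [Real.exp_pos 3]
  set L₁ := Real.log r with hL₁
  set L₂ := Real.log (Real.log (1 / z)) with hL₂
  have hL₁0 : 0 ≤ L₁ := Real.log_nonneg hr
  have hL₂1 : 1 ≤ L₂ := by
    rw [hL₂, Real.le_log_iff_exp_le (by linarith)]; linarith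
  have hlog15 : 1 / 3 ≤ Real.log (3 / 2) := by
    have h1 : Real.log ((3 / 2) ^ 3) = 3 * Real.log (3 / 2) := by rw [Real.log_pow]; norm_num
    have h2 : 1 ≤ Real.log ((3 / 2) ^ 3) := by
      rw [Real.le_log_iff_exp_le (by norm_num)]; norm_num; linarith
    linarith
  have hlog125 : 1 / 5 ≤ Real.log (5 / 4) := by
    have h1 : Real.log ((5 / 4) ^ 5) = 5 * Real.log (5 / 4) := by rw [Real.log_pow]; norm_num
    have h2 : 1 ≤ Real.log ((5 / 4) ^ 5) := by
      rw [Real.le_log_iff_exp_le (by norm_num)]; norm_num; linarith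
    linarith
  have hlog6 : Real.log 6 ≤ 2 := by
    rw [Real.log_le_iff_le_exp (by norm_num)]
    have h1 : Real.exp 2 = Real.exp 1 ^ 2 := by rw [← Real.exp_nat_mul]; norm_num
    nlinarith
  have hlog6' : 1 ≤ Real.log 6 := by
    rw [Real.le_log_iff_exp_le (by norm_num)]; linarith
  -- The gap stage and the decay stage take time logarithmic in `r`, by `log (3/2) ≥ 1/3` and `log
  -- (5/4) ≥ 1/5`; the quadratic stage gets the rest. The additive constants are paid by `log log
  -- (1/z) ≥ 1`.
  set k₁ := ⌈3 * L₁⌉₊ with hk₁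
  set k₂ := ⌈5 * L₁ + 10⌉₊ with hk₂
  have hk₁l : 3 * L₁ ≤ k₁ := Nat.le_ceil _
  have hk₁u : (k₁ : ℝ) < 3 * L₁ + 1 := Nat.ceil_lt_add_one (by positivity)
  have hk₂l : 5 * L₁ + 10 ≤ k₂ := Nat.le_ceil _
  have hk₂u : (k₂ : ℝ) < 5 * L₁ + 10 + 1 := Nat.ceil_lt_add_one (by positivity)
  have hNk : k₁ + k₂ + 1 ≤ N := by
    have : (k₁ : ℝ) + k₂ + 1 ≤ N := by linarith
    exact_mod_cast this
  obtain ⟨k₃, hk₃⟩ := Nat.exists_eq_add_of_le hNk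
  have hk₃l : 2 * L₂ ≤ k₃ := by
    have : (N : ℝ) = k₁ + k₂ + 1 + k₃ := by rw [hk₃]; push_cast; ring
    linarith
  refine ⟨k₁, k₂, k₃, ?_, ?_, ?_, by omega⟩
  · rw [← Real.log_le_log_iff hr0 (by positivity), Real.log_pow]
    nlinarith
  · have h1 : 6 * (r : ℝ) ≤ (5 / 4) ^ k₂ := by
      rw [← Real.log_le_log_iff (by positivity) (by positivity), Real.log_pow,
        Real.log_mul (by norm_num) hr0.ne']
      nlinarith
    calc 6 * (r : ℝ) * (4 / 5) ^ k₂ ≤ (5 / 4) ^ k₂ * (4 / 5) ^ k₂ := by gcongr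
      _ = 1 := by rw [← mul_pow]; norm_num
  · have h1 : Real.log (1 / z) ≤ 2 ^ k₃ := by
      rw [← Real.log_le_log_iff (by linarith) (by positivity), Real.log_pow]
      have := Real.log_two_gt_d9
      nlinarith
    have h2 : 1 / z ≤ 6 ^ (2 ^ k₃) := by
      rw [← Real.log_le_log_iff (by positivity) (by positivity), Real.log_pow]
      push_cast
      have : (0 : ℝ) ≤ 2 ^ k₃ := by positivity
      nlinarith
    rw [div_le_iff₀ hz0] at h2
    rw [one_div, inv_pow, ← one_div, div_le_iff₀ (by positivity)]
    linarith

/-- The proposed accuracy is admissible. -/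
lemma accuracy_admissible (h : ParamBounds r n ℓ σ₁ σᵣ μ w wmax) (hη0 : 0 < η) (hη1 : η < 1)
    (hδ0 : 0 < δ) (hδ1 : δ < 1)
    (hm : 10 ^ 21 * (n : ℝ) ^ 7 * (r : ℝ) ^ 7 * μ ^ 6 * σ₁ ^ 7 * (ℓ : ℝ) ^ 12 * wmax * Real.log (n / δ)
            / (σᵣ ^ 9 * η ^ 6 * w ^ 2) ≤ 2 * (m : ℝ))
    (hε : ε = 1 / 100000 * η ^ 2 * min (√w / ((n : ℝ) ^ 2 * (ℓ : ℝ) ^ 6 * √(σ₁ * wmax * r))) η) :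
    0 < ε ∧ ε ≤ 1 / √((r : ℝ) + ℓ) ∧
      10 ^ 11 * (μ ^ 6 * (r : ℝ) ^ 6 / w) * (σ₁ ^ 6 * (n : ℝ) ^ 3 / σᵣ ^ 9)
            * (Real.log (n / δ) / ε ^ 2) ≤ 2 * (m : ℝ) := by
  have hσ := h.σᵣ_pos
  have hσ₁ := h.σ₁_pos
  have hw0 := h.w_pos
  have hwm := h.wmax_pos
  have hr := h.one_le_r'
  have hn := h.one_le_n'
  have hℓ := h.one_le_l'
  have hμ := h.μ_pos
  have hL := (h.log_pos hδ0 hδ1).1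
  have hsw : 0 < √w := Real.sqrt_pos.mpr hw0
  have hQ1 := h.one_le_l_mul
  have hQ0 : 0 < √(σ₁ * wmax * r) := Real.sqrt_pos.mpr (by positivity)
  set a := √w / ((n : ℝ) ^ 2 * (ℓ : ℝ) ^ 6 * √(σ₁ * wmax * r)) with ha
  have ha0 : 0 < a := by positivity
  have hε0 : 0 < ε := by rw [hε]; positivity
  have ha1 : a ≤ 1 := by
    rw [ha, div_le_one (by positivity), mul_assoc]
    exact h.sqrt_w_le_one.trans (one_le_mul_of_one_le_of_one_le (one_le_pow₀ hn) hQ1)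
  refine ⟨hε0, ?_, ?_⟩
  · have h1 := h.accuracy_le hε.le
    have hrl : √((r : ℝ) + ℓ) ≤ 2 * (n ^ 2 * ℓ) := by
      have h2 : √((r : ℝ) + ℓ) ≤ r + ℓ := by
        rw [Real.sqrt_le_left (by positivity)]; nlinarith
      have h3 : (r : ℝ) ≤ n ^ 2 := h.r_le_n.trans (le_self_pow₀ hn (by norm_num))
      have h4 : (1 : ℝ) ≤ n ^ 2 := one_le_pow₀ hn
      nlinarith
    have h5 : (ℓ : ℝ) ≤ ℓ ^ 6 * √(σ₁ * wmax * r) := by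
      have h6 : 1 ≤ (ℓ : ℝ) ^ 2 * √(σ₁ * wmax * r) ^ 2 := by
        rw [Real.sq_sqrt (by positivity)]
        have h7 : 1 ≤ σ₁ * ℓ := hn.trans h.n_le_σ₁
        calc (1 : ℝ) = 1 * 1 * 1 := by norm_num
          _ ≤ ℓ * (σ₁ * ℓ) * (r * wmax) := by gcongr; exact h.one_le_wmax
          _ = _ := by ring
      have h8 : 1 ≤ (ℓ : ℝ) * √(σ₁ * wmax * r) := by
        rw [← mul_pow] at h6
        exact (one_le_sq_iff₀ (by positivity)).mp h6
      calc (ℓ : ℝ) = ℓ * 1 * 1 := by ring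
        _ ≤ ℓ * (ℓ : ℝ) ^ 4 * (ℓ * √(σ₁ * wmax * r)) := by gcongr; exact one_le_pow₀ hℓ
        _ = _ := by ring
    rw [le_div_iff₀ (by positivity)]
    calc ε * √((r : ℝ) + ℓ) ≤ ε * (2 * (n ^ 2 * (ℓ ^ 6 * √(σ₁ * wmax * r)))) := by
          gcongr; exact hrl.trans (by gcongr)
      _ ≤ ε * (100000 * (n ^ 2 * (ℓ ^ 6 * √(σ₁ * wmax * r)))) := by gcongr; norm_num
      _ ≤ η ^ 2 * √w := h1
      _ ≤ 1 := mul_le_one₀ (pow_le_one₀ hη0.le hη1.le) hsw.le h.sqrt_w_le_one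
  · refine le_trans ?_ hm
    -- Since `a` and `η` are at most `1`, `min a η ≥ η a`. So `ε²` is at least `10⁻¹⁰ η⁶ a²`, which
    -- is where `η⁶` and the factor `10²¹ = 10¹¹ · 10¹⁰` in the sample bound come from.
    have hεl : 1 / 100000 * η ^ 3 * a ≤ ε := by
      rw [hε]
      have : η * a ≤ min a η := le_min (mul_le_of_le_one_left ha0.le hη1.le)
        (mul_le_of_le_one_right hη0.le ha1)
      calc 1 / 100000 * η ^ 3 * a = 1 / 100000 * η ^ 2 * (η * a) := by ring
        _ ≤ _ := by gcongr
    have ha2 : a ^ 2 = w / (n ^ 4 * ℓ ^ 12 * (σ₁ * wmax * r)) := by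
      rw [ha, div_pow, mul_pow, mul_pow, Real.sq_sqrt hw0.le, Real.sq_sqrt (by positivity)]; ring
    have hεsq : 1 / 10 ^ 10 * η ^ 6 * (w / (n ^ 4 * ℓ ^ 12 * (σ₁ * wmax * r))) ≤ ε ^ 2 := by
      rw [← ha2]
      refine le_trans (le_of_eq ?_) (pow_le_pow_left₀ (by positivity) hεl 2)
      ring
    calc 10 ^ 11 * (μ ^ 6 * (r : ℝ) ^ 6 / w) * (σ₁ ^ 6 * (n : ℝ) ^ 3 / σᵣ ^ 9)
            * (Real.log (n / δ) / ε ^ 2)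
        ≤ 10 ^ 11 * (μ ^ 6 * (r : ℝ) ^ 6 / w) * (σ₁ ^ 6 * (n : ℝ) ^ 3 / σᵣ ^ 9)
            * (Real.log (n / δ) / (1 / 10 ^ 10 * η ^ 6 *
              (w / (n ^ 4 * ℓ ^ 12 * (σ₁ * wmax * r))))) := by gcongr
      _ = _ := by field_simp

end ParamBounds

/-! ### From accurate sample moments to the output mixture. -/

section SpectralOutput

variable {r n ℓ m T N L : ℕ} {X : ProductMixture r n ℓ} {σ₁ σᵣ μ w wmax ε η : ℝ}

/-- The lower bound on `n` in the form that the error analysis needs: the block norm of `U` beats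
the square of the condition number and `√r`. -/
lemma ParamBounds.incoherence_le (h : ParamBounds r n ℓ σ₁ σᵣ μ w wmax) :
    64 * (μ * √((r : ℝ) / n)) * σ₁ ^ 2 * √r ≤ σᵣ ^ 2 := by
  have hn := h.one_le_n'
  have hr := h.one_le_r'
  have hσ₁ := h.σ₁_pos
  have hσ := h.σᵣ_pos
  have hμ := h.μ_pos
  have hn0 : (0 : ℝ) < n := by linarith
  refine le_of_sq_le_sq ?_ (by positivity)
  have h1 : (64 * (μ * √((r : ℝ) / n)) * σ₁ ^ 2 * √r) ^ 2 = 4096 * σ₁ ^ 4 * μ ^ 2 * r ^ 2 * 1 / n := by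
    rw [mul_pow, mul_pow, mul_pow, mul_pow, Real.sq_sqrt (by positivity), Real.sq_sqrt (by positivity)]
    ring
  rw [h1, div_le_iff₀ hn0]
  calc 4096 * σ₁ ^ 4 * μ ^ 2 * r ^ 2 * 1 ≤ 4096 * σ₁ ^ 4 * μ ^ 2 * r ^ 2 * (μ ^ 2 * r) := by
        gcongr; exact h.one_le_μ
    _ = 4096 * σ₁ ^ 4 * μ ^ 4 * r ^ 3 := by ring
    _ ≤ n * σᵣ ^ 4 := h.n_ge
    _ = (σᵣ ^ 2) ^ 2 * n := by ring

lemma abs_mulVec_apply_le {ι κ : Type} [Fintype ι] [Fintype κ] [DecidableEq ι] [DecidableEq κ]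
    (A : Matrix ι κ ℝ) (x : EuclideanSpace ℝ κ) (i : ι) : |(A *ᵥ x.ofLp) i| ≤ ‖A‖ * ‖x‖ := by
  refine le_trans ?_ (A.l2_opNorm_mulVec x)
  simpa using PiLp.norm_apply_le (WithLp.toLp 2 (A *ᵥ x.ofLp) : EuclideanSpace ℝ ι) i

set_option maxHeartbeats 800000 in
/-- The whitened third moment is close to a rotation of the tensor of weights. -/
theorem exists_rotation (h : ParamBounds r n ℓ σ₁ σᵣ μ w wmax) (hw : ∀ q, w ≤ X.weight q)
    {U₀ : Matrix (Idx n ℓ) (Fin r) ℝ} {K : Matrix (Fin r) (Fin r) ℝ}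
    (hI : IncoherentFactorization X.M2 U₀ K σ₁ σᵣ (μ * √((r : ℝ) / n))) (hε0 : 0 < ε)
    (hεr : ε * (100000 * r ^ 3) ≤ √w)
    (hT : 1 ≤ T) (hiter : σ₁ * (1 / 2) ^ T ≤ ε * √w * σᵣ ^ 3 / (2000 * σ₁ ^ 2 * √r))
    {y₁ y₂ : Fin m → Fin n → Fin ℓ}
    (h₂ : fro (mask2 (sampleM2 y₁ - X.M2)) ≤ ε * √w * σᵣ ^ 4 / (36000 * σ₁ ^ 3 * √r))
    (h₃ : tnorm (mask3 (sampleM3 y₂ - moment3 X)) ≤ ε * (σᵣ * √σᵣ) / 12)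
    {U : Matrix (Idx n ℓ) (Fin r) ℝ} {s : Fin r → ℝ} {G : Tensor3 (Fin r)}
    (hU : IsSecondMomentEstimate T (sampleM2 y₁) U s) (hG : IsTensorLSOutput (sampleM3 y₂) U s G) :
    ∃ O : Matrix (Fin r) (Fin r) ℝ, Oᵀ * O = 1 ∧
      tnorm (G - tensorApply (weightTensor X) Oᵀ) ≤ ε ∧
      fro (factor X - unwhiten U s * O) ≤ ε * √w * √σ₁ / 20 ∧ ‖unwhiten U s‖ ≤ √(2 * σ₁) := by
  have hr := h.one_le_r'
  have hσ₁ := h.σ₁_pos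
  have hσ := h.σᵣ_pos
  have hσle := h.σᵣ_le
  have hw0 := h.w_pos
  have hsw : 0 < √w := Real.sqrt_pos.mpr hw0
  have hsw1 := h.sqrt_w_le_one
  have hsr : 1 ≤ √(r : ℝ) := Real.one_le_sqrt.mpr hr
  have hε5 : ε ≤ 1 / 100000 := by
    have : (1 : ℝ) ≤ r ^ 3 := one_le_pow₀ hr
    nlinarith
  set b := μ * √((r : ℝ) / n) with hb
  have hb0 : 0 ≤ b := hI.b_nonneg
  have hbσ := h.incoherence_le
  rw [← hb] at hbσ
  -- All precisions are expressed through the inverse condition number `t` and the scaled accuracy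
  -- `z = ε √w / √r`.
  set t := σᵣ / σ₁ with ht
  have ht0 : 0 < t := by positivity
  have ht1 : t ≤ 1 := (div_le_one hσ₁).mpr hσle
  have htσ : σᵣ = t * σ₁ := by rw [ht]; field_simp
  set z := ε * √w / √r with hz
  have hz0 : 0 < z := by positivity
  have hzε : z ≤ ε * √w := div_le_self (by positivity) hsr
  have hz5 : z ≤ 1 / 100000 := hzε.trans ((mul_le_of_le_one_right hε0.le hsw1).trans hε5)
  have hzr : √r * z = ε * √w := by rw [hz]; field_simp
  have hbt : 64 * b * √r ≤ t ^ 2 := by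
    rw [ht, div_pow, le_div_iff₀ (by positivity)]; linarith
  have hb64 : 64 * b ≤ t ^ 2 := le_trans (le_mul_of_one_le_right (by positivity) hsr) hbt
  have he2 : ε * √w * σᵣ ^ 4 / (36000 * σ₁ ^ 3 * √r) = z * t ^ 3 / 36000 * σᵣ := by
    rw [hz, ht]; field_simp
  have hit : ε * √w * σᵣ ^ 3 / (2000 * σ₁ ^ 2 * √r) = z * t ^ 2 / 2000 * σᵣ := by
    rw [hz, ht]; field_simp
  rw [he2] at h₂
  rw [hit] at hiter
  have ht2 : t ^ 2 ≤ t := pow_le_of_le_one ht0.le ht1 (by norm_num)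
  have ht3 : t ^ 3 ≤ 1 := pow_le_one₀ ht0.le ht1
  obtain ⟨M', V, hM', hsvd⟩ := hU
  -- Half of this error comes from the finite number of iterations, half from sampling. The factor
  -- `t²` pays for the condition numbers lost in whitening.
  have hMerr : fro (M' - X.M2) ≤ z * t ^ 2 / 1000 * σᵣ := by
    have h1 := hI.altMin_error (transpose_mask2_sampleM2 y₁) h₂ h.one_le_r ?_ ?_ ?_ hT hM'
    · have h2 : 18 * σ₁ * (z * t ^ 3 / 36000 * σᵣ) / σᵣ = z * t ^ 2 / 2000 * σᵣ := by
        rw [htσ]; field_simp; norm_num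
      linarith
    · have : b * 4 ≤ t := by linarith
      rw [htσ]
      nlinarith
    · have h1 : √r * (b ^ 2 * σ₁ + z * t ^ 3 / 36000 * σᵣ) =
          σ₁ * (b * (√r * b) + √r * z * (t ^ 3 / 36000) * t) := by rw [htσ]; ring
      rw [h1, hzr]
      have h2 : b * (√r * b) ≤ t / 16 := by
        have h3 : √r * b ≤ 1 := by nlinarith
        calc b * (√r * b) ≤ b * 1 := by gcongr
          _ ≤ t / 16 := by linarith
      have h4 : ε * √w * (t ^ 3 / 36000) * t ≤ t / 16 := by
        have h5 : ε * √w ≤ 1 := (mul_le_of_le_one_right hε0.le hsw1).trans (by linarith)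
        calc ε * √w * (t ^ 3 / 36000) * t ≤ 1 * (1 / 36000) * t := by gcongr
          _ ≤ t / 16 := by linarith
      calc σ₁ * (b * (√r * b) + ε * √w * (t ^ 3 / 36000) * t) ≤ σ₁ * (t / 16 + t / 16) := by gcongr
        _ = σᵣ / 8 := by rw [htσ]; ring
    · calc z * t ^ 3 / 36000 * σᵣ ≤ 1 * 1 / 36000 * σᵣ := by gcongr; linarith
        _ ≤ σᵣ / 128 := by linarith
  have hκ : σ₁ / σᵣ = t⁻¹ := by rw [ht, inv_div]
  have hwpos : ∀ q, 0 < X.weight q := fun q => hw0.trans_le (hw q)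
  rw [moment3_eq X hwpos] at h₃
  obtain ⟨O, hO, hGO, hAO⟩ := hI.tensorLS_error (M2_eq_factor X) hsvd hMerr
    (by
      rw [hκ]
      have : 24 * (z * t ^ 2 / 1000) * t⁻¹ = 24 * z / 1000 * t := by field_simp
      rw [this]; nlinarith)
    (by
      rw [hκ]
      have : 16 * t⁻¹ ^ 2 * (b + 2 * (z * t ^ 2 / 1000)) = 16 * (b / t ^ 2) + 32 * z / 1000 := by
        field_simp; ring
      rw [this]
      have : b / t ^ 2 ≤ 1 / 64 := by rw [div_le_iff₀ (by positivity)]; linarith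
      linarith) hG h₃
  refine ⟨O, hO, ?_, ?_, hI.opNorm_unwhiten_le hsvd hMerr ?_⟩
  · refine hGO.trans ?_
    have h1 : 6 * (ε * (σᵣ * √σᵣ) / 12) / (σᵣ * √σᵣ) = ε / 2 := by
      have := (Real.sqrt_pos.mpr hσ).ne'
      field_simp; norm_num
    have h2 : 306 * (σ₁ / σᵣ) * (z * t ^ 2 / 1000) * tnorm (weightTensor X) ≤ ε / 2 := by
      rw [hκ]
      calc 306 * t⁻¹ * (z * t ^ 2 / 1000) * tnorm (weightTensor X)
          ≤ 306 * t⁻¹ * (z * t ^ 2 / 1000) * (√r / √w) := by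
            gcongr; exact tnorm_weightTensor_le X hw0 hw
        _ = 306 / 1000 * t * (√r * z / √w) := by field_simp
        _ = 306 / 1000 * t * ε := by rw [hzr, mul_div_assoc, div_self hsw.ne', mul_one]
        _ ≤ 306 / 1000 * 1 * ε := by gcongr
        _ ≤ ε / 2 := by linarith
    linarith
  · refine hAO.trans ?_
    rw [hκ]
    calc 35 * (z * t ^ 2 / 1000) * t⁻¹ * √σ₁ = 35 / 1000 * z * t * √σ₁ := by field_simp
      _ ≤ 35 / 1000 * (ε * √w) * 1 * √σ₁ := by gcongr
      _ ≤ ε * √w * √σ₁ / 20 := by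
        have : 0 ≤ ε * √w * √σ₁ := by positivity
        linarith
  · have : z * t ^ 2 ≤ 1 := mul_le_one₀ (by linarith) (by positivity) (by linarith)
    linarith

/-- The weight is `λ⁻²` with `λ ≥ 1`, so the inversion does not amplify the error beyond the
derivative: `18 = 3 · 6`. -/
lemma abs_inv_sq_sub_le {lam l ε : ℝ} (hlam : 1 ≤ lam) (hε : ε ≤ 1 / 100000)
    (h : |l - lam| ≤ 6 * ε) : |(l ^ 2)⁻¹ - (lam ^ 2)⁻¹| ≤ 18 * ε := by
  have hε0 : 0 ≤ ε := by linarith [abs_nonneg (l - lam)]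
  obtain ⟨h1, h2⟩ := abs_le.mp h
  have hl : 99 / 100 * lam ≤ l := by linarith
  have hl' : l ≤ 101 / 100 * lam := by linarith
  have hl0 : 0 < l := by linarith
  have hlam0 : 0 < lam := by linarith
  have h3 : (l ^ 2)⁻¹ - (lam ^ 2)⁻¹ = (lam - l) * ((lam + l) / (l ^ 2 * lam ^ 2)) := by
    field_simp; ring
  rw [h3, abs_mul, abs_sub_comm, abs_of_nonneg (a := (lam + l) / (l ^ 2 * lam ^ 2)) (by positivity)]
  have h4 : (lam + l) / (l ^ 2 * lam ^ 2) ≤ 3 := by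
    rw [div_le_iff₀ (by positivity)]
    have h5 : (99 / 100 * lam) ^ 2 * lam ^ 2 ≤ l ^ 2 * lam ^ 2 := by gcongr
    have h6 : lam ≤ lam ^ 4 := le_self_pow₀ hlam (by norm_num)
    nlinarith
  calc |l - lam| * ((lam + l) / (l ^ 2 * lam ^ 2)) ≤ 6 * ε * 3 := by gcongr
    _ = 18 * ε := by ring

lemma sqrt_two_mul_le {x : ℝ} (hx : 0 ≤ x) : √(2 * x) ≤ 142 / 100 * √x := by
  refine le_of_sq_le_sq ?_ (by positivity)
  rw [mul_pow, Real.sq_sqrt (by positivity), Real.sq_sqrt hx]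
  linarith

/-- The estimated factors, once the power method has recovered the rotated basis. -/
lemma abs_piHat_sub_le {U : Matrix (Idx n ℓ) (Fin r) ℝ} {s : Fin r → ℝ} {O : Matrix (Fin r) (Fin r) ℝ}
    (hw0 : 0 < w) (hw : ∀ q, w ≤ X.weight q) (hσ₁ : 0 < σ₁) (hε0 : 0 < ε)
    (hA : fro (factor X - unwhiten U s * O) ≤ ε * √w * √σ₁ / 20) (hu : ‖unwhiten U s‖ ≤ √(2 * σ₁))
    {v v' : Fin r → EuclideanSpace ℝ (Fin r)} (hv : ∀ q a, v q a = O a q) {lam : Fin r → ℝ} {k q : Fin r}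
    (hnorm : ‖v' q‖ = 1) (hv' : (√(X.weight k))⁻¹ * ‖v' q - v k‖ ≤ 6 * ε)
    (hlam : |lam q - (√(X.weight k))⁻¹| ≤ 6 * ε) (i : Fin n) (j : Fin ℓ) :
    |piHat U s v' lam q i j - X.prob k i j| ≤ 18 * ε * √σ₁ := by
  have hwk : 0 < √(X.weight k) := Real.sqrt_pos.mpr (hw0.trans_le (hw k))
  set κ := (√(X.weight k))⁻¹ with hκ
  have hκ0 : 0 < κ := by positivity
  have h1 : piHat U s v' lam q i j = (unwhiten U s *ᵥ (lam q • v' q).ofLp) (i, j) := by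
    rw [piHat, Matrix.mul_diagonal, Matrix.mul_apply, mulVec, dotProduct, Finset.sum_mul]
    refine Finset.sum_congr rfl fun a _ => ?_
    simp only [Matrix.of_apply, PiLp.smul_apply, smul_eq_mul]
    ring
  have h2 : (unwhiten U s * O) (i, j) k * κ = (unwhiten U s *ᵥ (κ • v k).ofLp) (i, j) := by
    rw [Matrix.mul_apply, mulVec, dotProduct, Finset.sum_mul]
    refine Finset.sum_congr rfl fun a _ => ?_
    simp only [PiLp.smul_apply, smul_eq_mul, hv]
    ring
  have h3 : X.prob k i j = factor X (i, j) k * κ := by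
    rw [factor_apply, mul_assoc, hκ, mul_inv_cancel₀ hwk.ne', mul_one]
  have h4 : piHat U s v' lam q i j - X.prob k i j =
      (unwhiten U s *ᵥ (lam q • v' q - κ • v k).ofLp) (i, j) -
        (factor X - unwhiten U s * O) (i, j) k * κ := by
    rw [WithLp.ofLp_sub, mulVec_sub, Pi.sub_apply, ← h1, ← h2, h3, Matrix.sub_apply]
    ring
  have h5 : ‖lam q • v' q - κ • v k‖ ≤ 12 * ε := by
    have : lam q • v' q - κ • v k = (lam q - κ) • v' q + κ • (v' q - v k) := by
      rw [sub_smul, smul_sub]; abel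
    rw [this]
    refine (norm_add_le _ _).trans ?_
    rw [norm_smul, norm_smul, hnorm, Real.norm_eq_abs, Real.norm_eq_abs, abs_of_pos hκ0]
    linarith
  have h6 : κ ≤ (√w)⁻¹ := by
    rw [hκ]
    exact inv_anti₀ (Real.sqrt_pos.mpr hw0) (Real.sqrt_le_sqrt (hw k))
  have h7 : |(factor X - unwhiten U s * O) (i, j) k * κ| ≤ ε * √σ₁ / 20 := by
    rw [abs_mul, abs_of_pos hκ0]
    calc _ ≤ ε * √w * √σ₁ / 20 * (√w)⁻¹ := by
          gcongr; exact (abs_apply_le_fro _ _ _).trans hA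
      _ = ε * √σ₁ / 20 := by
          have := (Real.sqrt_pos.mpr hw0).ne'
          field_simp
  -- The eigenpair contributes `1.42 · 12 ε √σ₁` and the factor matrix `ε √σ₁ / 20`; together they
  -- stay below `18 ε √σ₁`.
  have h8 : |(unwhiten U s *ᵥ (lam q • v' q - κ • v k).ofLp) (i, j)| ≤
      142 / 100 * √σ₁ * (12 * ε) := by
    refine (abs_mulVec_apply_le _ _ _).trans ?_
    gcongr
    exact hu.trans (sqrt_two_mul_le hσ₁.le)
  rw [h4]
  refine (abs_sub _ _).trans ?_
  have : 0 ≤ ε * √σ₁ := by positivity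
  linarith

/-- If the sample moments are accurate, the algorithm succeeds for all starting points that hit
every cone around the vectors of a suitable orthonormal basis. -/
theorem exists_basis_forall_output (h : ParamBounds r n ℓ σ₁ σᵣ μ w wmax) (hw : ∀ q, w ≤ X.weight q)
    {U₀ : Matrix (Idx n ℓ) (Fin r) ℝ} {K : Matrix (Fin r) (Fin r) ℝ}
    (hI : IncoherentFactorization X.M2 U₀ K σ₁ σᵣ (μ * √((r : ℝ) / n))) (hε0 : 0 < ε)
    (hεr : ε * (100000 * r ^ 3) ≤ √w)
    (hη : 3 * r * (18 * ε / √w) + 3 * n * ℓ * (18 * ε * √(σ₁ * r * (1 + ε * σᵣ) / w)) ≤ η)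
    (hT : 1 ≤ T) (hiter : σ₁ * (1 / 2) ^ T ≤ ε * √w * σᵣ ^ 3 / (2000 * σ₁ ^ 2 * √r))
    (hN : 20 * (Real.log r + Real.log (Real.log (1 / (ε * √w)))) ≤ N)
    {y₁ y₂ : Fin m → Fin n → Fin ℓ}
    (h₂ : fro (mask2 (sampleM2 y₁ - X.M2)) ≤ ε * √w * σᵣ ^ 4 / (36000 * σ₁ ^ 3 * √r))
    (h₃ : tnorm (mask3 (sampleM3 y₂ - moment3 X)) ≤ ε * (σᵣ * √σᵣ) / 12)
    {U : Matrix (Idx n ℓ) (Fin r) ℝ} {s : Fin r → ℝ} {G : Tensor3 (Fin r)}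
    (hU : IsSecondMomentEstimate T (sampleM2 y₁) U s) (hG : IsTensorLSOutput (sampleM3 y₂) U s G) :
    ∃ v : OrthonormalBasis (Fin r) ℝ (EuclideanSpace ℝ (Fin r)),
      ∀ θ : Fin r → Fin L → Metric.sphere (0 : EuclideanSpace ℝ (Fin r)) 1,
        (∀ q i, ∃ τ, θ q τ ∈ startSet v i) → ∀ v' lam,
          IsPowerDecomposition N G (fun q τ => (θ q τ : EuclideanSpace ℝ (Fin r))) v' lam →
          ∃ Y : ProductMixture r n ℓ,
            Y.weight = thresholdNormalize (18 * ε / √w) (wHat lam) ∧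
            (∀ q i, Y.prob q i =
              thresholdNormalize (18 * ε * √(σ₁ * r * (1 + ε * σᵣ) / w)) (piHat U s v' lam q i)) ∧
            InformationTheory.klDiv X.law Y.law ≤ ENNReal.ofReal η := by
  obtain ⟨O, hO, hGO, hAO, hu⟩ := exists_rotation h hw hI hε0 hεr hT hiter h₂ h₃ hU hG
  have hr := h.one_le_r'
  have hσ₁ := h.σ₁_pos
  have hσ := h.σᵣ_pos
  have hw0 := h.w_pos
  have hsw : 0 < √w := Real.sqrt_pos.mpr hw0
  have hsw1 := h.sqrt_w_le_one
  have hwpos : ∀ q, 0 < X.weight q := fun q => hw0.trans_le (hw q)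
  have hw1 : ∀ q, X.weight q ≤ 1 := fun q =>
    X.weight_sum ▸ Finset.single_le_sum (fun p _ => X.weight_nonneg p) (Finset.mem_univ q)
  have hε5 : ε ≤ 1 / 100000 := by
    have : (1 : ℝ) ≤ r ^ 3 := one_le_pow₀ hr
    nlinarith
  have hon : Orthonormal ℝ fun q : Fin r =>
      (WithLp.toLp 2 fun a => O a q : EuclideanSpace ℝ (Fin r)) := by
    rw [orthonormal_iff_ite]
    intro p q
    have := congrFun (congrFun hO p) q
    rw [Matrix.mul_apply, Matrix.one_apply] at this
    rw [← this]
    simp [PiLp.inner_apply, mul_comm]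
  have hcard : Fintype.card (Fin r) = Module.finrank ℝ (EuclideanSpace ℝ (Fin r)) := by simp
  obtain ⟨v, hv⟩ : ∃ v : OrthonormalBasis (Fin r) ℝ (EuclideanSpace ℝ (Fin r)),
      ∀ q a, v q a = O a q := by
    have : Nonempty (Fin r) := ⟨⟨0, h.one_le_r⟩⟩
    refine ⟨(basisOfOrthonormalOfCardEqFinrank hon hcard).toOrthonormalBasis (by simpa using hon),
      fun q a => by simp⟩
  -- The basis is fixed by the samples before the starting points enter; this order is what allows a
  -- bound over independent starting points.
  refine ⟨v, fun θ hθ v' lam hdec => ?_⟩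
  set κ : Fin r → ℝ := fun q => (√(X.weight q))⁻¹ with hκ
  have hκ1 : ∀ q, 1 ≤ κ q := fun q =>
    (one_le_inv₀ (Real.sqrt_pos.mpr (hwpos q))).mpr (Real.sqrt_le_one.mpr (hw1 q))
  have hκw : ∀ q, κ q ≤ (√w)⁻¹ := fun q => inv_anti₀ hsw (Real.sqrt_le_sqrt (hw q))
  obtain ⟨k₁, k₂, k₃, hk₁, hk₂, hk₃, hNk⟩ := h.exists_stages hε0 hεr hN
  obtain ⟨π, hπ⟩ := powerDecomposition_error (v := v) (lam := κ) (ε := ε)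
    (fun x hx => by
      rw [← contract_tensorApply_diagonal (D := weightTensor X) (O := O) (fun a b c => rfl) hv,
        ← contract_sub]
      exact (norm_contract_le _ hx).trans hGO)
    hκ1 hε0 (hεr.trans hsw1) (fun q τ => mem_sphere_zero_iff_norm.mp (θ q τ).2)
    hθ hk₁ hk₂
    (fun i => by
      calc (1 / 6) ^ 2 ^ k₃ * κ i ≤ ε * √w * (√w)⁻¹ := by
            gcongr; exact hκw i
        _ = ε := by rw [mul_assoc, mul_inv_cancel₀ hsw.ne', mul_one]) hNk hdec
  obtain ⟨Y, hY1, hY2, hY3⟩ := exists_mixture_klDiv_le X (w := wHat lam) (p := piHat U s v' lam)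
    (εw := 18 * ε / √w) (επ := 18 * ε * √(σ₁ * r * (1 + ε * σᵣ) / w)) (by positivity) (by positivity)
    π.symm
    (fun k => by
      obtain ⟨-, -, h1⟩ := hπ (π.symm k)
      rw [Equiv.apply_symm_apply] at h1
      have h2 := abs_inv_sq_sub_le (hκ1 k) hε5 h1
      have h3 : (κ k ^ 2)⁻¹ = X.weight k := by
        rw [hκ, inv_pow, inv_inv, Real.sq_sqrt (hwpos k).le]
      rw [h3] at h2
      exact h2.trans (le_div_self (by positivity) hsw hsw1))
    (fun k i j => by
      obtain ⟨h0, h1, h2⟩ := hπ (π.symm k)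
      rw [Equiv.apply_symm_apply] at h1 h2
      refine (abs_piHat_sub_le hw0 hw hσ₁ hε0 hAO hu hv h0 h1 h2 i j).trans ?_
      gcongr
      rw [le_div_iff₀ hw0, mul_assoc]
      have : 0 ≤ ε * σᵣ := by positivity
      gcongr
      exact h.w_le_one.trans (one_le_mul_of_one_le_of_one_le hr (by linarith)))
  exact ⟨Y, hY1, hY2, hY3.trans (ENNReal.ofReal_le_ofReal hη)⟩

/-- The two halves of the sample are accurate with probability at least `1 - δ / 2`. -/
lemma ParamBounds.measure_bad_samples_le {δ : ℝ} (h : ParamBounds r n ℓ σ₁ σᵣ μ w wmax)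
    (X : ProductMixture r n ℓ) (hδ0 : 0 < δ) (hδ1 : δ < 1) (hε0 : 0 < ε)
    (hm : 10 ^ 11 * (μ ^ 6 * (r : ℝ) ^ 6 / w) * (σ₁ ^ 6 * (n : ℝ) ^ 3 / σᵣ ^ 9)
      * (Real.log (n / δ) / ε ^ 2) ≤ 2 * (m : ℝ)) :
    ((Measure.pi fun _ : Fin m => X.law).prod (Measure.pi fun _ : Fin m => X.law))
      {y | ¬ (fro (mask2 (sampleM2 y.1 - X.M2)) ≤ ε * √w * σᵣ ^ 4 / (36000 * σ₁ ^ 3 * √r) ∧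
        tnorm (mask3 (sampleM3 y.2 - moment3 X)) ≤ ε * (σᵣ * √σᵣ) / 12)} ≤
      ENNReal.ofReal (δ / 2) := by
  have hm1 := h.one_le_m hδ0 hδ1 hε0 hm
  have hs := (h.log_pos hδ0 hδ1).2.2
  have hexp : Real.exp (-Real.log (4 / δ)) = δ / 4 := by
    rw [← Real.log_inv, inv_div, Real.exp_log (by positivity)]
  have h2 := measure_sampleM2 X hm1 h.one_le_n hs
  have h3 := measure_sampleM3 X hm1 h.one_le_n hs
  rw [hexp] at h2 h3
  refine (measure_mono (t := ({y | ¬ fro (mask2 (sampleM2 y - X.M2)) ≤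
        n * (1 + √(8 * Real.log (4 / δ))) / √m} ×ˢ Set.univ) ∪
      (Set.univ ×ˢ {y | ¬ tnorm (mask3 (sampleM3 y - moment3 X)) ≤
        n * √n * (1 + √(8 * Real.log (4 / δ))) / √m})) ?_).trans ?_
  · intro y hy
    by_contra hc
    simp only [Set.mem_union, Set.mem_prod, Set.mem_ofPred_eq, Set.mem_univ, and_true, true_and,
      not_or, not_not] at hc
    exact hy ⟨hc.1.trans (h.error2_le hδ0 hδ1 hε0 hm), hc.2.trans (h.error3_le hδ0 hδ1 hε0 hm)⟩
  · refine (measure_union_le _ _).trans ?_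
    rw [Measure.prod_prod, Measure.prod_prod, measure_univ, mul_one, one_mul]
    refine (add_le_add h2 h3).trans_eq ?_
    rw [← ENNReal.ofReal_add (by positivity) (by positivity)]
    congr 1; ring

end SpectralOutput

end ProductMixtureLearning

/-! ### The choice of constants and the union of the failure events. -/

open ProductMixtureLearning in
theorem mainTheorem6 :
    ∃ C C₀ C₁ C₂ C₃ C₄ C₅ C₆ c : ℝ,
      (0 < C ∧ 0 < C₀ ∧ 0 < C₁ ∧ 0 < C₂ ∧ 0 < C₃ ∧ 0 < C₄ ∧ 0 < C₅ ∧ 0 < C₆ ∧ 0 < c) ∧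
      ∀ (r n ℓ m : ℕ) (X : ProductMixture r n ℓ) (μ η δ σ₁ σᵣ wmin wmax εstar : ℝ),
        σ₁ = sigma X.M2 1 → σᵣ = sigma X.M2 r →
        wmin = ⨅ q, X.weight q → wmax = ⨆ q, X.weight q →
        0 < wmin → 0 < σᵣ → IsBlockIncoherent r X.M2 μ →
        0 < η → η < 1 → 0 < δ → δ < 1 →
        C₀ * σ₁ ^ (4.5 : ℝ) * μ ^ 4 * (r : ℝ) ^ (3.5 : ℝ) / σᵣ ^ (4.5 : ℝ) ≤ n →
        -- the number of samples is `2 m`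
        C * (n : ℝ) ^ 7 * (r : ℝ) ^ 7 * μ ^ 6 * σ₁ ^ 7 * (ℓ : ℝ) ^ 12 * wmax * Real.log (n / δ)
            / (σᵣ ^ 9 * η ^ 6 * wmin ^ 2) ≤ 2 * (m : ℝ) →
        εstar = c * η ^ 2 * min (√wmin / ((n : ℝ) ^ 2 * (ℓ : ℝ) ^ 6 * √(σ₁ * wmax * r))) η →
        -- the accuracy `εstar` is admissible for this number of samples
        (0 < εstar ∧ εstar ≤ C₁ / √((r : ℝ) + ℓ) ∧
          C₂ * (μ ^ 6 * (r : ℝ) ^ 6 / wmin) * (σ₁ ^ 6 * (n : ℝ) ^ 3 / σᵣ ^ 9)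
            * (Real.log (n / δ) / εstar ^ 2) ≤ 2 * (m : ℝ)) ∧
        -- and so the conclusion holds for `εM = εstar`, and for every smaller admissible accuracy
        ∀ εM : ℝ, 0 < εM → εM ≤ εstar →
          C₂ * (μ ^ 6 * (r : ℝ) ^ 6 / wmin) * (σ₁ ^ 6 * (n : ℝ) ^ 3 / σᵣ ^ 9)
            * (Real.log (n / δ) / εM ^ 2) ≤ 2 * (m : ℝ) →
          ∀ T N L : ℕ, 1 ≤ T → 1 ≤ L →
            C₄ * Real.log (2 * √(frobSq X.M2) / (εM * σᵣ * wmin)) ≤ T →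
            C₅ * (Real.log r + Real.log (Real.log (1 / (εM * √wmin)))) ≤ N →
            C₆ * (r : ℝ) ^ C₆ * Real.log (2 / δ) ≤ L →
            -- the steps before the power method always have an output
            (∀ y₁ : Fin m → Fin n → Fin ℓ, ∃ (U : Matrix (Idx n ℓ) (Fin r) ℝ) (s : Fin r → ℝ),
              IsSecondMomentEstimate T (sampleM2 y₁) U s) ∧
            (∀ (y₂ : Fin m → Fin n → Fin ℓ) (U : Matrix (Idx n ℓ) (Fin r) ℝ) (s : Fin r → ℝ),
              ∃ G, IsTensorLSOutput (sampleM3 y₂) U s G) ∧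
            -- however their ties are broken, the algorithm fails with probability at most `δ`
            ∀ (U : (Fin m → Fin n → Fin ℓ) → Matrix (Idx n ℓ) (Fin r) ℝ)
              (s : (Fin m → Fin n → Fin ℓ) → Fin r → ℝ)
              (G : (Fin m → Fin n → Fin ℓ) → (Fin m → Fin n → Fin ℓ) → Tensor3 (Fin r)),
              (∀ y₁, IsSecondMomentEstimate T (sampleM2 y₁) (U y₁) (s y₁)) →
              (∀ y₁ y₂, IsTensorLSOutput (sampleM3 y₂) (U y₁) (s y₁) (G y₁ y₂)) →
              (((MeasureTheory.Measure.pi fun _ : Fin m => X.law).prod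
                (MeasureTheory.Measure.pi fun _ : Fin m => X.law)).prod
                (MeasureTheory.Measure.pi fun _ : Fin r =>
                  MeasureTheory.Measure.pi fun _ : Fin L => uniformSphere r))
                {ω | ¬ ((∃ v lam, IsPowerDecomposition N (G ω.1.1 ω.1.2)
                        (fun q τ => (ω.2 q τ : EuclideanSpace ℝ (Fin r))) v lam) ∧
                    ∀ v lam, IsPowerDecomposition N (G ω.1.1 ω.1.2)
                        (fun q τ => (ω.2 q τ : EuclideanSpace ℝ (Fin r))) v lam →
                      ∃ Xhat : ProductMixture r n ℓ,
                        Xhat.weight = thresholdNormalize (C₃ * εM / √wmin) (wHat lam) ∧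
                        (∀ q i, Xhat.prob q i =
                          thresholdNormalize (C₃ * εM * √(σ₁ * r * (1 + εM * σᵣ) / wmin))
                            (piHat (U ω.1.1) (s ω.1.1) v lam q i)) ∧
                        InformationTheory.klDiv X.law Xhat.law ≤ ENNReal.ofReal η)}
                ≤ ENNReal.ofReal δ := by
  -- `4096 = 64²` comes from the incoherence bound, `18` from the error of weights and factors, and
  -- `5`, `20`, `24` from the numbers of iterations and of starting points.
  refine ⟨10 ^ 21, 4096, 1, 10 ^ 11, 18, 5, 20, 24, 1 / 100000, by norm_num, ?_⟩
  intro r n ℓ m X μ η δ σ₁ σᵣ w wmax εs hσ₁ hσᵣ hw hwmax hw0 hσ hinc hη0 hη1 hδ0 hδ1 hn hm hεs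
  obtain ⟨h, hrn, hwq, hfro, U₀, K, hI⟩ :=
    exists_paramBounds X hσ₁ hσᵣ hw hwmax hw0 hσ hinc le_rfl hn
  refine ⟨h.accuracy_admissible hη0 hη1 hδ0 hδ1 hm hεs, ?_⟩
  intro ε hε0 hεle hmε T N L hT hL hTlog hNlog hLlog
  rw [hεs] at hεle
  refine ⟨fun y₁ => exists_isSecondMomentEstimate hrn (transpose_mask2_sampleM2 y₁),
    fun y₂ U s => exists_isTensorLSOutput _ U s, ?_⟩
  intro U s G hU hG
  have hεr := h.accuracy_r hη0 hη1 hε0 hεle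
  have hr := h.one_le_r'
  -- The same constant `24` serves as coefficient and as exponent; only the second power of `r` is
  -- needed.
  have hLlog' : 24 * (r : ℝ) ^ 2 * Real.log (2 / δ) ≤ L := by
    refine le_trans ?_ hLlog
    have h1 : (r : ℝ) ^ 2 ≤ (r : ℝ) ^ (24 : ℝ) := by
      rw [← Real.rpow_natCast]
      exact Real.rpow_le_rpow_of_exponent_le hr (by norm_num)
    have h2 : 0 ≤ Real.log (2 / δ) :=
      Real.log_nonneg ((one_le_div hδ0).mpr (by linarith))
    gcongr
  have := isProbabilityMeasure_uniformSphere h.one_le_r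
  have key : ∀ y : (Fin m → Fin n → Fin ℓ) × (Fin m → Fin n → Fin ℓ),
      ∃ v : OrthonormalBasis (Fin r) ℝ (EuclideanSpace ℝ (Fin r)),
        (fro (mask2 (sampleM2 y.1 - X.M2)) ≤ ε * √w * σᵣ ^ 4 / (36000 * σ₁ ^ 3 * √r) ∧
          tnorm (mask3 (sampleM3 y.2 - moment3 X)) ≤ ε * (σᵣ * √σᵣ) / 12) →
        ∀ θ : Fin r → Fin L → Metric.sphere (0 : EuclideanSpace ℝ (Fin r)) 1,
          (∀ q i, ∃ τ, θ q τ ∈ startSet v i) → ∀ v' lam,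
            IsPowerDecomposition N (G y.1 y.2) (fun q τ => (θ q τ : EuclideanSpace ℝ (Fin r))) v' lam →
            ∃ Y : ProductMixture r n ℓ,
              Y.weight = thresholdNormalize (18 * ε / √w) (wHat lam) ∧
              (∀ q i, Y.prob q i = thresholdNormalize (18 * ε * √(σ₁ * r * (1 + ε * σᵣ) / w))
                (piHat (U y.1) (s y.1) v' lam q i)) ∧
              InformationTheory.klDiv X.law Y.law ≤ ENNReal.ofReal η := by
    intro y
    by_cases hy : fro (mask2 (sampleM2 y.1 - X.M2)) ≤ ε * √w * σᵣ ^ 4 / (36000 * σ₁ ^ 3 * √r) ∧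
        tnorm (mask3 (sampleM3 y.2 - moment3 X)) ≤ ε * (σᵣ * √σᵣ) / 12
    · obtain ⟨v, hv⟩ := exists_basis_forall_output (L := L) h hwq hI hε0 hεr
        (h.divergence_le hη0 hη1 hε0 hεle) hT (h.iteration_le hε0 hεr hfro hTlog) hNlog hy.1 hy.2
        (hU y.1) (hG y.1 y.2)
      exact ⟨v, fun _ => hv⟩
    -- For inaccurate samples nothing is claimed and any basis will do, so that a basis is attached
    -- to every sample.
    · exact ⟨EuclideanSpace.basisFun (Fin r) ℝ, fun hy' => absurd hy' hy⟩
  choose v hv using key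
  rw [← add_halves δ, ENNReal.ofReal_add (by positivity) (by positivity)]
  -- One half of `δ` covers inaccurate moments; the other, for each fixed pair of sample halves and
  -- its basis, covers starting points that miss a cone.
  refine measure_prod_le_add _ _ (h.measure_bad_samples_le X hδ0 hδ1 hε0 hmε)
    (fun y => measure_no_start_le (v y) hδ0 hδ1 hLlog') ?_
  intro ω hω
  by_contra hc
  rw [not_or] at hc
  obtain ⟨hc1, hc2⟩ := hc
  refine hω ⟨exists_isPowerDecomposition N hL _ _, hv ω.1 (not_not.mp hc1) ω.2 fun q i => ?_⟩
  by_contra! hno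
  exact hc2 ⟨q, i, hno⟩
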